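/- **Setting.** Let $M$ be a smooth supermanifold of dimension $n|m$ (even coordinates $x^1,\dots,x^n$, odd ones $x^{n+1},\dots,x^{n+m}$, parity of $x^a$ denoted $\tilde a$). $\mathrm{fun}(T^*M)$ denotes the formal functions on $T^*M$ (formal power series in the momenta $p_a$, with $p_a=\frac{\partial x^{a'}}{\partial x^a}p_{a'}$ under a change of coordinates), with the canonical Poisson bracket $$\{H,K\}=\sum_a (-1)^{\tilde a\tilde H}\frac{\partial H}{\partial x^a}\frac{\partial K}{\partial p_a}-(-1)^{\tilde a(\tilde H+1)}\frac{\partial H}{\partial p_a}\frac{\partial K}{\partial x^a}$$ (left derivatives). For a Weil superalgebra $A=\mathbb R\oplus\mathfrak m$ (finite-dimensional, supercommutative, $\mathfrak m$ nilpotent) let $G(A)$ be the set of thick morphisms $\Phi\colon M\to M$ with parameters in $A$ that are the identity modulo $\mathfrak m$. Such a $\Phi$ is given in every chart by an even generating function $S(x,q)$, a power series in $q$ with $S\equiv x^aq_a$ modulo $\mathfrak m$; under a change of coordinates $$S'(x',q')=S(x,q)-y^aq_a+y'^{a'}(y)\,q'_{a'},\qquad q_a=\frac{\partial y'^{a'}}{\partial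 y^a}(y)\,q'_{a'},\quad y^a=(-1)^{\tilde a}\frac{\partial S}{\partial q_a}(x,q).$$ The composition $\Phi\circ\Psi$ has the generating function $$S_\Phi(y,r)+S_\Psi(x,q)-y^aq_a,\qquad q_a=\frac{\partial S_\Phi}{\partial y^a}(y,r),\quad y^a=(-1)^{\tilde a}\frac{\partial S_\Psi}{\partial q_a}(x,q),$$ and the nonlinear pullback of an even function $f$ is $$\Phi^*[f](x)=f(y)+S(x,q)-y^aq_a,\qquad q_a=\frac{\partial f}{\partial y^a}(y),\quad y^a=(-1)^{\tilde a}\frac{\partial S}{\partial q_a}(x,q).$$ **Theorem.** 1. With this composition, $G$ is a functor from Weil superalgebras to groups with $G(\mathbb R)=\{1\}$, that is, a formal supergroup (the formal supergroup of thick diffeomorphisms of $M$). By nonlinear pullbacks it acts from the right, naturally in $A$, on the even functions on $M$ with coefficients in $\mathfrak m$: $(\Phi\circ\Psi)^*=\Psi^*\circ\Phi^*$ and $\mathrm{id}^*=\mathrm{id}$. 2. $\mathrm{fun}(T^*M)$ is a Lie superalgebra under the canonical Poisson bracket, and it is the Lie superalgebra of $G$. Namely, for $i\in\{0,1\}$ and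 $\tau$ of parity $i$ with $\tau^2=0$, the map $H\mapsto 1+\tau H$, where $1+\tau H$ has the generating function $x^ap_a+\tau H(x,p)$, is a bijection from the functions $H$ of parity $i$ onto $G(\mathbb R[\tau])$. It takes sums to products and multiplication by a real number $r$ to the map induced by $\tau\mapsto r\tau$; and for all $H,K$ of parities $i,j$, all Weil superalgebras $A$ and all $s,t\in A$ of parities $i,j$ with $s^2=t^2=0$, in $G(A)$ $$(1+sH)(1+tK)(1+sH)^{-1}(1+tK)^{-1}=1+ts\{H,K\}.$$ 3. The infinitesimal action corresponding to the nonlinear pullbacks is the Hamilton–Jacobi action: for every $H\in\mathrm{fun}(T^*M)$ of parity $i$, every $\varepsilon\in A$ of parity $i$ with $\varepsilon^2=0$, and every even function $f$ on $M$ with coefficients in $A$, $$(1+\varepsilon H)^*[f]=f+\varepsilon H\Bigl(x,\frac{\partial f}{\partial x}\Bigr),$$ provided that $f$ has coefficients in $\mathfrak m$ (so that the power series $H$ can be evaluated) or that $H$ is in every chart a polynomial in the momenta (then $f$ is arbitrary). -/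

import Mathlib

open scoped TensorProduct ContDiff
open TopologicalSpace

universe u

noncomputable section

namespace ThickMorphism

/-! ### Superalgebras over `ℝ`: a `ℤ/2`-grading is given by its parity involution -/

/-- The sign `(-1)^i`, for `i ∈ ℤ/2`. -/
def sgn (i : ZMod 2) : ℝ := if i = 0 then 1 else -1

/-- A superalgebra structure: the parity involution, equal to `+1` on even elements and to `-1`
on odd elements. -/
class Superalgebra (R : Type*) [Ring R] [Algebra ℝ R] where
  par : R →ₐ[ℝ] R
  par_par : ∀ x, par (par x) = x

/-- The homogeneous elements of parity `i`. -/
def homog (R : Type*) [Ring R] [Algebra ℝ R] [Superalgebra R] (i : ZMod 2) : Submodule ℝ R where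
  carrier := {x | Superalgebra.par x = sgn i • x}
  add_mem' := by
    intro a b ha hb
    simp only [Set.mem_ofPred_eq] at *
    rw [map_add, ha, hb, smul_add]
  zero_mem' := by simp
  smul_mem' := by
    intro c x hx
    simp only [Set.mem_ofPred_eq] at *
    rw [map_smul, hx, smul_comm]

/-- Supercommutativity: `x y = (-1)^{ij} y x` for homogeneous `x`, `y` of parities `i`, `j`. -/
def IsSupercommutative (R : Type*) [Ring R] [Algebra ℝ R] [Superalgebra R] : Prop :=
  ∀ i j : ZMod 2, ∀ x ∈ homog R i, ∀ y ∈ homog R j, x * y = sgn (i * j) • (y * x)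

section Grading

variable {R : Type*} [Ring R] [Algebra ℝ R] [Superalgebra R]

theorem mem_homog {i : ZMod 2} {x : R} : x ∈ homog R i ↔ Superalgebra.par x = sgn i • x := Iff.rfl

theorem zmod_two (i : ZMod 2) : i = 0 ∨ i = 1 := by
  revert i
  decide

theorem sgn_zero : sgn 0 = 1 := by simp [sgn]

theorem sgn_one : sgn 1 = -1 := by simp [sgn]

theorem sgn_add (i j : ZMod 2) : sgn (i + j) = sgn i * sgn j := by
  have h : (1 + 1 : ZMod 2) = 0 := by decide
  rcases zmod_two i with rfl | rfl <;> rcases zmod_two j with rfl | rfl <;> simp [sgn, h]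

theorem sgn_mul_self (i : ZMod 2) : sgn i * sgn i = 1 := by
  rcases zmod_two i with rfl | rfl <;> simp [sgn]

instance : SetLike.GradedMonoid (homog R) where
  one_mem := by simp [mem_homog, sgn_zero]
  mul_mem := by
    intro i j x y hx hy
    rw [mem_homog] at *
    rw [map_mul, hx, hy, sgn_add, smul_mul_smul_comm]

/-- The homogeneous component of parity `i`. -/
def comp (R : Type*) [Ring R] [Algebra ℝ R] [Superalgebra R] (i : ZMod 2) : R →ₗ[ℝ] homog R i where
  toFun x := ⟨(2⁻¹ : ℝ) • (x + sgn i • Superalgebra.par x), by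
    rw [mem_homog, map_smul, map_add, map_smul, Superalgebra.par_par, smul_comm (sgn i),
      smul_add (sgn i), smul_smul (sgn i), sgn_mul_self, one_smul, add_comm]⟩
  map_add' x y := by
    ext
    simp only [map_add, smul_add, Submodule.coe_add]
    abel
  map_smul' c x := by
    ext
    simp only [map_smul, smul_add, RingHom.id_apply, Submodule.coe_smul]
    rw [smul_comm c (2⁻¹ : ℝ) x, smul_comm c (2⁻¹ : ℝ), smul_comm c (sgn i)]

theorem comp_zero_add_comp_one (x : R) : ((comp R 0 x : R) + (comp R 1 x : R)) = x := by
  simp only [comp, LinearMap.coe_mk, AddHom.coe_mk, sgn_zero, sgn_one]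
  module

theorem comp_coe_same (i : ZMod 2) (x : homog R i) : comp R i (x : R) = x := by
  ext
  have h := x.2
  rw [mem_homog] at h
  simp only [comp, LinearMap.coe_mk, AddHom.coe_mk, h, smul_smul, sgn_mul_self]
  module

theorem comp_coe_ne {i j : ZMod 2} (hij : j ≠ i) (x : homog R i) : comp R j (x : R) = 0 := by
  ext
  have h := x.2
  rw [mem_homog] at h
  have hs : sgn j * sgn i = -1 := by
    rcases zmod_two i with rfl | rfl <;> rcases zmod_two j with rfl | rfl <;> simp_all [sgn]
  simp only [comp, LinearMap.coe_mk, AddHom.coe_mk, h, smul_smul, hs]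
  simp

instance : DirectSum.Decomposition (homog R) :=
  DirectSum.Decomposition.ofLinearMap (homog R)
    (DirectSum.lof ℝ (ZMod 2) (fun i => homog R i) 0 ∘ₗ comp R 0
      + DirectSum.lof ℝ (ZMod 2) (fun i => homog R i) 1 ∘ₗ comp R 1)
    (by
      ext x
      simp [comp_zero_add_comp_one])
    (by
      ext i x : 2
      have h10 : (1 : ZMod 2) ≠ 0 := by decide
      rcases zmod_two i with rfl | rfl
      · simp [comp_coe_same (0 : ZMod 2) x, comp_coe_ne h10 x]
      · simp [comp_coe_same (1 : ZMod 2) x, comp_coe_ne h10.symm x])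

instance : GradedAlgebra (homog R) where

end Grading

/-! ### Graded tensor products -/

section Tensor

/-- The tensor product of superalgebras, `(r ⊗ a)(s ⊗ b) = (-1)^{ij} rs ⊗ ab` for `a` of parity
`i` and `s` of parity `j`. -/
abbrev STensor (R B : Type*) [Ring R] [Algebra ℝ R] [Superalgebra R] [Ring B] [Algebra ℝ B]
    [Superalgebra B] : Type _ :=
  GradedTensorProduct ℝ (homog R) (homog B)

variable {R R' B B' : Type*} [Ring R] [Algebra ℝ R] [Superalgebra R] [Ring R'] [Algebra ℝ R']
  [Superalgebra R'] [Ring B] [Algebra ℝ B] [Superalgebra B] [Ring B'] [Algebra ℝ B']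
  [Superalgebra B']

/-- The pure tensor `r ⊗ b`. -/
def stmul (r : R) (b : B) : STensor R B :=
  GradedTensorProduct.of ℝ (homog R) (homog B) (r ⊗ₜ[ℝ] b)

/-- The linear map `f ⊗ g` (without signs). -/
def tmap (f : R →ₗ[ℝ] R') (g : B →ₗ[ℝ] B') : STensor R B →ₗ[ℝ] STensor R' B' :=
  (GradedTensorProduct.of ℝ (homog R') (homog B')).toLinearMap ∘ₗ TensorProduct.map f g ∘ₗ
    (GradedTensorProduct.of ℝ (homog R) (homog B)).symm.toLinearMap

theorem tmap_stmul (f : R →ₗ[ℝ] R') (g : B →ₗ[ℝ] B') (r : R) (b : B) :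
    tmap f g (stmul r b) = stmul (f r) (g b) := rfl

theorem tensor_hom_ext {E : Type*} [AddCommMonoid E] [Module ℝ E]
    {f g : STensor R B →ₗ[ℝ] E} (h : ∀ i j, ∀ r ∈ homog R i, ∀ b ∈ homog B j,
      f (stmul r b) = g (stmul r b)) : f = g := by
  have key : f ∘ₗ (GradedTensorProduct.of ℝ (homog R) (homog B)).toLinearMap
      = g ∘ₗ (GradedTensorProduct.of ℝ (homog R) (homog B)).toLinearMap := by
    apply TensorProduct.ext'
    intro r b
    change f (stmul r b) = g (stmul r b)
    have hr := comp_zero_add_comp_one r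
    have hb := comp_zero_add_comp_one b
    have e : stmul r b = stmul (comp R 0 r : R) (comp B 0 b : B)
        + stmul (comp R 0 r : R) (comp B 1 b : B)
        + (stmul (comp R 1 r : R) (comp B 0 b : B) + stmul (comp R 1 r : R) (comp B 1 b : B)) := by
      conv_lhs => rw [← hr, ← hb]
      simp only [stmul, TensorProduct.add_tmul, TensorProduct.tmul_add, map_add]
      abel
    rw [e]
    simp only [map_add]
    rw [h _ _ _ (comp R 0 r).2 _ (comp B 0 b).2, h _ _ _ (comp R 0 r).2 _ (comp B 1 b).2,
      h _ _ _ (comp R 1 r).2 _ (comp B 0 b).2, h _ _ _ (comp R 1 r).2 _ (comp B 1 b).2]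
  exact GradedTensorProduct.hom_ext _ _ key

theorem stmul_mul_stmul {i j : ZMod 2} (r : R) {b : B} (hb : b ∈ homog B i) {s : R}
    (hs : s ∈ homog R j) (c : B) :
    stmul r b * stmul s c = sgn (i * j) • stmul (r * s) (b * c) := by
  have h := GradedTensorProduct.tmul_coe_mul_coe_tmul (R := ℝ) (homog R) (homog B) r ⟨b, hb⟩
    ⟨s, hs⟩ c
  refine h.trans ?_
  have h10 : (1 : ZMod 2) ≠ 0 := by decide
  rcases zmod_two (i * j) with h0 | h0 <;> rw [h0]
  · rw [uzpow_zero, one_smul, sgn_zero, one_smul]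
    rfl
  · rw [uzpow_one, sgn_one, neg_smul, one_smul]
    simp only [Units.neg_smul, one_smul]
    rfl

/-- The parity of `r ⊗ b` is the sum of the parities of `r` and `b`. -/
instance : Superalgebra (STensor R B) where
  par := AlgHom.ofLinearMap
    (tmap (Superalgebra.par (R := R)).toLinearMap (Superalgebra.par (R := B)).toLinearMap)
    (by
      change tmap _ _ (stmul 1 1) = stmul 1 1
      rw [tmap_stmul]
      simp)
    (by
      rw [LinearMap.map_mul_iff]
      refine tensor_hom_ext fun i j r hr b hb => ?_
      refine tensor_hom_ext fun k l s hs c hc => ?_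
      change tmap _ _ (stmul r b * stmul s c) = tmap _ _ (stmul r b) * tmap _ _ (stmul s c)
      rw [stmul_mul_stmul r hb hs c, map_smul, tmap_stmul, tmap_stmul, tmap_stmul]
      simp only [AlgHom.toLinearMap_apply]
      have hb' : Superalgebra.par b ∈ homog B j := by
        rw [mem_homog] at hb
        rw [hb]
        exact Submodule.smul_mem _ _ hb
      have hs' : Superalgebra.par s ∈ homog R k := by
        rw [mem_homog] at hs
        rw [hs]
        exact Submodule.smul_mem _ _ hs
      rw [stmul_mul_stmul _ hb' hs' _]
      simp)
  par_par x := by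
    have : tmap (Superalgebra.par (R := R)).toLinearMap (Superalgebra.par (R := B)).toLinearMap ∘ₗ
        tmap (Superalgebra.par (R := R)).toLinearMap (Superalgebra.par (R := B)).toLinearMap
        = LinearMap.id := by
      refine tensor_hom_ext fun i j r hr b hb => ?_
      simp [tmap_stmul, Superalgebra.par_par]
    exact LinearMap.congr_fun this x

end Tensor

/-- The Grassmann algebra on `m` odd generators. -/
abbrev Grassmann (m : ℕ) : Type := ExteriorAlgebra ℝ (Fin m → ℝ)

instance (m : ℕ) : Superalgebra (Grassmann m) where
  par := CliffordAlgebra.involute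
  par_par := CliffordAlgebra.involute_involute

/-- The left derivative with respect to the `μ`-th generator of the Grassmann algebra. -/
def grassmannDeriv {m : ℕ} (μ : Fin m) : Grassmann m →ₗ[ℝ] Grassmann m :=
  CliffordAlgebra.contractLeft (LinearMap.proj μ : Module.Dual ℝ (Fin m → ℝ))

/-! ### Weil superalgebras: the test algebras for formal supergroups -/

/-- A Weil superalgebra: a finite-dimensional supercommutative algebra `A = ℝ ⊕ 𝔪`, where the
ideal `𝔪 = ker aug` consists of nilpotent elements. -/
structure WeilSuperalgebra where
  carrier : Type
  [ring : Ring carrier]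
  [algebra : Algebra ℝ carrier]
  [super : Superalgebra carrier]
  [finite : Module.Finite ℝ carrier]
  comm : IsSupercommutative carrier
  aug : carrier →ₐ[ℝ] ℝ
  nilpotent : ∀ a, aug a = 0 → IsNilpotent a

namespace WeilSuperalgebra

instance : CoeSort WeilSuperalgebra Type := ⟨carrier⟩

instance (A : WeilSuperalgebra) : Ring A := A.ring

instance (A : WeilSuperalgebra) : Algebra ℝ A := A.algebra

instance (A : WeilSuperalgebra) : Superalgebra A := A.super

instance (A : WeilSuperalgebra) : Module.Finite ℝ A := A.finite

/-- Morphisms of Weil superalgebras: parity-preserving algebra homomorphisms. -/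
structure Hom (A B : WeilSuperalgebra) where
  toAlgHom : A →ₐ[ℝ] B
  map_par : ∀ a, toAlgHom (Superalgebra.par a) = Superalgebra.par (toAlgHom a)

/-- The identity morphism. -/
def Hom.id (A : WeilSuperalgebra) : Hom A A := ⟨AlgHom.id ℝ A, fun _ => rfl⟩

/-- The composition `ψ ∘ φ`. -/
def Hom.comp {A B C : WeilSuperalgebra} (ψ : Hom B C) (φ : Hom A B) : Hom A C :=
  ⟨ψ.toAlgHom.comp φ.toAlgHom, fun a => by simp [φ.map_par, ψ.map_par]⟩

/-- The trivial Weil superalgebra `ℝ`. -/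
def real : WeilSuperalgebra where
  carrier := ℝ
  super := ⟨AlgHom.id ℝ ℝ, fun _ => rfl⟩
  comm := by
    intro i j x hx y hy
    have key : ∀ (k : ZMod 2) (w : ℝ), w = sgn k • w → k = 0 ∨ w = 0 := by
      intro k w hw
      rcases zmod_two k with rfl | rfl
      · exact Or.inl rfl
      · refine Or.inr ?_
        rw [sgn_one, smul_eq_mul] at hw
        linarith
    rcases key i x hx with rfl | rfl
    · rw [zero_mul, sgn_zero, one_smul, mul_comm]
    · simp
  aug := AlgHom.id ℝ ℝ
  nilpotent := by
    intro a ha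
    have h : a = 0 := ha
    rw [h]
    exact IsNilpotent.zero

/-- The unit `ℝ → A`. -/
def unit (A : WeilSuperalgebra) : Hom real A where
  toAlgHom := Algebra.ofId ℝ A
  map_par a := by
    exact ((Superalgebra.par (R := A)).commutes a).symm

theorem aug_par (A : WeilSuperalgebra) (a : A) : A.aug (Superalgebra.par a) = A.aug a := by
  have h := comp_zero_add_comp_one (R := A) a
  have hodd : A.aug (ThickMorphism.comp A 1 a : A) = 0 := by
    have h1 := A.comm 1 1 _ (ThickMorphism.comp A 1 a).2 _ (ThickMorphism.comp A 1 a).2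
    have h2 := congrArg A.aug h1
    rw [mul_one, sgn_one, neg_smul, one_smul, map_neg, map_mul] at h2
    exact mul_self_eq_zero.mp (by linarith)
  have p0 : Superalgebra.par (ThickMorphism.comp A 0 a : A) = (ThickMorphism.comp A 0 a : A) := by
    have := (ThickMorphism.comp A 0 a).2
    rwa [mem_homog, sgn_zero, one_smul] at this
  have p1 : Superalgebra.par (ThickMorphism.comp A 1 a : A)
      = -(ThickMorphism.comp A 1 a : A) := by
    have := (ThickMorphism.comp A 1 a).2
    rwa [mem_homog, sgn_one, neg_smul, one_smul] at this
  rw [← h, map_add, p0, p1, map_add, map_add, map_neg, hodd, neg_zero]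

/-- The augmentation `A → ℝ`, reduction modulo `𝔪`. -/
def reduction (A : WeilSuperalgebra) : Hom A real where
  toAlgHom := A.aug
  map_par a := A.aug_par a

/-- The superalgebra structure of the dual numbers `ℝ[τ]` with `τ` of parity `i`. -/
@[reducible]
def dualSuper (i : ZMod 2) : Superalgebra (DualNumber ℝ) where
  par := DualNumber.lift ⟨(Algebra.ofId ℝ (DualNumber ℝ), sgn i • DualNumber.eps), by
    simp, fun r => (Algebra.commutes r _).symm⟩
  par_par := by
    intro x
    rw [← AlgHom.comp_apply]
    conv_rhs => rw [← AlgHom.id_apply (R := ℝ) x]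
    congr 1
    apply DualNumber.algHom_ext
    simp [DualNumber.lift_apply_apply, smul_smul, sgn_mul_self]

theorem dualSuper_par (i : ZMod 2) (x : DualNumber ℝ) :
    (dualSuper i).par x = (TrivSqZeroExt.inl x.fst + TrivSqZeroExt.inr (sgn i * x.snd)) := by
  change DualNumber.lift _ x = _
  rw [DualNumber.lift_apply_apply]
  ext <;> simp [Algebra.ofId_apply, TrivSqZeroExt.algebraMap_eq_inl, mul_comm]

/-- The dual numbers `ℝ[τ]`, `τ² = 0`, with generator `τ` of parity `i`. -/
def dual (i : ZMod 2) : WeilSuperalgebra where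
  carrier := DualNumber ℝ
  super := dualSuper i
  finite := inferInstanceAs (Module.Finite ℝ (ℝ × ℝ))
  comm := by
    let _ := dualSuper i
    intro k l x hx y hy
    rw [mem_homog] at hx hy
    change (dualSuper i).par x = _ at hx
    change (dualSuper i).par y = _ at hy
    rw [dualSuper_par] at hx hy
    have hx0 := congrArg TrivSqZeroExt.fst hx
    have hx1 := congrArg TrivSqZeroExt.snd hx
    have hy0 := congrArg TrivSqZeroExt.fst hy
    have hy1 := congrArg TrivSqZeroExt.snd hy
    have h10 : (1 : ZMod 2) * 1 = 1 := by decide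
    rcases zmod_two k with rfl | rfl
    · rw [zero_mul, sgn_zero, one_smul, mul_comm]
    rcases zmod_two l with rfl | rfl
    · rw [mul_zero, sgn_zero, one_smul, mul_comm]
    simp only [sgn_one, TrivSqZeroExt.fst_add, TrivSqZeroExt.fst_inl, TrivSqZeroExt.fst_inr,
      TrivSqZeroExt.fst_smul, smul_eq_mul] at hx0 hy0
    have hx2 : x.fst = 0 := by linarith
    have hy2 : y.fst = 0 := by linarith
    have hxy : x * y = 0 := by
      ext <;> simp [hx2, hy2]
    have hyx : y * x = 0 := by
      ext <;> simp [hx2, hy2]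
    rw [hxy, hyx, smul_zero]
  aug := TrivSqZeroExt.fstHom ℝ ℝ ℝ
  nilpotent := by
    intro a ha
    have h0 : a.fst = 0 := ha
    refine ⟨2, ?_⟩
    rw [pow_two]
    ext <;> simp [h0]

/-- The generator of the dual numbers. -/
def tau (i : ZMod 2) : dual i := _root_.id (DualNumber.eps : DualNumber ℝ)

/-- The algebra homomorphism `a + b τ ↦ a + b t` for `t² = 0`. -/
def dualLift (A : Type*) [Ring A] [Algebra ℝ A] (t : A) (ht2 : t * t = 0) :
    DualNumber ℝ →ₐ[ℝ] A :=
  DualNumber.lift ⟨(Algebra.ofId ℝ A, t), ht2, fun r => (Algebra.commutes r t).symm⟩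

theorem dualLift_apply (A : Type*) [Ring A] [Algebra ℝ A] (t : A) (ht2 : t * t = 0)
    (x : DualNumber ℝ) : dualLift A t ht2 x = algebraMap ℝ A x.fst + x.snd • t := by
  rw [dualLift, DualNumber.lift_apply_apply]
  simp [Algebra.ofId_apply, Algebra.smul_def]

/-- The morphism `ℝ[τ] → A` sending `τ` to an element of parity `i` and square zero. -/
def Hom.ofDual {A : WeilSuperalgebra} {i : ZMod 2} (t : A) (ht : t ∈ homog A i) (ht2 : t * t = 0) :
    Hom (dual i) A where
  toAlgHom := _root_.id (dualLift A t ht2)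
  map_par a := by
    have h : ∀ x : DualNumber ℝ, dualLift A t ht2 ((dualSuper i).par x)
        = Superalgebra.par (dualLift A t ht2 x) := by
      intro x
      rw [dualSuper_par, dualLift_apply, dualLift_apply, map_add, AlgHom.commutes, map_smul]
      rw [mem_homog] at ht
      rw [ht, smul_smul]
      simp [mul_comm]
    exact h a

theorem tau_mem (i : ZMod 2) (r : ℝ) : r • tau i ∈ homog (dual i) i := by
  refine Submodule.smul_mem _ _ ?_
  change (dualSuper i).par DualNumber.eps = sgn i • (DualNumber.eps : DualNumber ℝ)
  rw [dualSuper_par]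
  ext
  · exact (by simp : (_ : ℝ) = 0).trans (smul_zero (sgn i)).symm
  · refine Eq.trans ?_ (rfl : sgn i * 1 = _)
    simp

theorem tau_sq (i : ZMod 2) (r : ℝ) : (r • tau i) * (r • tau i) = 0 := by
  have h : tau i * tau i = 0 := DualNumber.eps_mul_eps
  rw [smul_mul_smul_comm, h, smul_zero]

end WeilSuperalgebra

/-! ### Supermanifolds -/

/-- A topological space with a sheaf of supercommutative superalgebras. -/
structure SuperSpace where
  carrier : Type u
  [top : TopologicalSpace carrier]
  /-- the sections of the structure sheaf over an open set -/
  sec : Opens carrier → Type u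
  [ring : ∀ U, Ring (sec U)]
  [algebra : ∀ U, Algebra ℝ (sec U)]
  [super : ∀ U, Superalgebra (sec U)]
  comm : ∀ U, IsSupercommutative (sec U)
  /-- restriction of sections -/
  res : ∀ {W U : Opens carrier}, W ≤ U → sec U →ₐ[ℝ] sec W
  res_par : ∀ {W U : Opens carrier} (h : W ≤ U) (s : sec U),
    res h (Superalgebra.par s) = Superalgebra.par (res h s)
  res_refl : ∀ (U : Opens carrier) (s : sec U), res le_rfl s = s
  res_res : ∀ {W V U : Opens carrier} (h : W ≤ V) (h' : V ≤ U) (s : sec U),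
    res h (res h' s) = res (h.trans h') s
  glue : ∀ {ι : Type u} (U : ι → Opens carrier) (s : ∀ i, sec (U i)),
    (∀ i j, res (inf_le_left : U i ⊓ U j ≤ U i) (s i) = res inf_le_right (s j)) →
      ∃! t : sec (⨆ i, U i), ∀ i, res (le_iSup U i) t = s i

namespace SuperSpace

variable (M : SuperSpace.{u})

instance : TopologicalSpace M.carrier := M.top

instance (U : Opens M.carrier) : Ring (M.sec U) := M.ring U

instance (U : Opens M.carrier) : Algebra ℝ (M.sec U) := M.algebra U

instance (U : Opens M.carrier) : Superalgebra (M.sec U) := M.super U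

end SuperSpace

/-- The algebra of functions on `ℝⁿ` that are smooth on `V` (two of them define the same smooth
function on `V` when they agree on `V`). -/
def smoothOn {n : ℕ} (V : Set (Fin n → ℝ)) : Subalgebra ℝ ((Fin n → ℝ) → ℝ) where
  carrier := {g | ContDiffOn ℝ ∞ g V}
  mul_mem' := fun ha hb => ContDiffOn.mul ha hb
  add_mem' := fun ha hb => ContDiffOn.add ha hb
  algebraMap_mem' := fun _ => contDiffOn_const

/-- The coordinate function `v ↦ v a`. -/
def smoothCoord {n : ℕ} (V : Set (Fin n → ℝ)) (a : Fin n) : smoothOn V :=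
  ⟨fun v => v a, (contDiff_apply ℝ ℝ a).contDiffOn⟩

/-- The partial derivative `∂/∂v^a` on an open set. -/
def smoothDeriv {n : ℕ} {V : Set (Fin n → ℝ)} (hV : IsOpen V) (a : Fin n) (g : smoothOn V) :
    smoothOn V :=
  ⟨fun v => fderiv ℝ (g : (Fin n → ℝ) → ℝ) v (Pi.single a 1),
    ((g.2 : ContDiffOn ℝ ∞ _ V).fderiv_of_isOpen hV (m := ∞) (by simp)).clm_apply
      contDiffOn_const⟩

/-- The product `ξ^{μ₁} ⋯ ξ^{μ_k}` for `I = {μ₁ < ⋯ < μ_k}`. -/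
def oddMonomial {m : ℕ} {R : Type*} [Ring R] (ξ : Fin m → R) (I : Finset (Fin m)) : R :=
  ((I.sort (· ≤ ·)).map ξ).prod

/-- A chart of dimension `n|m`: a homeomorphism `φ` of an open set `U` onto an open set in `ℝⁿ`
and an isomorphism of the structure sheaf over `U` with the sheaf `C^∞ ⊗ Λ(ξ^1, …, ξ^m)`:
every section over `W ⊆ U` is uniquely `∑_I g_I ξ^I` with smooth `g_I`. -/
structure SuperChart (M : SuperSpace.{u}) (n m : ℕ) where
  φ : OpenPartialHomeomorph M.carrier (Fin n → ℝ)
  /-- the embedding of the smooth functions of the even coordinates -/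
  fn : ∀ W : Opens M.carrier, (W : Set M.carrier) ⊆ φ.source → smoothOn (φ '' W) →ₐ[ℝ] M.sec W
  fn_par : ∀ (W : Opens M.carrier) hW g, Superalgebra.par (fn W hW g) = fn W hW g
  fn_res : ∀ (W W' : Opens M.carrier) (hW : (W : Set M.carrier) ⊆ φ.source) (h : W' ≤ W)
    (g : smoothOn (φ '' W)), M.res h (fn W hW g) =
      fn W' (Set.Subset.trans h hW) ⟨g, g.2.mono (Set.image_mono h)⟩
  fn_congr : ∀ (W : Opens M.carrier) hW (g g' : smoothOn (φ '' W)),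
    Set.EqOn (g : (Fin n → ℝ) → ℝ) g' (φ '' W) → fn W hW g = fn W hW g'
  /-- the odd coordinates -/
  odd : Fin m → M.sec ⟨φ.source, φ.open_source⟩
  odd_par : ∀ μ, Superalgebra.par (odd μ) = - odd μ
  expand_exists : ∀ (W : Opens M.carrier) (hW : (W : Set M.carrier) ⊆ φ.source) (s : M.sec W),
    ∃ g : Finset (Fin m) → smoothOn (φ '' W),
      s = ∑ I, fn W hW (g I) * oddMonomial (fun μ => M.res hW (odd μ)) I
  expand_unique : ∀ (W : Opens M.carrier) (hW : (W : Set M.carrier) ⊆ φ.source)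
    (g g' : Finset (Fin m) → smoothOn (φ '' W)),
    ∑ I, fn W hW (g I) * oddMonomial (fun μ => M.res hW (odd μ)) I =
      ∑ I, fn W hW (g' I) * oddMonomial (fun μ => M.res hW (odd μ)) I →
    ∀ I, Set.EqOn (g I : (Fin n → ℝ) → ℝ) (g' I) (φ '' W)

/-- A supermanifold of dimension `n|m`. -/
structure Supermanifold (n m : ℕ) extends SuperSpace.{u} where
  t2 : T2Space carrier
  second_countable : SecondCountableTopology carrier
  exists_chart : ∀ x : carrier, ∃ c : SuperChart toSuperSpace n m, x ∈ c.φ.source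

namespace SuperChart

variable {M : SuperSpace.{u}} {n m : ℕ} (c : SuperChart M n m)

/-- The domain of the chart. -/
def dom : Opens M.carrier := ⟨c.φ.source, c.φ.open_source⟩

variable {c} {W : Opens M.carrier} (hW : W ≤ c.dom)

/-- The section `∑_I g_I ξ^I`. -/
def expand (g : Finset (Fin m) → smoothOn (c.φ '' W)) : M.sec W :=
  ∑ I, c.fn W hW (g I) * oddMonomial (fun μ => M.res hW (c.odd μ)) I

/-- The coefficients `g_I` of a section. -/
def coeffs (s : M.sec W) : Finset (Fin m) → smoothOn (c.φ '' W) :=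
  Classical.choose (c.expand_exists W hW s)

theorem expand_coeffs (s : M.sec W) : expand hW (coeffs hW s) = s :=
  (Classical.choose_spec (c.expand_exists W hW s)).symm

theorem coeffs_eqOn {s : M.sec W} {g : Finset (Fin m) → smoothOn (c.φ '' W)}
    (h : expand hW g = s) (I : Finset (Fin m)) :
    Set.EqOn (coeffs hW s I : (Fin n → ℝ) → ℝ) (g I) (c.φ '' W) :=
  c.expand_unique W hW _ _ ((expand_coeffs hW s).trans h.symm) I

theorem expand_congr {g g' : Finset (Fin m) → smoothOn (c.φ '' W)}
    (h : ∀ I, Set.EqOn (g I : (Fin n → ℝ) → ℝ) (g' I) (c.φ '' W)) :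
    expand hW g = expand hW g' := by
  unfold expand
  refine Finset.sum_congr rfl fun I _ => ?_
  rw [c.fn_congr W hW _ _ (h I)]

theorem expand_add (g g' : Finset (Fin m) → smoothOn (c.φ '' W)) :
    expand hW (g + g') = expand hW g + expand hW g' := by
  simp [expand, add_mul, Finset.sum_add_distrib]

theorem expand_smul (r : ℝ) (g : Finset (Fin m) → smoothOn (c.φ '' W)) :
    expand hW (r • g) = r • expand hW g := by
  simp [expand, Finset.smul_sum]

theorem isOpen_image {c : SuperChart M n m} {W : Opens M.carrier} (hW : W ≤ c.dom) :
    IsOpen (c.φ '' W) := c.φ.isOpen_image_of_subset_source W.2 hW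

/-- Partial derivatives on the level of coefficients. The odd ones are left derivatives:
`∂/∂ξ^μ (g ξ^I) = (-1)^{#{ν ∈ I, ν < μ}} g ξ^{I ∖ μ}` for `μ ∈ I`. -/
def derivCoeffs (g : Finset (Fin m) → smoothOn (c.φ '' W)) :
    Fin n ⊕ Fin m → Finset (Fin m) → smoothOn (c.φ '' W)
  | .inl a => fun I => smoothDeriv (isOpen_image hW) a (g I)
  | .inr μ => fun I => if μ ∈ I then 0 else
      ((-1 : ℝ) ^ (I.filter (· < μ)).card) • g (insert μ I)

theorem derivCoeffs_congr {g g' : Finset (Fin m) → smoothOn (c.φ '' W)}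
    (h : ∀ I, Set.EqOn (g I : (Fin n → ℝ) → ℝ) (g' I) (c.φ '' W)) (a : Fin n ⊕ Fin m)
    (I : Finset (Fin m)) : Set.EqOn (derivCoeffs hW g a I : (Fin n → ℝ) → ℝ)
      (derivCoeffs hW g' a I) (c.φ '' W) := by
  rcases a with a | μ
  · intro v hv
    have he := (h I).eventuallyEq_of_mem ((isOpen_image hW).mem_nhds hv)
    simp only [derivCoeffs, smoothDeriv]
    rw [he.fderiv_eq]
  · intro v hv
    simp only [derivCoeffs]
    split_ifs
    · rfl
    · have := h (insert μ I) hv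
      simp [this]

/-- The partial derivative of sections over `W` with respect to the `a`-th coordinate. -/
def pd (a : Fin n ⊕ Fin m) : M.sec W →ₗ[ℝ] M.sec W where
  toFun s := expand hW (derivCoeffs hW (coeffs hW s) a)
  map_add' s t := by
    rw [← expand_add]
    refine expand_congr hW fun I => ?_
    have h := coeffs_eqOn hW (s := s + t) (g := coeffs hW s + coeffs hW t)
      (by rw [expand_add, expand_coeffs, expand_coeffs])
    refine (derivCoeffs_congr hW h a I).trans ?_
    intro v hv
    rcases a with a | μ
    · have d1 := ((coeffs hW s I).2 : ContDiffOn ℝ ∞ _ _).differentiableOn (by simp) v hv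
        |>.differentiableAt ((isOpen_image hW).mem_nhds hv)
      have d2 := ((coeffs hW t I).2 : ContDiffOn ℝ ∞ _ _).differentiableOn (by simp) v hv
        |>.differentiableAt ((isOpen_image hW).mem_nhds hv)
      simp [derivCoeffs, smoothDeriv, fderiv_add d1 d2]
    · simp only [derivCoeffs, Pi.add_apply]
      split_ifs <;> simp
  map_smul' r s := by
    rw [RingHom.id_apply, ← expand_smul]
    refine expand_congr hW fun I => ?_
    have h := coeffs_eqOn hW (s := r • s) (g := r • coeffs hW s)
      (by rw [expand_smul, expand_coeffs])
    refine (derivCoeffs_congr hW h a I).trans ?_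
    intro v hv
    rcases a with a | μ
    · have d1 := ((coeffs hW s I).2 : ContDiffOn ℝ ∞ _ _).differentiableOn (by simp) v hv
        |>.differentiableAt ((isOpen_image hW).mem_nhds hv)
      simp [derivCoeffs, smoothDeriv, fderiv_const_smul d1]
    · simp only [derivCoeffs, Pi.smul_apply]
      split_ifs
      · simp
      · rw [smul_comm]

/-- The coordinates `z^a` on `W`: the even ones `x^a` and the odd ones `ξ^μ`. -/
def coord : Fin n ⊕ Fin m → M.sec W
  | .inl a => c.fn W hW (smoothCoord _ a)
  | .inr μ => M.res hW (c.odd μ)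

end SuperChart

/-! ### Functions with parameters, and formal functions on the cotangent bundle -/

/-- The index type of the coordinates: `n` even and `m` odd ones. -/
abbrev Idx (n m : ℕ) : Type := Fin n ⊕ Fin m

/-- The parity of a coordinate (and of the conjugate momentum). -/
def ix {n m : ℕ} : Idx n m → ZMod 2
  | .inl _ => 0
  | .inr _ => 1

/-- Functions on `W` with parameters in `A`: the superalgebra `O(W) ⊗ A`. -/
abbrev Fun (M : SuperSpace.{u}) (A : WeilSuperalgebra) (W : Opens M.carrier) : Type u :=
  STensor (M.sec W) A

/-- Formal functions on the cotangent bundle over `W`, with parameters in `A`, in the presence of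
`n|m` momenta: power series in the even momenta `p_1, …, p_n` with coefficients in
`O(W) ⊗ A ⊗ Λ(p_{n+1}, …, p_{n+m})`, the last factor containing the odd momenta. -/
abbrev Mom (M : SuperSpace.{u}) (n m : ℕ) (A : WeilSuperalgebra) (W : Opens M.carrier) :
    Type u :=
  MvPowerSeries (Fin n) (STensor (Fun M A W) (Grassmann m))

/-- Apply a linear map to all coefficients of a power series. -/
def coeffwise {σ R S : Type*} [Ring R] [Ring S] [Algebra ℝ R] [Algebra ℝ S] (f : R →ₗ[ℝ] S) :
    MvPowerSeries σ R →ₗ[ℝ] MvPowerSeries σ S where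
  toFun F := fun d => f (MvPowerSeries.coeff d F)
  map_add' F G := by
    funext d
    exact map_add f _ _
  map_smul' r F := by
    funext d
    exact map_smul f _ _

section Momenta

variable {M : SuperSpace.{u}} {n m : ℕ} {A B : WeilSuperalgebra} {W W' : Opens M.carrier}

/-- Restriction of functions with parameters. -/
def resFun (h : W' ≤ W) : Fun M A W →ₗ[ℝ] Fun M A W' := tmap (M.res h).toLinearMap LinearMap.id

/-- Change of parameters along `A → B`. -/
def pushFun (φ : WeilSuperalgebra.Hom A B) : Fun M A W →ₗ[ℝ] Fun M B W :=
  tmap LinearMap.id φ.toAlgHom.toLinearMap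

/-- Restriction of formal functions on the cotangent bundle. -/
def resMom (h : W' ≤ W) : Mom M n m A W →ₗ[ℝ] Mom M n m A W' :=
  coeffwise (tmap (resFun h) LinearMap.id)

/-- Change of parameters along `A → B`. -/
def pushMom (φ : WeilSuperalgebra.Hom A B) : Mom M n m A W →ₗ[ℝ] Mom M n m B W :=
  coeffwise (tmap (pushFun φ) LinearMap.id)

/-- The parity involution on formal functions on the cotangent bundle. -/
def parMom : Mom M n m A W →ₗ[ℝ] Mom M n m A W :=
  coeffwise (Superalgebra.par (R := STensor (Fun M A W) (Grassmann m))).toLinearMap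

/-- A function on the base as a function on the cotangent bundle, independent of the momenta. -/
def const (f : Fun M A W) : Mom M n m A W := MvPowerSeries.C (stmul f 1)

/-- A parameter as a function on the cotangent bundle. -/
def scal (t : A) : Mom M n m A W := const (stmul 1 t)

/-- Restriction to the zero section (setting all momenta to zero). -/
def zeroSection (F : Mom M n m A W) : Mom M n m A W :=
  MvPowerSeries.C (tmap LinearMap.id
    (Algebra.linearMap ℝ (Grassmann m) ∘ₗ ExteriorAlgebra.algebraMapInv.toLinearMap)
    (MvPowerSeries.constantCoeff F))

/-- The momentum `p_a`. -/
def mom : Idx n m → Mom M n m A W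
  | .inl a => MvPowerSeries.X a
  | .inr μ => MvPowerSeries.C (stmul 1 (ExteriorAlgebra.ι ℝ (Pi.single μ 1)))

/-- The left derivative `∂/∂p_a`. -/
def dp : Idx n m → Mom M n m A W → Mom M n m A W
  | .inl a => fun F d => ((d a + 1 : ℕ) : ℝ) • MvPowerSeries.coeff (d + Finsupp.single a 1) F
  | .inr μ => coeffwise (tmap (Superalgebra.par (R := Fun M A W)).toLinearMap (grassmannDeriv μ))

variable {c : SuperChart M n m} (hW : W ≤ c.dom)

/-- The left derivative `∂/∂z^a` with respect to a coordinate of the chart, at fixed momenta. -/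
def dz (a : Idx n m) : Mom M n m A W → Mom M n m A W :=
  coeffwise (tmap (tmap (SuperChart.pd hW a) LinearMap.id) LinearMap.id)

/-- The coordinate `z^a` of the chart, as a function on the cotangent bundle. -/
def zc (a : Idx n m) : Mom M n m A W := const (stmul (SuperChart.coord hW a) 1)

/-- `D^k F` restricted to the zero section, where `D = ∑_a (δ^a ∂/∂z^a + P_a ∂/∂p_a)` and the
derivatives do not act on `δ` and `P`. -/
def taylorTerm (δ P : Idx n m → Mom M n m A W) : ℕ → Mom M n m A W → Mom M n m A W
  | 0, F => zeroSection F
  | k + 1, F => ∑ a, (δ a * taylorTerm δ P k (dz hW a F) + P a * taylorTerm δ P k (dp a F))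

/-- The substitution `F(y, P)` of `z^a = y^a`, `p_a = P_a` into `F = F(z, p)`, by the Taylor
expansion `∑_k D^k F / k!` at the point `(z, 0)` of the zero section, with displacement
`(y - z, P)`. Only finitely many terms contribute to a given coefficient if the `y^a - z^a` are
nilpotent and the `P_a` vanish at `p = 0` up to nilpotents, or if `F` is a polynomial in `p`. -/
def subst (y P : Idx n m → Mom M n m A W) (F : Mom M n m A W) : Mom M n m A W :=
  fun d => ∑ᶠ k : ℕ, ((k.factorial : ℝ)⁻¹) •
    MvPowerSeries.coeff d (taylorTerm hW (fun a => y a - zc hW a) P k F)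

/-- The generating function `∑_a z^a p_a` of the identity. -/
def idGen : Mom M n m A W := ∑ a, zc hW a * mom a

/-- `G(x, r)` is obtained from the generating functions `F(y, r)` and `S(x, q)` by
`G = F(y, r) + S(x, q) - y^a q_a`, where `y` and `q` are found from the equations
`q_a = ∂F/∂y^a (y, r)` and `y^a = (-1)^a ∂S/∂q_a (x, q)`
(`y` has the parities of the coordinates and equals `x` modulo nilpotent parameters). -/
def IsElimination (F S G : Mom M n m A W) : Prop :=
  ∃ y q : Idx n m → Mom M n m A W,
    (∀ a, parMom (y a) = sgn (ix a) • y a) ∧ (∀ a, parMom (q a) = sgn (ix a) • q a) ∧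
    (∀ a, pushMom A.reduction (y a) = zc hW a) ∧
    (∀ a, q a = subst hW y mom (dz hW a F)) ∧
    (∀ a, y a = sgn (ix a) • subst hW (zc hW) q (dp a S)) ∧
    G = subst hW y mom F + subst hW (zc hW) q S - ∑ a, y a * q a

/-- The canonical Poisson bracket on the cotangent bundle in the given coordinates,
`{F, G} = ∑_a (-1)^{a F} ∂F/∂z^a ∂G/∂p_a - (-1)^{a (F + 1)} ∂F/∂p_a ∂G/∂z^a`,
so that `{x^a, p_b} = δ^a_b` for the even coordinates. -/
def poisson (F G : Mom M n m A W) : Mom M n m A W :=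
  ∑ a, ((dz hW a (if ix a = 0 then F else parMom F)) * dp a G
    - sgn (ix a) • ((dp a (if ix a = 0 then F else parMom F)) * dz hW a G))

end Momenta

/-! ### Thick morphisms -/

section ThickMorphisms

variable {n m : ℕ} (M : Supermanifold.{u} n m)

/-- The charts of a supermanifold. -/
abbrev Chart : Type u := SuperChart M.toSuperSpace n m

/-- A family, parametrized by the Weil superalgebra `A`, of thick morphisms of `M` to itself that
is the identity modulo the maximal ideal of `A`. It is specified by its generating functions
`S(x, q)` in all charts (the same chart is used for the source and for the target); they are even,
equal to `x^a q_a` modulo the maximal ideal, and transform under a change of coordinates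
`x' = x'(x)` by `S'(x', q') = S(x, q) - y^a q_a + y'^{a'}(y) q'_{a'}`, where
`q_a = ∂y'^{a'}/∂y^a (y) q'_{a'}` and `y^a = (-1)^a ∂S/∂q_a (x, q)`. -/
@[ext]
structure ThickPoint (A : WeilSuperalgebra) where
  gen : ∀ c : Chart M, Mom M.toSuperSpace n m A c.dom
  even : ∀ c, parMom (gen c) = gen c
  reduces : ∀ c, pushMom A.reduction (gen c) = idGen (le_refl c.dom)
  compat : ∀ c c' : Chart M,
    IsElimination (c := c) (W := c.dom ⊓ c'.dom) inf_le_left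
      (idGen (c := c') inf_le_right) (resMom inf_le_left (gen c)) (resMom inf_le_right (gen c'))

variable {M}

/-- `Θ` is the composition `Φ ∘ Ψ`: its generating function is
`S_Φ(y, r) + S_Ψ(x, q) - y^a q_a`, where `q_a = ∂S_Φ/∂y^a (y, r)`, `y^a = (-1)^a ∂S_Ψ/∂q_a (x, q)`. -/
def IsComposition {A : WeilSuperalgebra} (Φ Ψ Θ : ThickPoint M A) : Prop :=
  ∀ c, IsElimination (le_refl c.dom) (Φ.gen c) (Ψ.gen c) (Θ.gen c)

/-- `g` is the nonlinear pullback `Φ^*[f]`: it equals `f(y) + S(x, q) - y^a q_a`, where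
`q_a = ∂f/∂y^a (y)` and `y^a = (-1)^a ∂S/∂q_a (x, q)`. -/
def IsPullback {A : WeilSuperalgebra} (Φ : ThickPoint M A) (f g : Fun M.toSuperSpace A ⊤) : Prop :=
  ∀ c, IsElimination (le_refl c.dom) (const (resFun le_top f)) (Φ.gen c)
    (const (resFun le_top g))

/-- Even functions on `M` with parameters in `A` that vanish modulo the maximal ideal: the
`A`-points of the formal neighborhood of zero in the space of even functions. -/
def formalFunctions (M : Supermanifold.{u} n m) (A : WeilSuperalgebra) :
    Set (Fun M.toSuperSpace A ⊤) :=
  {f | f ∈ homog _ 0 ∧ pushFun A.reduction f = 0}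

/-- Formal functions on `T^*M`: families `H(x, p)` in all charts that are compatible with the
changes of coordinates `x' = x'(x)`, `p_a = ∂x'^{a'}/∂x^a p'_{a'}`. -/
def IsCotangentFunction (H : ∀ c : Chart M, Mom M.toSuperSpace n m .real c.dom) : Prop :=
  ∀ c c' : Chart M, resMom (W' := c.dom ⊓ c'.dom) inf_le_right (H c') =
    subst (c := c) inf_le_left (zc (c := c) inf_le_left)
      (fun a => ∑ b, dz (c := c) inf_le_left a (zc (c := c') inf_le_right b) * mom b)
      (resMom inf_le_left (H c))

/-- `H` is a polynomial in the momenta in every chart. -/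
def IsFibrewisePolynomial (H : ∀ c : Chart M, Mom M.toSuperSpace n m .real c.dom) : Prop :=
  ∀ c, ∃ N : ℕ, ∀ d : Fin n →₀ ℕ, N ≤ d.degree → MvPowerSeries.coeff d (H c) = 0

end ThickMorphisms

/-! ### Formal supergroups and Lie superalgebras -/

/-- A formal supergroup with the given functor of points: a functor from Weil superalgebras to
groups with only one real point. -/
structure FormalSupergroup (G : WeilSuperalgebra → Type u) where
  mul : ∀ {A}, G A → G A → G A
  one : ∀ A, G A
  inv : ∀ {A}, G A → G A
  mul_assoc : ∀ {A} (x y z : G A), mul (mul x y) z = mul x (mul y z)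
  one_mul : ∀ {A} (x : G A), mul (one A) x = x
  mul_one : ∀ {A} (x : G A), mul x (one A) = x
  inv_mul : ∀ {A} (x : G A), mul (inv x) x = one A
  map : ∀ {A B}, WeilSuperalgebra.Hom A B → G A → G B
  map_mul : ∀ {A B} (φ : WeilSuperalgebra.Hom A B) (x y : G A),
    map φ (mul x y) = mul (map φ x) (map φ y)
  map_id : ∀ {A} (x : G A), map (.id A) x = x
  map_comp : ∀ {A B C} (ψ : WeilSuperalgebra.Hom B C) (φ : WeilSuperalgebra.Hom A B) (x : G A),
    map (ψ.comp φ) x = map ψ (map φ x)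
  trivial : ∀ x : G .real, x = one .real

/-- A Lie superalgebra structure (with even bracket) on a real vector space. -/
structure LieSuperalgebra (L : Type*) [AddCommGroup L] [Module ℝ L] where
  par : L →ₗ[ℝ] L
  par_par : ∀ x, par (par x) = x
  bracket : L →ₗ[ℝ] L →ₗ[ℝ] L
  par_bracket : ∀ x y, par (bracket x y) = bracket (par x) (par y)
  skew : ∀ (i j : ZMod 2) (x y : L), par x = sgn i • x → par y = sgn j • y →
    bracket x y = -(sgn (i * j) • bracket y x)
  jacobi : ∀ (i j : ZMod 2) (x y z : L), par x = sgn i • x → par y = sgn j • y →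
    bracket x (bracket y z) = bracket (bracket x y) z + sgn (i * j) • bracket y (bracket x z)

namespace LieSuperalgebra

variable {L : Type*} [AddCommGroup L] [Module ℝ L] (𝔏 : LieSuperalgebra L)

/-- The elements of parity `i`. -/
def part (i : ZMod 2) : Submodule ℝ L := LinearMap.eqLocus 𝔏.par (sgn i • LinearMap.id)

theorem bracket_mem {i j : ZMod 2} {x y : L} (hx : x ∈ 𝔏.part i) (hy : y ∈ 𝔏.part j) :
    𝔏.bracket x y ∈ 𝔏.part (i + j) := by
  have hx' : 𝔏.par x = sgn i • x := hx
  have hy' : 𝔏.par y = sgn j • y := hy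
  change 𝔏.par (𝔏.bracket x y) = sgn (i + j) • 𝔏.bracket x y
  rw [𝔏.par_bracket, hx', hy', map_smul, map_smul, LinearMap.smul_apply, smul_smul, sgn_add,
    mul_comm]

end LieSuperalgebra

/-- The Lie superalgebra of a formal supergroup `G`: its part of parity `i` is identified (by
`e i`) with the tangent vectors of parity `i` at the identity, that is, with `G(ℝ[τ])`, where `τ`
has parity `i` and `τ² = 0`; the addition comes from the group structure, the multiplication by a
number `r` comes from `τ ↦ r τ`, and the bracket comes from the group commutator: if `x(s)` denotes
the image of `e i x` under `τ ↦ s`, then `x(s) y(t) x(s)⁻¹ y(t)⁻¹ = [x, y](ts)`. -/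
structure IsLieSuperalgebraOf {G : WeilSuperalgebra → Type u} (𝔾 : FormalSupergroup G)
    {L : Type*} [AddCommGroup L] [Module ℝ L] (𝔏 : LieSuperalgebra L)
    (e : ∀ i : ZMod 2, 𝔏.part i ≃ G (.dual i)) : Prop where
  map_add : ∀ (i : ZMod 2) (x y : 𝔏.part i), e i (x + y) = 𝔾.mul (e i x) (e i y)
  map_smul : ∀ (i : ZMod 2) (r : ℝ) (x : 𝔏.part i), e i (r • x) =
    𝔾.map (.ofDual (r • WeilSuperalgebra.tau i) (WeilSuperalgebra.tau_mem i r)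
      (WeilSuperalgebra.tau_sq i r)) (e i x)
  commutator : ∀ (A : WeilSuperalgebra) (i j : ZMod 2) (x : 𝔏.part i) (y : 𝔏.part j) (s t : A)
    (hs : s ∈ homog A i) (ht : t ∈ homog A j) (hs2 : s * s = 0) (ht2 : t * t = 0)
    (hts : t * s ∈ homog A (i + j)) (hts2 : (t * s) * (t * s) = 0),
    𝔾.mul (𝔾.mul (𝔾.map (.ofDual s hs hs2) (e i x)) (𝔾.map (.ofDual t ht ht2) (e j y)))
      (𝔾.mul (𝔾.inv (𝔾.map (.ofDual s hs hs2) (e i x)))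
        (𝔾.inv (𝔾.map (.ofDual t ht ht2) (e j y)))) =
    𝔾.map (.ofDual (t * s) hts hts2) (e (i + j) ⟨𝔏.bracket x y, 𝔏.bracket_mem x.2 y.2⟩)

end ThickMorphism

end

open ThickMorphism

/-! All the local work takes place in one algebra: power series in the even momenta with
coefficients in O(W) ⊗ A ⊗ Λ(odd momenta). It carries two filtrations. The powers `N j` of the ideal
of nilpotent parameters become zero after finitely many steps, and `fil k`, the total degree in 𝔪
and in the momenta, is separated and makes the Taylor series defining a substitution converge.
`PhaseSpace` axiomatizes what is needed, with several charts on the same open set treated as several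
systems of canonical coordinates.

The analytic input is one rigidity statement, `twisted_eq_zero`: a continuous twisted derivation
that kills coordinates, momenta and parameters is zero. For a smooth function f, Hadamard's lemma f
= f(v) + ∑ (x - v) g shows that the image of f vanishes at v to one nilpotent order more than the
images of the g, and nilpotency ends the induction. Since the defects of the identities in question
are twisted derivations, this gives the uniqueness of substitutions, the chain rule, the
supercommutation of partial derivatives and the change of coordinates.

Elimination of y and q is a fixed point problem. Because S - xp is nilpotent, the positions depend
on the momenta with a gain of one order in `N`, so the iteration stabilizes at a unique solution
(`NearId.exists_solution`, `NearId.solution_unique`). The result is a critical value: its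
derivatives ignore the variation of y and q (`IsElim.envelope`). Associativity (`Elim.assoc`)
follows, because both bracketings eliminate the same variables and uniqueness identifies the
intermediate points. It is proved for two systems of coordinates at once. The transformation law of
a generating function is itself an elimination, with F = x'p', so the compatibility of products,
inverses and pullbacks with changes of charts is again associativity (`compat_mul`, `compat_inv`,
`Elim.change`). Inverses exist because F ↦ elim(F, S) - F is contracting.

If s² = 0, elimination with xp + sH has the closed form F + s H(x, ∂F/∂x) (`elim_gen_add`). This one
formula has four uses. With F = x'p' it says that xp + sH defines a thick morphism when H transforms
as a function on T*M (for s = τ, exactly when), and over the dual numbers every point has this form.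
With F = xp + sH it computes products: the mixed terms of (1 + sH)(1 + tK) and (1 + tK)(1 + sH)
differ by ts{H, K}, and 1 + ts{H, K} commutes with both factors. With F a function on the base it is
the Hamilton–Jacobi action. When that function is not small, H must be a polynomial in the momenta,
and the substitution is controlled by `Tame`.

The bracket is globally defined because cotangent lifts of coordinate changes are canonical
(`hamiltonian_lift`). This is checked on coordinates, where the only nontrivial case, the vanishing
of the brackets of the transformed momenta, comes from the Jacobi identity and the vanishing of
these momenta on the zero section. -/

noncomputable section

namespace ThickMorphism

/-! ### Signs and parities -/

section Parity

variable {R : Type*} [Ring R] [Algebra ℝ R] [Superalgebra R]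

theorem zmod_two_one_add_one : (1 + 1 : ZMod 2) = 0 := by decide

theorem zmod_two_add_self (i : ZMod 2) : i + i = 0 := by
  revert i
  decide

theorem zmod_two_mul_self (i : ZMod 2) : i * i = i := by
  revert i
  decide

theorem sgn_smul_sgn_smul {E : Type*} [AddCommGroup E] [Module ℝ E] (i : ZMod 2) (x : E) :
    sgn i • sgn i • x = x := by
  rw [smul_smul, sgn_mul_self, one_smul]

/-- The `i`-th power of the parity involution. -/
def parPow (i : ZMod 2) : R →ₐ[ℝ] R := if i = 0 then AlgHom.id ℝ R else Superalgebra.par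

@[simp]
theorem parPow_zero (x : R) : parPow 0 x = x := by simp [parPow]

theorem parPow_one (x : R) : parPow 1 x = Superalgebra.par x := by simp [parPow]

theorem parPow_parPow (i j : ZMod 2) (x : R) : parPow i (parPow j x) = parPow (i + j) x := by
  rcases zmod_two i with rfl | rfl <;> rcases zmod_two j with rfl | rfl <;>
    simp [parPow_one, zmod_two_one_add_one, Superalgebra.par_par]

@[simp]
theorem parPow_self (i : ZMod 2) (x : R) : parPow i (parPow i x) = x := by
  rw [parPow_parPow, zmod_two_add_self, parPow_zero]

theorem parPow_of_mem {j : ZMod 2} {x : R} (hx : x ∈ homog R j) (i : ZMod 2) :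
    parPow i x = sgn (i * j) • x := by
  rw [mem_homog] at hx
  rcases zmod_two i with rfl | rfl
  · simp [sgn_zero]
  · rw [parPow_one, one_mul, hx]

theorem mem_homog_zero {x : R} : x ∈ homog R 0 ↔ Superalgebra.par x = x := by
  rw [mem_homog, sgn_zero, one_smul]

theorem parPow_of_mem_zero {x : R} (hx : x ∈ homog R 0) (i : ZMod 2) : parPow i x = x := by
  rw [parPow_of_mem hx, mul_zero, sgn_zero, one_smul]

theorem parPow_mem {j : ZMod 2} {x : R} (hx : x ∈ homog R j) (i : ZMod 2) :
    parPow i x ∈ homog R j := by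
  rw [parPow_of_mem hx]
  exact Submodule.smul_mem _ _ hx

theorem mul_mem_homog {i j : ZMod 2} {x y : R} (hx : x ∈ homog R i) (hy : y ∈ homog R j) :
    x * y ∈ homog R (i + j) := SetLike.mul_mem_graded hx hy

theorem mul_self_mem_homog {i : ZMod 2} {x y : R} (hx : x ∈ homog R i) (hy : y ∈ homog R i) :
    x * y ∈ homog R 0 := by
  have := mul_mem_homog hx hy
  rwa [zmod_two_add_self] at this

theorem one_mem_homog : (1 : R) ∈ homog R 0 := SetLike.GradedOne.one_mem

theorem coe_comp (i : ZMod 2) (x : R) :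
    (comp R i x : R) = (2⁻¹ : ℝ) • (x + sgn i • Superalgebra.par x) := rfl

theorem homog_induction {P : R → Prop} (hadd : ∀ x y, P x → P y → P (x + y))
    (h : ∀ i, ∀ x ∈ homog R i, P x) (x : R) : P x := by
  rw [← comp_zero_add_comp_one x]
  exact hadd _ _ (h _ _ (comp R 0 x).2) (h _ _ (comp R 1 x).2)

/-- Supercommutativity for one homogeneous factor. -/
theorem IsSupercommutative.swap (hR : IsSupercommutative R) {i : ZMod 2} {x : R}
    (hx : x ∈ homog R i) (y : R) : x * y = parPow i y * x := by
  induction y using homog_induction with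
  | hadd y z hy hz => rw [mul_add, hy, hz, map_add, add_mul]
  | h j y hy => rw [hR i j x hx y hy, parPow_of_mem hy, smul_mul_assoc]

theorem IsSupercommutative.of_swap (h : ∀ i : ZMod 2, ∀ x ∈ homog R i, ∀ y : R,
    x * y = parPow i y * x) : IsSupercommutative R := by
  intro i j x hx y hy
  rw [h i x hx, parPow_of_mem hy, smul_mul_assoc]

end Parity

/-! ### Superderivations -/

/-- A left derivation of parity `i`. -/
structure IsSuperDer {R : Type*} [Ring R] [Algebra ℝ R] [Superalgebra R] (i : ZMod 2)
    (D : R →ₗ[ℝ] R) : Prop where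
  leibniz : ∀ x y, D (x * y) = D x * y + parPow i x * D y
  par : ∀ x, D (Superalgebra.par x) = sgn i • Superalgebra.par (D x)

namespace IsSuperDer

variable {R : Type*} [Ring R] [Algebra ℝ R] [Superalgebra R] {i : ZMod 2} {D : R →ₗ[ℝ] R}

theorem parPow (h : IsSuperDer i D) (j : ZMod 2) (x : R) :
    D (parPow j x) = sgn (i * j) • ThickMorphism.parPow j (D x) := by
  rcases zmod_two j with rfl | rfl
  · simp [sgn_zero]
  · simp only [parPow_one, h.par, mul_one]

theorem mem (h : IsSuperDer i D) {j : ZMod 2} {x : R} (hx : x ∈ homog R j) :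
    D x ∈ homog R (i + j) := by
  rw [mem_homog] at *
  have := h.par x
  rw [hx, map_smul] at this
  rw [← sgn_smul_sgn_smul i (Superalgebra.par (D x)), ← this, smul_smul, sgn_add]

theorem map_one (h : IsSuperDer i D) : D 1 = 0 := by
  have := h.leibniz 1 1
  simpa using this

end IsSuperDer

/-! ### Graded tensor products -/

section Tensor

variable {R R' B B' : Type*} [Ring R] [Algebra ℝ R] [Superalgebra R] [Ring R'] [Algebra ℝ R']
  [Superalgebra R'] [Ring B] [Algebra ℝ B] [Superalgebra B] [Ring B'] [Algebra ℝ B']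
  [Superalgebra B']

theorem stmul_add (r : R) (b c : B) : stmul r (b + c) = stmul r b + stmul r c := by
  simp [stmul, TensorProduct.tmul_add]

theorem add_stmul (r s : R) (b : B) : stmul (r + s) b = stmul r b + stmul s b := by
  simp [stmul, TensorProduct.add_tmul]

theorem stmul_smul (x : ℝ) (r : R) (b : B) : stmul r (x • b) = x • stmul r b := by
  simp [stmul]

theorem smul_stmul (x : ℝ) (r : R) (b : B) : stmul (x • r) b = x • stmul r b := by
  rw [stmul, stmul, ← TensorProduct.smul_tmul', map_smul]

theorem zero_stmul (b : B) : stmul (0 : R) b = 0 := by simp [stmul]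

theorem stmul_zero (r : R) : stmul r (0 : B) = 0 := by simp [stmul]

theorem stmul_one_one : stmul (1 : R) (1 : B) = 1 := rfl

theorem par_stmul (r : R) (b : B) :
    Superalgebra.par (stmul r b) = stmul (Superalgebra.par r) (Superalgebra.par b) := rfl

theorem parPow_stmul (i : ZMod 2) (r : R) (b : B) :
    parPow i (stmul r b) = stmul (parPow i r) (parPow i b) := by
  rcases zmod_two i with rfl | rfl
  · simp
  · simp only [parPow_one, par_stmul]

theorem stmul_mem {i j : ZMod 2} {r : R} (hr : r ∈ homog R i) {b : B} (hb : b ∈ homog B j) :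
    stmul r b ∈ homog (STensor R B) (i + j) := by
  rw [mem_homog] at *
  rw [par_stmul, hr, hb, smul_stmul, stmul_smul, smul_smul, sgn_add]

/-- Only one of the two inner factors needs a parity: the sign is absorbed into a power of the
parity involution on the other, which is linear and so permits induction over sums. -/
theorem stmul_mul_stmul' {i : ZMod 2} (r : R) {b : B} (hb : b ∈ homog B i) (s : R) (c : B) :
    stmul r b * stmul s c = stmul (r * parPow i s) (b * c) := by
  induction s using homog_induction with
  | hadd s t hs ht => rw [add_stmul, mul_add, hs, ht, map_add, mul_add, add_stmul]
  | h j s hs => rw [stmul_mul_stmul r hb hs, parPow_of_mem hs, mul_smul_comm, smul_stmul]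

theorem stmul_mul_stmul'' {j : ZMod 2} (r : R) (b : B) {s : R} (hs : s ∈ homog R j) (c : B) :
    stmul r b * stmul s c = stmul (r * s) (parPow j b * c) := by
  induction b using homog_induction with
  | hadd s t hs ht => rw [stmul_add, add_mul, hs, ht, map_add, add_mul, stmul_add]
  | h i s hb =>
    rw [stmul_mul_stmul r hb hs, parPow_of_mem hb, smul_mul_assoc, stmul_smul, mul_comm]

theorem stmul_one_mul_stmul (r s : R) (c : B) : stmul r 1 * stmul s c = stmul (r * s) c := by
  rw [stmul_mul_stmul' r one_mem_homog, parPow_zero, one_mul]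

theorem stmul_mul_one_stmul (r : R) (b c : B) : stmul r b * stmul 1 c = stmul r (b * c) := by
  rw [stmul_mul_stmul'' r b one_mem_homog, parPow_zero, mul_one]

theorem tensor_induction {P : STensor R B → Prop} (hadd : ∀ x y, P x → P y → P (x + y))
    (h : ∀ i j, ∀ r ∈ homog R i, ∀ b ∈ homog B j, P (stmul r b)) (x : STensor R B) : P x := by
  have hx : ∀ y : R ⊗[ℝ] B, P (GradedTensorProduct.of ℝ (homog R) (homog B) y) := by
    intro y
    induction y using TensorProduct.induction_on with
    | zero =>
      have := h 0 0 0 (Submodule.zero_mem _) 0 (Submodule.zero_mem _)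
      rw [zero_stmul] at this
      simpa using this
    | tmul r b =>
      change P (stmul r b)
      induction r using homog_induction with
      | hadd r s hr hs =>
        rw [add_stmul]
        exact hadd _ _ hr hs
      | h i r hr =>
        induction b using homog_induction with
        | hadd b c hb hc =>
          rw [stmul_add]
          exact hadd _ _ hb hc
        | h j b hb => exact h i j r hr b hb
    | add y z hy hz =>
      rw [map_add]
      exact hadd _ _ hy hz
  exact hx x

theorem tmap_id (x : STensor R B) : tmap LinearMap.id LinearMap.id x = x := by
  induction x using tensor_induction with
  | hadd x y hx hy => simp only [map_add, hx, hy]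
  | h i j r _ b _ => simp [tmap_stmul]

/-- The tensor product of supercommutative algebras is supercommutative. -/
theorem IsSupercommutative.tensor (hR : IsSupercommutative R) (hB : IsSupercommutative B) :
    IsSupercommutative (STensor R B) := by
  have key : ∀ i j k l, ∀ r ∈ homog R i, ∀ b ∈ homog B j, ∀ s ∈ homog R k, ∀ c ∈ homog B l,
      stmul r b * stmul s c = sgn ((i + j) * (k + l)) • (stmul s c * stmul r b) := by
    intro i j k l r hr b hb s hs c hc
    rw [stmul_mul_stmul r hb hs, stmul_mul_stmul s hc hr, hR i k r hr s hs, hB j l b hb c hc,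
      smul_stmul, stmul_smul]
    simp only [smul_smul, ← sgn_add]
    congr 2
    -- The two sign exponents differ by 2il, which is zero in ℤ/2.
    linear_combination (-(i * l)) * zmod_two_one_add_one
  refine IsSupercommutative.of_swap fun k x hx y => ?_
  -- A homogeneous tensor need not be given as a sum of homogeneous pure tensors of the same parity,
  -- so the induction runs over all x and is about the component of x.
  have main : ∀ x : STensor R B, (comp (STensor R B) k x : STensor R B) * y
      = parPow k y * (comp (STensor R B) k x : STensor R B) := by
    intro x
    induction x using tensor_induction with
    | hadd x z hx hz => simp only [map_add, Submodule.coe_add, add_mul, mul_add, hx, hz]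
    | h i j r hr b hb =>
      by_cases hk : k = i + j
      · subst hk
        rw [comp_coe_same (i + j) ⟨_, stmul_mem hr hb⟩]
        simp only
        induction y using tensor_induction with
        | hadd x z hx hz => simp only [map_add, add_mul, mul_add, hx, hz]
        | h k l s hs c hc =>
          rw [key _ _ _ _ r hr b hb s hs c hc, parPow_of_mem (stmul_mem hs hc), smul_mul_assoc]
      · rw [comp_coe_ne hk ⟨_, stmul_mem hr hb⟩]
        simp
  have := main x
  rwa [comp_coe_same k ⟨x, hx⟩] at this

/-- The tensor product of even algebra homomorphisms. -/
def tmapHom (f : R →ₐ[ℝ] R') (g : B →ₐ[ℝ] B')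
    (hf : ∀ x, f (Superalgebra.par x) = Superalgebra.par (f x))
    (hg : ∀ x, g (Superalgebra.par x) = Superalgebra.par (g x)) : STensor R B →ₐ[ℝ] STensor R' B' :=
  AlgHom.ofLinearMap (tmap f.toLinearMap g.toLinearMap)
    (by
      change tmap _ _ (stmul 1 1) = stmul 1 1
      simp [tmap_stmul])
    (by
      intro x y
      induction x using tensor_induction with
      | hadd x z hx hz => simp only [map_add, add_mul, hx, hz]
      | h i j r hr b hb =>
        induction y using tensor_induction with
        | hadd x z hx hz => simp only [map_add, mul_add, hx, hz]
        | h k l s hs c hc =>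
          have hb' : g b ∈ homog B' j := by
            rw [mem_homog] at *
            rw [← hg, hb, map_smul]
          have hs' : f s ∈ homog R' k := by
            rw [mem_homog] at *
            rw [← hf, hs, map_smul]
          rw [stmul_mul_stmul r hb hs, map_smul]
          simp only [tmap_stmul, AlgHom.toLinearMap_apply, map_mul]
          rw [stmul_mul_stmul _ hb' hs'])

theorem tmap_par (f : R →ₗ[ℝ] R') (g : B →ₗ[ℝ] B')
    (hf : ∀ x, f (Superalgebra.par x) = Superalgebra.par (f x))
    (hg : ∀ x, g (Superalgebra.par x) = Superalgebra.par (g x)) (x : STensor R B) :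
    tmap f g (Superalgebra.par x) = Superalgebra.par (tmap f g x) := by
  induction x using tensor_induction with
  | hadd x z hx hz => simp only [map_add, hx, hz]
  | h i j r hr b hb => simp only [par_stmul, tmap_stmul, hf, hg]

theorem IsSuperDer.tmap_left {i : ZMod 2} {D : R →ₗ[ℝ] R} (h : IsSuperDer i D) :
    IsSuperDer i (tmap D LinearMap.id : STensor R B →ₗ[ℝ] STensor R B) where
  leibniz x y := by
    induction x using tensor_induction with
    | hadd x z hx hz =>
      simp only [map_add, add_mul, hx, hz]
      abel
    | h k l r hr b hb =>
      induction y using tensor_induction with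
      | hadd x z hx hz =>
        simp only [map_add, mul_add, hx, hz]
        abel
      | h k' l' s hs c hc =>
        rw [stmul_mul_stmul r hb hs, map_smul, tmap_stmul, tmap_stmul, tmap_stmul, parPow_stmul]
        simp only [LinearMap.id_apply]
        rw [stmul_mul_stmul (D r) hb hs, stmul_mul_stmul _ (parPow_mem hb i) (h.mem hs),
          h.leibniz, add_stmul, smul_add, parPow_of_mem hb, smul_mul_assoc, stmul_smul, smul_smul,
          ← sgn_add]
        congr 3
        rcases zmod_two i with rfl | rfl <;> rcases zmod_two l with rfl | rfl <;>
          rcases zmod_two k' with rfl | rfl <;> rfl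
  par x := by
    induction x using tensor_induction with
    | hadd x z hx hz => simp only [map_add, smul_add, hx, hz]
    | h k l r hr b hb =>
      simp only [par_stmul, tmap_stmul, h.par, smul_stmul, LinearMap.id_apply]

/-- A left derivation of the second factor has to pass the first one; `parPow i` is the resulting
sign. -/
theorem IsSuperDer.tmap_right {i : ZMod 2} {D : B →ₗ[ℝ] B} (h : IsSuperDer i D) :
    IsSuperDer i (tmap (ThickMorphism.parPow i).toLinearMap D :
      STensor R B →ₗ[ℝ] STensor R B) where
  leibniz x y := by
    induction x using tensor_induction with
    | hadd x z hx hz =>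
      simp only [map_add, add_mul, hx, hz]
      abel
    | h k l r hr b hb =>
      induction y using tensor_induction with
      | hadd x z hx hz =>
        simp only [map_add, mul_add, hx, hz]
        abel
      | h k' l' s hs c hc =>
        rw [stmul_mul_stmul r hb hs, map_smul, tmap_stmul, tmap_stmul, tmap_stmul, parPow_stmul]
        simp only [AlgHom.toLinearMap_apply]
        rw [stmul_mul_stmul _ (h.mem hb) hs, stmul_mul_stmul _ (parPow_mem hb i) (parPow_mem hs i),
          h.leibniz, stmul_add, smul_add, map_mul, parPow_of_mem hs, mul_smul_comm, smul_stmul,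
          smul_smul, ← sgn_add]
        congr 3
        rcases zmod_two i with rfl | rfl <;> rcases zmod_two l with rfl | rfl <;>
          rcases zmod_two k' with rfl | rfl <;> rfl
  par x := by
    induction x using tensor_induction with
    | hadd x z hx hz => simp only [map_add, smul_add, hx, hz]
    | h k l r hr b hb =>
      simp only [par_stmul, tmap_stmul, h.par, stmul_smul, AlgHom.toLinearMap_apply]
      congr 2
      rcases zmod_two i with rfl | rfl <;> simp [parPow_one]

/-! ### Tensor products of subspaces -/

/-- The span of the pure tensors `v ⊗ w` with `v ∈ V`, `w ∈ W`. -/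
def tens (V : Submodule ℝ R) (W : Submodule ℝ B) : Submodule ℝ (STensor R B) :=
  Submodule.span ℝ {x | ∃ v ∈ V, ∃ w ∈ W, stmul v w = x}

theorem stmul_mem_tens {V : Submodule ℝ R} {W : Submodule ℝ B} {v : R} (hv : v ∈ V) {w : B}
    (hw : w ∈ W) : stmul v w ∈ tens V W := Submodule.subset_span ⟨v, hv, w, hw, rfl⟩

theorem tens_le {V : Submodule ℝ R} {W : Submodule ℝ B} {X : Submodule ℝ (STensor R B)}
    (h : ∀ v ∈ V, ∀ w ∈ W, stmul v w ∈ X) : tens V W ≤ X := by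
  refine Submodule.span_le.mpr ?_
  rintro _ ⟨v, hv, w, hw, rfl⟩
  exact h v hv w hw

theorem tens_mono {V V' : Submodule ℝ R} {W W' : Submodule ℝ B} (hV : V ≤ V') (hW : W ≤ W') :
    tens V W ≤ tens V' W' := tens_le fun _ hv _ hw => stmul_mem_tens (hV hv) (hW hw)

theorem tens_top_top : tens (⊤ : Submodule ℝ R) (⊤ : Submodule ℝ B) = ⊤ := by
  rw [eq_top_iff]
  intro x _
  induction x using tensor_induction with
  | hadd x z hx hz => exact Submodule.add_mem _ (hx trivial) (hz trivial)
  | h k l r hr b hb => exact stmul_mem_tens Submodule.mem_top Submodule.mem_top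

theorem tens_bot_right (V : Submodule ℝ R) : tens V (⊥ : Submodule ℝ B) = ⊥ := by
  rw [eq_bot_iff]
  refine tens_le fun v _ w hw => ?_
  rw [(Submodule.mem_bot ℝ).mp hw, stmul_zero]
  exact Submodule.zero_mem _

theorem tens_bot_left (W : Submodule ℝ B) : tens (⊥ : Submodule ℝ R) W = ⊥ := by
  rw [eq_bot_iff]
  refine tens_le fun v hv w _ => ?_
  rw [(Submodule.mem_bot ℝ).mp hv, zero_stmul]
  exact Submodule.zero_mem _

/-- A subspace is graded if it is stable under the parity involution. -/
def IsGraded (V : Submodule ℝ R) : Prop := ∀ x ∈ V, Superalgebra.par x ∈ V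

theorem IsGraded.parPow {V : Submodule ℝ R} (h : IsGraded V) (i : ZMod 2) {x : R} (hx : x ∈ V) :
    parPow i x ∈ V := by
  rcases zmod_two i with rfl | rfl
  · simpa using hx
  · rw [parPow_one]
    exact h x hx

theorem isGraded_top : IsGraded (⊤ : Submodule ℝ R) := fun _ _ => trivial

theorem IsGraded.comp {V : Submodule ℝ R} (h : IsGraded V) (i : ZMod 2) {x : R} (hx : x ∈ V) :
    (ThickMorphism.comp R i x : R) ∈ V := by
  rw [coe_comp]
  exact Submodule.smul_mem _ _ (Submodule.add_mem _ hx (Submodule.smul_mem _ _ (h x hx)))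

theorem IsGraded.mul {V W : Submodule ℝ R} (hV : IsGraded V) (hW : IsGraded W) :
    IsGraded (V * W) := by
  intro x hx
  induction hx using Submodule.mul_induction_on' with
  | mem_mul_mem m hm n hn =>
    rw [map_mul]
    exact Submodule.mul_mem_mul (hV m hm) (hW n hn)
  | add x _ y _ hx hy =>
    rw [map_add]
    exact Submodule.add_mem _ hx hy

theorem IsGraded.pow {V : Submodule ℝ R} (hV : IsGraded V) (k : ℕ) : IsGraded (V ^ k) := by
  induction k with
  | zero =>
    rw [pow_zero]
    intro x hx
    rw [Submodule.mem_one] at hx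
    obtain ⟨r, rfl⟩ := hx
    rw [AlgHom.commutes]
    exact Submodule.algebraMap_mem r
  | succ k ih =>
    rw [pow_succ]
    exact ih.mul hV

theorem IsGraded.tens {V : Submodule ℝ R} {W : Submodule ℝ B} (hV : IsGraded V)
    (hW : IsGraded W) : IsGraded (tens V W) := by
  intro x hx
  induction hx using Submodule.span_induction with
  | mem x h =>
    obtain ⟨v, hv, w, hw, rfl⟩ := h
    exact stmul_mem_tens (hV v hv) (hW w hw)
  | zero => simp
  | add x y _ _ hx hy =>
    rw [map_add]
    exact Submodule.add_mem _ hx hy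
  | smul a x _ hx =>
    rw [map_smul]
    exact Submodule.smul_mem _ _ hx

/-- Gradedness makes the sign rule harmless: the homogeneous components of w stay in W, and the
parity involution keeps s in V'. -/
theorem tens_mul_tens_le {V V' V'' : Submodule ℝ R} {W W' W'' : Submodule ℝ B}
    (hW : IsGraded W) (hV' : IsGraded V') (hV : V * V' ≤ V'') (hWW : W * W' ≤ W'') :
    tens V W * tens V' W' ≤ tens V'' W'' := by
  rw [tens, tens, Submodule.span_mul_span, Submodule.span_le]
  rintro _ ⟨_, ⟨v, hv, w, hw, rfl⟩, _, ⟨s, hs, c, hc, rfl⟩, rfl⟩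
  change stmul v w * stmul s c ∈ tens V'' W''
  rw [← comp_zero_add_comp_one w, stmul_add, add_mul,
    stmul_mul_stmul' v (ThickMorphism.comp B 0 w).2,
    stmul_mul_stmul' v (ThickMorphism.comp B 1 w).2]
  have h : ∀ i : ZMod 2, stmul (v * ThickMorphism.parPow i s) ((ThickMorphism.comp B i w : B) * c)
      ∈ tens V'' W'' := fun i => stmul_mem_tens
    (hV (Submodule.mul_mem_mul hv (hV'.parPow i hs)))
    (hWW (Submodule.mul_mem_mul (hW.comp i hw) hc))
  exact Submodule.add_mem _ (h 0) (h 1)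

end Tensor

/-! ### The filtration by the powers of an ideal -/

section Filtration

variable {R : Type*} [Ring R] [Algebra ℝ R]

theorem top_mul_top_submodule : (⊤ : Submodule ℝ R) * ⊤ = ⊤ := by
  rw [eq_top_iff]
  intro x _
  have := Submodule.mul_mem_mul (Submodule.mem_top : x ∈ (⊤ : Submodule ℝ R))
    (Submodule.mem_top : (1 : R) ∈ (⊤ : Submodule ℝ R))
  rwa [mul_one] at this

/-- The `k`-th power of the ideal generated by `V`. -/
def idealPow (V : Submodule ℝ R) (k : ℕ) : Submodule ℝ R := V ^ k * ⊤

variable {V : Submodule ℝ R}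

theorem idealPow_zero : idealPow V 0 = ⊤ := by rw [idealPow, pow_zero, one_mul]

/-- The condition ⊤ V = V ⊤ says that V generates the same ideal from the left and from the right.
This is what makes `idealPow` multiplicative. -/
theorem top_mul_pow (hV : ⊤ * V = V * ⊤) (k : ℕ) : ⊤ * V ^ k = V ^ k * ⊤ := by
  induction k with
  | zero => rw [pow_zero, one_mul, mul_one]
  | succ k ih => rw [pow_succ, ← mul_assoc, ih, mul_assoc, hV, mul_assoc]

theorem idealPow_mul (hV : ⊤ * V = V * ⊤) (k l : ℕ) :
    idealPow V k * idealPow V l = idealPow V (k + l) := by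
  rw [idealPow, idealPow, idealPow, mul_assoc, ← mul_assoc ⊤, top_mul_pow hV, mul_assoc,
    top_mul_top_submodule, ← mul_assoc, ← pow_add]

theorem idealPow_anti {k l : ℕ} (h : k ≤ l) :
    idealPow V l ≤ idealPow V k := by
  obtain ⟨j, rfl⟩ := Nat.exists_eq_add_of_le h
  rw [idealPow, idealPow, pow_add, mul_assoc]
  exact mul_le_mul_right le_top _

theorem idealPow_eq_bot {k : ℕ} (h : V ^ k = ⊥) : idealPow V k = ⊥ := by
  rw [idealPow, h, Submodule.bot_mul]

theorem le_idealPow_one : V ≤ idealPow V 1 := by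
  intro x hx
  rw [idealPow, pow_one]
  have := Submodule.mul_mem_mul hx (Submodule.mem_top : (1 : R) ∈ (⊤ : Submodule ℝ R))
  rwa [mul_one] at this

theorem isGraded_idealPow [Superalgebra R] (hV : IsGraded V) (k : ℕ) : IsGraded (idealPow V k) :=
  (hV.pow k).mul isGraded_top

end Filtration

/-! ### The Grassmann algebra -/

section Grassmann

variable {m : ℕ}

theorem par_ι (v : Fin m → ℝ) : Superalgebra.par (ExteriorAlgebra.ι ℝ v : Grassmann m)
    = -ExteriorAlgebra.ι ℝ v := CliffordAlgebra.involute_ι v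

theorem ι_mem (v : Fin m → ℝ) : (ExteriorAlgebra.ι ℝ v : Grassmann m) ∈ homog (Grassmann m) 1 := by
  rw [mem_homog, par_ι, sgn_one, neg_smul, one_smul]

@[elab_as_elim]
theorem grassmann_induction {P : Grassmann m → Prop} (x : Grassmann m)
    (scalar : ∀ r : ℝ, P (algebraMap ℝ _ r)) (add : ∀ x y, P x → P y → P (x + y))
    (ι_mul : ∀ v x, P x → P (ExteriorAlgebra.ι ℝ v * x)) : P x :=
  CliffordAlgebra.left_induction 0 (P := fun x => P x) scalar add
    (fun x v h => ι_mul v x h) x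

theorem ι_mul_swap (v : Fin m → ℝ) (y : Grassmann m) :
    ExteriorAlgebra.ι ℝ v * y = Superalgebra.par y * ExteriorAlgebra.ι ℝ v := by
  induction y using grassmann_induction with
  | scalar r => rw [AlgHom.commutes, Algebra.commutes]
  | add x y hx hy => rw [mul_add, hx, hy, map_add, add_mul]
  | ι_mul w x hx =>
    have h : (ExteriorAlgebra.ι ℝ v : Grassmann m) * ExteriorAlgebra.ι ℝ w
        = -(ExteriorAlgebra.ι ℝ w * ExteriorAlgebra.ι ℝ v) :=
      eq_neg_of_add_eq_zero_left (ExteriorAlgebra.ι_add_mul_swap v w)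
    rw [← mul_assoc, h, neg_mul, mul_assoc, hx, map_mul, par_ι, mul_assoc, neg_mul]

/-- Induction on the number of generators: removing a generator shifts the parity of the component
by one, and `ι_mul_swap` moves that generator past y. -/
theorem isSupercommutative_grassmann : IsSupercommutative (Grassmann m) := by
  refine IsSupercommutative.of_swap fun i x hx y => ?_
  have main : ∀ (x : Grassmann m) (i : ZMod 2) (y : Grassmann m),
      (comp (Grassmann m) i x : Grassmann m) * y
        = parPow i y * (comp (Grassmann m) i x : Grassmann m) := by
    intro x
    induction x using grassmann_induction with
    | scalar r =>
      intro i y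
      rcases zmod_two i with rfl | rfl
      · simp only [coe_comp, sgn_zero, one_smul, AlgHom.commutes, parPow_zero, ← map_add,
          smul_mul_assoc, mul_smul_comm]
        rw [Algebra.commutes]
      · simp [coe_comp, sgn_one]
    | add x y hx hy =>
      intro i z
      simp only [map_add, Submodule.coe_add, add_mul, mul_add, hx, hy]
    | ι_mul v x hx =>
      intro i y
      have e : (comp (Grassmann m) i (ExteriorAlgebra.ι ℝ v * x) : Grassmann m)
          = ExteriorAlgebra.ι ℝ v * (comp (Grassmann m) (1 + i) x : Grassmann m) := by
        rw [coe_comp, coe_comp, map_mul, par_ι, sgn_add, sgn_one]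
        simp only [mul_smul_comm, mul_add, neg_mul, one_mul, neg_smul, mul_neg, smul_neg]
      rw [e, mul_assoc, hx, ← mul_assoc, ι_mul_swap, ← parPow_one, parPow_parPow, ← add_assoc,
        zmod_two_one_add_one, zero_add, mul_assoc]
  have := main x i y
  rwa [comp_coe_same i ⟨x, hx⟩] at this

theorem grassmannDeriv_ι_mul (μ : Fin m) (v : Fin m → ℝ) (x : Grassmann m) :
    grassmannDeriv μ (ExteriorAlgebra.ι ℝ v * x)
      = v μ • x - ExteriorAlgebra.ι ℝ v * grassmannDeriv μ x :=
  CliffordAlgebra.contractLeft_ι_mul _ _ _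

theorem grassmannDeriv_algebraMap (μ : Fin m) (r : ℝ) :
    grassmannDeriv μ (algebraMap ℝ (Grassmann m) r) = 0 :=
  CliffordAlgebra.contractLeft_algebraMap _ _ _

theorem grassmannDeriv_ι (μ : Fin m) (v : Fin m → ℝ) :
    grassmannDeriv μ (ExteriorAlgebra.ι ℝ v) = algebraMap ℝ (Grassmann m) (v μ) :=
  CliffordAlgebra.contractLeft_ι _ _ _

theorem isSuperDer_grassmannDeriv (μ : Fin m) : IsSuperDer 1 (grassmannDeriv μ) where
  leibniz x y := by
    rw [parPow_one]
    induction x using grassmann_induction with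
    | scalar r =>
      rw [grassmannDeriv_algebraMap, AlgHom.commutes, zero_mul, zero_add, ← Algebra.smul_def,
        map_smul, Algebra.smul_def]
    | add x z hx hz =>
      simp only [map_add, add_mul, hx, hz]
      abel
    | ι_mul v x hx =>
      rw [mul_assoc, grassmannDeriv_ι_mul, hx, grassmannDeriv_ι_mul, map_mul, par_ι]
      simp only [mul_add, sub_mul, neg_mul, mul_assoc, smul_mul_assoc]
      abel
  par x := by
    rw [sgn_one]
    induction x using grassmann_induction with
    | scalar r => simp [grassmannDeriv_algebraMap]
    | add x z hx hz => simp only [map_add, smul_add, hx, hz]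
    | ι_mul v x hx =>
      rw [map_mul, par_ι, neg_mul, map_neg, grassmannDeriv_ι_mul, grassmannDeriv_ι_mul, hx,
        map_sub, map_smul, map_mul, par_ι]
      simp only [neg_smul, one_smul, mul_neg, neg_mul]

theorem oddMonomial_empty {R : Type*} [Ring R] (ξ : Fin m → R) : oddMonomial ξ ∅ = 1 := by
  simp [oddMonomial]

theorem oddMonomial_insert {R : Type*} [Ring R] (ξ : Fin m → R) {a : Fin m} {I : Finset (Fin m)}
    (h : ∀ x ∈ I, a < x) : oddMonomial ξ (insert a I) = ξ a * oddMonomial ξ I := by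
  rw [oddMonomial, Finset.sort_insert _ (fun b hb => (h b hb).le)
    (fun ha => lt_irrefl _ (h a ha))]
  simp [oddMonomial]

/-- The monomials in the generators. -/
def grassmannMonomial (I : Finset (Fin m)) : Grassmann m :=
  oddMonomial (fun μ => ExteriorAlgebra.ι ℝ (Pi.single μ 1)) I

theorem grassmannMonomial_eq_basis (I : Finset (Fin m)) :
    grassmannMonomial I = (Pi.basisFun ℝ (Fin m)).ExteriorAlgebra I := by
  rw [ExteriorAlgebra.basis_apply_ofCard _ rfl, grassmannMonomial, oddMonomial]
  change _ = (List.ofFn _).prod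
  congr 1
  apply List.ext_getElem
  · simp
  · intro i h1 h2
    simp only [List.getElem_map, List.getElem_ofFn, Function.comp_apply, Pi.basisFun_apply]
    congr 2

theorem span_grassmannMonomial :
    Submodule.span ℝ (Set.range (grassmannMonomial (m := m))) = ⊤ := by
  rw [← (Pi.basisFun ℝ (Fin m)).ExteriorAlgebra.span_eq]
  congr 2
  funext I
  exact grassmannMonomial_eq_basis I

/-- The sign counts the generators standing before ξ^μ. It is the sign in `derivCoeffs`, so the odd
partial derivatives of sections can be identified with the contraction. Inserting the elements from
the smallest one puts the new generator in front. -/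
theorem grassmannDeriv_monomial (μ : Fin m) (I : Finset (Fin m)) :
    grassmannDeriv μ (grassmannMonomial I) =
      if μ ∈ I then ((-1 : ℝ) ^ ((I.erase μ).filter (· < μ)).card) • grassmannMonomial (I.erase μ)
      else 0 := by
  induction I using Finset.induction_on_min with
  | empty =>
    simp only [grassmannMonomial, oddMonomial_empty, Finset.notMem_empty, if_false]
    exact (isSuperDer_grassmannDeriv μ).map_one
  | insert a I h ih =>
    have ha : a ∉ I := fun ha => lt_irrefl _ (h a ha)
    rw [grassmannMonomial, oddMonomial_insert _ h, grassmannDeriv_ι_mul]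
    change _ - _ * grassmannDeriv μ (grassmannMonomial I) = _
    rw [ih]
    by_cases hμ : μ = a
    · subst hμ
      have hc : (I.filter (· < μ)) = ∅ := by
        rw [Finset.filter_eq_empty_iff]
        exact fun x hx => not_lt.mpr (h x hx).le
      simp [ha, hc, grassmannMonomial]
    · rw [Pi.single_eq_of_ne hμ, zero_smul, zero_sub]
      by_cases hI : μ ∈ I
      · have haμ : a < μ := h μ hI
        have h' : ∀ x ∈ I.erase μ, a < x := fun x hx => h x (Finset.mem_of_mem_erase hx)
        have ha' : a ∉ (I.erase μ).filter (· < μ) := by simp [ha]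
        rw [if_pos hI, if_pos (Finset.mem_insert_of_mem hI),
          Finset.erase_insert_of_ne (Ne.symm hμ), Finset.filter_insert, if_pos haμ,
          Finset.card_insert_of_notMem ha', pow_succ, grassmannMonomial, grassmannMonomial,
          oddMonomial_insert _ h']
        simp
      · rw [if_neg hI, if_neg (by simp [hμ, hI])]
        simp

/-- The space of generators. -/
def generators (m : ℕ) : Submodule ℝ (Grassmann m) :=
  LinearMap.range (ExteriorAlgebra.ι ℝ : (Fin m → ℝ) →ₗ[ℝ] Grassmann m)

theorem isGraded_generators : IsGraded (generators m) := by
  rintro _ ⟨v, rfl⟩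
  rw [par_ι]
  exact Submodule.neg_mem _ ⟨v, rfl⟩

theorem top_mul_generators : ⊤ * generators m = generators m * ⊤ := by
  apply le_antisymm
  · rw [Submodule.mul_le]
    rintro y _ _ ⟨v, rfl⟩
    rw [← Superalgebra.par_par y, ← ι_mul_swap]
    exact Submodule.mul_mem_mul ⟨v, rfl⟩ Submodule.mem_top
  · rw [Submodule.mul_le]
    rintro _ ⟨v, rfl⟩ y _
    rw [ι_mul_swap]
    exact Submodule.mul_mem_mul Submodule.mem_top ⟨v, rfl⟩

/-- The exterior power of degree m + 1 has dimension equal to a vanishing binomial coefficient. -/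
theorem generators_pow : generators m ^ (m + 1) = ⊥ := by
  have h := exteriorPower.finrank_eq (R := ℝ) (M := Fin m → ℝ) (n := m + 1)
  rw [Module.finrank_fin_fun, Nat.choose_succ_self] at h
  have : Module.Finite ℝ (generators m ^ (m + 1) : Submodule ℝ (Grassmann m)) :=
    Module.Finite.of_basis ((Pi.basisFun ℝ (Fin m)).exteriorPower (m + 1))
  exact Submodule.finrank_eq_zero.mp h

theorem algebraMapInv_par (x : Grassmann m) :
    ExteriorAlgebra.algebraMapInv (Superalgebra.par x) = ExteriorAlgebra.algebraMapInv x := by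
  induction x using grassmann_induction with
  | scalar r => simp
  | add x y hx hy => simp only [map_add, hx, hy]
  | ι_mul v x hx => simp [par_ι, ExteriorAlgebra.algebraMapInv]

instance : Module.Finite ℝ (Grassmann m) :=
  Module.Finite.of_basis (Pi.basisFun ℝ (Fin m)).ExteriorAlgebra

end Grassmann

/-! ### The maximal ideal of a Weil superalgebra -/

namespace WeilSuperalgebra

variable (A : WeilSuperalgebra)

/-- The maximal ideal. -/
def maxIdeal : Submodule ℝ A := LinearMap.ker A.aug.toLinearMap

variable {A}

theorem mem_maxIdeal {a : A} : a ∈ A.maxIdeal ↔ A.aug a = 0 := Iff.rfl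

theorem isGraded_maxIdeal : IsGraded A.maxIdeal := fun a ha => by
  rw [mem_maxIdeal] at *
  rw [aug_par, ha]

theorem top_mul_maxIdeal : ⊤ * A.maxIdeal = A.maxIdeal * ⊤ := by
  have h1 : ⊤ * A.maxIdeal = A.maxIdeal := by
    apply le_antisymm
    · rw [Submodule.mul_le]
      intro x _ y hy
      rw [mem_maxIdeal] at *
      rw [map_mul, hy, mul_zero]
    · intro x hx
      rw [← one_mul x]
      exact Submodule.mul_mem_mul Submodule.mem_top hx
  have h2 : A.maxIdeal * ⊤ = A.maxIdeal := by
    apply le_antisymm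
    · rw [Submodule.mul_le]
      intro x hx y _
      rw [mem_maxIdeal] at *
      rw [map_mul, hx, zero_mul]
    · intro x hx
      rw [← mul_one x]
      exact Submodule.mul_mem_mul hx Submodule.mem_top
  rw [h1, h2]

/-- If a were outside a maximal left ideal J, then 1 = j + ba with j in J; but ba is nilpotent, so j
would be a unit. -/
theorem maxIdeal_le_jacobson {a : A} (ha : a ∈ A.maxIdeal) : a ∈ Ring.jacobson A := by
  rw [Ring.jacobson, Module.jacobson, Submodule.mem_sInf]
  intro J hJ
  by_contra hJa
  have hsup : J ⊔ Submodule.span A {a} = ⊤ := by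
    refine hJ.2 _ (lt_of_le_of_ne le_sup_left fun h => hJa ?_)
    rw [h]
    exact Submodule.mem_sup_right (Submodule.mem_span_singleton_self a)
  have h1 : (1 : A) ∈ J ⊔ Submodule.span A {a} := by rw [hsup]; exact Submodule.mem_top
  obtain ⟨j, hj, y, hy, hjy⟩ := Submodule.mem_sup.mp h1
  obtain ⟨b, rfl⟩ := Submodule.mem_span_singleton.mp hy
  have hn : IsNilpotent (b • a) := A.nilpotent _ (by
    rw [smul_eq_mul, map_mul, mem_maxIdeal.mp ha, mul_zero])
  have hu : IsUnit j := by
    rw [eq_sub_of_add_eq hjy]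
    exact hn.isUnit_one_sub
  exact hJ.1 (Ideal.eq_top_of_isUnit_mem J hj hu)

/-- The definition only makes single elements nilpotent. A common exponent comes from A being
Artinian, so that its Jacobson radical is nilpotent. -/
theorem exists_maxIdeal_pow_eq_bot : ∃ K, A.maxIdeal ^ K = ⊥ := by
  have : IsArtinianRing A := IsArtinianRing.of_finite ℝ A
  obtain ⟨K, hK⟩ := IsSemiprimaryRing.isNilpotent (R := A)
  refine ⟨K, ?_⟩
  have h : ∀ k, ∀ x ∈ A.maxIdeal ^ k, x ∈ Ring.jacobson A ^ k := by
    intro k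
    induction k with
    | zero =>
      intro x _
      rw [Submodule.pow_zero, Submodule.one_eq_span]
      exact Submodule.mem_span_singleton.mpr ⟨x, mul_one x⟩
    | succ k ih =>
      intro x hx
      rw [pow_succ] at hx
      rw [Submodule.pow_succ]
      induction hx using Submodule.mul_induction_on' with
      | mem_mul_mem m hm n hn => exact Submodule.mul_mem_mul (ih m hm) (maxIdeal_le_jacobson hn)
      | add x _ y _ hx hy => exact Submodule.add_mem _ hx hy
  rw [eq_bot_iff]
  intro x hx
  have := h K x hx
  rw [hK] at this
  exact this

end WeilSuperalgebra

/-! ### Hadamard's lemma -/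

section Hadamard

/-- Differentiation under the integral: the partial derivative is continuous, hence bounded by a
constant on a closed ball times [0, 1], which provides the dominating function. -/
theorem hasFDerivAt_parametric_integral {E F : Type*} [NormedAddCommGroup E] [NormedSpace ℝ E]
    [ProperSpace E] [NormedAddCommGroup F] [NormedSpace ℝ F] {f : E × ℝ → F}
    (hf : ContDiff ℝ 1 f) (x₀ : E) :
    HasFDerivAt (fun x => ∫ t in (0 : ℝ)..1, f (x, t))
      (∫ t in (0 : ℝ)..1, (fderiv ℝ f (x₀, t)).comp (ContinuousLinearMap.inl ℝ E ℝ)) x₀ := by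
  have hc' : Continuous fun p : E × ℝ => (fderiv ℝ f p).comp (ContinuousLinearMap.inl ℝ E ℝ) :=
    (hf.continuous_fderiv one_ne_zero).clm_comp continuous_const
  obtain ⟨C, hC⟩ := ((isCompact_closedBall x₀ 1).prod (isCompact_Icc (a := (0 : ℝ)) (b := 1))
    ).exists_bound_of_continuousOn hc'.continuousOn
  refine intervalIntegral.hasFDerivAt_integral_of_dominated_of_fderiv_le
    (F' := fun x t => (fderiv ℝ f (x, t)).comp (ContinuousLinearMap.inl ℝ E ℝ))
    (bound := fun _ => C) (Metric.closedBall_mem_nhds x₀ one_pos) ?_ ?_ ?_ ?_ ?_ ?_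
  · refine Filter.Eventually.of_forall fun x => ?_
    exact (hf.continuous.comp (Continuous.prodMk_right x)).aestronglyMeasurable
  · exact (hf.continuous.comp (Continuous.prodMk_right x₀)).intervalIntegrable _ _
  · exact (hc'.comp (Continuous.prodMk_right x₀)).aestronglyMeasurable
  · refine Filter.Eventually.of_forall fun t ht x hx => hC (x, t) ⟨hx, ?_⟩
    rw [Set.uIoc_of_le zero_le_one] at ht
    exact ⟨ht.1.le, ht.2⟩
  · exact intervalIntegrable_const
  · refine Filter.Eventually.of_forall fun t _ x _ => ?_
    have h1 := (hf.differentiable one_ne_zero (x, t)).hasFDerivAt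
    exact h1.comp x (hasFDerivAt_prodMk_left x t)

/-- The derivative of the integral is an integral of the same kind with values in a space of linear
maps; this is why the target F varies inside the induction. -/
theorem contDiff_parametric_integral_nat {E : Type} [NormedAddCommGroup E] [NormedSpace ℝ E]
    [ProperSpace E] (k : ℕ) : ∀ {F : Type} [NormedAddCommGroup F] [NormedSpace ℝ F]
    {f : E × ℝ → F}, ContDiff ℝ k f → ContDiff ℝ k fun x => ∫ t in (0 : ℝ)..1, f (x, t) := by
  induction k with
  | zero =>
    intro F _ _ f hf
    rw [Nat.cast_zero, contDiff_zero] at *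
    exact intervalIntegral.continuous_parametric_intervalIntegral_of_continuous'
      (f := fun x t => f (x, t)) hf 0 1
  | succ k ih =>
    intro F _ _ f hf
    have h1 : ContDiff ℝ 1 f := hf.of_le (by
      rw [Nat.cast_succ]
      exact le_add_self)
    rw [Nat.cast_succ, contDiff_succ_iff_hasFDerivAt]
    refine ⟨_, ?_, fun x => hasFDerivAt_parametric_integral h1 x⟩
    have h2 : ContDiff ℝ k fun p : E × ℝ =>
        (fderiv ℝ f p).comp (ContinuousLinearMap.inl ℝ E ℝ) := by
      refine ContDiff.clm_comp ?_ contDiff_const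
      exact hf.fderiv_right (by rw [Nat.cast_succ])
    exact ih h2

theorem contDiff_parametric_integral {E : Type} [NormedAddCommGroup E] [NormedSpace ℝ E]
    [ProperSpace E] {F : Type} [NormedAddCommGroup F] [NormedSpace ℝ F]
    {f : E × ℝ → F} (hf : ContDiff ℝ ∞ f) : ContDiff ℝ ∞ fun x => ∫ t in (0 : ℝ)..1, f (x, t) :=
  contDiff_infty.mpr fun k => contDiff_parametric_integral_nat k (contDiff_infty.mp hf k)

/-- Integrate the derivative of f along the segment from v to x; g a is the integral of ∂f/∂x^a over
it. -/
theorem hadamard_global {n : ℕ} {f : (Fin n → ℝ) → ℝ} (hf : ContDiff ℝ ∞ f) (v : Fin n → ℝ) :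
    ∃ g : Fin n → (Fin n → ℝ) → ℝ, (∀ a, ContDiff ℝ ∞ (g a)) ∧
      ∀ x, f x - f v = ∑ a, (x a - v a) * g a x := by
  have hpath : ContDiff ℝ ∞ fun p : (Fin n → ℝ) × ℝ => v + p.2 • (p.1 - v) := by fun_prop
  refine ⟨fun a x => ∫ t in (0 : ℝ)..1, fderiv ℝ f (v + t • (x - v)) (Pi.single a 1),
    fun a => ?_, fun x => ?_⟩
  · refine contDiff_parametric_integral (f := fun p : (Fin n → ℝ) × ℝ =>
      fderiv ℝ f (v + p.2 • (p.1 - v)) (Pi.single a 1)) ?_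
    exact ((hf.fderiv_right (m := ∞) (by simp)).comp hpath).clm_apply contDiff_const
  · have hd : ∀ t ∈ Set.uIcc (0 : ℝ) 1, HasDerivAt (fun t => f (v + t • (x - v)))
        (fderiv ℝ f (v + t • (x - v)) (x - v)) t := by
      intro t _
      have h1 := (hf.differentiable (by simp) (v + t • (x - v))).hasFDerivAt
      have h2 : HasDerivAt (fun t : ℝ => v + t • (x - v)) (x - v) t := by
        simpa using ((hasDerivAt_id t).smul_const (x - v)).const_add v
      exact h1.comp_hasDerivAt t h2
    have hcont : ∀ w : Fin n → ℝ, Continuous fun t : ℝ => fderiv ℝ f (v + t • (x - v)) w := by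
      intro w
      have h3 : Continuous fun t : ℝ => v + t • (x - v) := by fun_prop
      exact ((hf.continuous_fderiv (by simp)).comp h3).clm_apply continuous_const
    have hi := intervalIntegral.integral_eq_sub_of_hasDerivAt hd
      ((hcont (x - v)).intervalIntegrable _ _)
    simp only [one_smul, zero_smul, add_zero, add_sub_cancel] at hi
    rw [← hi]
    have hsum : ∀ t : ℝ, fderiv ℝ f (v + t • (x - v)) (x - v)
        = ∑ a, (x a - v a) * fderiv ℝ f (v + t • (x - v)) (Pi.single a 1) := by
      intro t
      conv_lhs => arg 2; rw [← Finset.univ_sum_single (x - v)]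
      rw [map_sum]
      refine Finset.sum_congr rfl fun a _ => ?_
      have : Pi.single a ((x - v) a) = (x a - v a) • (Pi.single a 1 : Fin n → ℝ) := by
        rw [← Pi.single_smul', smul_eq_mul, mul_one, Pi.sub_apply]
      rw [this, map_smul, smul_eq_mul]
    simp only [hsum]
    rw [intervalIntegral.integral_finsetSum
      fun a _ => ((hcont _).const_mul _ |>.intervalIntegrable _ _)]
    refine Finset.sum_congr rfl fun a _ => ?_
    rw [intervalIntegral.integral_const_mul]

/-- A function that is smooth on an open set `V` and vanishes at `v ∈ V` is a combination of the
`x^a - v^a`. -/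
theorem hadamard {n : ℕ} {V : Set (Fin n → ℝ)} (hV : IsOpen V) (f : smoothOn V) {v : Fin n → ℝ}
    (hv : v ∈ V) : ∃ g : Fin n → smoothOn V, ∀ x ∈ V,
      (f : (Fin n → ℝ) → ℝ) x - (f : (Fin n → ℝ) → ℝ) v
        = ∑ a, (x a - v a) * (g a : (Fin n → ℝ) → ℝ) x := by
  -- V need not be star-shaped around v, so f is cut off by a bump function that is 1 at v and the
  -- global statement is applied to χf.
  obtain ⟨χ, hχ1, hχ2, hχ3, -, hχ4⟩ :
      ∃ χ : (Fin n → ℝ) → ℝ, tsupport χ ⊆ V ∧ HasCompactSupport χ ∧ ContDiff ℝ ∞ χ ∧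
        Set.range χ ⊆ Set.Icc 0 1 ∧ χ v = 1 :=
    exists_contDiff_tsupport_subset (hV.mem_nhds hv)
  have hF : ContDiff ℝ ∞ fun x => χ x * (f : (Fin n → ℝ) → ℝ) x := by
    rw [contDiff_iff_contDiffAt]
    intro x
    by_cases hx : x ∈ tsupport χ
    · exact hχ3.contDiffAt.mul
        (((f.2 : ContDiffOn ℝ ∞ _ _) x (hχ1 hx)).contDiffAt (hV.mem_nhds (hχ1 hx)))
    · refine (contDiffAt_const (c := (0 : ℝ))).congr_of_eventuallyEq ?_
      filter_upwards [notMem_tsupport_iff_eventuallyEq.mp hx] with y hy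
      rw [hy]
      simp
  obtain ⟨g, hg, hg'⟩ := hadamard_global hF v
  obtain ⟨h, hh, hh'⟩ := hadamard_global hχ3 v
  -- The cutoff is undone by f - f(v) = (χf - f(v)) - (χ - 1) f, using Hadamard's lemma for χ as
  -- well.
  refine ⟨fun a => ⟨g a, (hg a).contDiffOn⟩ - ⟨h a, (hh a).contDiffOn⟩ * f, fun x _ => ?_⟩
  have e1 := hg' x
  have e2 := hh' x
  rw [hχ4] at e1 e2
  simp only [AddSubgroupClass.coe_sub, MulMemClass.coe_mul, Pi.sub_apply, Pi.mul_apply, mul_sub,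
    Finset.sum_sub_distrib, ← mul_assoc, ← Finset.sum_mul]
  rw [← e1, ← e2]
  ring

end Hadamard

/-! ### Sections over the domain of a chart -/

namespace SuperChart

variable {M : SuperSpace.{u}} {n m : ℕ} {c : SuperChart M n m} {W : Opens M.carrier}
  (hW : W ≤ c.dom)

theorem odd_mem (μ : Fin m) : M.res hW (c.odd μ) ∈ homog (M.sec W) 1 := by
  have h := M.res_par hW (c.odd μ)
  rw [mem_homog, ← h, sgn_one, neg_smul, one_smul]
  exact (congrArg (M.res hW) (c.odd_par μ)).trans (map_neg _ _)

theorem par_fn (g : smoothOn (c.φ '' W)) : Superalgebra.par (c.fn W hW g) = c.fn W hW g :=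
  c.fn_par W hW g

theorem fn_mem (g : smoothOn (c.φ '' W)) : c.fn W hW g ∈ homog (M.sec W) 0 := by
  rw [mem_homog_zero, par_fn]

/-- The algebra homomorphism sending the generators of the Grassmann algebra to the odd
coordinates. -/
def oddHom : Grassmann m →ₐ[ℝ] M.sec W :=
  ExteriorAlgebra.lift ℝ ⟨∑ μ, (LinearMap.proj μ).smulRight (M.res hW (c.odd μ)), fun v => by
    have h : ∀ x ∈ homog (M.sec W) 1, x * x = 0 := by
      intro x hx
      have h2 := M.comm W 1 1 x hx x hx
      rw [mul_one, sgn_one, neg_smul, one_smul] at h2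
      have h3 : (2 : ℝ) • (x * x) = 0 := by
        rw [two_smul]
        exact add_eq_zero_iff_eq_neg.mpr h2
      exact (smul_eq_zero.mp h3).resolve_left two_ne_zero
    refine h _ ?_
    rw [LinearMap.sum_apply]
    exact Submodule.sum_mem _ fun μ _ => Submodule.smul_mem _ _ (odd_mem hW μ)⟩

theorem oddHom_ι (v : Fin m → ℝ) :
    oddHom hW (ExteriorAlgebra.ι ℝ v) = ∑ μ, v μ • M.res hW (c.odd μ) := by
  rw [oddHom, ExteriorAlgebra.lift_ι_apply]
  simp

theorem oddHom_single (μ : Fin m) :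
    oddHom hW (ExteriorAlgebra.ι ℝ (Pi.single μ 1)) = M.res hW (c.odd μ) := by
  rw [oddHom_ι, Finset.sum_eq_single μ]
  · simp
  · intro ν _ h
    rw [Pi.single_eq_of_ne h, zero_smul]
  · simp

theorem oddHom_monomial (I : Finset (Fin m)) :
    oddHom hW (grassmannMonomial I) = oddMonomial (fun μ => M.res hW (c.odd μ)) I := by
  rw [grassmannMonomial, oddMonomial, oddMonomial, map_list_prod, List.map_map]
  congr 2
  funext μ
  exact oddHom_single hW μ

theorem oddHom_par (x : Grassmann m) :
    oddHom hW (Superalgebra.par x) = Superalgebra.par (oddHom hW x) := by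
  induction x using grassmann_induction with
  | scalar r => simp
  | add x y hx hy => simp only [map_add, hx, hy]
  | ι_mul v x hx =>
    have h : oddHom hW (ExteriorAlgebra.ι ℝ v) ∈ homog (M.sec W) 1 := by
      rw [oddHom_ι]
      exact Submodule.sum_mem _ fun μ _ => Submodule.smul_mem _ _ (odd_mem hW μ)
    rw [mem_homog, sgn_one, neg_smul, one_smul] at h
    rw [map_mul, map_mul, map_mul, map_mul, hx, par_ι, map_neg, h]

theorem expand_eq_sum (g : Finset (Fin m) → smoothOn (c.φ '' W)) :
    expand hW g = ∑ I, c.fn W hW (g I) * oddHom hW (grassmannMonomial I) := by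
  simp only [expand, oddHom_monomial]

/-- Replaces the chosen coefficients of a section by products of a smooth function and an element of
the Grassmann algebra, on which derivatives can be computed. -/
theorem sec_induction {P : M.sec W → Prop} (s : M.sec W) (add : ∀ s t, P s → P t → P (s + t))
    (mul : ∀ g x, P (c.fn W hW g * oddHom hW x)) : P s := by
  have h0 : P 0 := by
    have := mul 0 0
    rwa [map_zero, zero_mul] at this
  rw [← expand_coeffs hW s, expand_eq_sum]
  exact Finset.sum_induction _ P add h0 fun I _ => mul _ _

/-- `pd` is defined through chosen coefficients, but these are unique as functions on the image of W
and the derivatives depend only on that; so every expansion may be used. -/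
theorem pd_expand (g : Finset (Fin m) → smoothOn (c.φ '' W)) (a : Fin n ⊕ Fin m) :
    pd hW a (expand hW g) = expand hW (derivCoeffs hW g a) := by
  change expand hW (derivCoeffs hW (coeffs hW (expand hW g)) a) = _
  exact expand_congr hW fun I => derivCoeffs_congr hW (fun J => coeffs_eqOn hW rfl J) a I

theorem expand_single (g : smoothOn (c.φ '' W)) (I : Finset (Fin m)) :
    expand hW (Pi.single I g) = c.fn W hW g * oddHom hW (grassmannMonomial I) := by
  rw [expand_eq_sum, Finset.sum_eq_single I]
  · rw [Pi.single_eq_same]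
  · intro J _ h
    rw [Pi.single_eq_of_ne h, map_zero, zero_mul]
  · simp

theorem monomial_linear_ext {E : Type*} [AddCommGroup E] [Module ℝ E] {f g : Grassmann m →ₗ[ℝ] E}
    (h : ∀ I, f (grassmannMonomial I) = g (grassmannMonomial I)) : f = g := by
  refine LinearMap.ext_on_range span_grassmannMonomial h

/-- Both sides are linear in x, so monomials suffice, where the expansion has a single coefficient.
-/
theorem pd_inl_fn_mul (a : Fin n) (g : smoothOn (c.φ '' W)) (x : Grassmann m) :
    pd hW (.inl a) (c.fn W hW g * oddHom hW x)
      = c.fn W hW (smoothDeriv (isOpen_image hW) a g) * oddHom hW x := by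
  have h : pd hW (.inl a) ∘ₗ LinearMap.mulLeft ℝ (c.fn W hW g) ∘ₗ (oddHom hW).toLinearMap
      = LinearMap.mulLeft ℝ (c.fn W hW (smoothDeriv (isOpen_image hW) a g)) ∘ₗ
        (oddHom hW).toLinearMap := by
    refine monomial_linear_ext fun I => ?_
    simp only [LinearMap.comp_apply, LinearMap.mulLeft_apply, AlgHom.toLinearMap_apply]
    rw [← expand_single, ← expand_single, pd_expand]
    refine expand_congr hW fun J v hv => ?_
    by_cases hJ : J = I
    · subst hJ
      simp [derivCoeffs]
    · simp [derivCoeffs, Pi.single_eq_of_ne hJ, smoothDeriv]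
  exact LinearMap.congr_fun h x

theorem pd_inr_fn_mul (μ : Fin m) (g : smoothOn (c.φ '' W)) (x : Grassmann m) :
    pd hW (.inr μ) (c.fn W hW g * oddHom hW x)
      = c.fn W hW g * oddHom hW (grassmannDeriv μ x) := by
  have h : pd hW (.inr μ) ∘ₗ LinearMap.mulLeft ℝ (c.fn W hW g) ∘ₗ (oddHom hW).toLinearMap
      = LinearMap.mulLeft ℝ (c.fn W hW g) ∘ₗ (oddHom hW).toLinearMap ∘ₗ grassmannDeriv μ := by
    refine monomial_linear_ext fun I => ?_
    simp only [LinearMap.comp_apply, LinearMap.mulLeft_apply, AlgHom.toLinearMap_apply]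
    rw [← expand_single, pd_expand, grassmannDeriv_monomial]
    by_cases hμ : μ ∈ I
    · rw [if_pos hμ, map_smul, mul_smul_comm, ← expand_single, ← expand_smul]
      congr 1
      funext J
      simp only [derivCoeffs, Pi.smul_apply]
      by_cases hJ : J = I.erase μ
      · subst hJ
        rw [if_neg (Finset.notMem_erase μ I), Finset.insert_erase hμ, Pi.single_eq_same,
          Pi.single_eq_same]
      · rw [Pi.single_eq_of_ne hJ, smul_zero]
        split_ifs with h
        · rfl
        · rw [Pi.single_eq_of_ne, smul_zero]
          rintro rfl
          exact hJ (Finset.erase_insert h).symm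
    · rw [if_neg hμ, map_zero, mul_zero]
      have h0 : derivCoeffs hW (Pi.single I g) (.inr μ) = 0 := by
        funext J
        simp only [derivCoeffs, Pi.zero_apply]
        split_ifs with h
        · rfl
        · rw [Pi.single_eq_of_ne, smul_zero]
          rintro rfl
          exact hμ (Finset.mem_insert_self _ _)
      rw [h0, expand_eq_sum]
      simp
  exact LinearMap.congr_fun h x

theorem fn_mul_oddHom_mul (g g' : smoothOn (c.φ '' W)) (x x' : Grassmann m) :
    c.fn W hW g * oddHom hW x * (c.fn W hW g' * oddHom hW x')
      = c.fn W hW (g * g') * oddHom hW (x * x') := by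
  have h := (M.comm W).swap (fn_mem hW g') (oddHom hW x)
  rw [parPow_zero] at h
  rw [map_mul, map_mul, mul_assoc, ← mul_assoc _ (c.fn W hW g'), ← h]
  simp only [mul_assoc]

theorem smoothDeriv_mul {V : Set (Fin n → ℝ)} (hV : IsOpen V) (a : Fin n) (g g' : smoothOn V) :
    Set.EqOn (smoothDeriv hV a (g * g') : (Fin n → ℝ) → ℝ)
      (smoothDeriv hV a g * g' + g * smoothDeriv hV a g' : smoothOn V) V := by
  intro v hv
  have d : ∀ g : smoothOn V, DifferentiableAt ℝ (g : (Fin n → ℝ) → ℝ) v := fun g =>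
    ((g.2 : ContDiffOn ℝ ∞ _ _).differentiableOn (by simp) v hv).differentiableAt (hV.mem_nhds hv)
  simp only [smoothDeriv, MulMemClass.coe_mul, AddMemClass.coe_add, Pi.add_apply, Pi.mul_apply]
  rw [fderiv_mul (d g) (d g')]
  simp only [add_apply, smul_apply, smul_eq_mul]
  ring

/-- The partial derivatives are left derivations. -/
theorem isSuperDer_pd (a : Idx n m) : IsSuperDer (ix a) (pd hW a) where
  leibniz s t := by
    induction s using sec_induction hW with
    | add s s' hs hs' =>
      simp only [map_add, add_mul, hs, hs']
      abel
    | mul g x =>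
      induction t using sec_induction hW with
      | add s s' hs hs' =>
        simp only [map_add, mul_add, hs, hs']
        abel
      | mul g' x' =>
        rw [fn_mul_oddHom_mul]
        rcases a with a | μ
        · rw [pd_inl_fn_mul, pd_inl_fn_mul, pd_inl_fn_mul, ix, parPow_zero, fn_mul_oddHom_mul,
            fn_mul_oddHom_mul, ← add_mul, ← map_add,
            c.fn_congr W hW _ _ (smoothDeriv_mul (isOpen_image hW) a g g')]
        · rw [pd_inr_fn_mul, pd_inr_fn_mul, pd_inr_fn_mul, ix, parPow_one, map_mul Superalgebra.par, par_fn,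
            ← oddHom_par, fn_mul_oddHom_mul, fn_mul_oddHom_mul,
            (isSuperDer_grassmannDeriv μ).leibniz, parPow_one, map_add, mul_add]
  par s := by
    induction s using sec_induction hW with
    | add s s' hs hs' => simp only [map_add, smul_add, hs, hs']
    | mul g x =>
      rw [map_mul, par_fn, ← oddHom_par]
      rcases a with a | μ
      · rw [pd_inl_fn_mul, pd_inl_fn_mul, map_mul, par_fn, ← oddHom_par, ix, sgn_zero, one_smul]
      · rw [pd_inr_fn_mul, pd_inr_fn_mul, map_mul, par_fn, ← oddHom_par,
          (isSuperDer_grassmannDeriv μ).par, ix, map_smul, mul_smul_comm]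

theorem coord_inl (a : Fin n) : coord hW (.inl a) = c.fn W hW (smoothCoord _ a) * oddHom hW 1 := by
  rw [map_one, mul_one]
  rfl

theorem coord_inr (μ : Fin m) : coord hW (.inr μ)
    = c.fn W hW 1 * oddHom hW (ExteriorAlgebra.ι ℝ (Pi.single μ 1)) := by
  rw [map_one, one_mul, oddHom_single]
  rfl

theorem coord_mem (a : Idx n m) : coord hW a ∈ homog (M.sec W) (ix a) := by
  rcases a with a | μ
  · exact fn_mem hW _
  · exact odd_mem hW μ

theorem pd_coord (a b : Idx n m) : pd hW a (coord hW b) = if a = b then 1 else 0 := by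
  rcases b with b | ν
  · rw [coord_inl]
    rcases a with a | μ
    · rw [pd_inl_fn_mul, map_one, mul_one]
      have h : Set.EqOn (smoothDeriv (isOpen_image hW) a (smoothCoord _ b) : (Fin n → ℝ) → ℝ)
          (algebraMap ℝ (smoothOn (c.φ '' W)) (if a = b then 1 else 0)) (c.φ '' W) := by
        intro v _
        have h1 : HasFDerivAt (fun v : Fin n → ℝ => v b)
          (ContinuousLinearMap.proj b : (Fin n → ℝ) →L[ℝ] ℝ) v := hasFDerivAt_apply b v
        simp only [smoothDeriv, smoothCoord]
        rw [h1.fderiv]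
        by_cases hab : a = b
        · subst hab
          simp
        · simp [hab, Ne.symm hab]
      rw [c.fn_congr W hW _ _ h, AlgHom.commutes]
      by_cases hab : a = b <;> simp [hab]
    · rw [pd_inr_fn_mul, (isSuperDer_grassmannDeriv μ).map_one]
      simp
  · rw [coord_inr]
    rcases a with a | μ
    · rw [pd_inl_fn_mul]
      have h : Set.EqOn (smoothDeriv (isOpen_image hW) a 1 : (Fin n → ℝ) → ℝ)
          (0 : smoothOn (c.φ '' W)) (c.φ '' W) := by
        intro v _
        have h1 : ((1 : smoothOn (c.φ '' W)) : (Fin n → ℝ) → ℝ) = fun _ => (1 : ℝ) := rfl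
        simp only [smoothDeriv]
        rw [h1]
        simp
      rw [c.fn_congr W hW _ _ h]
      simp
    · rw [pd_inr_fn_mul, map_one, one_mul, grassmannDeriv_ι, AlgHom.commutes]
      by_cases hab : μ = ν
      · subst hab
        simp
      · simp [hab]

theorem res_fn_mul {W' : Opens M.carrier} (h : W' ≤ W) (g : smoothOn (c.φ '' W))
    (x : Grassmann m) : M.res h (c.fn W hW g * oddHom hW x)
      = c.fn W' (h.trans hW) ⟨g, g.2.mono (Set.image_mono h)⟩ * oddHom (h.trans hW) x := by
  rw [map_mul, c.fn_res W W' hW h]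
  congr 1
  have : (M.res h).comp (oddHom hW) = oddHom (h.trans hW) := by
    apply ExteriorAlgebra.hom_ext
    ext μ
    simp only [LinearMap.comp_apply, AlgHom.toLinearMap_apply, AlgHom.comp_apply,
      LinearMap.single_apply]
    rw [oddHom_single, oddHom_single]
    exact M.res_res h hW (c.odd μ)
  exact AlgHom.congr_fun this x

theorem res_pd {W' : Opens M.carrier} (h : W' ≤ W) (a : Idx n m) (s : M.sec W) :
    M.res h (pd hW a s) = pd (h.trans hW) a (M.res h s) := by
  induction s using sec_induction hW with
  | add s t hs ht => simp only [map_add, hs, ht]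
  | mul g x =>
    rcases a with a | μ
    · rw [pd_inl_fn_mul, res_fn_mul, res_fn_mul, pd_inl_fn_mul]
      rfl
    · rw [pd_inr_fn_mul, res_fn_mul, res_fn_mul, pd_inr_fn_mul]

theorem res_coord {W' : Opens M.carrier} (h : W' ≤ W) (a : Idx n m) :
    M.res h (coord hW a) = coord (h.trans hW) a := by
  rcases a with a | μ
  · exact c.fn_res W W' hW h _
  · exact M.res_res h hW _

/-! ### Vanishing at a point -/

/-- The ideal of the sections vanishing at a point of the chart. -/
def vanishing (v : Fin n → ℝ) : Submodule ℝ (M.sec W) :=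
  Submodule.span ℝ {s | ∃ (g : smoothOn (c.φ '' W)) (t : M.sec W),
    (g : (Fin n → ℝ) → ℝ) v = 0 ∧ c.fn W hW g * t = s}

theorem vanishing_mul_top (v : Fin n → ℝ) : vanishing hW v * ⊤ ≤ vanishing hW v := by
  rw [vanishing, ← Submodule.span_univ, Submodule.span_mul_span]
  refine Submodule.span_mono ?_
  rintro _ ⟨_, ⟨g, t, hg, rfl⟩, s, _, rfl⟩
  exact ⟨g, t * s, hg, (mul_assoc _ _ _).symm⟩

theorem top_mul_vanishing (v : Fin n → ℝ) : ⊤ * vanishing hW v ≤ vanishing hW v := by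
  rw [vanishing, ← Submodule.span_univ, Submodule.span_mul_span]
  refine Submodule.span_mono ?_
  rintro _ ⟨s, _, _, ⟨g, t, hg, rfl⟩, rfl⟩
  refine ⟨g, s * t, hg, ?_⟩
  have h := (M.comm W).swap (fn_mem hW g) s
  rw [parPow_zero] at h
  change _ = s * (_ * t)
  rw [← mul_assoc, h, mul_assoc]

theorem isGraded_vanishing (v : Fin n → ℝ) : IsGraded (vanishing hW v) := by
  intro s hs
  induction hs using Submodule.span_induction with
  | mem s h =>
    obtain ⟨g, t, hg, rfl⟩ := h
    rw [map_mul, par_fn]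
    exact Submodule.subset_span ⟨g, _, hg, rfl⟩
  | zero => simp
  | add x y _ _ hx hy =>
    rw [map_add]
    exact Submodule.add_mem _ hx hy
  | smul a x _ hx =>
    rw [map_smul]
    exact Submodule.smul_mem _ _ hx

theorem coeffs_eq_zero_of_mem_vanishing {v : Fin n → ℝ} (hv : v ∈ c.φ '' W) {s : M.sec W}
    (hs : s ∈ vanishing hW v) (I : Finset (Fin m)) :
    (coeffs hW s I : (Fin n → ℝ) → ℝ) v = 0 := by
  induction hs using Submodule.span_induction with
  | mem s h =>
    obtain ⟨g, t, hg, rfl⟩ := h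
    have h1 : expand hW (fun J => g * coeffs hW t J) = c.fn W hW g * t := by
      conv_rhs => rw [← expand_coeffs hW t]
      simp only [expand, map_mul, Finset.mul_sum, mul_assoc]
    rw [coeffs_eqOn hW h1 I hv]
    simp [hg]
  | zero =>
    have h1 : expand hW (0 : Finset (Fin m) → smoothOn (c.φ '' W)) = 0 := by simp [expand]
    rw [coeffs_eqOn hW h1 I hv]
    rfl
  | add x y _ _ hx hy =>
    have h1 : expand hW (coeffs hW x + coeffs hW y) = x + y := by
      rw [expand_add, expand_coeffs, expand_coeffs]
    rw [coeffs_eqOn hW h1 I hv]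
    simp [hx, hy]
  | smul a x _ hx =>
    have h1 : expand hW (a • coeffs hW x) = a • x := by rw [expand_smul, expand_coeffs]
    rw [coeffs_eqOn hW h1 I hv]
    simp [hx]

/-- The coefficients of a section are honest functions, determined by their values. This reduces
identities of sections to one point at a time, where Hadamard's lemma applies. -/
theorem eq_zero_of_forall_vanishing {s : M.sec W}
    (hs : ∀ v ∈ c.φ '' W, s ∈ vanishing hW v) : s = 0 := by
  rw [← expand_coeffs hW s]
  have h : expand hW (coeffs hW s) = expand hW 0 :=
    expand_congr hW fun I v hv => coeffs_eq_zero_of_mem_vanishing hW hv (hs v hv) I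
  rw [h]
  simp [expand]

theorem coord_sub_mem_vanishing (v : Fin n → ℝ) (a : Fin n) :
    coord hW (.inl a) - algebraMap ℝ _ (v a) ∈ vanishing hW v := by
  refine Submodule.subset_span
    ⟨smoothCoord _ a - algebraMap ℝ _ (v a), 1, ?_, ?_⟩
  · simp [smoothCoord]
  · rw [map_sub, AlgHom.commutes, mul_one]
    rfl

/-- Hadamard's lemma on the level of sections. It holds over all of W, so no shrinking of
neighborhoods is needed. -/
theorem fn_sub_eq_sum (f : smoothOn (c.φ '' W)) {v : Fin n → ℝ} (hv : v ∈ c.φ '' W) :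
    ∃ g : Fin n → smoothOn (c.φ '' W), c.fn W hW f
      = algebraMap ℝ _ ((f : (Fin n → ℝ) → ℝ) v)
        + ∑ a, (coord hW (.inl a) - algebraMap ℝ _ (v a)) * c.fn W hW (g a) := by
  obtain ⟨g, hg⟩ := hadamard (isOpen_image hW) f hv
  refine ⟨g, ?_⟩
  have h : Set.EqOn (f : (Fin n → ℝ) → ℝ)
      (algebraMap ℝ (smoothOn (c.φ '' W)) ((f : (Fin n → ℝ) → ℝ) v)
        + ∑ a, (smoothCoord _ a - algebraMap ℝ _ (v a)) * g a : smoothOn (c.φ '' W))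
      (c.φ '' W) := by
    intro x hx
    have := hg x hx
    rw [sub_eq_iff_eq_add'] at this
    rw [this]
    simp [smoothCoord]
  rw [c.fn_congr W hW _ _ h, map_add, AlgHom.commutes, map_sum]
  congr 1
  refine Finset.sum_congr rfl fun a _ => ?_
  rw [map_mul, map_sub, AlgHom.commutes]
  rfl

end SuperChart

/-! ### Power series over a superalgebra -/

section PowerSeries

variable {σ B B' : Type*} [Ring B] [Algebra ℝ B] [Ring B'] [Algebra ℝ B']

theorem coeff_coeffwise (f : B →ₗ[ℝ] B') (F : MvPowerSeries σ B) (d : σ →₀ ℕ) :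
    MvPowerSeries.coeff d (coeffwise f F) = f (MvPowerSeries.coeff d F) := rfl

theorem coeffwise_C (f : B →ₗ[ℝ] B') (b : B) :
    coeffwise f (MvPowerSeries.C (σ := σ) b) = MvPowerSeries.C (f b) := by
  classical
  ext d
  rw [coeff_coeffwise, MvPowerSeries.coeff_C, MvPowerSeries.coeff_C]
  split_ifs
  · rfl
  · rw [map_zero]

/-- Apply an algebra homomorphism to all coefficients of a power series. -/
def coeffwiseHom (f : B →ₐ[ℝ] B') : MvPowerSeries σ B →ₐ[ℝ] MvPowerSeries σ B' :=
  AlgHom.ofLinearMap (coeffwise f.toLinearMap)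
    (by
      have := coeffwise_C (σ := σ) f.toLinearMap 1
      simpa using this)
    (by
      classical
      intro F G
      ext d
      simp only [coeff_coeffwise, MvPowerSeries.coeff_mul, AlgHom.toLinearMap_apply, map_sum,
        map_mul])

theorem sum_antidiagonal_swap_finsupp {E : Type*} [AddCommMonoid E] [DecidableEq σ] (d : σ →₀ ℕ)
    (f : (σ →₀ ℕ) × (σ →₀ ℕ) → E) : ∑ p ∈ Finset.HasAntidiagonal.antidiagonal d, f p.swap
      = ∑ p ∈ Finset.HasAntidiagonal.antidiagonal d, f p := by
  conv_rhs => rw [← Finset.HasAntidiagonal.map_swap_antidiagonal, Finset.sum_map]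
  rfl

/-- Power series whose coefficients lie in given subspaces. -/
def coeffsIn (V : (σ →₀ ℕ) → Submodule ℝ B) : Submodule ℝ (MvPowerSeries σ B) where
  carrier := {F | ∀ d, MvPowerSeries.coeff d F ∈ V d}
  add_mem' hF hG d := by
    rw [map_add]
    exact Submodule.add_mem _ (hF d) (hG d)
  zero_mem' d := by
    rw [map_zero]
    exact Submodule.zero_mem _
  smul_mem' r F hF d := Submodule.smul_mem (V d) r (hF d)

theorem mul_mem_coeffsIn {V V' V'' : (σ →₀ ℕ) → Submodule ℝ B}
    (h : ∀ d e, V d * V' e ≤ V'' (d + e)) {F G : MvPowerSeries σ B} (hF : F ∈ coeffsIn V)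
    (hG : G ∈ coeffsIn V') : F * G ∈ coeffsIn V'' := by
  classical
  intro d
  rw [MvPowerSeries.coeff_mul]
  refine Submodule.sum_mem _ fun p hp => ?_
  rw [← Finset.HasAntidiagonal.mem_antidiagonal.mp hp]
  exact h _ _ (Submodule.mul_mem_mul (hF _) (hG _))

/-- The partial derivative with respect to a variable of a power series. -/
def powerDeriv (a : σ) : MvPowerSeries σ B →ₗ[ℝ] MvPowerSeries σ B where
  toFun F := fun d => ((d a + 1 : ℕ) : ℝ) • MvPowerSeries.coeff (d + Finsupp.single a 1) F
  map_add' F G := by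
    funext d
    change _ • MvPowerSeries.coeff _ (F + G) = _
    rw [map_add, smul_add]
    rfl
  map_smul' r F := by
    funext d
    exact smul_comm _ r (MvPowerSeries.coeff (d + Finsupp.single a 1) F)

theorem coeff_powerDeriv (a : σ) (F : MvPowerSeries σ B) (d : σ →₀ ℕ) :
    MvPowerSeries.coeff d (powerDeriv a F)
      = ((d a + 1 : ℕ) : ℝ) • MvPowerSeries.coeff (d + Finsupp.single a 1) F := rfl

/-- The combinatorial half of the Leibniz rule for power series: shift the first exponent by one;
the pairs not reached have p.1 a = 0 and contribute nothing. -/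
theorem sum_antidiagonal_add_single [DecidableEq σ] (a : σ) (d : σ →₀ ℕ) (F G : (σ →₀ ℕ) → B) :
    ∑ p ∈ (Finset.HasAntidiagonal.antidiagonal (d + Finsupp.single a 1) :
        Finset ((σ →₀ ℕ) × (σ →₀ ℕ))), ((p.1 a : ℕ) : ℝ) • (F p.1 * G p.2)
      = ∑ p ∈ Finset.HasAntidiagonal.antidiagonal d,
        ((p.1 a + 1 : ℕ) : ℝ) • (F (p.1 + Finsupp.single a 1) * G p.2) := by
  symm
  refine Finset.sum_of_injOn (fun p => (p.1 + Finsupp.single a 1, p.2)) ?_ ?_ ?_ ?_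
  · rintro ⟨p1, p2⟩ _ ⟨q1, q2⟩ _ h
    simp only [Prod.mk.injEq, add_left_inj] at h
    rw [h.1, h.2]
  · rintro ⟨p1, p2⟩ hp
    simp only [Finset.mem_coe,
      Finset.HasAntidiagonal.mem_antidiagonal] at *
    rw [← hp]
    abel
  · rintro ⟨p1, p2⟩ hp hp'
    simp only [Finset.HasAntidiagonal.mem_antidiagonal] at hp
    suffices h : p1 a = 0 by simp [h]
    by_contra h
    refine hp' ⟨(p1 - Finsupp.single a 1, p2), ?_, ?_⟩
    · simp only [Finset.mem_coe, Finset.HasAntidiagonal.mem_antidiagonal]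
      have h1 : p1 - Finsupp.single a 1 + Finsupp.single a 1 = p1 :=
        Finsupp.sub_add_single_one_cancel h
      apply add_right_cancel (b := Finsupp.single a 1)
      rw [← hp, add_right_comm, h1]
    · simp only [Prod.mk.injEq, and_true]
      exact Finsupp.sub_add_single_one_cancel h
  · rintro ⟨p1, p2⟩ _
    simp

variable [Superalgebra B]

instance : Superalgebra (MvPowerSeries σ B) where
  par := coeffwiseHom Superalgebra.par
  par_par F := by
    ext d
    exact Superalgebra.par_par _

theorem coeff_par (F : MvPowerSeries σ B) (d : σ →₀ ℕ) :
    MvPowerSeries.coeff d (Superalgebra.par F)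
      = Superalgebra.par (MvPowerSeries.coeff d F) := rfl

theorem coeff_parPow (i : ZMod 2) (F : MvPowerSeries σ B) (d : σ →₀ ℕ) :
    MvPowerSeries.coeff d (parPow i F) = parPow i (MvPowerSeries.coeff d F) := by
  rcases zmod_two i with rfl | rfl
  · simp
  · simp only [parPow_one, coeff_par]

theorem coeff_mem {i : ZMod 2} {F : MvPowerSeries σ B} (hF : F ∈ homog _ i) (d : σ →₀ ℕ) :
    MvPowerSeries.coeff d F ∈ homog B i := by
  rw [mem_homog] at *
  rw [← coeff_par, hF]
  rfl

theorem IsSupercommutative.mvPowerSeries (hB : IsSupercommutative B) :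
    IsSupercommutative (MvPowerSeries σ B) := by
  classical
  refine IsSupercommutative.of_swap fun i F hF G => ?_
  ext d
  rw [MvPowerSeries.coeff_mul, MvPowerSeries.coeff_mul, ← sum_antidiagonal_swap_finsupp]
  refine Finset.sum_congr rfl fun p _ => ?_
  rw [coeff_parPow]
  exact hB.swap (coeff_mem hF _) _

theorem IsSuperDer.coeffwise {i : ZMod 2} {D : B →ₗ[ℝ] B} (h : IsSuperDer i D) :
    IsSuperDer i (coeffwise (σ := σ) D) where
  leibniz F G := by
    classical
    ext d
    simp only [coeff_coeffwise, MvPowerSeries.coeff_mul, map_add, map_sum, h.leibniz,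
      coeff_parPow, Finset.sum_add_distrib]
  par F := by
    ext d
    exact h.par _

theorem isSuperDer_powerDeriv (a : σ) : IsSuperDer 0 (powerDeriv (B := B) a) where
  leibniz F G := by
    classical
    ext d
    have h1 := sum_antidiagonal_add_single a d (fun e => MvPowerSeries.coeff e F)
      (fun e => MvPowerSeries.coeff e G)
    have h2 : ∑ p ∈ (Finset.HasAntidiagonal.antidiagonal (d + Finsupp.single a 1) :
        Finset ((σ →₀ ℕ) × (σ →₀ ℕ))),
        ((p.2 a : ℕ) : ℝ) • (MvPowerSeries.coeff p.1 F * MvPowerSeries.coeff p.2 G)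
        = ∑ p ∈ Finset.HasAntidiagonal.antidiagonal d, ((p.2 a + 1 : ℕ) : ℝ) •
          (MvPowerSeries.coeff p.1 F * MvPowerSeries.coeff (p.2 + Finsupp.single a 1) G) := by
      -- The sum weighted by the second exponent is the same statement with the factors
      -- interchanged, hence the opposite ring.
      have h := sum_antidiagonal_add_single (B := Bᵐᵒᵖ) a d
        (fun e => MulOpposite.op (MvPowerSeries.coeff e G))
        (fun e => MulOpposite.op (MvPowerSeries.coeff e F))
      have h' := congrArg MulOpposite.unop h
      simp only [Finset.unop_sum, MulOpposite.unop_smul, MulOpposite.unop_mul,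
        MulOpposite.unop_op] at h'
      rw [← sum_antidiagonal_swap_finsupp]
      exact h'.trans (sum_antidiagonal_swap_finsupp d fun p => ((p.2 a + 1 : ℕ) : ℝ) •
        (MvPowerSeries.coeff p.1 F * MvPowerSeries.coeff (p.2 + Finsupp.single a 1) G))
    rw [parPow_zero, map_add, coeff_powerDeriv, MvPowerSeries.coeff_mul, MvPowerSeries.coeff_mul,
      MvPowerSeries.coeff_mul]
    simp only [coeff_powerDeriv, smul_mul_assoc, mul_smul_comm]
    rw [← h1, ← h2, ← Finset.sum_add_distrib, Finset.smul_sum]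
    refine Finset.sum_congr rfl fun p hp => ?_
    rw [← add_smul]
    congr 1
    have := DFunLike.congr_fun (Finset.HasAntidiagonal.mem_antidiagonal.mp hp) a
    simp only [Finsupp.coe_add, Pi.add_apply, Finsupp.single_eq_same] at this
    exact_mod_cast this.symm
  par F := by
    ext d
    rw [sgn_zero, one_smul, coeff_par, coeff_powerDeriv, coeff_powerDeriv, coeff_par, map_smul]

theorem IsGraded.coeffsIn {V : (σ →₀ ℕ) → Submodule ℝ B} (h : ∀ d, IsGraded (V d)) :
    IsGraded (coeffsIn V) := fun _ hF d => h d _ (hF d)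

end PowerSeries

/-! ### Formal functions on the cotangent bundle of a chart -/

section Mom

variable {M : SuperSpace.{u}} {n m : ℕ} {A : WeilSuperalgebra} {W : Opens M.carrier}

theorem isSupercommutative_fun : IsSupercommutative (Fun M A W) := (M.comm W).tensor A.comm

theorem isSupercommutative_mom : IsSupercommutative (Mom M n m A W) :=
  (isSupercommutative_fun.tensor isSupercommutative_grassmann).mvPowerSeries

theorem par_C {σ B : Type*} [Ring B] [Algebra ℝ B] [Superalgebra B] (b : B) :
    Superalgebra.par (MvPowerSeries.C b : MvPowerSeries σ B)
      = MvPowerSeries.C (Superalgebra.par b) :=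
  coeffwise_C (σ := σ) (Superalgebra.par (R := B)).toLinearMap b

theorem smul_C {σ B : Type*} [Ring B] [Algebra ℝ B] (r : ℝ) (b : B) :
    (MvPowerSeries.C (r • b) : MvPowerSeries σ B) = r • MvPowerSeries.C b :=
  (coeffwise_C (σ := σ) (r • LinearMap.id : B →ₗ[ℝ] B) b).symm

theorem C_mem {σ B : Type*} [Ring B] [Algebra ℝ B] [Superalgebra B] {i : ZMod 2} {b : B}
    (hb : b ∈ homog B i) : (MvPowerSeries.C b : MvPowerSeries σ B) ∈ homog _ i := by
  rw [mem_homog] at *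
  rw [par_C, hb, smul_C]

theorem const_mem {i : ZMod 2} {f : Fun M A W} (hf : f ∈ homog _ i) :
    (const f : Mom M n m A W) ∈ homog _ i := by
  have := stmul_mem hf (one_mem_homog : (1 : Grassmann m) ∈ _)
  rw [add_zero] at this
  exact C_mem this

theorem X_mem {σ B : Type*} [Ring B] [Algebra ℝ B] [Superalgebra B] (a : σ) :
    (MvPowerSeries.X a : MvPowerSeries σ B) ∈ homog _ 0 := by
  classical
  rw [mem_homog_zero]
  ext d
  rw [coeff_par, MvPowerSeries.coeff_X]
  split_ifs <;> simp

theorem mom_mem (a : Idx n m) : (mom a : Mom M n m A W) ∈ homog _ (ix a) := by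
  rcases a with a | μ
  · exact X_mem a
  · have := stmul_mem (one_mem_homog : (1 : Fun M A W) ∈ _) (ι_mem (Pi.single μ 1 : Fin m → ℝ))
    rw [zero_add] at this
    exact C_mem this

variable {c : SuperChart M n m} (hW : W ≤ c.dom)

theorem zc_mem (a : Idx n m) : (zc hW a : Mom M n m A W) ∈ homog _ (ix a) := by
  have := stmul_mem (SuperChart.coord_mem hW a) (one_mem_homog : (1 : A) ∈ _)
  rw [add_zero] at this
  exact const_mem this

/-- The derivative `∂/∂z^a` as a linear map. -/
def dzLin (a : Idx n m) : Mom M n m A W →ₗ[ℝ] Mom M n m A W :=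
  coeffwise (tmap (tmap (SuperChart.pd hW a) LinearMap.id) LinearMap.id)

theorem dzLin_apply (a : Idx n m) (F : Mom M n m A W) : dzLin hW a F = dz hW a F := rfl

/-- The derivative `∂/∂p_a` as a linear map. -/
def dpLin : Idx n m → Mom M n m A W →ₗ[ℝ] Mom M n m A W
  | .inl a => powerDeriv a
  | .inr μ => coeffwise (tmap (Superalgebra.par (R := Fun M A W)).toLinearMap (grassmannDeriv μ))

theorem dpLin_apply (a : Idx n m) (F : Mom M n m A W) : dpLin a F = dp a F := by
  rcases a with a | μ <;> rfl

theorem isSuperDer_dzLin (a : Idx n m) :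
    IsSuperDer (ix a) (dzLin hW a : Mom M n m A W →ₗ[ℝ] Mom M n m A W) :=
  ((SuperChart.isSuperDer_pd hW a).tmap_left.tmap_left).coeffwise

theorem isSuperDer_dpLin (a : Idx n m) :
    IsSuperDer (ix a) (dpLin a : Mom M n m A W →ₗ[ℝ] Mom M n m A W) := by
  rcases a with a | μ
  · exact isSuperDer_powerDeriv a
  · have h := (isSuperDer_grassmannDeriv μ).tmap_right (R := Fun M A W)
    have e : (parPow 1 : Fun M A W →ₐ[ℝ] Fun M A W) = Superalgebra.par :=
      DFunLike.ext _ _ fun x => parPow_one x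
    rw [e] at h
    exact h.coeffwise

theorem dzLin_C (a : Idx n m) (b : STensor (Fun M A W) (Grassmann m)) :
    dzLin hW a (MvPowerSeries.C b : Mom M n m A W)
      = MvPowerSeries.C (tmap (tmap (SuperChart.pd hW a) LinearMap.id) LinearMap.id b) :=
  coeffwise_C _ b

theorem powerDeriv_C {σ B : Type*} [Ring B] [Algebra ℝ B] (a : σ) (b : B) :
    powerDeriv a (MvPowerSeries.C b : MvPowerSeries σ B) = 0 := by
  classical
  ext d
  rw [coeff_powerDeriv, MvPowerSeries.coeff_C, if_neg, smul_zero, map_zero]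
  intro h
  have := DFunLike.congr_fun h a
  simp at this

theorem powerDeriv_X {σ B : Type*} [DecidableEq σ] [Ring B] [Algebra ℝ B] (a b : σ) :
    powerDeriv a (MvPowerSeries.X b : MvPowerSeries σ B) = if a = b then 1 else 0 := by
  ext d
  rw [coeff_powerDeriv, MvPowerSeries.coeff_X]
  split_ifs with h1 h2 h2
  · subst h2
    have : d = 0 := by simpa using h1
    subst this
    simp
  · exfalso
    have h3 := DFunLike.congr_fun h1 a
    rw [Finsupp.add_apply, Finsupp.single_eq_same, Finsupp.single_eq_of_ne h2] at h3
    omega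
  · subst h2
    rw [MvPowerSeries.coeff_one, if_neg, smul_zero]
    rintro rfl
    exact h1 (zero_add _)
  · simp

theorem pd_one (a : Idx n m) : SuperChart.pd hW a 1 = 0 := (SuperChart.isSuperDer_pd hW a).map_one

theorem dzLin_mom (a b : Idx n m) : dzLin hW a (mom b : Mom M n m A W) = 0 := by
  classical
  rcases b with b | ν
  · ext d
    rw [mom, dzLin, coeff_coeffwise, MvPowerSeries.coeff_X]
    split_ifs
    · rw [← stmul_one_one, tmap_stmul, ← stmul_one_one, tmap_stmul, pd_one, zero_stmul, zero_stmul,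
        map_zero]
    · rw [map_zero, map_zero]
  · rw [mom, dzLin_C, tmap_stmul, ← stmul_one_one, tmap_stmul, pd_one, zero_stmul, zero_stmul,
      map_zero]

theorem dzLin_const (a : Idx n m) (f : Fun M A W) : dzLin hW a (const f : Mom M n m A W)
    = const (tmap (SuperChart.pd hW a) LinearMap.id f) := by
  rw [const, dzLin_C, tmap_stmul]
  rfl

theorem const_one : (const 1 : Mom M n m A W) = 1 := by
  rw [const, stmul_one_one, map_one]

theorem const_zero : (const 0 : Mom M n m A W) = 0 := by
  rw [const, zero_stmul, map_zero]

theorem dzLin_zc (a b : Idx n m) :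
    dzLin hW a (zc hW b : Mom M n m A W) = if a = b then 1 else 0 := by
  rw [zc, dzLin_const, tmap_stmul, SuperChart.pd_coord]
  split_ifs
  · exact const_one
  · rw [zero_stmul, const_zero]

theorem dpLin_const (a : Idx n m) (f : Fun M A W) : dpLin a (const f : Mom M n m A W) = 0 := by
  rcases a with a | μ
  · exact powerDeriv_C a _
  · have h : grassmannDeriv μ (1 : Grassmann m) = 0 := (isSuperDer_grassmannDeriv μ).map_one
    rw [dpLin, const, coeffwise_C, tmap_stmul, h, stmul_zero, map_zero]

theorem dpLin_mom (a b : Idx n m) :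
    dpLin a (mom b : Mom M n m A W) = if a = b then 1 else 0 := by
  classical
  rcases a with a | μ <;> rcases b with b | ν
  · simp only [dpLin, mom, powerDeriv_X, Sum.inl.injEq]
  · simp only [dpLin, mom, powerDeriv_C]
    simp
  · rw [if_neg (by simp)]
    ext d
    rw [dpLin, mom, coeff_coeffwise, MvPowerSeries.coeff_X]
    have h : grassmannDeriv μ (1 : Grassmann m) = 0 := (isSuperDer_grassmannDeriv μ).map_one
    split_ifs
    · rw [← stmul_one_one, tmap_stmul, h, stmul_zero, map_zero]
    · rw [map_zero, map_zero]
  · rw [dpLin, mom, coeffwise_C, tmap_stmul, grassmannDeriv_ι, AlgHom.toLinearMap_apply, map_one]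
    by_cases h : μ = ν
    · subst h
      rw [Pi.single_eq_same, map_one, stmul_one_one, map_one, if_pos rfl]
    · rw [Pi.single_eq_of_ne h, map_zero, stmul_zero, map_zero,
        if_neg fun h' => h (Sum.inr.inj h')]

theorem dzLin_scal (a : Idx n m) (t : A) : dzLin hW a (scal t : Mom M n m A W) = 0 := by
  rw [scal, dzLin_const, tmap_stmul, pd_one, zero_stmul, const_zero]

/-! #### Restriction to the zero section -/

/-- The coefficient of `1` in the odd momenta. -/
def grassmannZero : Grassmann m →ₐ[ℝ] Grassmann m :=
  (Algebra.ofId ℝ (Grassmann m)).comp ExteriorAlgebra.algebraMapInv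

theorem grassmannZero_par (x : Grassmann m) :
    grassmannZero (Superalgebra.par x) = Superalgebra.par (grassmannZero x) := by
  simp only [grassmannZero, AlgHom.comp_apply, algebraMapInv_par]
  exact (AlgHom.commutes _ _).symm

theorem grassmannZero_grassmannZero (x : Grassmann m) :
    grassmannZero (grassmannZero x) = grassmannZero x := by
  simp only [grassmannZero, AlgHom.comp_apply]
  congr 1
  exact AlgHom.commutes _ _

theorem grassmannZero_one : grassmannZero (1 : Grassmann m) = 1 := map_one _

theorem grassmannZero_ι (v : Fin m → ℝ) :
    grassmannZero (ExteriorAlgebra.ι ℝ v : Grassmann m) = 0 := by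
  simp [grassmannZero, ExteriorAlgebra.algebraMapInv]

/-- The restriction to the zero section of the odd momenta. -/
def oddZero : STensor (Fun M A W) (Grassmann m) →ₐ[ℝ] STensor (Fun M A W) (Grassmann m) :=
  tmapHom (AlgHom.id ℝ _) grassmannZero (fun _ => rfl) grassmannZero_par

theorem oddZero_stmul (f : Fun M A W) (x : Grassmann m) :
    oddZero (stmul f x) = stmul f (grassmannZero x) := rfl

theorem zeroSection_eq (F : Mom M n m A W) :
    zeroSection F = MvPowerSeries.C (oddZero (MvPowerSeries.constantCoeff F)) := rfl

/-- The restriction to the zero section as a homomorphism of algebras. -/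
def zeroSectionHom : Mom M n m A W →ₐ[ℝ] Mom M n m A W :=
  AlgHom.ofLinearMap
    { toFun := zeroSection
      map_add' := fun F G => by simp only [zeroSection_eq, map_add]
      map_smul' := fun r F => by
        have h : MvPowerSeries.constantCoeff (r • F)
            = r • MvPowerSeries.constantCoeff F := rfl
        rw [zeroSection_eq, h, map_smul, smul_C]
        rfl }
    (by
      change zeroSection 1 = 1
      simp only [zeroSection_eq, map_one])
    (fun F G => by
      change zeroSection (F * G) = zeroSection F * zeroSection G
      simp only [zeroSection_eq, map_mul])

theorem zeroSection_C (b : STensor (Fun M A W) (Grassmann m)) :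
    zeroSection (MvPowerSeries.C b : Mom M n m A W) = MvPowerSeries.C (oddZero b) := by
  rw [zeroSection_eq, MvPowerSeries.constantCoeff_C]

theorem zeroSection_const (f : Fun M A W) :
    zeroSection (const f : Mom M n m A W) = const f := by
  rw [const, zeroSection_C, oddZero_stmul, grassmannZero_one]

theorem zeroSection_par (F : Mom M n m A W) :
    zeroSection (Superalgebra.par F) = Superalgebra.par (zeroSection F) := by
  rw [zeroSection_eq, zeroSection_eq, par_C]
  congr 1
  exact tmap_par _ _ (fun _ => rfl) grassmannZero_par _

theorem oddZero_oddZero (x : STensor (Fun M A W) (Grassmann m)) :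
    oddZero (oddZero x) = oddZero x := by
  induction x using tensor_induction with
  | hadd x y hx hy => simp only [map_add, hx, hy]
  | h i j r _ b _ => rw [oddZero_stmul, oddZero_stmul, grassmannZero_grassmannZero]

theorem zeroSection_zeroSection (F : Mom M n m A W) :
    zeroSection (zeroSection F) = zeroSection F := by
  rw [zeroSection_eq F, zeroSection_C, oddZero_oddZero]

theorem exists_const_eq_zeroSection (F : Mom M n m A W) : ∃ f, zeroSection F = const f := by
  rw [zeroSection_eq]
  generalize MvPowerSeries.constantCoeff F = b
  induction b using tensor_induction with
  | hadd x y hx hy =>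
    obtain ⟨f, hf⟩ := hx
    obtain ⟨g, hg⟩ := hy
    refine ⟨f + g, ?_⟩
    rw [map_add, map_add, hf, hg, const, const, const, add_stmul, map_add]
  | h i j r _ b _ =>
    refine ⟨ExteriorAlgebra.algebraMapInv b • r, ?_⟩
    rw [oddZero_stmul, const, smul_stmul, ← stmul_smul]
    congr 2
    exact Algebra.algebraMap_eq_smul_one (R := ℝ) (A := Grassmann m) _

theorem zeroSection_mom (a : Idx n m) : zeroSection (mom a : Mom M n m A W) = 0 := by
  rcases a with a | μ
  · rw [zeroSection_eq, mom, MvPowerSeries.constantCoeff_X, map_zero, map_zero]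
  · rw [mom, zeroSection_C, oddZero_stmul, grassmannZero_ι, stmul_zero, map_zero]

theorem dzLin_zeroSection (a : Idx n m) (F : Mom M n m A W) :
    dzLin hW a (zeroSection F) = zeroSection (dzLin hW a F) := by
  rw [zeroSection_eq, zeroSection_eq, dzLin_C]
  congr 1
  have h : MvPowerSeries.constantCoeff (dzLin hW a F) = tmap (tmap (SuperChart.pd hW a)
      LinearMap.id) LinearMap.id (MvPowerSeries.constantCoeff F) := rfl
  rw [h]
  generalize MvPowerSeries.constantCoeff F = x
  induction x using tensor_induction with
  | hadd x y hx hy => simp only [map_add, hx, hy]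
  | h i j r _ b _ => rfl

theorem dpLin_zeroSection (a : Idx n m) (F : Mom M n m A W) : dpLin a (zeroSection F) = 0 := by
  obtain ⟨f, hf⟩ := exists_const_eq_zeroSection F
  rw [hf, dpLin_const]

theorem dpLin_scal (a : Idx n m) (t : A) : dpLin a (scal t : Mom M n m A W) = 0 :=
  dpLin_const a _

theorem scal_mem {i : ZMod 2} {t : A} (ht : t ∈ homog A i) :
    (scal t : Mom M n m A W) ∈ homog _ i := by
  have := stmul_mem (one_mem_homog : (1 : M.sec W) ∈ _) ht
  rw [zero_add] at this
  exact const_mem this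

end Mom

/-! ### The filtrations by powers of the maximal ideal and by degree in the momenta -/

theorem tmap_mem_tens {R R' B B' : Type*} [Ring R] [Algebra ℝ R] [Superalgebra R] [Ring R']
    [Algebra ℝ R'] [Superalgebra R'] [Ring B] [Algebra ℝ B] [Superalgebra B] [Ring B']
    [Algebra ℝ B'] [Superalgebra B'] {V : Submodule ℝ R} {V' : Submodule ℝ R'}
    {W : Submodule ℝ B} {W' : Submodule ℝ B'} {f : R →ₗ[ℝ] R'} {g : B →ₗ[ℝ] B'}
    (hf : ∀ v ∈ V, f v ∈ V') (hg : ∀ w ∈ W, g w ∈ W') {x : STensor R B} (hx : x ∈ tens V W) :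
    tmap f g x ∈ tens V' W' := by
  have h : tens V W ≤ (tens V' W').comap (tmap f g) := tens_le fun v hv w hw => by
    rw [Submodule.mem_comap, tmap_stmul]
    exact stmul_mem_tens (hf v hv) (hg w hw)
  exact h hx

theorem grassmannZero_mem {m l : ℕ} {x : Grassmann m} (hx : x ∈ idealPow (generators m) l) :
    grassmannZero x ∈ idealPow (generators m) l := by
  rcases l with _ | l
  · rw [idealPow_zero]
    trivial
  · have h : grassmannZero x = 0 := by
      have h1 := idealPow_anti (V := generators m) (Nat.succ_le_succ (Nat.zero_le l)) hx
      rw [idealPow, pow_one] at h1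
      clear hx
      induction h1 using Submodule.mul_induction_on' with
      | mem_mul_mem y hy z _ =>
        obtain ⟨v, rfl⟩ := hy
        rw [map_mul, grassmannZero_ι, zero_mul]
      | add y _ z _ hy hz => rw [map_add, hy, hz, add_zero]
    rw [h]
    exact Submodule.zero_mem _

/-- A contraction removes at most one generator from a product. -/
theorem grassmannDeriv_mem {m l : ℕ} (μ : Fin m) {x : Grassmann m}
    (hx : x ∈ idealPow (generators m) (l + 1)) :
    grassmannDeriv μ x ∈ idealPow (generators m) l := by
  induction l generalizing x with
  | zero =>
    rw [idealPow_zero]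
    trivial
  | succ l ih =>
    rw [idealPow, pow_succ', mul_assoc] at hx
    induction hx using Submodule.mul_induction_on' with
    | mem_mul_mem y hy z hz =>
      obtain ⟨v, rfl⟩ := hy
      rw [grassmannDeriv_ι_mul]
      refine Submodule.sub_mem _ (Submodule.smul_mem _ _ hz) ?_
      rw [idealPow, pow_succ', mul_assoc]
      exact Submodule.mul_mem_mul ⟨v, rfl⟩ (ih hz)
    | add y _ z _ hy hz =>
      rw [map_add]
      exact Submodule.add_mem _ hy hz

section Filtration

variable {M : SuperSpace.{u}} {n m : ℕ} {A : WeilSuperalgebra} {W : Opens M.carrier}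

variable (M m A W) in
/-- The step of the bifiltration of `O(W) ⊗ A ⊗ Λ` by the powers of `𝔪` and of the ideal of odd
momenta. -/
def bifil (p : ℕ × ℕ) : Submodule ℝ (STensor (Fun M A W) (Grassmann m)) :=
  tens (tens ⊤ (idealPow A.maxIdeal p.1)) (idealPow (generators m) p.2)

theorem isGraded_bifil (p : ℕ × ℕ) : IsGraded (bifil M m A W p) :=
  (isGraded_top.tens (isGraded_idealPow A.isGraded_maxIdeal _)).tens
    (isGraded_idealPow isGraded_generators _)

theorem bifil_mul (p q : ℕ × ℕ) :
    bifil M m A W p * bifil M m A W q ≤ bifil M m A W (p + q) := by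
  refine tens_mul_tens_le (isGraded_idealPow isGraded_generators _)
    (isGraded_top.tens (isGraded_idealPow A.isGraded_maxIdeal _))
    (tens_mul_tens_le (isGraded_idealPow A.isGraded_maxIdeal _) isGraded_top le_top
      (idealPow_mul A.top_mul_maxIdeal _ _).le)
    (idealPow_mul top_mul_generators _ _).le

theorem bifil_zero : bifil M m A W 0 = ⊤ := by
  rw [bifil, Prod.fst_zero, Prod.snd_zero, idealPow_zero, idealPow_zero, tens_top_top,
    tens_top_top]

theorem bifil_anti {p q : ℕ × ℕ} (h : p ≤ q) : bifil M m A W q ≤ bifil M m A W p :=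
  tens_mono (tens_mono le_rfl (idealPow_anti h.1)) (idealPow_anti h.2)

/-- A large total degree forces a large power of 𝔪 or more than m odd momenta, and either vanishes.
-/
theorem exists_bifil_eq_bot : ∃ K, ∀ p : ℕ × ℕ, K ≤ p.1 + p.2 → bifil M m A W p = ⊥ := by
  obtain ⟨K, hK⟩ := A.exists_maxIdeal_pow_eq_bot
  refine ⟨K + (m + 1), fun p hp => ?_⟩
  rcases le_or_gt K p.1 with h | h
  · have h0 : idealPow A.maxIdeal p.1 = ⊥ :=
      le_bot_iff.mp ((idealPow_anti h).trans (idealPow_eq_bot hK).le)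
    rw [bifil, h0, tens_bot_right, tens_bot_left]
  · have h0 : idealPow (generators m) p.2 = ⊥ := le_bot_iff.mp
      ((idealPow_anti (by omega : m + 1 ≤ p.2)).trans (idealPow_eq_bot generators_pow).le)
    rw [bifil, h0, tens_bot_right]

variable (M m A W) in
/-- The filtration of `O(W) ⊗ A ⊗ Λ` by the total degree. -/
def coeffFil (k : ℕ) : Submodule ℝ (STensor (Fun M A W) (Grassmann m)) :=
  ⨆ p : {p : ℕ × ℕ // k ≤ p.1 + p.2}, bifil M m A W p

theorem bifil_le_coeffFil {p : ℕ × ℕ} {k : ℕ} (h : k ≤ p.1 + p.2) :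
    bifil M m A W p ≤ coeffFil M m A W k :=
  le_iSup (fun p : {p : ℕ × ℕ // k ≤ p.1 + p.2} => bifil M m A W p) ⟨p, h⟩

theorem coeffFil_zero : coeffFil M m A W 0 = ⊤ :=
  top_le_iff.mp (bifil_zero.ge.trans (bifil_le_coeffFil (Nat.zero_le _)))

theorem coeffFil_anti {k l : ℕ} (h : k ≤ l) : coeffFil M m A W l ≤ coeffFil M m A W k :=
  iSup_le fun p => bifil_le_coeffFil (h.trans p.2)

theorem coeffFil_mul (k l : ℕ) :
    coeffFil M m A W k * coeffFil M m A W l ≤ coeffFil M m A W (k + l) := by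
  rw [coeffFil, Submodule.iSup_mul]
  refine iSup_le fun p => ?_
  rw [coeffFil, Submodule.mul_iSup]
  refine iSup_le fun q => (bifil_mul _ _).trans (bifil_le_coeffFil ?_)
  have hp := p.2
  have hq := q.2
  rw [Prod.fst_add, Prod.snd_add]
  omega

/-- The number s is the loss of degree in the odd momenta: 0 for homomorphisms and base derivatives,
1 for the derivative along an odd momentum. -/
theorem coeffFil_map {M' : SuperSpace.{u}} {A' : WeilSuperalgebra} {W' : Opens M'.carrier} {s : ℕ}
    (T : STensor (Fun M A W) (Grassmann m) →ₗ[ℝ] STensor (Fun M' A' W') (Grassmann m))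
    (hT : ∀ p, ∀ x ∈ bifil M m A W p, T x ∈ bifil M' m A' W' (p.1, p.2 - s)) {k : ℕ}
    {x : STensor (Fun M A W) (Grassmann m)} (hx : x ∈ coeffFil M m A W (k + s)) :
    T x ∈ coeffFil M' m A' W' k := by
  have h : coeffFil M m A W (k + s) ≤ (coeffFil M' m A' W' k).comap T :=
    iSup_le fun p y hy => by
      have hp := p.2
      exact bifil_le_coeffFil (by dsimp only; omega) (hT _ y hy)
  exact h hx

theorem isGraded_coeffFil (k : ℕ) : IsGraded (coeffFil M m A W k) := fun _ hx =>
  coeffFil_map (s := 0) (Superalgebra.par (R := STensor (Fun M A W) (Grassmann m))).toLinearMap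
    (fun p _ hy => isGraded_bifil p _ hy) hx

theorem exists_coeffFil_eq_bot : ∃ K, ∀ k, K ≤ k → coeffFil M m A W k = ⊥ := by
  obtain ⟨K, hK⟩ := exists_bifil_eq_bot (M := M) (m := m) (A := A) (W := W)
  exact ⟨K, fun k hk => le_bot_iff.mp (iSup_le fun p => (hK _ (hk.trans p.2)).le)⟩

variable (M n m A W) in
/-- Formal functions on the cotangent bundle with coefficients in `𝔪^j`. -/
def nilFil (j : ℕ) : Submodule ℝ (Mom M n m A W) := coeffsIn fun _ => bifil M m A W (j, 0)

variable (M n m A W) in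
/-- The filtration of formal functions on the cotangent bundle by the total degree in `𝔪` and in
the momenta. -/
def momFil (k : ℕ) : Submodule ℝ (Mom M n m A W) :=
  coeffsIn fun d => coeffFil M m A W (k - d.degree)

theorem mem_momFil {k : ℕ} {F : Mom M n m A W} : F ∈ momFil M n m A W k ↔
    ∀ d, MvPowerSeries.coeff d F ∈ coeffFil M m A W (k - d.degree) := Iff.rfl

theorem nilFil_zero : nilFil M n m A W 0 = ⊤ := by
  refine top_le_iff.mp fun F _ d => ?_
  have : ((0, 0) : ℕ × ℕ) = 0 := rfl
  rw [this, bifil_zero]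
  trivial

theorem nilFil_anti {i j : ℕ} (h : i ≤ j) : nilFil M n m A W j ≤ nilFil M n m A W i :=
  fun _ hF d => bifil_anti (show ((i, 0) : ℕ × ℕ) ≤ (j, 0) from ⟨h, le_rfl⟩) (hF d)

theorem nilFil_mul {i j : ℕ} {x y : Mom M n m A W} (hx : x ∈ nilFil M n m A W i)
    (hy : y ∈ nilFil M n m A W j) : x * y ∈ nilFil M n m A W (i + j) :=
  mul_mem_coeffsIn (fun _ _ => bifil_mul (i, 0) (j, 0)) hx hy

theorem exists_nilFil_eq_bot : ∃ K, nilFil M n m A W K = ⊥ := by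
  obtain ⟨K, hK⟩ := exists_bifil_eq_bot (M := M) (m := m) (A := A) (W := W)
  refine ⟨K, le_bot_iff.mp fun F hF => ?_⟩
  rw [Submodule.mem_bot]
  ext d
  have := hF d
  rwa [hK (K, 0) le_rfl, Submodule.mem_bot] at this

theorem momFil_zero : momFil M n m A W 0 = ⊤ := by
  refine top_le_iff.mp fun F _ => mem_momFil.mpr fun d => ?_
  rw [Nat.zero_sub, coeffFil_zero]
  trivial

theorem momFil_anti {k l : ℕ} (h : k ≤ l) : momFil M n m A W l ≤ momFil M n m A W k :=
  fun _ hF d => coeffFil_anti (Nat.sub_le_sub_right h _) (hF d)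

theorem momFil_mul {k l : ℕ} {x y : Mom M n m A W} (hx : x ∈ momFil M n m A W k)
    (hy : y ∈ momFil M n m A W l) : x * y ∈ momFil M n m A W (k + l) :=
  mul_mem_coeffsIn (fun d e => (coeffFil_mul _ _).trans (coeffFil_anti (by
    rw [map_add]
    omega))) hx hy

theorem isGraded_momFil (k : ℕ) : IsGraded (momFil M n m A W k) :=
  IsGraded.coeffsIn fun _ => isGraded_coeffFil _

/-- The coefficient at p^d of an element of degree k lies in degree k - |d| of a filtration that
stops at K. Hence each coefficient sees only finitely many steps; separatedness, closedness and the
finiteness of the sums in `subst` rest on this. -/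
theorem exists_coeff_eq_zero : ∃ K, ∀ k d, ∀ F ∈ momFil M n m A W k, K + d.degree ≤ k →
    MvPowerSeries.coeff d F = 0 := by
  obtain ⟨K, hK⟩ := exists_coeffFil_eq_bot (M := M) (m := m) (A := A) (W := W)
  refine ⟨K, fun k d F hF h => ?_⟩
  have := mem_momFil.mp hF d
  rwa [hK _ (by omega), Submodule.mem_bot] at this

theorem momFil_separated {F : Mom M n m A W} (h : ∀ k, F ∈ momFil M n m A W k) : F = 0 := by
  obtain ⟨K, hK⟩ := exists_coeff_eq_zero (M := M) (n := n) (m := m) (A := A) (W := W)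
  ext d
  rw [hK _ d F (h (K + d.degree)) le_rfl, map_zero]

/-- Each single coefficient of F agrees with that of a sufficiently good approximation G. -/
theorem nilFil_closed {j : ℕ} {F : Mom M n m A W}
    (h : ∀ k, ∃ G ∈ nilFil M n m A W j, F - G ∈ momFil M n m A W k) :
    F ∈ nilFil M n m A W j := by
  obtain ⟨K, hK⟩ := exists_coeff_eq_zero (M := M) (n := n) (m := m) (A := A) (W := W)
  intro d
  obtain ⟨G, hG, hFG⟩ := h (K + d.degree)
  have := hK _ d _ hFG le_rfl
  rw [map_sub, sub_eq_zero] at this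
  rw [this]
  exact hG d

theorem nilFil_le_momFil : nilFil M n m A W 1 ≤ momFil M n m A W 1 := fun _ hF d =>
  bifil_le_coeffFil (p := (1, 0)) (by dsimp only; omega) (hF d)

theorem coeffwise_mem_momFil {M' : SuperSpace.{u}} {A' : WeilSuperalgebra} {W' : Opens M'.carrier}
    {s : ℕ} (T : STensor (Fun M A W) (Grassmann m) →ₗ[ℝ] STensor (Fun M' A' W') (Grassmann m))
    (hT : ∀ p, ∀ x ∈ bifil M m A W p, T x ∈ bifil M' m A' W' (p.1, p.2 - s)) {k : ℕ}
    {F : Mom M n m A W} (hF : F ∈ momFil M n m A W (k + s)) :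
    coeffwise T F ∈ momFil M' n m A' W' k := mem_momFil.mpr fun d => by
  rw [coeff_coeffwise]
  rcases le_total d.degree k with h | h
  · exact coeffFil_map T hT (coeffFil_anti (by omega) (hF d))
  · rw [Nat.sub_eq_zero_of_le h, coeffFil_zero]
    trivial

theorem coeffwise_mem_nilFil {M' : SuperSpace.{u}} {A' : WeilSuperalgebra} {W' : Opens M'.carrier}
    (T : STensor (Fun M A W) (Grassmann m) →ₗ[ℝ] STensor (Fun M' A' W') (Grassmann m)) {j : ℕ}
    (hT : ∀ x ∈ bifil M m A W (j, 0), T x ∈ bifil M' m A' W' (j, 0))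
    {F : Mom M n m A W} (hF : F ∈ nilFil M n m A W j) :
    coeffwise T F ∈ nilFil M' n m A' W' j := fun d => hT _ (hF d)

theorem tmap_tmap_mem_bifil {M' : SuperSpace.{u}} {A' : WeilSuperalgebra} {W' : Opens M'.carrier}
    (f : M.sec W →ₗ[ℝ] M'.sec W') (φ : A →ₗ[ℝ] A')
    (hφ : ∀ j, ∀ a ∈ idealPow A.maxIdeal j, φ a ∈ idealPow A'.maxIdeal j) (p : ℕ × ℕ)
    {x : STensor (Fun M A W) (Grassmann m)} (hx : x ∈ bifil M m A W p) :
    tmap (tmap f φ) LinearMap.id x ∈ bifil M' m A' W' p :=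
  tmap_mem_tens (fun _ hv => tmap_mem_tens (fun _ _ => Submodule.mem_top) (hφ _) hv) (fun _ hw => hw) hx

variable {c : SuperChart M n m} (hW : W ≤ c.dom)

theorem dzLin_mem_momFil {a : Idx n m} {k : ℕ} {F : Mom M n m A W}
    (hF : F ∈ momFil M n m A W k) : dzLin hW a F ∈ momFil M n m A W k :=
  coeffwise_mem_momFil (s := 0) _
    (fun p _ hx => tmap_tmap_mem_bifil _ _ (fun _ _ h => h) p hx) hF

theorem dzLin_mem_nilFil {a : Idx n m} {j : ℕ} {F : Mom M n m A W}
    (hF : F ∈ nilFil M n m A W j) : dzLin hW a F ∈ nilFil M n m A W j :=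
  coeffwise_mem_nilFil _ (fun _ hx => tmap_tmap_mem_bifil _ _ (fun _ _ h => h) _ hx) hF

theorem dpLin_mem_momFil {a : Idx n m} {k : ℕ} {F : Mom M n m A W}
    (hF : F ∈ momFil M n m A W (k + 1)) : dpLin a F ∈ momFil M n m A W k := by
  rcases a with a | μ
  · refine mem_momFil.mpr fun d => ?_
    rw [dpLin, coeff_powerDeriv]
    refine Submodule.smul_mem _ _ ?_
    have := mem_momFil.mp hF (d + Finsupp.single a 1)
    rwa [map_add, Finsupp.degree_single, Nat.add_sub_add_right] at this
  · refine coeffwise_mem_momFil (s := 1) _ (fun p x hx => tmap_mem_tens (fun v hv =>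
      isGraded_top.tens (isGraded_idealPow A.isGraded_maxIdeal _) v hv) ?_ hx) hF
    -- Without odd momenta nothing has to be shown: the truncated difference is 0 and the zeroth
    -- ideal power is everything.
    rcases p with ⟨i, _ | j⟩
    · intro w _
      rw [Nat.zero_sub, idealPow_zero]
      trivial
    · intro w hw
      exact grassmannDeriv_mem μ hw

theorem dpLin_mem_nilFil {a : Idx n m} {j : ℕ} {F : Mom M n m A W}
    (hF : F ∈ nilFil M n m A W j) : dpLin a F ∈ nilFil M n m A W j := by
  rcases a with a | μ
  · intro d
    rw [dpLin, coeff_powerDeriv]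
    exact Submodule.smul_mem _ _ (hF _)
  · refine coeffwise_mem_nilFil _ (fun x hx => tmap_mem_tens (fun v hv =>
      isGraded_top.tens (isGraded_idealPow A.isGraded_maxIdeal _) v hv) (fun w _ => ?_) hx) hF
    rw [idealPow_zero]
    trivial

theorem oddZero_mem_bifil {p : ℕ × ℕ} {x : STensor (Fun M A W) (Grassmann m)}
    (hx : x ∈ bifil M m A W p) : oddZero x ∈ bifil M m A W p :=
  tmap_mem_tens (fun _ hv => hv) (fun _ hw => grassmannZero_mem hw) hx

theorem oddZero_mem_coeffFil {k : ℕ} {x : STensor (Fun M A W) (Grassmann m)}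
    (hx : x ∈ coeffFil M m A W k) : oddZero x ∈ coeffFil M m A W k :=
  coeffFil_map (s := 0) oddZero.toLinearMap (fun _ _ hy => oddZero_mem_bifil hy) hx

theorem C_mem_coeffsIn {σ B : Type*} [Ring B] [Algebra ℝ B] {V : (σ →₀ ℕ) → Submodule ℝ B} {b : B}
    (hb : b ∈ V 0) : (MvPowerSeries.C b : MvPowerSeries σ B) ∈ coeffsIn V := by
  classical
  intro d
  rw [MvPowerSeries.coeff_C]
  split_ifs with h
  · rwa [h]
  · exact Submodule.zero_mem _

theorem zeroSection_mem_momFil {k : ℕ} {F : Mom M n m A W} (hF : F ∈ momFil M n m A W k) :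
    zeroSection F ∈ momFil M n m A W k := by
  rw [zeroSection_eq]
  exact C_mem_coeffsIn (V := fun d => coeffFil M m A W (k - d.degree))
    (oddZero_mem_coeffFil (hF 0))

theorem zeroSection_mem_nilFil {j : ℕ} {F : Mom M n m A W} (hF : F ∈ nilFil M n m A W j) :
    zeroSection F ∈ nilFil M n m A W j := by
  rw [zeroSection_eq]
  exact C_mem_coeffsIn (V := fun _ => bifil M m A W (j, 0)) (oddZero_mem_bifil (hF 0))

theorem mom_mem_momFil (a : Idx n m) : (mom a : Mom M n m A W) ∈ momFil M n m A W 1 := by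
  classical
  rcases a with a | μ
  · refine mem_momFil.mpr fun d => ?_
    rw [mom, MvPowerSeries.coeff_X]
    split_ifs with h
    · rw [h, Finsupp.degree_single, Nat.sub_self, coeffFil_zero]
      trivial
    · exact Submodule.zero_mem _
  · refine C_mem_coeffsIn (V := fun d => coeffFil M m A W (1 - d.degree)) ?_
    refine bifil_le_coeffFil (p := (0, 1)) (by simp) (stmul_mem_tens ?_ ?_)
    · rw [idealPow_zero, tens_top_top]
      trivial
    · exact le_idealPow_one ⟨_, rfl⟩

theorem scal_mem_nilFil {j : ℕ} {t : A} (ht : t ∈ idealPow A.maxIdeal j) :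
    (scal t : Mom M n m A W) ∈ nilFil M n m A W j := by
  refine C_mem_coeffsIn (V := fun _ => bifil M m A W (j, 0)) (stmul_mem_tens ?_ ?_)
  · exact stmul_mem_tens Submodule.mem_top ht
  · rw [idealPow_zero]
    trivial

end Filtration

/-! ### Components of tensors -/

section Slice

variable {R R' B B' : Type*} [Ring R] [Algebra ℝ R] [Superalgebra R] [Ring R'] [Algebra ℝ R']
  [Superalgebra R'] [Ring B] [Algebra ℝ B] [Superalgebra B] [Ring B'] [Algebra ℝ B']
  [Superalgebra B']

/-- The contraction of the second factor with a linear functional. -/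
def slice (g : B →ₗ[ℝ] ℝ) : STensor R B →ₗ[ℝ] R :=
  (TensorProduct.rid ℝ R).toLinearMap ∘ₗ TensorProduct.map LinearMap.id g ∘ₗ
    (GradedTensorProduct.of ℝ (homog R) (homog B)).symm.toLinearMap

theorem slice_stmul (g : B →ₗ[ℝ] ℝ) (r : R) (b : B) : slice g (stmul r b) = g b • r := by
  change TensorProduct.rid ℝ R (r ⊗ₜ g b) = _
  exact TensorProduct.rid_tmul _ _

theorem slice_tmap (g : B' →ₗ[ℝ] ℝ) (f : R →ₗ[ℝ] R') (h : B →ₗ[ℝ] B') (x : STensor R B) :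
    slice g (tmap f h x) = f (slice (g ∘ₗ h) x) := by
  induction x using tensor_induction with
  | hadd x y hx hy => simp only [map_add, hx, hy]
  | h i j r _ b _ => rw [tmap_stmul, slice_stmul, slice_stmul, map_smul, LinearMap.comp_apply]

theorem eq_sum_slice {I : Type*} [Fintype I] (b : Module.Basis I ℝ B) (x : STensor R B) :
    x = ∑ i, stmul (slice (b.coord i) x) (b i) := by
  induction x using tensor_induction with
  | hadd x y hx hy =>
    simp only [map_add, add_stmul, Finset.sum_add_distrib]
    rw [← hx, ← hy]
  | h i j r _ c _ =>
    simp only [slice_stmul, smul_stmul, Module.Basis.coord_apply]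
    conv_lhs => rw [← b.sum_repr c]
    have h : ∀ s : Finset I, stmul r (∑ i ∈ s, (b.repr c) i • b i)
        = ∑ i ∈ s, (b.repr c) i • stmul r (b i) := fun s => by
      classical
      induction s using Finset.induction_on with
      | empty => rw [Finset.sum_empty, Finset.sum_empty, stmul_zero]
      | insert i s hi ih => rw [Finset.sum_insert hi, Finset.sum_insert hi, stmul_add, ih, stmul_smul]
    exact h _

/-- Since parameters and odd momenta form finite-dimensional algebras, an identity of tensors can be
tested on its components in the first factor. -/
theorem slice_ext [Module.Finite ℝ B] {x y : STensor R B} (h : ∀ g, slice g x = slice g y) :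
    x = y := by
  rw [eq_sum_slice (Module.finBasis ℝ B) x, eq_sum_slice (Module.finBasis ℝ B) y]
  simp only [h]

theorem slice_mem {V : Submodule ℝ R} {W : Submodule ℝ B} (g : B →ₗ[ℝ] ℝ) {x : STensor R B}
    (hx : x ∈ tens V W) : slice g x ∈ V := by
  have h : tens V W ≤ V.comap (slice g) := tens_le fun v hv w _ => by
    rw [Submodule.mem_comap, slice_stmul]
    exact V.smul_mem _ hv
  exact h hx

end Slice

/-! ### Twisted derivations -/

section TwistedKernel

variable {R : Type*} [Ring R] [Algebra ℝ R]

/-- The kernel of a twisted derivation is a subalgebra. -/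
def twistedKernel (Δ : R →ₗ[ℝ] R) (ψ₁ ψ₂ : R →ₐ[ℝ] R)
    (h : ∀ F G, Δ (F * G) = Δ F * ψ₁ G + ψ₂ F * Δ G) : Subalgebra ℝ R where
  carrier := {F | Δ F = 0}
  mul_mem' {F G} hF hG := by
    change Δ _ = 0 at hF hG
    change Δ _ = 0
    rw [h, hF, hG, zero_mul, mul_zero, add_zero]
  add_mem' {F G} hF hG := by
    change Δ _ = 0 at hF hG
    change Δ _ = 0
    rw [map_add, hF, hG, add_zero]
  algebraMap_mem' r := by
    change Δ _ = 0
    have h1 := h 1 1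
    rw [mul_one, map_one ψ₁, map_one ψ₂, mul_one, one_mul, left_eq_add] at h1
    rw [Algebra.algebraMap_eq_smul_one, map_smul, h1, smul_zero]

end TwistedKernel

/-! ### Approximation of power series by polynomials -/

section PolynomialDensity

variable {σ B : Type*} [Ring B] [Algebra ℝ B]

theorem monomial_mem {K : Subalgebra ℝ (MvPowerSeries σ B)} (hC : ∀ b, MvPowerSeries.C b ∈ K)
    (hX : ∀ a, MvPowerSeries.X a ∈ K) (d : σ →₀ ℕ) (b : B) : MvPowerSeries.monomial d b ∈ K := by
  classical
  induction d using Finsupp.induction_linear generalizing b with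
  | zero => exact hC b
  | add d e hd he =>
    have := K.mul_mem (hd b) (he 1)
    rwa [MvPowerSeries.monomial_mul_monomial, mul_one] at this
  | single a k =>
    induction k generalizing b with
    | zero =>
      rw [Finsupp.single_zero]
      exact hC b
    | succ k ih =>
      have := K.mul_mem (ih b) (hX a)
      rwa [MvPowerSeries.X_def, MvPowerSeries.monomial_mul_monomial, mul_one,
        ← Finsupp.single_add] at this

/-- The truncation of F at degree k is a finite sum of monomials, hence lies in K. -/
theorem exists_sub_coeff_eq_zero [Finite σ] {K : Subalgebra ℝ (MvPowerSeries σ B)}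
    (hC : ∀ b, MvPowerSeries.C b ∈ K) (hX : ∀ a, MvPowerSeries.X a ∈ K) (F : MvPowerSeries σ B)
    (k : ℕ) : ∃ G ∈ K, ∀ d, d.degree < k → MvPowerSeries.coeff d (F - G) = 0 := by
  classical
  refine ⟨∑ d ∈ (Finsupp.finite_of_degree_lt k).toFinset,
    MvPowerSeries.monomial d (MvPowerSeries.coeff d F),
    K.sum_mem fun d _ => monomial_mem hC hX d _, fun d hd => ?_⟩
  rw [map_sub, map_sum, Finset.sum_eq_single d]
  · rw [MvPowerSeries.coeff_monomial_same, sub_self]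
  · intro e _ he
    exact MvPowerSeries.coeff_monomial_ne he.symm _
  · intro h
    exact absurd ((Finsupp.finite_of_degree_lt k).mem_toFinset.mpr hd) h

end PolynomialDensity

/-! ### Rigidity of twisted derivations on the cotangent bundle of a chart -/

section Mom

variable {M : SuperSpace.{u}} {n m : ℕ} {A : WeilSuperalgebra} {W : Opens M.carrier}

/-- The inclusion of the functions on the base. -/
def constHom : Fun M A W →ₐ[ℝ] Mom M n m A W :=
  AlgHom.ofLinearMap
    { toFun := const
      map_add' := fun f g => by rw [const, const, const, add_stmul, map_add]
      map_smul' := fun r f => by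
        rw [const, const, smul_stmul, smul_C]
        rfl }
    const_one
    (fun f g => by
      change const (f * g) = const f * const g
      rw [const, const, const, ← map_mul, stmul_one_mul_stmul])

theorem constHom_apply (f : Fun M A W) : constHom f = (const f : Mom M n m A W) := rfl

theorem const_stmul (s : M.sec W) (t : A) :
    (const (stmul s t) : Mom M n m A W) = const (stmul s 1) * scal t := by
  rw [scal, ← constHom_apply, ← constHom_apply, ← constHom_apply, ← map_mul,
    stmul_one_mul_stmul, mul_one]

theorem C_stmul (f : Fun M A W) (x : Grassmann m) : (MvPowerSeries.C (stmul f x) : Mom M n m A W)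
    = const f * MvPowerSeries.C (stmul 1 x) := by
  rw [const, ← map_mul, stmul_mul_one_stmul, one_mul]

variable {c : SuperChart M n m} (hW : W ≤ c.dom)

variable (n m A W) in
/-- Functions of the base with values in the parameters. -/
def secHom : M.sec W →ₐ[ℝ] Mom M n m A W :=
  (constHom (n := n) (m := m)).comp
    (GradedTensorProduct.includeLeft (homog (M.sec W)) (homog A))

theorem secHom_coord (a : Idx n m) : secHom n m A W (SuperChart.coord hW a) = zc hW a := rfl

/-- No topology enters at this stage: expansions in the odd coordinates, in the odd momenta and in
the parameters are finite. -/
theorem mem_of_generators {K : Subalgebra ℝ (Mom M n m A W)}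
    (hfn : ∀ g, secHom n m A W (c.fn W hW g) ∈ K) (hz : ∀ μ, zc hW (.inr μ) ∈ K)
    (hp : ∀ a, mom a ∈ K) (ht : ∀ t, scal t ∈ K) (b : STensor (Fun M A W) (Grassmann m)) :
    MvPowerSeries.C b ∈ K := by
  have hodd : ∀ x : Grassmann m, secHom n m A W (SuperChart.oddHom hW x) ∈ K := by
    intro x
    induction x using grassmann_induction with
    | scalar r =>
      rw [AlgHom.commutes, AlgHom.commutes]
      exact K.algebraMap_mem r
    | add x y hx hy =>
      rw [map_add, map_add]
      exact K.add_mem hx hy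
    | ι_mul v x hx =>
      rw [map_mul, map_mul, SuperChart.oddHom_ι, map_sum]
      refine K.mul_mem (K.sum_mem fun μ _ => ?_) hx
      rw [map_smul]
      exact K.smul_mem (hz μ) _
  have hsec : ∀ s : M.sec W, secHom n m A W s ∈ K := by
    intro s
    induction s using SuperChart.sec_induction hW with
    | add s t hs ht =>
      rw [map_add]
      exact K.add_mem hs ht
    | mul g x =>
      rw [map_mul]
      exact K.mul_mem (hfn g) (hodd x)
  have hconst : ∀ f : Fun M A W, const f ∈ K := by
    intro f
    induction f using tensor_induction with
    | hadd f g hf hg =>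
      have := K.add_mem hf hg
      rwa [← constHom_apply, ← constHom_apply, ← map_add] at this
    | h i j s _ t _ =>
      rw [const_stmul]
      exact K.mul_mem (hsec s) (ht t)
  have hgr : ∀ x : Grassmann m, (MvPowerSeries.C (stmul 1 x) : Mom M n m A W) ∈ K := by
    intro x
    induction x using grassmann_induction with
    | scalar r =>
      rw [Algebra.algebraMap_eq_smul_one, stmul_smul, smul_C, stmul_one_one, map_one]
      exact K.smul_mem K.one_mem _
    | add x y hx hy =>
      rw [stmul_add, map_add]
      exact K.add_mem hx hy
    | ι_mul v x hx =>
      rw [← one_mul (1 : Fun M A W), ← stmul_one_mul_stmul, stmul_one_one, one_mul]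
      have e : stmul (1 : Fun M A W) (ExteriorAlgebra.ι ℝ v * x)
          = stmul 1 (ExteriorAlgebra.ι ℝ v) * stmul 1 x := by rw [stmul_mul_one_stmul]
      rw [e, map_mul]
      refine K.mul_mem ?_ hx
      have hv : v = ∑ μ, v μ • (Pi.single μ 1 : Fin m → ℝ) := by
        ext ν
        simp [Pi.single_apply]
      rw [hv, map_sum]
      have hs : ∀ s : Finset (Fin m), (MvPowerSeries.C (stmul 1
          (∑ μ ∈ s, ExteriorAlgebra.ι ℝ (v μ • (Pi.single μ 1 : Fin m → ℝ)))) : Mom M n m A W)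
          ∈ K := fun s => by
        induction s using Finset.induction_on with
        | empty =>
          rw [Finset.sum_empty, stmul_zero, map_zero]
          exact K.zero_mem
        | insert μ s hμ ih =>
          rw [Finset.sum_insert hμ, stmul_add, map_add, map_smul, stmul_smul, smul_C]
          exact K.add_mem (K.smul_mem (hp (.inr μ)) _) ih
      exact hs _
  induction b using tensor_induction with
  | hadd x y hx hy =>
    rw [map_add]
    exact K.add_mem hx hy
  | h i j f _ x _ =>
    rw [C_stmul]
    exact K.mul_mem (hconst f) (hgr x)

/-- The functions on the cotangent bundle that vanish over a point of the chart. -/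
def vanishingOver (v : Fin n → ℝ) : Submodule ℝ (Mom M n m A W) :=
  coeffsIn fun _ => tens (tens (SuperChart.vanishing hW v) ⊤) ⊤

theorem eq_zero_of_mem_vanishingOver {F : Mom M n m A W}
    (h : ∀ v ∈ c.φ '' W, F ∈ vanishingOver hW v) : F = 0 := by
  ext d
  refine slice_ext fun g => slice_ext fun g' => ?_
  rw [map_zero, map_zero, map_zero]
  exact SuperChart.eq_zero_of_forall_vanishing hW fun v hv => slice_mem g' (slice_mem g (h v hv d))

theorem mul_mem_vanishingOver {v : Fin n → ℝ} (F : Mom M n m A W) {G : Mom M n m A W}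
    (hG : G ∈ vanishingOver hW v) : F * G ∈ vanishingOver hW v := by
  have hF : F ∈ coeffsIn fun _ : Fin n →₀ ℕ =>
      (⊤ : Submodule ℝ (STensor (Fun M A W) (Grassmann m))) := fun _ => trivial
  refine mul_mem_coeffsIn (fun _ _ => ?_) hF hG
  rw [← tens_top_top, ← tens_top_top]
  exact tens_mul_tens_le isGraded_top ((SuperChart.isGraded_vanishing hW v).tens isGraded_top)
    (tens_mul_tens_le isGraded_top (SuperChart.isGraded_vanishing hW v)
      (SuperChart.top_mul_vanishing hW v) le_top) le_top

theorem mul_mem_vanishingOver_right {v : Fin n → ℝ} {F : Mom M n m A W}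
    (hF : F ∈ vanishingOver hW v) (G : Mom M n m A W) : F * G ∈ vanishingOver hW v := by
  have hG : G ∈ coeffsIn fun _ : Fin n →₀ ℕ =>
      (⊤ : Submodule ℝ (STensor (Fun M A W) (Grassmann m))) := fun _ => trivial
  refine mul_mem_coeffsIn (fun _ _ => ?_) hF hG
  conv_lhs => rw [← tens_top_top, ← tens_top_top]
  exact tens_mul_tens_le isGraded_top (isGraded_top.tens isGraded_top)
    (tens_mul_tens_le isGraded_top isGraded_top
      (SuperChart.vanishing_mul_top hW v) le_top) le_top

theorem zc_sub_mem_vanishingOver (v : Fin n → ℝ) (a : Fin n) :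
    zc hW (.inl a) - algebraMap ℝ (Mom M n m A W) (v a) ∈ vanishingOver hW v := by
  have h : zc hW (.inl a) - algebraMap ℝ (Mom M n m A W) (v a)
      = secHom n m A W (SuperChart.coord hW (.inl a) - algebraMap ℝ _ (v a)) := by
    rw [map_sub, AlgHom.commutes, secHom_coord]
  rw [h]
  exact C_mem_coeffsIn (V := fun _ => tens (tens (SuperChart.vanishing hW v) ⊤) ⊤)
    (stmul_mem_tens (stmul_mem_tens (SuperChart.coord_sub_mem_vanishing hW v a)
      Submodule.mem_top) Submodule.mem_top)

/-- Apply Δ to f = f(v) + ∑ (x - v) g. Since Δ kills x and constants, Δf = ∑ (ψ₂x - v) Δg, and ψ₂x -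
v is the sum of x - v, which vanishes at v, and of a nilpotent element. Thus Δf vanishes at v modulo
`nilFil (k + 1)` if every Δg does modulo `nilFil k`. The induction ends because the filtration
becomes zero, and v is arbitrary. -/
theorem twisted_eq_zero_of_fn (Δ : Mom M n m A W →ₗ[ℝ] Mom M n m A W)
    (ψ₁ ψ₂ : Mom M n m A W →ₐ[ℝ] Mom M n m A W)
    (hΔ : ∀ F G, Δ (F * G) = Δ F * ψ₁ G + ψ₂ F * Δ G)
    (hψ : ∀ a, ψ₂ (zc hW (.inl a)) - zc hW (.inl a) ∈ nilFil M n m A W 1)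
    (hz : ∀ a, Δ (zc hW (.inl a)) = 0) (f : smoothOn (c.φ '' W)) :
    Δ (secHom n m A W (c.fn W hW f)) = 0 := by
  refine eq_zero_of_mem_vanishingOver hW fun v hv => ?_
  have hs : ∀ r : ℝ, Δ (algebraMap ℝ _ r) = 0 :=
    (twistedKernel Δ ψ₁ ψ₂ hΔ).algebraMap_mem
  have key : ∀ k (f : smoothOn (c.φ '' W)),
      Δ (secHom n m A W (c.fn W hW f)) ∈ vanishingOver hW v ⊔ nilFil M n m A W k := by
    intro k
    induction k with
    | zero =>
      intro f
      rw [nilFil_zero, sup_top_eq]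
      trivial
    | succ k ih =>
      intro f
      obtain ⟨g, hg⟩ := SuperChart.fn_sub_eq_sum hW f hv
      rw [hg, map_add, map_add, AlgHom.commutes, hs, zero_add, map_sum, map_sum]
      refine Submodule.sum_mem _ fun a _ => ?_
      rw [map_mul, hΔ, map_sub, AlgHom.commutes, map_sub, hs, secHom_coord, hz, sub_zero, zero_mul,
        zero_add, map_sub, AlgHom.commutes]
      obtain ⟨x, hx, y, hy, hxy⟩ := Submodule.mem_sup.mp (ih (g a))
      have e : ψ₂ (zc hW (.inl a)) - algebraMap ℝ (Mom M n m A W) (v a)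
          = (zc hW (.inl a) - algebraMap ℝ (Mom M n m A W) (v a))
            + (ψ₂ (zc hW (.inl a)) - zc hW (.inl a)) := by abel
      rw [e, add_mul]
      refine Submodule.add_mem _ (Submodule.mem_sup_left (mul_mem_vanishingOver_right hW
        (zc_sub_mem_vanishingOver hW v a) _)) ?_
      rw [← hxy, mul_add]
      refine Submodule.add_mem _ (Submodule.mem_sup_left (mul_mem_vanishingOver hW _ hx))
        (Submodule.mem_sup_right ?_)
      rw [add_comm k]
      exact nilFil_mul (hψ a) hy
  obtain ⟨K, hK⟩ := exists_nilFil_eq_bot (M := M) (n := n) (m := m) (A := A) (W := W)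
  have := key K f
  rwa [hK, sup_bot_eq] at this

/-- The kernel of Δ is a subalgebra. It contains the smooth functions by the pointwise argument,
hence all polynomials in the even momenta, and these are dense for the filtration; s measures the
loss of degree under Δ. -/
theorem twisted_eq_zero (Δ : Mom M n m A W →ₗ[ℝ] Mom M n m A W)
    (ψ₁ ψ₂ : Mom M n m A W →ₐ[ℝ] Mom M n m A W) (s : ℕ)
    (hΔ : ∀ F G, Δ (F * G) = Δ F * ψ₁ G + ψ₂ F * Δ G)
    (hψ : ∀ a, ψ₂ (zc hW (.inl a)) - zc hW (.inl a) ∈ nilFil M n m A W 1)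
    (hz : ∀ a, Δ (zc hW a) = 0) (hp : ∀ a, Δ (mom a) = 0) (ht : ∀ t, Δ (scal t) = 0)
    (hc : ∀ k F, F ∈ momFil M n m A W (k + s) → Δ F ∈ momFil M n m A W k) : Δ = 0 := by
  refine LinearMap.ext fun F => momFil_separated fun k => ?_
  have hC := mem_of_generators hW (K := twistedKernel Δ ψ₁ ψ₂ hΔ)
    (twisted_eq_zero_of_fn hW Δ ψ₁ ψ₂ hΔ hψ fun a => hz _) (fun μ => hz _) hp ht
  obtain ⟨G, hG, hFG⟩ := exists_sub_coeff_eq_zero hC (fun a => hp (.inl a)) F (k + s)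
  have hG' : Δ G = 0 := hG
  rw [← sub_add_cancel F G, map_add, hG', add_zero]
  refine hc k _ (mem_momFil.mpr fun d => ?_)
  rcases lt_or_ge d.degree (k + s) with h | h
  · rw [hFG d h]
    exact Submodule.zero_mem _
  · rw [Nat.sub_eq_zero_of_le h, coeffFil_zero]
    trivial

end Mom

/-! ### Phase spaces: the calculus of formal functions in an abstract form -/

/-- The restriction of `(∑_a E_a D_a)^k F` by `zs`, where the `D_a` do not act on the `E_a`. -/
def taylor {R β : Type*} [Ring R] [Algebra ℝ R] [Fintype β] (zs : R →ₐ[ℝ] R) (D : β → R →ₗ[ℝ] R)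
    (E : β → R) : ℕ → R →ₗ[ℝ] R
  | 0 => zs.toLinearMap
  | k + 1 => ∑ a, LinearMap.mulLeft ℝ (E a) ∘ₗ taylor zs D E k ∘ₗ D a

/-- The displacement of a point from the point of the zero section with the same positions. -/
def displacement {R ι : Type*} [Ring R] (crd w : ι ⊕ ι → R) : ι ⊕ ι → R :=
  Sum.elim (fun a => w (.inl a) - crd (.inl a)) (fun a => w (.inr a))

/-- An algebra of formal functions with several systems of canonical coordinates that share their
momenta. The coordinates are indexed by `ι ⊕ ι` (positions and momenta). The submodules `N j` are
the powers of the ideal of nilpotent parameters, and `fil k` is the filtration by the powers of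
the ideal generated by parameters and momenta, in which the algebra is complete. -/
structure PhaseSpace (R : Type*) [Ring R] [Algebra ℝ R] [Superalgebra R] (ι κ : Type*)
    [Fintype ι] [DecidableEq ι] where
  comm : IsSupercommutative R
  ix : ι → ZMod 2
  crd : κ → ι ⊕ ι → R
  D : κ → ι ⊕ ι → R →ₗ[ℝ] R
  zs : R →ₐ[ℝ] R
  scalars : Set R
  N : ℕ → Submodule ℝ R
  fil : ℕ → Submodule ℝ R
  sub : κ → (ι ⊕ ι → R) → R → R
  crd_mem : ∀ c α, crd c α ∈ homog R (Sum.elim ix ix α)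
  crd_inr : ∀ c c' a, crd c (.inr a) = crd c' (.inr a)
  isSuperDer : ∀ c α, IsSuperDer (Sum.elim ix ix α) (D c α)
  D_inr : ∀ c c' a, D c (.inr a) = D c' (.inr a)
  D_crd : ∀ c α β, D c α (crd c β) = if α = β then 1 else 0
  D_scalar : ∀ c α, ∀ x ∈ scalars, D c α x = 0
  zs_par : ∀ F, zs (Superalgebra.par F) = Superalgebra.par (zs F)
  zs_zs : ∀ F, zs (zs F) = zs F
  zs_crd_inl : ∀ c a, zs (crd c (.inl a)) = crd c (.inl a)
  zs_crd_inr : ∀ c a, zs (crd c (.inr a)) = 0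
  zs_scalar : ∀ x ∈ scalars, zs x = x
  D_inl_zs : ∀ c a F, D c (.inl a) (zs F) = zs (D c (.inl a) F)
  D_inr_zs : ∀ c a F, D c (.inr a) (zs F) = 0
  N_zero : N 0 = ⊤
  N_anti : ∀ {i j}, i ≤ j → N j ≤ N i
  N_mul : ∀ {i j x y}, x ∈ N i → y ∈ N j → x * y ∈ N (i + j)
  N_eq_bot : ∃ K, N K = ⊥
  D_mem_N : ∀ {c α j F}, F ∈ N j → D c α F ∈ N j
  zs_mem_N : ∀ {j F}, F ∈ N j → zs F ∈ N j
  N_closed : ∀ {j F}, (∀ k, ∃ G ∈ N j, F - G ∈ fil k) → F ∈ N j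
  N_le_fil : N 1 ≤ fil 1
  fil_zero : fil 0 = ⊤
  fil_anti : ∀ {k l}, k ≤ l → fil l ≤ fil k
  fil_mul : ∀ {i j x y}, x ∈ fil i → y ∈ fil j → x * y ∈ fil (i + j)
  fil_par : ∀ k, IsGraded (fil k)
  fil_separated : ∀ F, (∀ k, F ∈ fil k) → F = 0
  crd_inr_mem_fil : ∀ c a, crd c (.inr a) ∈ fil 1
  D_inl_mem_fil : ∀ {c a k F}, F ∈ fil k → D c (.inl a) F ∈ fil k
  D_inr_mem_fil : ∀ {c a k F}, F ∈ fil (k + 1) → D c (.inr a) F ∈ fil k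
  zs_mem_fil : ∀ {k F}, F ∈ fil k → zs F ∈ fil k
  /-- The substitution is the sum of the Taylor series at the zero section. -/
  sub_spec : ∀ c w F, (∀ k, ∃ K, ∀ j ≥ K, taylor zs (D c) (displacement (crd c) w) j F ∈ fil k) →
    ∀ k, ∃ K, ∀ L ≥ K, sub c w F - ∑ j ∈ Finset.range L,
      ((j.factorial : ℝ)⁻¹) • taylor zs (D c) (displacement (crd c) w) j F ∈ fil k
  /-- A continuous twisted derivation that vanishes on coordinates and parameters is zero. -/
  twisted_ext : ∀ c (Δ : R →ₗ[ℝ] R) (ψ₁ ψ₂ : R →ₐ[ℝ] R) (s : ℕ),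
    (∀ F G, Δ (F * G) = Δ F * ψ₁ G + ψ₂ F * Δ G) →
    (∀ a, ix a = 0 → ψ₂ (crd c (.inl a)) - crd c (.inl a) ∈ N 1) →
    (∀ α, Δ (crd c α) = 0) → (∀ x ∈ scalars, Δ x = 0) →
    (∀ k F, F ∈ fil (k + s) → Δ F ∈ fil k) → Δ = 0

namespace PhaseSpace

variable {R : Type*} [Ring R] [Algebra ℝ R] [Superalgebra R] {ι κ : Type*} [Fintype ι]
  [DecidableEq ι] (Q : PhaseSpace R ι κ)

/-- The parity of a coordinate or momentum. -/
abbrev px (α : ι ⊕ ι) : ZMod 2 := Sum.elim Q.ix Q.ix α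

theorem mul_mem_N_left {j : ℕ} (x : R) {y : R} (hy : y ∈ Q.N j) : x * y ∈ Q.N j := by
  have := Q.N_mul (i := 0) (x := x) (by rw [Q.N_zero]; trivial) hy
  rwa [zero_add] at this

theorem mul_mem_N_right {j : ℕ} {x : R} (hx : x ∈ Q.N j) (y : R) : x * y ∈ Q.N j := by
  have := Q.N_mul (j := 0) (y := y) hx (by rw [Q.N_zero]; trivial)
  rwa [add_zero] at this

theorem mul_mem_fil_left {j : ℕ} (x : R) {y : R} (hy : y ∈ Q.fil j) : x * y ∈ Q.fil j := by
  have := Q.fil_mul (i := 0) (x := x) (by rw [Q.fil_zero]; trivial) hy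
  rwa [zero_add] at this

theorem mul_mem_fil_right {j : ℕ} {x : R} (hx : x ∈ Q.fil j) (y : R) : x * y ∈ Q.fil j := by
  have := Q.fil_mul (j := 0) (y := y) hx (by rw [Q.fil_zero]; trivial)
  rwa [add_zero] at this


/-! #### Convergent series -/

/-- `x` is a null sequence. -/
def Null (x : ℕ → R) : Prop := ∀ k, ∃ K, ∀ j ≥ K, x j ∈ Q.fil k

/-- The series `∑ x_j` converges to `s`. -/
def SumsTo (x : ℕ → R) (s : R) : Prop :=
  ∀ k, ∃ K, ∀ L ≥ K, s - ∑ j ∈ Finset.range L, x j ∈ Q.fil k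

variable {Q}

theorem SumsTo.unique {x : ℕ → R} {s t : R} (hs : Q.SumsTo x s) (ht : Q.SumsTo x t) : s = t := by
  rw [← sub_eq_zero]
  refine Q.fil_separated _ fun k => ?_
  obtain ⟨K, hK⟩ := hs k
  obtain ⟨K', hK'⟩ := ht k
  have := Submodule.sub_mem _ (hK _ (le_max_left K K')) (hK' _ (le_max_right K K'))
  rwa [sub_sub_sub_cancel_right] at this

theorem SumsTo.add {x y : ℕ → R} {s t : R} (hs : Q.SumsTo x s) (ht : Q.SumsTo y t) :
    Q.SumsTo (fun j => x j + y j) (s + t) := by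
  intro k
  obtain ⟨K, hK⟩ := hs k
  obtain ⟨K', hK'⟩ := ht k
  refine ⟨max K K', fun L hL => ?_⟩
  rw [Finset.sum_add_distrib, add_sub_add_comm]
  exact Submodule.add_mem _ (hK _ (le_trans (le_max_left _ _) hL))
    (hK' _ (le_trans (le_max_right _ _) hL))

/-- Series may be mapped by linear maps that are continuous up to a shift of the filtration. -/
theorem SumsTo.map {R' κ' : Type*} [Ring R'] [Algebra ℝ R'] [Superalgebra R']
    {Q' : PhaseSpace R' ι κ'} (f : R →ₗ[ℝ] R') {d : ℕ}
    (hf : ∀ k F, F ∈ Q.fil (k + d) → f F ∈ Q'.fil k) {x : ℕ → R} {s : R} (hs : Q.SumsTo x s) :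
    Q'.SumsTo (fun j => f (x j)) (f s) := by
  intro k
  obtain ⟨K, hK⟩ := hs (k + d)
  refine ⟨K, fun L hL => ?_⟩
  rw [← map_sum, ← map_sub]
  exact hf _ _ (hK L hL)

theorem SumsTo.mul_left {x : ℕ → R} {s : R} (hs : Q.SumsTo x s) (r : R) :
    Q.SumsTo (fun j => r * x j) (r * s) :=
  hs.map (LinearMap.mulLeft ℝ r) (d := 0) fun _ _ h => Q.mul_mem_fil_left r h

theorem SumsTo.smul {x : ℕ → R} {s : R} (hs : Q.SumsTo x s) (r : ℝ) :
    Q.SumsTo (fun j => r • x j) (r • s) :=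
  hs.map (r • LinearMap.id) (d := 0) fun _ _ h => Submodule.smul_mem _ r h

theorem SumsTo.congr {x y : ℕ → R} {s : R} (hs : Q.SumsTo x s) (h : ∀ j, x j = y j) :
    Q.SumsTo y s := (funext h : x = y) ▸ hs

theorem SumsTo.of_eq_zero {x : ℕ → R} {m : ℕ} (h : ∀ j ≥ m, x j = 0) :
    Q.SumsTo x (∑ j ∈ Finset.range m, x j) := by
  intro k
  refine ⟨m, fun L hL => ?_⟩
  rw [← Finset.sum_range_add_sum_Ico _ hL, Finset.sum_eq_zero (s := Finset.Ico m L)]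
  · simp
  · intro j hj
    exact h j (Finset.mem_Ico.mp hj).1

theorem SumsTo.mem_fil {x : ℕ → R} {s : R} (hs : Q.SumsTo x s) {k : ℕ}
    (h : ∀ j, x j ∈ Q.fil k) : s ∈ Q.fil k := by
  obtain ⟨K, hK⟩ := hs k
  have := Submodule.add_mem _ (hK K le_rfl) (Submodule.sum_mem _ fun j (_ : j ∈ Finset.range K) => h j)
  rwa [sub_add_cancel] at this

theorem SumsTo.mem_N {x : ℕ → R} {s : R} (hs : Q.SumsTo x s) {i : ℕ}
    (h : ∀ j, x j ∈ Q.N i) : s ∈ Q.N i := by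
  refine Q.N_closed fun k => ?_
  obtain ⟨K, hK⟩ := hs k
  exact ⟨_, Submodule.sum_mem _ fun j (_ : j ∈ Finset.range K) => h j, hK K le_rfl⟩

/-- The Cauchy product of convergent series. -/
theorem SumsTo.mul {x y : ℕ → R} {s t : R} (hs : Q.SumsTo x s) (ht : Q.SumsTo y t)
    (hx : Q.Null x) (hy : Q.Null y) :
    Q.SumsTo (fun j => ∑ p ∈ Finset.HasAntidiagonal.antidiagonal j, x p.1 * y p.2) (s * t) := by
  intro k
  obtain ⟨K₁, h₁⟩ := hs k
  obtain ⟨K₂, h₂⟩ := ht k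
  obtain ⟨K₃, h₃⟩ := hx k
  obtain ⟨K₄, h₄⟩ := hy k
  refine ⟨K₁ + K₂ + (K₃ + K₄), fun L hL => ?_⟩
  have e : ∑ j ∈ Finset.range L, ∑ p ∈ Finset.HasAntidiagonal.antidiagonal j, x p.1 * y p.2
      = ∑ p ∈ (Finset.range L ×ˢ Finset.range L).filter (fun p => p.1 + p.2 < L),
        x p.1 * y p.2 := by
    rw [Finset.sum_sigma']
    refine Finset.sum_bij' (fun q _ => q.2) (fun p _ => ⟨p.1 + p.2, p⟩) ?_ ?_ ?_ ?_ ?_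
    · rintro ⟨j, p⟩ h
      simp only [Finset.mem_sigma, Finset.mem_range, Finset.HasAntidiagonal.mem_antidiagonal,
        Finset.mem_filter, Finset.mem_product] at *
      omega
    · rintro p h
      simp only [Finset.mem_sigma, Finset.mem_range, Finset.HasAntidiagonal.mem_antidiagonal,
        Finset.mem_filter, Finset.mem_product] at *
      exact ⟨h.2, trivial⟩
    · rintro ⟨j, p⟩ h
      simp only [Finset.mem_sigma, Finset.HasAntidiagonal.mem_antidiagonal] at h
      obtain ⟨-, rfl⟩ := h
      rfl
    · intros
      rfl
    · intros
      rfl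
  have e2 : (∑ j ∈ Finset.range L, x j) * (∑ j ∈ Finset.range L, y j)
      = ∑ p ∈ (Finset.range L ×ˢ Finset.range L).filter (fun p => p.1 + p.2 < L), x p.1 * y p.2
        + ∑ p ∈ (Finset.range L ×ˢ Finset.range L).filter (fun p => ¬ p.1 + p.2 < L),
          x p.1 * y p.2 := by
    rw [Finset.sum_filter_add_sum_filter_not, Finset.sum_mul_sum, ← Finset.sum_product']
  have e3 : s * t - ∑ j ∈ Finset.range L, ∑ p ∈ Finset.HasAntidiagonal.antidiagonal j,
        x p.1 * y p.2 = (s - ∑ j ∈ Finset.range L, x j) * t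
      + (∑ j ∈ Finset.range L, x j) * (t - ∑ j ∈ Finset.range L, y j)
      + ∑ p ∈ (Finset.range L ×ˢ Finset.range L).filter (fun p => ¬ p.1 + p.2 < L),
          x p.1 * y p.2 := by
    rw [sub_mul, mul_sub, e2, e]
    abel
  rw [e3]
  refine Submodule.add_mem _ (Submodule.add_mem _ (Q.mul_mem_fil_right (h₁ L (by omega)) t)
    (Q.mul_mem_fil_left _ (h₂ L (by omega)))) (Submodule.sum_mem _ fun p hp => ?_)
  simp only [Finset.mem_filter, not_lt] at hp
  -- The indices add up to at least L, so one of the two factors is far out in its null sequence.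
  rcases le_or_gt K₃ p.1 with h | h
  · exact Q.mul_mem_fil_right (h₃ _ h) _
  · exact Q.mul_mem_fil_left _ (h₄ _ (by omega))

end PhaseSpace

namespace PhaseSpace

theorem taylor_succ {R β : Type*} [Ring R] [Algebra ℝ R] [Fintype β] (zs : R →ₐ[ℝ] R)
    (D : β → R →ₗ[ℝ] R) (E : β → R)
    (k : ℕ) (F : R) : taylor zs D E (k + 1) F = ∑ a, E a * taylor zs D E k (D a F) := by
  simp [taylor, LinearMap.sum_apply]

theorem taylor_zero {R β : Type*} [Ring R] [Algebra ℝ R] [Fintype β] (zs : R →ₐ[ℝ] R)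
    (D : β → R →ₗ[ℝ] R) (E : β → R)
    (F : R) : taylor zs D E 0 F = zs F := rfl


variable {R : Type*} [Ring R] [Algebra ℝ R] [Superalgebra R] {ι κ : Type*} [Fintype ι]
  [DecidableEq ι] (Q : PhaseSpace R ι κ)

/-! #### Taylor series -/

/-- The `k`-th term of the Taylor series. -/
def tay (c : κ) (E : ι ⊕ ι → R) (k : ℕ) : R →ₗ[ℝ] R :=
  ((k.factorial : ℝ)⁻¹) • taylor Q.zs (Q.D c) E k

theorem tay_zero (c : κ) (E : ι ⊕ ι → R) (F : R) : Q.tay c E 0 F = Q.zs F := by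
  simp [tay, taylor_zero]

theorem tay_succ (c : κ) (E : ι ⊕ ι → R) (k : ℕ) (F : R) :
    ((k + 1 : ℕ) : ℝ) • Q.tay c E (k + 1) F = ∑ α, E α * Q.tay c E k (Q.D c α F) := by
  simp only [tay, LinearMap.smul_apply, taylor_succ, mul_smul_comm, ← Finset.smul_sum, smul_smul]
  congr 1
  rw [Nat.factorial_succ]
  push_cast
  have : (k.factorial : ℝ) ≠ 0 := by positivity
  field_simp

theorem tay_succ' (c : κ) (E : ι ⊕ ι → R) (k : ℕ) (F : R) :
    Q.tay c E (k + 1) F = (((k + 1 : ℕ) : ℝ)⁻¹) • ∑ α, E α * Q.tay c E k (Q.D c α F) := by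
  rw [← tay_succ, smul_smul, inv_mul_cancel₀ (by positivity), one_smul]

variable {Q} {c : κ} {E : ι ⊕ ι → R}

theorem parPow_zs (i : ZMod 2) (F : R) : Q.zs (parPow i F) = parPow i (Q.zs F) := by
  rcases zmod_two i with rfl | rfl
  · simp
  · simp only [parPow_one, Q.zs_par]

theorem tay_par (hE : ∀ α, E α ∈ homog R (Q.px α)) (k : ℕ) (F : R) :
    Q.tay c E k (Superalgebra.par F) = Superalgebra.par (Q.tay c E k F) := by
  induction k generalizing F with
  | zero => rw [tay_zero, tay_zero, Q.zs_par]
  | succ k ih =>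
    rw [tay_succ', tay_succ', map_smul, map_sum]
    congr 1
    refine Finset.sum_congr rfl fun α _ => ?_
    rw [(Q.isSuperDer c α).par, map_smul, ih, map_mul, mem_homog.mp (hE α), mul_smul_comm,
      smul_mul_assoc]

theorem tay_parPow (hE : ∀ α, E α ∈ homog R (Q.px α)) (k : ℕ) (i : ZMod 2) (F : R) :
    Q.tay c E k (parPow i F) = parPow i (Q.tay c E k F) := by
  rcases zmod_two i with rfl | rfl
  · simp
  · simp only [parPow_one, tay_par hE]

/-- The operator ∑ E D is even, so its divided powers obey the Leibniz rule without signs. The proof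
multiplies by k + 1 and distributes it as the sum of the two indices over the antidiagonal. -/
theorem tay_mul (hE : ∀ α, E α ∈ homog R (Q.px α)) (k : ℕ) (F G : R) :
    Q.tay c E k (F * G) = ∑ p ∈ Finset.HasAntidiagonal.antidiagonal k,
      Q.tay c E p.1 F * Q.tay c E p.2 G := by
  induction k generalizing F G with
  | zero => simp [tay_zero]
  | succ k ih =>
    have hk : ((k + 1 : ℕ) : ℝ) ≠ 0 := by positivity
    apply smul_right_injective R hk
    change ((k + 1 : ℕ) : ℝ) • _ = ((k + 1 : ℕ) : ℝ) • _
    have e1 : ((k + 1 : ℕ) : ℝ) • ∑ p ∈ Finset.HasAntidiagonal.antidiagonal (k + 1),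
          Q.tay c E p.1 F * Q.tay c E p.2 G
        = ∑ p ∈ Finset.HasAntidiagonal.antidiagonal (k + 1),
          ((p.1 : ℝ) • (Q.tay c E p.1 F * Q.tay c E p.2 G)
            + (p.2 : ℝ) • (Q.tay c E p.1 F * Q.tay c E p.2 G)) := by
      rw [Finset.smul_sum]
      refine Finset.sum_congr rfl fun p hp => ?_
      rw [← add_smul, ← Finset.HasAntidiagonal.mem_antidiagonal.mp hp, Nat.cast_add]
    rw [e1, Finset.sum_add_distrib, Finset.Nat.sum_antidiagonal_succ,
      Finset.Nat.sum_antidiagonal_succ', tay_succ]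
    simp only [Nat.cast_zero, zero_smul, zero_add]
    have e2 : ∀ p : ℕ × ℕ, ((p.1 + 1 : ℕ) : ℝ) • (Q.tay c E (p.1 + 1) F * Q.tay c E p.2 G)
        = ∑ α, E α * Q.tay c E p.1 (Q.D c α F) * Q.tay c E p.2 G := fun p => by
      rw [← smul_mul_assoc, tay_succ, Finset.sum_mul]
    have e3 : ∀ p : ℕ × ℕ, ((p.2 + 1 : ℕ) : ℝ) • (Q.tay c E p.1 F * Q.tay c E (p.2 + 1) G)
        = ∑ α, Q.tay c E p.1 F * (E α * Q.tay c E p.2 (Q.D c α G)) := fun p => by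
      rw [← mul_smul_comm, tay_succ, Finset.mul_sum]
    rw [Finset.sum_congr rfl fun p _ => e2 p, Finset.sum_congr rfl fun p _ => e3 p,
      Finset.sum_comm, Finset.sum_comm (t := Finset.univ), ← Finset.sum_add_distrib]
    refine Finset.sum_congr rfl fun α _ => ?_
    rw [(Q.isSuperDer c α).leibniz, map_add, ih, ih, mul_add, Finset.mul_sum, Finset.mul_sum]
    congr 1
    · refine Finset.sum_congr rfl fun p _ => ?_
      rw [mul_assoc]
    · refine Finset.sum_congr rfl fun p _ => ?_
      rw [tay_parPow hE, ← mul_assoc, Q.comm.swap (hE α), parPow_self, mul_assoc]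

theorem tay_one_of_pos {k : ℕ} (hk : k ≠ 0) : Q.tay c E k 1 = 0 := by
  obtain ⟨k, rfl⟩ := Nat.exists_eq_succ_of_ne_zero hk
  rw [Nat.succ_eq_add_one, tay_succ']
  simp [(Q.isSuperDer c _).map_one]

theorem tay_scalar_of_pos {k : ℕ} (hk : k ≠ 0) {x : R} (hx : x ∈ Q.scalars) :
    Q.tay c E k x = 0 := by
  obtain ⟨k, rfl⟩ := Nat.exists_eq_succ_of_ne_zero hk
  rw [Nat.succ_eq_add_one, tay_succ']
  simp [Q.D_scalar _ _ x hx]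

theorem tay_one_crd (β : ι ⊕ ι) : Q.tay c E 1 (Q.crd c β) = E β := by
  have h : ∀ α, E α * Q.tay c E 0 (Q.D c α (Q.crd c β)) = if α = β then E β else 0 := by
    intro α
    rw [tay_zero, Q.D_crd]
    split_ifs with h
    · rw [map_one, mul_one, h]
    · rw [map_zero, mul_zero]
  rw [tay_succ', Finset.sum_congr rfl fun α _ => h α]
  simp

theorem tay_crd_of_two_le {k : ℕ} (hk : 2 ≤ k) (β : ι ⊕ ι) : Q.tay c E k (Q.crd c β) = 0 := by
  obtain ⟨k, rfl⟩ := Nat.exists_eq_add_of_le' hk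
  rw [tay_succ', Finset.sum_eq_zero, smul_zero]
  intro α _
  rw [Q.D_crd]
  split_ifs
  · rw [tay_one_of_pos (Nat.succ_ne_zero k), mul_zero]
  · rw [map_zero, mul_zero]

theorem tay_mem_N {j : ℕ} {F : R} (hF : F ∈ Q.N j) (k : ℕ) : Q.tay c E k F ∈ Q.N j := by
  induction k generalizing F with
  | zero =>
    rw [tay_zero]
    exact Q.zs_mem_N hF
  | succ k ih =>
    rw [tay_succ']
    exact Submodule.smul_mem _ _ (Submodule.sum_mem _ fun α _ =>
      Q.mul_mem_N_left _ (ih (Q.D_mem_N hF)))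

/-- The order of F adds to the order of the change in displacement. This additivity is what later
makes elimination contracting. -/
theorem tay_sub_mem_N {E' : ι ⊕ ι → R} {i : ℕ} (h : ∀ α, E α - E' α ∈ Q.N i) {j : ℕ} {F : R}
    (hF : F ∈ Q.N j) (k : ℕ) : Q.tay c E k F - Q.tay c E' k F ∈ Q.N (i + j) := by
  induction k generalizing F with
  | zero =>
    rw [tay_zero, tay_zero, sub_self]
    exact Submodule.zero_mem _
  | succ k ih =>
    rw [tay_succ', tay_succ', ← smul_sub, ← Finset.sum_sub_distrib]
    refine Submodule.smul_mem _ _ (Submodule.sum_mem _ fun α _ => ?_)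
    have e : E α * Q.tay c E k (Q.D c α F) - E' α * Q.tay c E' k (Q.D c α F)
        = (E α - E' α) * Q.tay c E k (Q.D c α F)
          + E' α * (Q.tay c E k (Q.D c α F) - Q.tay c E' k (Q.D c α F)) := by
      noncomm_ring
    rw [e]
    exact Submodule.add_mem _ (Q.N_mul (h α) (tay_mem_N (Q.D_mem_N hF) k))
      (Q.mul_mem_N_left _ (ih (Q.D_mem_N hF)))

/-- A factor s sees the displacement only up to what s annihilates. It is moved past each E by
supercommutativity and moved back afterwards. -/
theorem mul_tay_eq {E' : ι ⊕ ι → R} {i : ZMod 2} {s : R} (hs : s ∈ homog R i)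
    (h : ∀ α, s * E α = s * E' α) (k : ℕ) (F : R) :
    s * Q.tay c E k F = s * Q.tay c E' k F := by
  induction k generalizing F with
  | zero => rw [tay_zero, tay_zero]
  | succ k ih =>
    rw [tay_succ', tay_succ', mul_smul_comm, mul_smul_comm, Finset.mul_sum, Finset.mul_sum]
    congr 1
    refine Finset.sum_congr rfl fun α _ => ?_
    rw [← mul_assoc, h, Q.comm.swap hs, mul_assoc, ih, ← mul_assoc, ← Q.comm.swap hs, mul_assoc]

theorem tay_of_zs_eq_succ {F : R} (hF : Q.zs F = F) (k : ℕ) : Q.tay c E (k + 1) F =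
    (((k + 1 : ℕ) : ℝ)⁻¹) • ∑ a, E (.inl a) * Q.tay c E k (Q.D c (.inl a) F) := by
  rw [tay_succ', Fintype.sum_sum_type]
  congr 1
  rw [add_eq_left]
  refine Finset.sum_eq_zero fun a _ => ?_
  rw [← hF, Q.D_inr_zs, map_zero, mul_zero]

/-- Every displacement has degree at least one, so the k-th term has degree k; this is the
convergence of the Taylor series. -/
theorem tay_mem_fil (hE : ∀ a, E (.inl a) ∈ Q.N 1) (hE' : ∀ a, E (.inr a) ∈ Q.fil 1)
    (k : ℕ) (F : R) : Q.tay c E k F ∈ Q.fil k := by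
  induction k generalizing F with
  | zero =>
    rw [Q.fil_zero]
    trivial
  | succ k ih =>
    rw [tay_succ']
    refine Submodule.smul_mem _ _ (Submodule.sum_mem _ fun α _ => ?_)
    rw [add_comm]
    refine Q.fil_mul ?_ (ih _)
    rcases α with a | a
    · exact Q.N_le_fil (hE a)
    · exact hE' a

/-- A fibre derivative loses one degree and the momentum in front of it restores it. Consequently
substitution is continuous. -/
theorem tay_mem_fil_of_mem (hE' : ∀ a, E (.inr a) ∈ Q.fil 1) {j : ℕ} {F : R}
    (hF : F ∈ Q.fil j) (k : ℕ) : Q.tay c E k F ∈ Q.fil j := by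
  induction k generalizing j F with
  | zero =>
    rw [tay_zero]
    exact Q.zs_mem_fil hF
  | succ k ih =>
    rw [tay_succ']
    refine Submodule.smul_mem _ _ (Submodule.sum_mem _ fun α _ => ?_)
    rcases α with a | a
    · exact Q.mul_mem_fil_left _ (ih (Q.D_inl_mem_fil hF))
    · rcases j with - | j
      · rw [Q.fil_zero]
        trivial
      · rw [add_comm]
        exact Q.fil_mul (hE' a) (ih (Q.D_inr_mem_fil hF))

theorem null_tay (hE : ∀ a, E (.inl a) ∈ Q.N 1) (hE' : ∀ a, E (.inr a) ∈ Q.fil 1) (F : R) :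
    Q.Null fun k => Q.tay c E k F := fun k =>
  ⟨k, fun _ hj => Q.fil_anti hj (tay_mem_fil hE hE' _ F)⟩

end PhaseSpace

namespace PhaseSpace

variable {R : Type*} [Ring R] [Algebra ℝ R] [Superalgebra R] {ι κ : Type*} [Fintype ι]
  [DecidableEq ι] {Q : PhaseSpace R ι κ} {c : κ} {w w' : ι ⊕ ι → R}

/-! #### Substitutions -/

theorem sumsTo_sub {F : R} (h : Q.Null fun k => Q.tay c (displacement (Q.crd c) w) k F) :
    Q.SumsTo (fun k => Q.tay c (displacement (Q.crd c) w) k F) (Q.sub c w F) := by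
  refine Q.sub_spec c w F fun k => ?_
  obtain ⟨K, hK⟩ := h k
  refine ⟨K, fun j hj => ?_⟩
  have := Submodule.smul_mem _ (j.factorial : ℝ) (hK j hj)
  simp only [tay, LinearMap.smul_apply, smul_smul] at this
  rwa [mul_inv_cancel₀ (by positivity), one_smul] at this

variable (Q) in
/-- Points at which all formal functions can be evaluated. -/
structure IsPoint (c : κ) (w : ι ⊕ ι → R) : Prop where
  mem : ∀ α, w α ∈ homog R (Q.px α)
  inl : ∀ a, w (.inl a) - Q.crd c (.inl a) ∈ Q.N 1
  inr : ∀ a, w (.inr a) ∈ Q.fil 1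

theorem displacement_mem (h : ∀ α, w α ∈ homog R (Q.px α)) (α : ι ⊕ ι) :
    displacement (Q.crd c) w α ∈ homog R (Q.px α) := by
  rcases α with a | a
  · exact Submodule.sub_mem _ (h (.inl a)) (Q.crd_mem c (.inl a))
  · exact h (.inr a)

theorem IsPoint.null (hw : Q.IsPoint c w) (F : R) :
    Q.Null fun k => Q.tay c (displacement (Q.crd c) w) k F :=
  null_tay (E := displacement (Q.crd c) w) hw.inl hw.inr F

theorem IsPoint.sumsTo (hw : Q.IsPoint c w) (F : R) :
    Q.SumsTo (fun k => Q.tay c (displacement (Q.crd c) w) k F) (Q.sub c w F) :=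
  sumsTo_sub (hw.null F)

/-- If two series have null terms of positive order in `N i`, their sums differ by the difference
of the initial terms. -/
theorem SumsTo.sub_zero_mem_N {x : ℕ → R} {s : R} (hs : Q.SumsTo x s) {i : ℕ}
    (h : ∀ j, x (j + 1) ∈ Q.N i) : s - x 0 ∈ Q.N i := by
  refine Q.N_closed fun k => ?_
  obtain ⟨K, hK⟩ := hs k
  refine ⟨∑ j ∈ Finset.range K, x (j + 1), Submodule.sum_mem _ fun j _ => h j, ?_⟩
  have := hK (K + 1) (Nat.le_succ K)
  rw [Finset.sum_range_succ'] at this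
  rwa [sub_sub, add_comm]

theorem sub_eq_of_tay_eq_zero {F : R} {m : ℕ}
    (h : ∀ j ≥ m, Q.tay c (displacement (Q.crd c) w) j F = 0) :
    Q.sub c w F = ∑ j ∈ Finset.range m, Q.tay c (displacement (Q.crd c) w) j F := by
  refine (sumsTo_sub fun k => ⟨m, fun j hj => ?_⟩).unique (SumsTo.of_eq_zero h)
  simp only [h j hj]
  exact Submodule.zero_mem _

theorem sub_scalar {x : R} (hx : x ∈ Q.scalars) : Q.sub c w x = x := by
  rw [sub_eq_of_tay_eq_zero (m := 1) fun j hj => tay_scalar_of_pos (by omega) hx]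
  simp [tay_zero, Q.zs_scalar x hx]

theorem sub_one : Q.sub c w 1 = 1 := by
  rw [sub_eq_of_tay_eq_zero (m := 1) fun j hj => tay_one_of_pos (by omega)]
  simp [tay_zero]

/-- The Taylor series of a coordinate stops after the linear term, so w is completely arbitrary
here. This matters for differentials of functions that are not small. -/
theorem sub_crd (α : ι ⊕ ι) : Q.sub c w (Q.crd c α) = w α := by
  rw [sub_eq_of_tay_eq_zero (m := 2) fun j hj => tay_crd_of_two_le hj α]
  rw [Finset.sum_range_succ, Finset.sum_range_one, tay_zero, tay_one_crd]
  rcases α with a | a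
  · rw [Q.zs_crd_inl]
    exact add_sub_cancel _ _
  · rw [Q.zs_crd_inr, zero_add]
    rfl

/-- Functions on the base are not affected by substitutions of momenta. -/
theorem sub_of_zs_eq {F : R} (hF : Q.zs F = F)
    (hw : ∀ a, w (.inl a) = Q.crd c (.inl a)) : Q.sub c w F = F := by
  rw [sub_eq_of_tay_eq_zero (m := 1)]
  · simp [tay_zero, hF]
  · intro j hj
    obtain ⟨j, rfl⟩ := Nat.exists_eq_add_of_le' hj
    rw [tay_of_zs_eq_succ hF]
    simp [displacement, hw]

/-- Substitution as a homomorphism of algebras. -/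
def subHom (hw : Q.IsPoint c w) : R →ₐ[ℝ] R :=
  AlgHom.ofLinearMap
    { toFun := Q.sub c w
      map_add' := fun F G => (hw.sumsTo (F + G)).unique
        (((hw.sumsTo F).add (hw.sumsTo G)).congr fun _ => (map_add _ _ _).symm)
      map_smul' := fun r F => (hw.sumsTo (r • F)).unique
        (((hw.sumsTo F).smul r).congr fun _ => (map_smul _ _ _).symm) }
    sub_one
    (fun F G => (hw.sumsTo (F * G)).unique
      (((hw.sumsTo F).mul (hw.sumsTo G) (hw.null F) (hw.null G)).congr fun j =>
          (tay_mul (displacement_mem hw.mem) j F G).symm))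

theorem subHom_apply (hw : Q.IsPoint c w) (F : R) : subHom hw F = Q.sub c w F := rfl

variable (Q) in
/-- Homomorphisms that substitute points for the coordinates. -/
structure IsSubstitution (ψ : R →ₐ[ℝ] R) : Prop where
  par : ∀ F, ψ (Superalgebra.par F) = Superalgebra.par (ψ F)
  fil : ∀ k F, F ∈ Q.fil k → ψ F ∈ Q.fil k
  N : ∀ k F, F ∈ Q.N k → ψ F ∈ Q.N k
  scalar : ∀ x ∈ Q.scalars, ψ x = x
  base : ∀ c a, ψ (Q.crd c (.inl a)) - Q.crd c (.inl a) ∈ Q.N 1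

theorem isSubstitution_subHom (hw : Q.IsPoint c w) : Q.IsSubstitution (subHom hw) where
  par F := (hw.sumsTo _).unique (((hw.sumsTo F).map Superalgebra.par.toLinearMap (d := 0)
    fun k G hG => Q.fil_par k G hG).congr fun j => (tay_par (displacement_mem hw.mem) j F).symm)
  fil k F hF := (hw.sumsTo F).mem_fil fun j => tay_mem_fil_of_mem (E := displacement (Q.crd c) w) hw.inr hF j
  N k F hF := (hw.sumsTo F).mem_N fun j => tay_mem_N hF j
  scalar x hx := sub_scalar hx
  base c' a := by
    have h := (hw.sumsTo (Q.crd c' (.inl a))).sub_zero_mem_N (i := 1) fun j => ?_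
    · rwa [tay_zero, Q.zs_crd_inl] at h
    -- A position of another chart is a function on the base, so its higher Taylor terms contain
    -- only displacements of positions, which are nilpotent.
    · rw [tay_of_zs_eq_succ (Q.zs_crd_inl c' a)]
      exact Submodule.smul_mem _ _ (Submodule.sum_mem _ fun a _ =>
        Q.mul_mem_N_right (hw.inl a) _)

end PhaseSpace

namespace PhaseSpace

variable {R : Type*} [Ring R] [Algebra ℝ R] [Superalgebra R] {ι κ : Type*} [Fintype ι]
  [DecidableEq ι] {Q : PhaseSpace R ι κ} {c : κ} {w w' : ι ⊕ ι → R} {ψ φ : R →ₐ[ℝ] R}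

theorem IsSubstitution.parPow (h : Q.IsSubstitution ψ) (i : ZMod 2) (F : R) :
    ψ (parPow i F) = ThickMorphism.parPow i (ψ F) := by
  rcases zmod_two i with rfl | rfl
  · simp
  · simp only [parPow_one, h.par]

theorem IsSubstitution.mem (h : Q.IsSubstitution ψ) {i : ZMod 2} {F : R} (hF : F ∈ homog R i) :
    ψ F ∈ homog R i := by
  rw [mem_homog] at *
  rw [← h.par, hF, map_smul]

theorem isSubstitution_id : Q.IsSubstitution (AlgHom.id ℝ R) where
  par _ := rfl
  fil _ _ hF := hF
  N _ _ hF := hF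
  scalar _ _ := rfl
  base c a := by
    rw [AlgHom.id_apply, sub_self]
    exact Submodule.zero_mem _

theorem IsSubstitution.comp (hψ : Q.IsSubstitution ψ) (hφ : Q.IsSubstitution φ) :
    Q.IsSubstitution (ψ.comp φ) where
  par F := by simp [hψ.par, hφ.par]
  fil k F hF := hψ.fil _ _ (hφ.fil _ _ hF)
  N k F hF := hψ.N _ _ (hφ.N _ _ hF)
  scalar x hx := by simp [hψ.scalar x hx, hφ.scalar x hx]
  base c a := by
    have h1 := hψ.N _ _ (hφ.base c a)
    rw [map_sub] at h1
    have := Submodule.add_mem _ h1 (hψ.base c a)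
    rwa [sub_add_sub_cancel] at this

/-- A substitution is determined by the images of the coordinates. -/
theorem IsSubstitution.ext (hψ : Q.IsSubstitution ψ) (hφ : Q.IsSubstitution φ) (c : κ)
    (h : ∀ α, ψ (Q.crd c α) = φ (Q.crd c α)) : ψ = φ := by
  -- A difference of homomorphisms is a twisted derivation: (ψ - φ)(FG) = (ψ - φ)F · ψG + φF · (ψ -
  -- φ)G.
  have := Q.twisted_ext c (ψ.toLinearMap - φ.toLinearMap) ψ φ 0
    (fun F G => by
      simp only [LinearMap.sub_apply, AlgHom.toLinearMap_apply, map_mul]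
      noncomm_ring)
    (fun a _ => hφ.base c a)
    (fun α => by simp [h]) (fun x hx => by simp [hψ.scalar x hx, hφ.scalar x hx])
    (fun k F hF => Submodule.sub_mem _ (hψ.fil _ _ hF) (hφ.fil _ _ hF))
  ext F
  exact sub_eq_zero.mp (LinearMap.congr_fun this F)

theorem IsSubstitution.isPoint (hψ : Q.IsSubstitution ψ) (c : κ) :
    Q.IsPoint c fun α => ψ (Q.crd c α) where
  mem α := hψ.mem (Q.crd_mem c α)
  inl a := hψ.base c a
  inr a := hψ.fil _ _ (Q.crd_inr_mem_fil c a)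

/-- Any homomorphism of this kind is the Taylor substitution at the images of the coordinates, in
whichever chart. This is how composites of substitutions and changes of charts are computed. -/
theorem IsSubstitution.apply_eq (hψ : Q.IsSubstitution ψ) (h : ∀ α, ψ (Q.crd c α) = w α)
    (F : R) : ψ F = Q.sub c w F := by
  obtain rfl : (fun α => ψ (Q.crd c α)) = w := funext h
  have hw := hψ.isPoint c
  exact DFunLike.congr_fun (hψ.ext (isSubstitution_subHom hw) c fun α =>
    (sub_crd (w := fun α => ψ (Q.crd c α)) α).symm) F

theorem sub_crd_self (c : κ) (F : R) : Q.sub c (Q.crd c) F = F :=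
  (isSubstitution_id.apply_eq (fun _ => rfl) F).symm

theorem IsSubstitution.sub (hψ : Q.IsSubstitution ψ) (hw : Q.IsPoint c w) (F : R) :
    ψ (Q.sub c w F) = Q.sub c (fun α => ψ (w α)) F :=
  (hψ.comp (isSubstitution_subHom hw)).apply_eq (fun α => congrArg ψ (sub_crd α)) F

theorem IsPoint.map (hψ : Q.IsSubstitution ψ) (hw : Q.IsPoint c w) :
    Q.IsPoint c fun α => ψ (w α) where
  mem α := hψ.mem (hw.mem α)
  inl a := by
    have h1 := hψ.N _ _ (hw.inl a)
    rw [map_sub] at h1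
    have := Submodule.add_mem _ h1 (hψ.base c a)
    rwa [sub_add_sub_cancel] at this
  inr a := hψ.fil _ _ (hw.inr a)

/-! #### Derivations -/

variable (Q) in
/-- Superderivations that are continuous and vanish on parameters. -/
structure IsDerivation (i : ZMod 2) (D : R →ₗ[ℝ] R) : Prop where
  der : IsSuperDer i D
  fil : ∃ d, ∀ k F, F ∈ Q.fil (k + d) → D F ∈ Q.fil k
  scalar : ∀ x ∈ Q.scalars, D x = 0

theorem D_mem_fil (c : κ) (α : ι ⊕ ι) {k : ℕ} {F : R} (hF : F ∈ Q.fil (k + 1)) :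
    Q.D c α F ∈ Q.fil k := by
  rcases α with a | a
  · exact Q.fil_anti (Nat.le_succ k) (Q.D_inl_mem_fil hF)
  · exact Q.D_inr_mem_fil hF

theorem isDerivation_D (c : κ) (α : ι ⊕ ι) : Q.IsDerivation (Q.px α) (Q.D c α) where
  der := Q.isSuperDer c α
  fil := ⟨1, fun _ _ hF => D_mem_fil c α hF⟩
  scalar x hx := Q.D_scalar c α x hx

/-- As functions of F, the two sides are derivations twisted by ψ; their difference kills
coordinates and parameters, hence vanishes. -/
theorem IsDerivation.chain_rule {i : ZMod 2} {D : R →ₗ[ℝ] R} (hD : Q.IsDerivation i D)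
    (hψ : Q.IsSubstitution ψ) (c : κ) (F : R) :
    D (ψ F) = ∑ α, D (ψ (Q.crd c α)) * ψ (Q.D c α F) := by
  obtain ⟨d, hd⟩ := hD.fil
  have := Q.twisted_ext c (D ∘ₗ ψ.toLinearMap - ∑ α, LinearMap.mulLeft ℝ (D (ψ (Q.crd c α))) ∘ₗ
      ψ.toLinearMap ∘ₗ Q.D c α) ψ ((ThickMorphism.parPow i).comp ψ) (d + 1)
    (fun F G => by
      simp only [LinearMap.sub_apply, LinearMap.comp_apply, AlgHom.toLinearMap_apply, map_mul,
        hD.der.leibniz, LinearMap.sum_apply, LinearMap.mulLeft_apply, AlgHom.comp_apply,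
        (Q.isSuperDer c _).leibniz, map_add, Finset.sum_add_distrib, sub_mul, mul_sub,
        Finset.sum_mul, Finset.mul_sum]
      have e : ∀ α, D (ψ (Q.crd c α)) * (ψ (ThickMorphism.parPow (Q.px α) F) * ψ (Q.D c α G))
          = ThickMorphism.parPow i (ψ F) * (D (ψ (Q.crd c α)) * ψ (Q.D c α G)) := fun α => by
        rw [← mul_assoc, Q.comm.swap (hD.der.mem (hψ.mem (Q.crd_mem c α))), hψ.parPow,
          parPow_parPow, add_assoc, zmod_two_add_self, add_zero, mul_assoc]
      rw [Finset.sum_congr rfl fun α _ => e α]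
      simp only [mul_assoc]
      abel)
    (fun a ha => by
      have h : Q.crd c (.inl a) ∈ homog R 0 := ha ▸ Q.crd_mem c (.inl a)
      rw [AlgHom.comp_apply, parPow_of_mem_zero (hψ.mem h)]
      exact hψ.base c a)
    (fun α => by
      simp only [LinearMap.sub_apply, LinearMap.comp_apply, AlgHom.toLinearMap_apply,
        LinearMap.sum_apply, LinearMap.mulLeft_apply, Q.D_crd]
      rw [Finset.sum_eq_single α]
      · simp
      · intro β _ h
        simp [h]
      · simp)
    (fun x hx => by
      simp [hψ.scalar x hx, hD.scalar x hx, Q.D_scalar c _ x hx])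
    (fun k F hF => by
      refine Submodule.sub_mem _ (hd _ _ (hψ.fil _ _ (Q.fil_anti (by omega) hF))) ?_
      rw [LinearMap.sum_apply]
      exact Submodule.sum_mem _ fun α _ => Q.mul_mem_fil_left _
        (hψ.fil _ _ (D_mem_fil c α (Q.fil_anti (by omega) hF))))
  have h := LinearMap.congr_fun this F
  simp only [LinearMap.sub_apply, LinearMap.comp_apply, AlgHom.toLinearMap_apply,
    LinearMap.sum_apply, LinearMap.mulLeft_apply, LinearMap.zero_apply] at h
  exact sub_eq_zero.mp h

theorem IsDerivation.chain_rule_sub {i : ZMod 2} {D : R →ₗ[ℝ] R} (hD : Q.IsDerivation i D)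
    (hw : Q.IsPoint c w) (F : R) :
    D (Q.sub c w F) = ∑ α, D (w α) * Q.sub c w (Q.D c α F) := by
  have := hD.chain_rule (isSubstitution_subHom hw) c F
  simpa only [subHom_apply, sub_crd] using this

theorem IsDerivation.eq_sum {i : ZMod 2} {D : R →ₗ[ℝ] R} (hD : Q.IsDerivation i D) (c : κ)
    (F : R) : D F = ∑ α, D (Q.crd c α) * Q.D c α F :=
  hD.chain_rule isSubstitution_id c F

theorem D_inr_crd_inl (c c' : κ) (a b : ι) : Q.D c (.inr a) (Q.crd c' (.inl b)) = 0 := by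
  rw [← Q.zs_crd_inl c' b, Q.D_inr_zs]

/-- The change of coordinates for the derivatives along the base. -/
theorem D_inl_eq_sum (c c' : κ) (a : ι) (F : R) : Q.D c (.inl a) F
    = ∑ b, Q.D c (.inl a) (Q.crd c' (.inl b)) * Q.D c' (.inl b) F := by
  rw [(isDerivation_D c (.inl a)).eq_sum c', Fintype.sum_sum_type, add_eq_left]
  refine Finset.sum_eq_zero fun b _ => ?_
  rw [Q.crd_inr c' c, Q.D_crd, if_neg (by simp), zero_mul]

/-- The partial derivatives supercommute. -/
theorem D_D (c : κ) (α β : ι ⊕ ι) (F : R) :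
    Q.D c α (Q.D c β F) = sgn (Q.px α * Q.px β) • Q.D c β (Q.D c α F) := by
  have hα := Q.isSuperDer c α
  have hβ := Q.isSuperDer c β
  -- The supercommutator of two derivations is a derivation, and here it kills the coordinates. Each
  -- derivative may lose one degree, hence the shift 2.
  have := Q.twisted_ext c (Q.D c α ∘ₗ Q.D c β - sgn (Q.px α * Q.px β) • (Q.D c β ∘ₗ Q.D c α))
    (AlgHom.id ℝ R) (ThickMorphism.parPow (Q.px α + Q.px β)) 2
    (fun F G => by
      simp only [LinearMap.sub_apply, LinearMap.comp_apply, LinearMap.smul_apply, hα.leibniz,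
        hβ.leibniz, map_add, hα.parPow, hβ.parPow, AlgHom.id_apply, sub_mul, mul_sub, smul_add,
        smul_mul_assoc, mul_smul_comm, smul_smul, parPow_parPow]
      rw [mul_comm (Q.px β) (Q.px α), sgn_mul_self, one_smul, add_comm (Q.px β) (Q.px α)]
      abel)
    (fun a ha => by
      have h : Q.crd c (.inl a) ∈ homog R 0 := ha ▸ Q.crd_mem c (.inl a)
      rw [parPow_of_mem_zero h, sub_self]
      exact Submodule.zero_mem _)
    (fun γ => by
      simp only [LinearMap.sub_apply, LinearMap.comp_apply, LinearMap.smul_apply, Q.D_crd]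
      split_ifs <;> simp [hα.map_one, hβ.map_one])
    (fun x hx => by simp [Q.D_scalar c _ x hx])
    (fun k F hF => by
      refine Submodule.sub_mem _ ?_ (Submodule.smul_mem _ _ ?_)
      · exact D_mem_fil c α (D_mem_fil c β hF)
      · exact D_mem_fil c β (D_mem_fil c α hF))
  have h := LinearMap.congr_fun this F
  exact sub_eq_zero.mp h

/-! #### Congruences -/

theorem sub_sub_mem_N (hw : Q.IsPoint c w) (hw' : Q.IsPoint c w') {i : ℕ}
    (h : ∀ α, w α - w' α ∈ Q.N i) {j : ℕ} {F : R} (hF : F ∈ Q.N j) :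
    Q.sub c w F - Q.sub c w' F ∈ Q.N (i + j) := by
  have hs := (hw.sumsTo F).add ((hw'.sumsTo F).smul (-1))
  rw [neg_smul, one_smul, ← sub_eq_add_neg] at hs
  refine hs.mem_N fun k => ?_
  rw [neg_smul, one_smul, ← sub_eq_add_neg]
  refine tay_sub_mem_N (fun α => ?_) hF k
  rcases α with a | a
  · simpa [displacement] using h (.inl a)
  · exact h (.inr a)

theorem sub_sub_mem_N' (hw : Q.IsPoint c w) (hw' : Q.IsPoint c w') {i : ℕ}
    (h : ∀ α, w α - w' α ∈ Q.N i) (F : R) : Q.sub c w F - Q.sub c w' F ∈ Q.N i :=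
  sub_sub_mem_N hw hw' h (j := 0) (by rw [Q.N_zero]; trivial)

/-- Convergence of the two series suffices, so this also applies to points with large momenta. -/
theorem mul_sub_eq {i : ZMod 2} {s : R} (hs : s ∈ homog R i) (h : ∀ α, s * w α = s * w' α) {F : R}
    (hw : Q.Null fun k => Q.tay c (displacement (Q.crd c) w) k F)
    (hw' : Q.Null fun k => Q.tay c (displacement (Q.crd c) w') k F) :
    s * Q.sub c w F = s * Q.sub c w' F := by
  refine ((sumsTo_sub hw).mul_left s).unique
    (((sumsTo_sub hw').mul_left s).congr fun k => mul_tay_eq hs (fun α => ?_) k F)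
  rcases α with a | a
  · simp [displacement, mul_sub, h]
  · exact (h (.inr a)).symm

/-- The Taylor formula for displacements whose products vanish. -/
theorem sub_eq_add_sum (hw : Q.IsPoint c w)
    (h : ∀ α β, (w α - Q.crd c α) * (w β - Q.crd c β) = 0) (F : R) :
    Q.sub c w F = F + ∑ α, (w α - Q.crd c α) * Q.D c α F := by
  have hη : ∀ α, w α - Q.crd c α ∈ homog R (Q.px α) := fun α =>
    Submodule.sub_mem _ (hw.mem α) (Q.crd_mem c α)
  -- Since products of displacements vanish, the first-order Taylor polynomial is already
  -- multiplicative; it is a substitution with the right values on coordinates, and uniqueness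
  -- applies.
  let φ : R →ₐ[ℝ] R := AlgHom.ofLinearMap
    (LinearMap.id + ∑ α, LinearMap.mulLeft ℝ (w α - Q.crd c α) ∘ₗ Q.D c α)
    (by simp [LinearMap.sum_apply, (Q.isSuperDer c _).map_one])
    (fun F G => by
      simp only [LinearMap.add_apply, LinearMap.id_apply, LinearMap.sum_apply,
        LinearMap.comp_apply, LinearMap.mulLeft_apply, (Q.isSuperDer c _).leibniz, mul_add,
        add_mul, Finset.sum_add_distrib]
      have e1 : ∀ α, (w α - Q.crd c α) * (parPow (Q.px α) F * Q.D c α G)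
          = F * ((w α - Q.crd c α) * Q.D c α G) := fun α => by
        rw [← mul_assoc, Q.comm.swap (hη α), parPow_self, mul_assoc]
      have e2 : (∑ α, (w α - Q.crd c α) * Q.D c α F) * ∑ α, (w α - Q.crd c α) * Q.D c α G = 0 := by
        rw [Finset.sum_mul_sum]
        refine Finset.sum_eq_zero fun α _ => Finset.sum_eq_zero fun β _ => ?_
        rw [mul_assoc, ← mul_assoc (Q.D c α F), ← parPow_self (Q.px β) (Q.D c α F),
          ← Q.comm.swap (hη β), mul_assoc, ← mul_assoc, h, zero_mul]
      rw [Finset.sum_congr rfl fun α _ => e1 α, e2, Finset.sum_mul, Finset.mul_sum]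
      simp only [mul_assoc]
      abel)
  have hφ : ∀ F, φ F = F + ∑ α, (w α - Q.crd c α) * Q.D c α F := fun F => by
    simp [φ, LinearMap.sum_apply]
  have hs : Q.IsSubstitution φ :=
    { par := fun F => by
        rw [hφ, hφ, map_add, map_sum]
        congr 1
        refine Finset.sum_congr rfl fun α _ => ?_
        rw [(Q.isSuperDer c α).par, map_mul, mem_homog.mp (hη α), mul_smul_comm, smul_mul_assoc]
      fil := fun k F hF => by
        rw [hφ]
        refine Submodule.add_mem _ hF (Submodule.sum_mem _ fun α _ => ?_)
        rcases α with a | a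
        · exact Q.mul_mem_fil_left _ (Q.D_inl_mem_fil hF)
        · rcases k with - | k
          · rw [Q.fil_zero]
            trivial
          · rw [add_comm]
            exact Q.fil_mul (Submodule.sub_mem _ (hw.inr a) (Q.crd_inr_mem_fil c a))
              (Q.D_inr_mem_fil hF)
      N := fun k F hF => by
        rw [hφ]
        exact Submodule.add_mem _ hF (Submodule.sum_mem _ fun α _ =>
          Q.mul_mem_N_left _ (Q.D_mem_N hF))
      scalar := fun x hx => by simp [hφ, Q.D_scalar c _ x hx]
      base := fun c' a => by
        rw [hφ, add_sub_cancel_left, Fintype.sum_sum_type]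
        simp only [D_inr_crd_inl, mul_zero, Finset.sum_const_zero, add_zero]
        exact Submodule.sum_mem _ fun b _ => Q.mul_mem_N_right (hw.inl b) _ }
  rw [← hφ]
  refine (hs.apply_eq (fun β => ?_) F).symm
  rw [hφ, Finset.sum_eq_single β]
  · simp [Q.D_crd]
  · intro α _ hα
    rw [Q.D_crd, if_neg hα, mul_zero]
  · simp

end PhaseSpace

namespace PhaseSpace

variable {R : Type*} [Ring R] [Algebra ℝ R] [Superalgebra R] {ι κ : Type*} [Fintype ι]
  [DecidableEq ι] {Q : PhaseSpace R ι κ} {c c' : κ} {y y' q q' P : ι → R}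

/-! #### Elimination -/

variable (Q) in
/-- The generating function of the identity. -/
def gen (c : κ) : R := ∑ a, Q.crd c (.inl a) * Q.crd c (.inr a)

variable (Q) in
/-- The momenta. -/
def mo (c : κ) (a : ι) : R := Q.crd c (.inr a)

variable (Q) in
/-- The coordinates on the base. -/
def po (c : κ) (a : ι) : R := Q.crd c (.inl a)

variable (Q) in
/-- Points of the base close to the identity. -/
structure IsBase (c : κ) (y : ι → R) : Prop where
  mem : ∀ a, y a ∈ homog R (Q.ix a)
  near : ∀ a, y a - Q.po c a ∈ Q.N 1

variable (Q) in
/-- Values of the momenta at which power series can be evaluated. -/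
structure IsMomenta (q : ι → R) : Prop where
  mem : ∀ a, q a ∈ homog R (Q.ix a)
  fil : ∀ a, q a ∈ Q.fil 1

theorem IsBase.isPoint (hy : Q.IsBase c y) (hq : Q.IsMomenta q) : Q.IsPoint c (Sum.elim y q) where
  mem := by
    rintro (a | a)
    · exact hy.mem a
    · exact hq.mem a
  inl := hy.near
  inr := hq.fil

theorem isBase_po (c : κ) : Q.IsBase c (Q.po c) where
  mem a := Q.crd_mem c (.inl a)
  near a := by
    rw [sub_self]
    exact Submodule.zero_mem _

theorem isMomenta_mo (c : κ) : Q.IsMomenta (Q.mo c) where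
  mem a := Q.crd_mem c (.inr a)
  fil := Q.crd_inr_mem_fil c

theorem mo_eq (c c' : κ) : Q.mo c = Q.mo c' := funext fun a => Q.crd_inr c c' a

variable (Q) in
/-- Even functions that are small. -/
structure IsSmall (F : R) : Prop where
  even : F ∈ homog R 0
  fil : F ∈ Q.fil 1

variable (Q) in
/-- Generating functions close to the identity. -/
structure NearId (c : κ) (S : R) : Prop where
  even : S ∈ homog R 0
  near : S - Q.gen c ∈ Q.N 1

theorem gen_even (c : κ) : Q.gen c ∈ homog R 0 := Submodule.sum_mem _ fun a _ =>
  mul_self_mem_homog (Q.crd_mem c (.inl a)) (Q.crd_mem c (.inr a))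

theorem gen_mem_fil (c : κ) : Q.gen c ∈ Q.fil 1 := Submodule.sum_mem _ fun a _ =>
  Q.mul_mem_fil_left _ (Q.crd_inr_mem_fil c a)

theorem nearId_gen (c : κ) : Q.NearId c (Q.gen c) where
  even := gen_even c
  near := by
    rw [sub_self]
    exact Submodule.zero_mem _

theorem NearId.isSmall {S : R} (hS : Q.NearId c S) : Q.IsSmall S where
  even := hS.even
  fil := by
    have := Submodule.add_mem _ (Q.N_le_fil hS.near) (gen_mem_fil c)
    rwa [sub_add_cancel] at this

theorem isSmall_gen (c : κ) : Q.IsSmall (Q.gen c) := (nearId_gen c).isSmall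

theorem D_inr_gen (c c' : κ) (a : ι) :
    Q.D c (.inr a) (Q.gen c') = sgn (Q.ix a) • Q.po c' a := by
  have h : ∀ b, Q.D c (.inr a) (Q.crd c' (.inl b) * Q.crd c' (.inr b))
      = if a = b then sgn (Q.ix a) • Q.po c' a else 0 := fun b => by
    rw [(Q.isSuperDer c (.inr a)).leibniz, D_inr_crd_inl, zero_mul, zero_add, Q.crd_inr c' c,
      Q.D_crd]
    split_ifs with h1 h2 h2
    · subst h2
      rw [mul_one, parPow_of_mem (Q.crd_mem c' (.inl a))]
      simp [zmod_two_mul_self, po]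
    · exact absurd (Sum.inr.inj h1) h2
    · exact absurd (congrArg Sum.inr h2) h1
    · rw [mul_zero]
  rw [gen, map_sum, Finset.sum_congr rfl fun b _ => h b]
  simp

theorem D_inl_gen (c c' : κ) (a : ι) :
    Q.D c (.inl a) (Q.gen c') = ∑ b, Q.D c (.inl a) (Q.po c' b) * Q.mo c' b := by
  rw [gen, map_sum]
  refine Finset.sum_congr rfl fun b _ => ?_
  rw [(Q.isSuperDer c (.inl a)).leibniz, Q.crd_inr c' c, Q.D_crd, if_neg (by simp), mul_zero,
    add_zero]
  rw [mo, Q.crd_inr c' c]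
  rfl

theorem D_inl_gen_self (c : κ) (a : ι) : Q.D c (.inl a) (Q.gen c) = Q.mo c a := by
  rw [D_inl_gen, Finset.sum_eq_single a]
  · rw [po, Q.D_crd, if_pos rfl, one_mul]
  · intro b _ hb
    rw [po, Q.D_crd, if_neg (fun h => hb (Sum.inl.inj h).symm), zero_mul]
  · simp

theorem zs_D_inl_po (c c' : κ) (a b : ι) :
    Q.zs (Q.D c (.inl a) (Q.po c' b)) = Q.D c (.inl a) (Q.po c' b) := by
  rw [← Q.D_inl_zs, po, Q.zs_crd_inl]

theorem IsPoint.sub_mem {w : ι ⊕ ι → R} (hw : Q.IsPoint c w) {i : ZMod 2} {F : R}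
    (hF : F ∈ homog R i) : Q.sub c w F ∈ homog R i :=
  (isSubstitution_subHom hw).mem hF

theorem IsPoint.sub_fil {w : ι ⊕ ι → R} (hw : Q.IsPoint c w) {k : ℕ} {F : R}
    (hF : F ∈ Q.fil k) : Q.sub c w F ∈ Q.fil k :=
  (isSubstitution_subHom hw).fil k F hF

theorem IsPoint.sub_N {w : ι ⊕ ι → R} (hw : Q.IsPoint c w) {k : ℕ} {F : R}
    (hF : F ∈ Q.N k) : Q.sub c w F ∈ Q.N k :=
  (isSubstitution_subHom hw).N k F hF

theorem IsPoint.sub_add {w : ι ⊕ ι → R} (hw : Q.IsPoint c w) (F G : R) :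
    Q.sub c w (F + G) = Q.sub c w F + Q.sub c w G := map_add (subHom hw) F G

theorem IsPoint.sub_sub {w : ι ⊕ ι → R} (hw : Q.IsPoint c w) (F G : R) :
    Q.sub c w (F - G) = Q.sub c w F - Q.sub c w G := map_sub (subHom hw) F G

theorem IsPoint.sub_smul {w : ι ⊕ ι → R} (hw : Q.IsPoint c w) (r : ℝ) (F : R) :
    Q.sub c w (r • F) = r • Q.sub c w F := map_smul (subHom hw) r F

theorem IsPoint.sub_mul {w : ι ⊕ ι → R} (hw : Q.IsPoint c w) (F G : R) :
    Q.sub c w (F * G) = Q.sub c w F * Q.sub c w G := map_mul (subHom hw) F G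

theorem IsPoint.sub_sum {w : ι ⊕ ι → R} (hw : Q.IsPoint c w) {β : Type*} (s : Finset β)
    (F : β → R) : Q.sub c w (∑ b ∈ s, F b) = ∑ b ∈ s, Q.sub c w (F b) := map_sum (subHom hw) F s

theorem sub_po (a : ι) : Q.sub c (Sum.elim y q) (Q.po c a) = y a := sub_crd (.inl a)

theorem sub_mo (a : ι) : Q.sub c (Sum.elim y q) (Q.mo c a) = q a := sub_crd (.inr a)

theorem sub_po_mo (F : R) : Q.sub c (Sum.elim (Q.po c) (Q.mo c)) F = F := by
  have : Sum.elim (Q.po c) (Q.mo c) = Q.crd c := by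
    funext α
    rcases α with a | a <;> rfl
  rw [this, sub_crd_self]

theorem IsPoint.sub_gen (h : Q.IsPoint c (Sum.elim y q)) :
    Q.sub c (Sum.elim y q) (Q.gen c) = ∑ a, y a * q a := by
  rw [gen, h.sub_sum]
  refine Finset.sum_congr rfl fun a _ => ?_
  rw [h.sub_mul, sub_crd, sub_crd]
  rfl

variable (Q) in
/-- The momenta `∂F/∂z^a` at the point `(y, P)`. -/
def eliminationMomenta (c : κ) (F : R) (P y : ι → R) (a : ι) : R :=
  Q.sub c (Sum.elim y P) (Q.D c (.inl a) F)

variable (Q) in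
/-- The positions `± ∂S/∂p_a` at the point `(z, q)`. -/
def eliminationPositions (c : κ) (S : R) (q : ι → R) (a : ι) : R :=
  sgn (Q.ix a) • Q.sub c (Sum.elim (Q.po c) q) (Q.D c (.inr a) S)

theorem IsSmall.isMomenta {F : R} (hF : Q.IsSmall F) (hy : Q.IsBase c y) (hP : Q.IsMomenta P) :
    Q.IsMomenta (Q.eliminationMomenta c F P y) where
  mem a := by
    have := (Q.isSuperDer c (.inl a)).mem hF.even
    rw [add_zero] at this
    exact (hy.isPoint hP).sub_mem this
  fil a := (hy.isPoint hP).sub_fil (Q.D_inl_mem_fil hF.fil)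

/-- The identity contributes exactly the position itself, so the deviation is governed by S - xp,
which is nilpotent for S near the identity. -/
theorem NearId.positions_sub_po {S : R} (hq : Q.IsMomenta q) (a : ι) :
    Q.eliminationPositions c S q a - Q.po c a
      = sgn (Q.ix a) • Q.sub c (Sum.elim (Q.po c) q) (Q.D c (.inr a) (S - Q.gen c)) := by
  have hw := (isBase_po c).isPoint hq
  rw [map_sub, D_inr_gen, hw.sub_sub, hw.sub_smul, sub_po, smul_sub, sgn_smul_sgn_smul]
  rfl

theorem NearId.isBase {S : R} (hS : Q.NearId c S) (hq : Q.IsMomenta q) :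
    Q.IsBase c (Q.eliminationPositions c S q) where
  mem a := by
    have := (Q.isSuperDer c (.inr a)).mem hS.even
    rw [add_zero] at this
    exact Submodule.smul_mem _ _ (((isBase_po c).isPoint hq).sub_mem this)
  near a := by
    rw [positions_sub_po hq]
    exact Submodule.smul_mem _ _ (((isBase_po c).isPoint hq).sub_N (Q.D_mem_N hS.near))

theorem momenta_sub_mem {F F' : R} (hy : Q.IsBase c y)
    (hy' : Q.IsBase c y') (hP : Q.IsMomenta P) {i : ℕ} (h : ∀ a, y a - y' a ∈ Q.N i)
    (hFF : F - F' ∈ Q.N i) (a : ι) :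
    Q.eliminationMomenta c F P y a - Q.eliminationMomenta c F' P y' a ∈ Q.N i := by
  have hw := hy.isPoint hP
  have h1 := hw.sub_N (Q.D_mem_N (c := c) (α := .inl a) hFF)
  rw [map_sub, hw.sub_sub] at h1
  have h2 := sub_sub_mem_N' hw (hy'.isPoint hP) (i := i) (by
    rintro (b | b)
    · exact h b
    · simp) (Q.D c (.inl a) F')
  have := Submodule.add_mem _ h1 h2
  rwa [sub_add_sub_cancel] at this

/-- One nilpotent order is gained because q enters the deviation only through S - xp. -/
theorem NearId.positions_sub_mem {S : R} (hS : Q.NearId c S) (hq : Q.IsMomenta q)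
    (hq' : Q.IsMomenta q') {i : ℕ} (h : ∀ a, q a - q' a ∈ Q.N i) (a : ι) :
    Q.eliminationPositions c S q a - Q.eliminationPositions c S q' a ∈ Q.N (i + 1) := by
  rw [← sub_sub_sub_cancel_right _ _ (Q.po c a), positions_sub_po hq, positions_sub_po hq',
    ← smul_sub]
  refine Submodule.smul_mem _ _ (sub_sub_mem_N ((isBase_po c).isPoint hq)
    ((isBase_po c).isPoint hq') ?_ (Q.D_mem_N hS.near))
  rintro (b | b)
  · simp
  · exact h b

/-- The equations for the intermediate point of an elimination have a solution. -/
theorem NearId.exists_solution {S F : R} (hS : Q.NearId c S) (hF : Q.IsSmall F)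
    (hP : Q.IsMomenta P) :
    ∃ y, Q.IsBase c y ∧ Q.eliminationPositions c S (Q.eliminationMomenta c F P y) = y := by
  -- Fixed point iteration from the identity: consecutive iterates differ by ever higher nilpotent
  -- order, so the iteration stops changing after K steps, where `N K` is zero.
  let f : (ι → R) → ι → R := fun y => Q.eliminationPositions c S (Q.eliminationMomenta c F P y)
  have hb : ∀ k, Q.IsBase c (f^[k] (Q.po c)) := by
    intro k
    induction k with
    | zero => exact isBase_po c
    | succ k ih =>
      rw [Function.iterate_succ_apply']
      exact hS.isBase (hF.isMomenta ih hP)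
  have hd : ∀ k a, f^[k + 1] (Q.po c) a - f^[k] (Q.po c) a ∈ Q.N (k + 1) := by
    intro k
    induction k with
    | zero => exact (hb 1).near
    | succ k ih =>
      intro a
      rw [Function.iterate_succ_apply' f (k + 1), Function.iterate_succ_apply' f k]
      rw [Function.iterate_succ_apply' f k] at ih
      have hb1 := hb (k + 1)
      rw [Function.iterate_succ_apply'] at hb1
      refine hS.positions_sub_mem (hF.isMomenta hb1 hP) (hF.isMomenta (hb k) hP)
        (fun b => ?_) a
      refine momenta_sub_mem hb1 (hb k) hP ih ?_ b
      rw [sub_self]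
      exact Submodule.zero_mem _
  obtain ⟨K, hK⟩ := Q.N_eq_bot
  refine ⟨f^[K] (Q.po c), hb K, ?_⟩
  funext a
  have h := hd K a
  have h0 := Q.N_anti (Nat.le_succ K) h
  rw [hK, Submodule.mem_bot, sub_eq_zero, Function.iterate_succ_apply'] at h0
  exact h0

theorem eq_zero_of_forall_mem_N {x : R} (h0 : x ∈ Q.N 1)
    (h : ∀ i, 1 ≤ i → x ∈ Q.N i → x ∈ Q.N (i + 1)) : x = 0 := by
  have : ∀ i, x ∈ Q.N (i + 1) := by
    intro i
    induction i with
    | zero => exact h0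
    | succ i ih => exact h _ (Nat.succ_pos i) ih
  obtain ⟨K, hK⟩ := Q.N_eq_bot
  have h1 := Q.N_anti (Nat.le_succ K) (this K)
  rwa [hK, Submodule.mem_bot] at h1

/-- Solutions of the equations for close data are close. -/
theorem NearId.solution_sub_mem {S F F' : R} (hS : Q.NearId c S) (hF : Q.IsSmall F)
    (hF' : Q.IsSmall F') (hP : Q.IsMomenta P) (hy : Q.IsBase c y)
    (hy' : Q.IsBase c y')
    (h : Q.eliminationPositions c S (Q.eliminationMomenta c F P y) = y)
    (h' : Q.eliminationPositions c S (Q.eliminationMomenta c F' P y') = y') {i : ℕ}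
    (hFF : F - F' ∈ Q.N i) (a : ι) : y a - y' a ∈ Q.N (i + 1) := by
  -- Bootstrapping: closeness of order j of the data and of the positions passes to the momenta, and
  -- then returns to the positions with order j + 1.
  have key : ∀ j, j ≤ i → ∀ a, y a - y' a ∈ Q.N (j + 1) := by
    intro j
    induction j with
    | zero =>
      intro _ a
      have := Submodule.sub_mem _ (hy.near a) (hy'.near a)
      rwa [sub_sub_sub_cancel_right] at this
    | succ j ih =>
      intro hj a
      rw [← h, ← h']
      exact hS.positions_sub_mem (hF.isMomenta hy hP) (hF'.isMomenta hy' hP)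
        (momenta_sub_mem hy hy' hP (ih (by omega)) (Q.N_anti hj hFF)) a
  exact key i le_rfl a

theorem NearId.solution_unique {S F : R} (hS : Q.NearId c S) (hF : Q.IsSmall F)
    (hP : Q.IsMomenta P) (hy : Q.IsBase c y) (hy' : Q.IsBase c y')
    (h : Q.eliminationPositions c S (Q.eliminationMomenta c F P y) = y)
    (h' : Q.eliminationPositions c S (Q.eliminationMomenta c F P y') = y') : y = y' := by
  funext a
  obtain ⟨K, hK⟩ := Q.N_eq_bot
  have := hS.solution_sub_mem hF hF hP hy hy' h h' (i := K)
    (by rw [sub_self]; exact Submodule.zero_mem _) a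
  have h1 := Q.N_anti (Nat.le_succ K) this
  rwa [hK, Submodule.mem_bot, sub_eq_zero] at h1

end PhaseSpace

namespace PhaseSpace

variable {R : Type*} [Ring R] [Algebra ℝ R] [Superalgebra R] {ι κ : Type*} [Fintype ι]
  [DecidableEq ι] {Q : PhaseSpace R ι κ} {c c' : κ} {y y' q q' : ι → R} {F F' S G G' : R}

variable (Q) in
/-- The elimination of `y` and `q` from `F(y, r) + S(x, q) - y q`. -/
structure IsElim (c : κ) (F S : R) (y q : ι → R) (G : R) : Prop where
  base : Q.IsBase c y
  mem : ∀ a, q a ∈ homog R (Q.ix a)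
  momenta : Q.eliminationMomenta c F (Q.mo c) y = q
  positions : Q.eliminationPositions c S q = y
  eq : G = Q.sub c (Sum.elim y (Q.mo c)) F + Q.sub c (Sum.elim (Q.po c) q) S - ∑ a, y a * q a

variable (Q) in
/-- `G` is obtained from `F` and `S` by elimination. -/
def Elim (c : κ) (F S G : R) : Prop := ∃ y q, Q.IsElim c F S y q G

theorem IsElim.isMomenta (h : Q.IsElim c F S y q G) (hF : Q.IsSmall F) : Q.IsMomenta q :=
  h.momenta ▸ hF.isMomenta h.base (isMomenta_mo c)

theorem IsElim.fixed (h : Q.IsElim c F S y q G) :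
    Q.eliminationPositions c S (Q.eliminationMomenta c F (Q.mo c) y) = y := by
  rw [h.momenta, h.positions]

theorem exists_elim (hF : Q.IsSmall F) (hS : Q.NearId c S) : ∃ G, Q.Elim c F S G := by
  obtain ⟨y, hy, h⟩ := hS.exists_solution hF (isMomenta_mo c)
  exact ⟨_, y, _, hy, (hF.isMomenta hy (isMomenta_mo c)).mem, rfl, h, rfl⟩

theorem Elim.unique (h : Q.Elim c F S G) (h' : Q.Elim c F S G') (hF : Q.IsSmall F)
    (hS : Q.NearId c S) : G = G' := by
  obtain ⟨y, q, h⟩ := h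
  obtain ⟨y', q', h'⟩ := h'
  obtain rfl := hS.solution_unique hF (isMomenta_mo c) h.base h'.base h.fixed h'.fixed
  obtain rfl := h.momenta.symm.trans h'.momenta
  rw [h.eq, h'.eq]

theorem IsElim.even (h : Q.IsElim c F S y q G) (hF : Q.IsSmall F) (hS : Q.NearId c S) :
    G ∈ homog R 0 := by
  rw [h.eq]
  refine Submodule.sub_mem _ (Submodule.add_mem _ ?_ ?_) (Submodule.sum_mem _ fun a _ => ?_)
  · exact (h.base.isPoint (isMomenta_mo c)).sub_mem hF.even
  · exact ((isBase_po c).isPoint (h.isMomenta hF)).sub_mem hS.even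
  · exact mul_self_mem_homog (h.base.mem a) (h.mem a)

/-- Separation of the contributions of the identity and of the remainder of `S`. -/
theorem IsElim.eq' (h : Q.IsElim c F S y q G) (hF : Q.IsSmall F) :
    G = Q.sub c (Sum.elim y (Q.mo c)) F
      + (Q.sub c (Sum.elim (Q.po c) q) (S - Q.gen c) - ∑ a, (y a - Q.po c a) * q a) := by
  have hw := (isBase_po c).isPoint (h.isMomenta hF)
  rw [hw.sub_sub, hw.sub_gen, h.eq]
  simp only [sub_mul, Finset.sum_sub_distrib]
  abel

theorem IsElim.sub_mem (h : Q.IsElim c F S y q G) (hF : Q.IsSmall F) (hS : Q.NearId c S) :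
    G - F ∈ Q.N 1 := by
  have h1 := sub_sub_mem_N' (h.base.isPoint (isMomenta_mo c))
    ((isBase_po c).isPoint (isMomenta_mo c)) (i := 1) (by
      rintro (b | b)
      · exact h.base.near b
      · simp) F
  rw [sub_po_mo] at h1
  rw [h.eq' hF, add_sub_right_comm]
  exact Submodule.add_mem _ h1 (Submodule.sub_mem _
    (((isBase_po c).isPoint (h.isMomenta hF)).sub_N hS.near)
    (Submodule.sum_mem _ fun a _ => Q.mul_mem_N_right (h.base.near a) _))

theorem Elim.isSmall (h : Q.Elim c F S G) (hF : Q.IsSmall F) (hS : Q.NearId c S) :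
    Q.IsSmall G := by
  obtain ⟨y, q, h⟩ := h
  refine ⟨h.even hF hS, ?_⟩
  have := Submodule.add_mem _ (Q.N_le_fil (h.sub_mem hF hS)) hF.fil
  rwa [sub_add_cancel] at this

theorem Elim.sub_mem (h : Q.Elim c F S G) (hF : Q.IsSmall F) (hS : Q.NearId c S) :
    G - F ∈ Q.N 1 := by
  obtain ⟨y, q, h⟩ := h
  exact h.sub_mem hF hS

/-- The chart in which F is near the identity may differ from the chart of the elimination, as it
does in the transformation law of generating functions. -/
theorem Elim.nearId (h : Q.Elim c F S G) (hF : Q.NearId c' F) (hS : Q.NearId c S) :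
    Q.NearId c' G := by
  refine ⟨(h.isSmall hF.isSmall hS).even, ?_⟩
  have := Submodule.add_mem _ (h.sub_mem hF.isSmall hS) hF.near
  rwa [sub_add_sub_cancel] at this

/-- The derivatives of the result of an elimination. -/
theorem IsElim.envelope (h : Q.IsElim c F S y q G) (hF : Q.IsSmall F) {i : ZMod 2}
    {D : R →ₗ[ℝ] R} (hD : Q.IsDerivation i D) : D G =
      ∑ a, D (Q.mo c a) * Q.sub c (Sum.elim y (Q.mo c)) (Q.D c (.inr a) F)
        + ∑ a, D (Q.po c a) * Q.sub c (Sum.elim (Q.po c) q) (Q.D c (.inl a) S) := by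
  have e1 := hD.chain_rule_sub (h.base.isPoint (isMomenta_mo c)) F
  have e2 := hD.chain_rule_sub ((isBase_po c).isPoint (h.isMomenta hF)) S
  rw [Fintype.sum_sum_type] at e1 e2
  -- By the defining equations, the variation of yq cancels the variation of F through y and that of
  -- S through q: the result is a critical value.
  have e3 : ∀ a, D (y a * q a) = D (y a) * Q.sub c (Sum.elim y (Q.mo c)) (Q.D c (.inl a) F)
      + D (q a) * Q.sub c (Sum.elim (Q.po c) q) (Q.D c (.inr a) S) := fun a => by
    rw [hD.der.leibniz]
    congr 1
    · congr 1
      exact (congrFun h.momenta a).symm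
    · have hy : Q.sub c (Sum.elim (Q.po c) q) (Q.D c (.inr a) S) = sgn (Q.ix a) • y a := by
        conv_rhs => rw [← h.positions]
        rw [eliminationPositions, sgn_smul_sgn_smul]
      rw [hy, parPow_of_mem (h.base.mem a), smul_mul_assoc, mul_smul_comm,
        Q.comm _ _ _ (h.base.mem a) _ (hD.der.mem (h.mem a)), smul_smul, ← sgn_add]
      congr 2
      rcases zmod_two i with rfl | rfl <;> rcases zmod_two (Q.ix a) with h | h <;> rw [h] <;> decide
  rw [h.eq, map_sub, map_add, e1, e2, map_sum, Finset.sum_congr rfl fun a _ => e3 a,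
    Finset.sum_add_distrib]
  simp only [Sum.elim_inl, Sum.elim_inr]
  abel

theorem IsElim.D_inr (h : Q.IsElim c F S y q G) (hF : Q.IsSmall F) (c' : κ) (a : ι) :
    Q.D c' (.inr a) G = Q.sub c (Sum.elim y (Q.mo c)) (Q.D c' (.inr a) F) := by
  rw [Q.D_inr c' c, h.envelope hF (isDerivation_D c (.inr a)), Finset.sum_eq_single a]
  · rw [mo, Q.D_crd, if_pos rfl, one_mul, add_eq_left]
    refine Finset.sum_eq_zero fun b _ => ?_
    rw [po, D_inr_crd_inl, zero_mul]
  · intro b _ hb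
    rw [mo, Q.D_crd, if_neg fun h => hb (Sum.inr.inj h).symm, zero_mul]
  · simp

/-- The chart c of the derivative is independent of the chart c' of the elimination: the Jacobian
between them consists of functions on the base, which substitution of momenta leaves unchanged. -/
theorem IsElim.D_inl (h : Q.IsElim c' F S y q G) (hF : Q.IsSmall F) (c : κ) (a : ι) :
    Q.D c (.inl a) G = Q.sub c' (Sum.elim (Q.po c') q) (Q.D c (.inl a) S) := by
  have hw := (isBase_po c').isPoint (h.isMomenta hF)
  rw [h.envelope hF (isDerivation_D c (.inl a)), D_inl_eq_sum c c' a S, hw.sub_sum,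
    Finset.sum_eq_zero, zero_add]
  · refine Finset.sum_congr rfl fun b _ => ?_
    rw [hw.sub_mul]
    congr 1
    exact (sub_of_zs_eq (w := Sum.elim (Q.po c') q) (zs_D_inl_po c c' a b) fun _ => rfl).symm
  · intro b _
    rw [mo, Q.crd_inr c' c, Q.D_crd, if_neg (by simp), zero_mul]

theorem IsBase.map {ψ : R →ₐ[ℝ] R} (hψ : Q.IsSubstitution ψ) (hy : Q.IsBase c y) :
    Q.IsBase c fun a => ψ (y a) where
  mem a := hψ.mem (hy.mem a)
  near a := ((hy.isPoint (isMomenta_mo c)).map hψ).inl a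

theorem IsMomenta.map {ψ : R →ₐ[ℝ] R} (hψ : Q.IsSubstitution ψ) (hq : Q.IsMomenta q) :
    Q.IsMomenta fun a => ψ (q a) where
  mem a := hψ.mem (hq.mem a)
  fil a := hψ.fil _ _ (hq.fil a)

theorem IsSubstitution.sub_elim {ψ : R →ₐ[ℝ] R} (hψ : Q.IsSubstitution ψ) (hy : Q.IsBase c y)
    (hq : Q.IsMomenta q) (F : R) : ψ (Q.sub c (Sum.elim y q) F)
      = Q.sub c (Sum.elim (fun a => ψ (y a)) fun a => ψ (q a)) F := by
  rw [hψ.sub (hy.isPoint hq)]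
  congr 1
  funext α
  rcases α with a | a <;> rfl

/-- Substitutions of momenta do not depend on the coordinates on the base. -/
theorem sub_po_eq (c c' : κ) (hq : Q.IsMomenta q) (F : R) :
    Q.sub c (Sum.elim (Q.po c) q) F = Q.sub c' (Sum.elim (Q.po c') q) F := by
  have hs := isSubstitution_subHom ((isBase_po c).isPoint hq)
  refine hs.apply_eq (c := c') (fun α => ?_) F
  rcases α with a | a
  · exact sub_of_zs_eq (Q.zs_crd_inl c' a) fun _ => rfl
  · rw [Q.crd_inr c' c]
    exact sub_crd (.inr a)

/-- Associativity of elimination, for two systems of coordinates. -/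
theorem Elim.assoc {Φ Ψ X Θ Z : R} (hF : Q.IsSmall F) (hΦ : Q.NearId c' Φ) (hΨ : Q.NearId c Ψ)
    (hX : Q.Elim c' F Φ X) (hΘ : Q.Elim c Φ Ψ Θ) (hZ : Q.Elim c X Ψ Z) : Q.Elim c' F Θ Z := by
  have hXs := hX.isSmall hF hΦ
  obtain ⟨Y, P, hX⟩ := hX
  obtain ⟨y₀, q₀, hΘ⟩ := hΘ
  obtain ⟨y, q, hZ⟩ := hZ
  have hP := hX.isMomenta hF
  have hq₀ := hΘ.isMomenta hΦ.isSmall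
  have hq := hZ.isMomenta hXs
  -- σ evaluates at the intermediate point (y, p) of the outer elimination with Ψ. Applied to the
  -- data (Y, P) of the inner one, it gives the candidate solution for Θ.
  have hσ := isSubstitution_subHom (hZ.base.isPoint (isMomenta_mo c))
  set σ := subHom (hZ.base.isPoint (isMomenta_mo c)) with σ_def
  have hσP := hP.map hσ
  have hσmo : ∀ a, σ (Q.mo c' a) = Q.mo c' a := fun a => by
    rw [mo_eq c' c]
    exact sub_mo a
  have hσpo : ∀ a, σ (Q.po c a) = y a := fun a => sub_po a
  have e1 : ∀ G, σ (Q.sub c' (Sum.elim Y (Q.mo c')) G)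
      = Q.sub c' (Sum.elim (fun a => σ (Y a)) (Q.mo c')) G := fun G => by
    rw [hσ.sub_elim hX.base (isMomenta_mo c')]
    simp only [hσmo]
  have e2 : ∀ G, σ (Q.sub c' (Sum.elim (Q.po c') P) G)
      = Q.sub c (Sum.elim y fun a => σ (P a)) G := fun G => by
    rw [sub_po_eq c' c hP, hσ.sub_elim (isBase_po c) hP]
    simp only [hσpo]
  -- The envelope formula for X turns q = ∂X/∂z at y into the momentum equation of Φ at (y, σP).
  have eq : q = Q.eliminationMomenta c Φ (fun a => σ (P a)) y := by
    rw [← hZ.momenta]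
    funext a
    change σ (Q.D c (.inl a) X) = _
    rw [hX.D_inl hF, e2]
    rfl
  -- ρ keeps the positions and puts σP for the free momenta, the point at which Θ has to be
  -- evaluated.
  have hρ := isSubstitution_subHom ((isBase_po c).isPoint hσP)
  set ρ := subHom ((isBase_po c).isPoint hσP) with ρ_def
  have hρmo : ∀ a, ρ (Q.mo c a) = σ (P a) := fun a => sub_mo a
  have hρpo : ∀ a, ρ (Q.po c a) = Q.po c a := fun a => sub_po a
  have e3 : ∀ G, ρ (Q.sub c (Sum.elim y₀ (Q.mo c)) G)
      = Q.sub c (Sum.elim (fun a => ρ (y₀ a)) fun a => σ (P a)) G := fun G => by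
    rw [hρ.sub_elim hΘ.base (isMomenta_mo c)]
    simp only [hρmo]
  have e4 : ∀ G, ρ (Q.sub c (Sum.elim (Q.po c) q₀) G)
      = Q.sub c (Sum.elim (Q.po c) fun a => ρ (q₀ a)) G := fun G => by
    rw [hρ.sub_elim (isBase_po c) hq₀]
    simp only [hρpo]
  have hρq : (fun a => ρ (q₀ a)) = Q.eliminationMomenta c Φ (fun a => σ (P a))
      fun a => ρ (y₀ a) := by
    funext a
    rw [← hΘ.momenta]
    exact e3 _
  -- Both points solve the same intermediate equations between Φ and Ψ with end momenta σP, so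
  -- uniqueness identifies them.
  have hρy : (fun a => ρ (y₀ a)) = y := by
    refine hΨ.solution_unique hΦ.isSmall hσP (hΘ.base.map hρ) hZ.base ?_ ?_
    · rw [← hρq]
      funext a
      conv_rhs => rw [← hΘ.positions]
      rw [eliminationPositions, eliminationPositions, map_smul, e4]
    · rw [← eq, hZ.positions]
  refine ⟨fun a => σ (Y a), fun a => σ (P a), hX.base.map hσ, hσP.mem, ?_, ?_, ?_⟩
  · funext a
    conv_rhs => rw [← hX.momenta]
    rw [eliminationMomenta, eliminationMomenta, e1]
  · funext a
    conv_rhs => rw [← hX.positions]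
    rw [eliminationPositions, eliminationPositions, map_smul, e2, sub_po_eq c' c hσP,
      hΘ.D_inr hΦ.isSmall]
    congr 1
    refine (e3 _).trans ?_
    rw [hρy]
  -- After evaluation at the common points both results are F + Φ + Ψ minus the two pairings of
  -- intermediate variables.
  · have f1 : σ X = Q.sub c' (Sum.elim (fun a => σ (Y a)) (Q.mo c')) F
        + Q.sub c (Sum.elim y fun a => σ (P a)) Φ - ∑ a, σ (Y a) * σ (P a) := by
      rw [hX.eq, map_sub, map_add, e1, e2, map_sum]
      simp only [map_mul]
    have f2 : Q.sub c' (Sum.elim (Q.po c') fun a => σ (P a)) Θ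
        = Q.sub c (Sum.elim y fun a => σ (P a)) Φ + Q.sub c (Sum.elim (Q.po c) q) Ψ
          - ∑ a, y a * q a := by
      rw [sub_po_eq c' c hσP]
      change ρ Θ = _
      rw [hΘ.eq, map_sub, map_add, e3, e4, map_sum, hρq, hρy, ← eq]
      congr 1
      refine Finset.sum_congr rfl fun a _ => ?_
      rw [map_mul, ← congrFun hρy a]
      congr 1
      rw [eq, ← hρy]
      exact congrFun hρq a
    have f3 : Q.sub c (Sum.elim y (Q.mo c)) X = σ X := rfl
    rw [hZ.eq, f3, f1, f2]
    abel

theorem elim_gen_right (hF : Q.IsSmall F) : Q.Elim c F (Q.gen c) F := by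
  have hm := hF.isMomenta (isBase_po c) (isMomenta_mo c)
  refine ⟨Q.po c, Q.eliminationMomenta c F (Q.mo c) (Q.po c), isBase_po c, hm.mem, rfl, ?_, ?_⟩
  · funext a
    rw [eliminationPositions, D_inr_gen, ((isBase_po c).isPoint hm).sub_smul, sgn_smul_sgn_smul,
      sub_po]
  · rw [sub_po_mo, ((isBase_po c).isPoint hm).sub_gen, add_sub_cancel_right]

theorem elim_gen_left (hS : Q.NearId c S) : Q.Elim c (Q.gen c) S S := by
  obtain ⟨G, hG⟩ := exists_elim (isSmall_gen c) hS
  obtain ⟨y, q, h⟩ := hG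
  have hq : q = Q.mo c := by
    rw [← h.momenta]
    funext a
    rw [eliminationMomenta, D_inl_gen_self, sub_mo]
  have : G = S := by
    rw [h.eq, (h.base.isPoint (isMomenta_mo c)).sub_gen, hq, sub_po_mo, add_sub_cancel_left]
  exact ⟨y, q, this ▸ h⟩

/-- The map `F ↦ elim (F, S) - F` is contracting. -/
theorem Elim.contraction (h : Q.Elim c F S G) (h' : Q.Elim c F' S G') (hF : Q.IsSmall F)
    (hF' : Q.IsSmall F') (hS : Q.NearId c S) {i : ℕ} (hFF : F - F' ∈ Q.N i) :
    G - F - (G' - F') ∈ Q.N (i + 1) := by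
  obtain ⟨y, q, h⟩ := h
  obtain ⟨y', q', h'⟩ := h'
  have hq := h.isMomenta hF
  have hq' := h'.isMomenta hF'
  have hy : ∀ a, y a - y' a ∈ Q.N (i + 1) :=
    hS.solution_sub_mem hF hF' (isMomenta_mo c) h.base h'.base h.fixed h'.fixed hFF
  have hqq : ∀ a, q a - q' a ∈ Q.N i := fun a => by
    rw [← h.momenta, ← h'.momenta]
    exact momenta_sub_mem h.base h'.base (isMomenta_mo c)
      (fun b => Q.N_anti (Nat.le_succ i) (hy b)) hFF a
  have w := h.base.isPoint (isMomenta_mo c)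
  have w' := h'.base.isPoint (isMomenta_mo c)
  -- Every summand combines a nilpotent factor (y - z or S - xp) with a difference of order i, or
  -- contains y - y', which already has order i + 1.
  have e : G - F - (G' - F') =
      (Q.sub c (Sum.elim y (Q.mo c)) (F - F')
        - Q.sub c (Sum.elim (Q.po c) (Q.mo c)) (F - F'))
      + (Q.sub c (Sum.elim y (Q.mo c)) F' - Q.sub c (Sum.elim y' (Q.mo c)) F')
      + (Q.sub c (Sum.elim (Q.po c) q) (S - Q.gen c)
        - Q.sub c (Sum.elim (Q.po c) q') (S - Q.gen c))
      - ∑ a, ((y a - y' a) * q a + (y' a - Q.po c a) * (q a - q' a)) := by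
    rw [h.eq' hF, h'.eq' hF', sub_po_mo, w.sub_sub]
    have : ∀ a, (y a - y' a) * q a + (y' a - Q.po c a) * (q a - q' a)
        = (y a - Q.po c a) * q a - (y' a - Q.po c a) * q' a := fun a => by noncomm_ring
    rw [Finset.sum_congr rfl fun a _ => this a, Finset.sum_sub_distrib]
    abel
  rw [e]
  refine Submodule.sub_mem _ (Submodule.add_mem _ (Submodule.add_mem _ ?_ ?_) ?_)
    (Submodule.sum_mem _ fun a _ => Submodule.add_mem _ (Q.mul_mem_N_right (hy a) _) ?_)
  · rw [add_comm]
    refine sub_sub_mem_N w ((isBase_po c).isPoint (isMomenta_mo c)) ?_ hFF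
    rintro (b | b)
    · exact h.base.near b
    · simp
  · refine sub_sub_mem_N' w w' ?_ F'
    rintro (b | b)
    · exact hy b
    · simp
  · refine sub_sub_mem_N ((isBase_po c).isPoint hq) ((isBase_po c).isPoint hq') ?_ hS.near
    rintro (b | b)
    · simp
    · exact hqq b
  · rw [add_comm]
    exact Q.N_mul (h'.base.near a) (hqq a)

/-- Cancellation on the right. -/
theorem Elim.cancel (h : Q.Elim c F S G) (h' : Q.Elim c F' S G) (hF : Q.NearId c' F)
    (hF' : Q.NearId c' F') (hS : Q.NearId c S) : F = F' := by
  rw [← sub_eq_zero]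
  refine eq_zero_of_forall_mem_N (Q := Q) ?_ fun i _ hi => ?_
  · have := Submodule.sub_mem _ hF.near hF'.near
    rwa [sub_sub_sub_cancel_right] at this
  · have := h'.contraction h hF'.isSmall hF.isSmall hS (i := i)
      (by rw [← neg_sub]; exact Submodule.neg_mem _ hi)
    rwa [sub_sub_sub_cancel_left] at this

/-- Iterate X ↦ X + zp - elim(X, S) from zp. By the contraction property, consecutive iterates
differ by increasing nilpotent order, so a fixed point is reached, and fixed points are exactly the
X with elim(X, S) = zp. -/
theorem exists_left_inverse (hS : Q.NearId c S) :
    ∃ X, Q.NearId c X ∧ Q.Elim c X S (Q.gen c) := by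
  classical
  -- The default value is never used: elimination exists at every X near the identity.
  let e : R → R := fun X => if h : ∃ G, Q.Elim c X S G then h.choose else 0
  have he : ∀ X, Q.NearId c X → Q.Elim c X S (e X) := fun X hX => by
    have h := exists_elim hX.isSmall hS
    simp only [e, dif_pos h]
    exact h.choose_spec
  let f : R → R := fun X => X + Q.gen c - e X
  have hf : ∀ k, Q.NearId c (f^[k] (Q.gen c)) := by
    intro k
    induction k with
    | zero => exact nearId_gen c
    | succ k ih =>
      rw [Function.iterate_succ_apply']
      have hG := he _ ih
      refine ⟨Submodule.sub_mem _ (Submodule.add_mem _ ih.even (gen_even c))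
        (hG.nearId ih hS).even, ?_⟩
      have := Submodule.neg_mem _ (hG.sub_mem ih.isSmall hS)
      rw [neg_sub] at this
      have e2 : f (f^[k] (Q.gen c)) - Q.gen c = f^[k] (Q.gen c) - e (f^[k] (Q.gen c)) := by
        simp only [f]
        abel
      rwa [e2]
  have hd : ∀ k, f^[k + 1] (Q.gen c) - f^[k] (Q.gen c) ∈ Q.N (k + 1) := by
    intro k
    induction k with
    | zero => exact (hf 1).near
    | succ k ih =>
      have h := (he _ (hf k)).contraction (he _ (hf (k + 1))) (hf k).isSmall (hf (k + 1)).isSmall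
        hS (i := k + 1) (by rw [← neg_sub]; exact Submodule.neg_mem _ ih)
      have e2 : f^[k + 1 + 1] (Q.gen c) - f^[k + 1] (Q.gen c)
          = e (f^[k] (Q.gen c)) - f^[k] (Q.gen c)
            - (e (f^[k + 1] (Q.gen c)) - f^[k + 1] (Q.gen c)) := by
        rw [Function.iterate_succ_apply' f (k + 1)]
        nth_rewrite 2 [Function.iterate_succ_apply' f k]
        simp only [f]
        abel
      rwa [e2]
  obtain ⟨K, hK⟩ := Q.N_eq_bot
  refine ⟨f^[K] (Q.gen c), hf K, ?_⟩
  have h0 := Q.N_anti (Nat.le_succ K) (hd K)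
  rw [hK, Submodule.mem_bot, sub_eq_zero, Function.iterate_succ_apply'] at h0
  have h1 : e (f^[K] (Q.gen c)) = Q.gen c := by
    have h2 : f^[K] (Q.gen c) + Q.gen c - e (f^[K] (Q.gen c)) = f^[K] (Q.gen c) := h0
    rw [add_sub_assoc, add_eq_left, sub_eq_zero] at h2
    exact h2.symm
  have h3 := he _ (hf K)
  rwa [h1] at h3

end PhaseSpace

namespace PhaseSpace

variable {R : Type*} [Ring R] [Algebra ℝ R] [Superalgebra R] {ι κ : Type*} [Fintype ι]
  [DecidableEq ι] {Q : PhaseSpace R ι κ} {c c' : κ} {w : ι ⊕ ι → R} {y q q' : ι → R}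
  {F G H K L S X : R} {s t : R} {i j : ZMod 2}

/-! #### Functions with convergent Taylor series -/

variable (Q) in
/-- The Taylor series of `F` at `w` converges. -/
def Tame (c : κ) (w : ι ⊕ ι → R) (F : R) : Prop :=
  Q.Null fun k => Q.tay c (displacement (Q.crd c) w) k F

theorem Tame.sumsTo (h : Q.Tame c w F) :
    Q.SumsTo (fun k => Q.tay c (displacement (Q.crd c) w) k F) (Q.sub c w F) := sumsTo_sub h

theorem Tame.add (hF : Q.Tame c w F) (hG : Q.Tame c w G) : Q.Tame c w (F + G) := by
  intro k
  obtain ⟨K, hK⟩ := hF k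
  obtain ⟨K', hK'⟩ := hG k
  refine ⟨max K K', fun j hj => ?_⟩
  simp only [map_add]
  exact Submodule.add_mem _ (hK j (le_trans (le_max_left _ _) hj))
    (hK' j (le_trans (le_max_right _ _) hj))

theorem Tame.mul (hw : ∀ α, w α ∈ homog R (Q.px α)) (hF : Q.Tame c w F) (hG : Q.Tame c w G) :
    Q.Tame c w (F * G) := by
  intro k
  obtain ⟨K, hK⟩ := hF k
  obtain ⟨K', hK'⟩ := hG k
  refine ⟨K + K', fun j hj => ?_⟩
  simp only [tay_mul (displacement_mem hw)]
  refine Submodule.sum_mem _ fun p hp => ?_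
  have := Finset.HasAntidiagonal.mem_antidiagonal.mp hp
  rcases le_or_gt K p.1 with h | h
  · exact Q.mul_mem_fil_right (hK _ h) _
  · exact Q.mul_mem_fil_left _ (hK' _ (by omega))

theorem Tame.sub_add (hF : Q.Tame c w F) (hG : Q.Tame c w G) :
    Q.sub c w (F + G) = Q.sub c w F + Q.sub c w G :=
  (hF.add hG).sumsTo.unique ((hF.sumsTo.add hG.sumsTo).congr fun _ => (map_add _ _ _).symm)

theorem Tame.sub_mul (hw : ∀ α, w α ∈ homog R (Q.px α)) (hF : Q.Tame c w F)
    (hG : Q.Tame c w G) : Q.sub c w (F * G) = Q.sub c w F * Q.sub c w G :=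
  (hF.mul hw hG).sumsTo.unique ((hF.sumsTo.mul hG.sumsTo hF hG).congr fun j =>
    (tay_mul (displacement_mem hw) j F G).symm)

theorem tame_of_eq_zero {m : ℕ}
    (h : ∀ j ≥ m, Q.tay c (displacement (Q.crd c) w) j F = 0) : Q.Tame c w F := fun k =>
  ⟨m, fun j hj => by
    simp only [h j hj]
    exact Submodule.zero_mem _⟩

theorem tame_scalar (hs : s ∈ Q.scalars) : Q.Tame c w s :=
  tame_of_eq_zero (m := 1) fun _ hj => tay_scalar_of_pos (by omega) hs

theorem tame_crd (α : ι ⊕ ι) : Q.Tame c w (Q.crd c α) :=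
  tame_of_eq_zero (m := 2) fun _ hj => tay_crd_of_two_le hj α

theorem tame_algebraMap (r : ℝ) : Q.Tame c w (algebraMap ℝ R r) :=
  tame_of_eq_zero (m := 1) fun _ hj => by
    rw [Algebra.algebraMap_eq_smul_one, map_smul, tay_one_of_pos (by omega), smul_zero]

theorem sub_algebraMap (r : ℝ) : Q.sub c w (algebraMap ℝ R r) = algebraMap ℝ R r := by
  rw [sub_eq_of_tay_eq_zero (m := 1) fun _ hj => ?_]
  · simp [tay_zero]
  · rw [Algebra.algebraMap_eq_smul_one, map_smul, tay_one_of_pos (by omega), smul_zero]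

theorem Tame.smul (hF : Q.Tame c w F) (r : ℝ) : Q.Tame c w (r • F) := fun k => by
  obtain ⟨K, hK⟩ := hF k
  refine ⟨K, fun j hj => ?_⟩
  simp only [map_smul]
  exact Submodule.smul_mem _ _ (hK j hj)

theorem Tame.sub_smul (hF : Q.Tame c w F) (r : ℝ) : Q.sub c w (r • F) = r • Q.sub c w F :=
  (hF.smul r).sumsTo.unique ((hF.sumsTo.smul r).congr fun _ => (map_smul _ _ _).symm)

theorem Tame.sub_mem (hw : ∀ α, w α ∈ homog R (Q.px α)) (h : Q.Tame c w F)
    (hF : F ∈ homog R i) : Q.sub c w F ∈ homog R i := by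
  have h1 := h.sumsTo.map (Superalgebra.par (R := R)).toLinearMap (Q' := Q) (d := 0)
    fun k G hG => Q.fil_par k G hG
  refine h1.unique ((h.sumsTo.smul (sgn i)).congr fun k => ?_)
  rw [AlgHom.toLinearMap_apply, ← tay_par (displacement_mem hw), mem_homog.mp hF, map_smul]

theorem tame_of_zs_eq (hF : Q.zs F = F) (q : ι → R) : Q.Tame c (Sum.elim (Q.po c) q) F := by
  refine tame_of_eq_zero (m := 1) fun j hj => ?_
  obtain ⟨j, rfl⟩ := Nat.exists_eq_add_of_le' hj
  rw [tay_of_zs_eq_succ hF]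
  simp [displacement, po]

theorem sub_po_of_zs_eq (hF : Q.zs F = F) (q : ι → R) :
    Q.sub c (Sum.elim (Q.po c) q) F = F := sub_of_zs_eq hF fun _ => rfl

theorem elim_po_mem (hq : ∀ a, q a ∈ homog R (Q.ix a)) (α : ι ⊕ ι) :
    Sum.elim (Q.po c) q α ∈ homog R (Q.px α) := by
  rcases α with a | a
  · exact Q.crd_mem c (.inl a)
  · exact hq a

variable (Q) in
/-- Polynomials in the momenta. -/
def poly : Subalgebra ℝ R := Algebra.adjoin ℝ ({F | Q.zs F = F} ∪ {F | ∃ c a, Q.mo c a = F})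

theorem mem_poly_of_zs_eq (hF : Q.zs F = F) : F ∈ Q.poly :=
  Algebra.subset_adjoin (Or.inl hF)

theorem mo_mem_poly (c : κ) (a : ι) : Q.mo c a ∈ Q.poly :=
  Algebra.subset_adjoin (Or.inr ⟨c, a, rfl⟩)

@[elab_as_elim]
theorem poly_induction {p : (F : R) → F ∈ Q.poly → Prop}
    (base : ∀ F (h : Q.zs F = F), p F (mem_poly_of_zs_eq h))
    (mo : ∀ c a, p (Q.mo c a) (mo_mem_poly c a))
    (add : ∀ F G hF hG, p F hF → p G hG → p (F + G) (Subalgebra.add_mem _ hF hG))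
    (mul : ∀ F G hF hG, p F hF → p G hG → p (F * G) (Subalgebra.mul_mem _ hF hG))
    {F : R} (hF : F ∈ Q.poly) : p F hF := by
  induction hF using Algebra.adjoin_induction with
  | mem F h =>
    rcases h with h | ⟨c, a, rfl⟩
    · exact base F h
    · exact mo c a
  | algebraMap r => exact base _ (AlgHom.commutes _ r)
  | add F G hF hG h h' => exact add F G hF hG h h'
  | mul F G hF hG h h' => exact mul F G hF hG h h'

theorem parPow_mem_poly (hF : F ∈ Q.poly) (i : ZMod 2) : parPow i F ∈ Q.poly := by
  induction hF using poly_induction with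
  | base F h => exact mem_poly_of_zs_eq (by rw [parPow_zs, h])
  | mo c a =>
    rw [mo, parPow_of_mem (Q.crd_mem c (.inr a))]
    exact Subalgebra.smul_mem _ (mo_mem_poly c a) _
  | add F G _ _ h h' =>
    rw [map_add]
    exact Subalgebra.add_mem _ h h'
  | mul F G _ _ h h' =>
    rw [map_mul]
    exact Subalgebra.mul_mem _ h h'

theorem D_inr_mem_poly (hF : F ∈ Q.poly) (c : κ) (a : ι) : Q.D c (.inr a) F ∈ Q.poly := by
  induction hF using poly_induction with
  | base F h =>
    rw [← h, Q.D_inr_zs]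
    exact Subalgebra.zero_mem _
  | mo c' b =>
    rw [mo, Q.crd_inr c' c, Q.D_crd]
    split_ifs
    · exact Subalgebra.one_mem _
    · exact Subalgebra.zero_mem _
  | add F G _ _ h h' =>
    rw [map_add]
    exact Subalgebra.add_mem _ h h'
  | mul F G hF hG h h' =>
    rw [(Q.isSuperDer c (.inr a)).leibniz]
    exact Subalgebra.add_mem _ (Subalgebra.mul_mem _ h hG)
      (Subalgebra.mul_mem _ (parPow_mem_poly hF _) h')

theorem tame_of_mem_poly (hq : ∀ a, q a ∈ homog R (Q.ix a)) (hF : F ∈ Q.poly) :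
    Q.Tame c (Sum.elim (Q.po c) q) F := by
  induction hF using poly_induction with
  | base F h => exact tame_of_zs_eq h q
  | mo c' a =>
    rw [mo_eq c' c]
    exact tame_crd (.inr a)
  | add F G _ _ h h' => exact h.add h'
  | mul F G _ _ h h' => exact h.mul (elim_po_mem hq) h'

theorem tame_of (hq : ∀ a, q a ∈ homog R (Q.ix a)) (h : (∀ a, q a ∈ Q.fil 1) ∨ F ∈ Q.poly) :
    Q.Tame c (Sum.elim (Q.po c) q) F := by
  rcases h with h | h
  · exact ((isBase_po c).isPoint ⟨hq, h⟩).null F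
  · exact tame_of_mem_poly hq h

/-! #### Functions on the base -/

/-- A function is constant along the fibres if its derivatives along the fibres vanish. -/
theorem zs_eq_of_D_inr (h : ∀ a, Q.D c (.inr a) F = 0) : Q.zs F = F := by
  -- Expand F at the point with its own coordinates: the displacement is zero in the positions and p
  -- in the momenta, so only the restriction to the zero section survives.
  have e := sub_eq_of_tay_eq_zero (Q := Q) (c := c) (w := Q.crd c) (F := F) (m := 1) fun j hj => by
    obtain ⟨j, rfl⟩ := Nat.exists_eq_add_of_le' hj
    rw [tay_succ', Fintype.sum_sum_type]
    simp [displacement, h]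
  rw [sub_crd_self] at e
  simpa [tay_zero] using e.symm

/-- By the envelope formula the fibre derivatives of G are those of F at another point, hence zero.
So the pullback of a function is again a function. -/
theorem Elim.zs_eq (h : Q.Elim c F S G) (hF : Q.IsSmall F) (hFz : Q.zs F = F) : Q.zs G = G := by
  obtain ⟨y, q, h⟩ := h
  refine zs_eq_of_D_inr (c := c) fun a => ?_
  rw [h.D_inr hF, ← hFz, Q.D_inr_zs]
  exact map_zero (subHom (h.base.isPoint (isMomenta_mo c)))

theorem zs_sub_eq (h : Q.Tame c (Sum.elim (Q.po c) q) F) (hq : ∀ a, Q.zs (q a) = q a) :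
    Q.zs (Q.sub c (Sum.elim (Q.po c) q) F) = Q.sub c (Sum.elim (Q.po c) q) F := by
  refine (h.sumsTo.map Q.zs.toLinearMap (Q' := Q) (d := 0)
    fun _ _ hG => Q.zs_mem_fil hG).unique (h.sumsTo.congr fun k => ?_)
  symm
  change Q.zs _ = _
  clear h
  induction k generalizing F with
  | zero => rw [tay_zero, Q.zs_zs]
  | succ k ih =>
    rw [tay_succ', map_smul, map_sum]
    congr 1
    refine Finset.sum_congr rfl fun α _ => ?_
    rw [map_mul, ih]
    congr 1
    rcases α with a | a
    · simp [displacement, po]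
    · exact hq a

/-- Substitution of the differential of a function into a polynomial in the momenta does not
depend on the coordinates. -/
theorem sub_differential (hF : F ∈ homog R 0) (hH : H ∈ Q.poly) :
    Q.sub c' (Sum.elim (Q.po c') fun a => Q.D c' (.inl a) F)
        (Q.sub c (Sum.elim (Q.po c) fun a => Q.D c (.inl a) (Q.gen c')) H)
      = Q.sub c (Sum.elim (Q.po c) fun a => Q.D c (.inl a) F) H := by
  have hm : ∀ c a, Q.D c (.inl a) F ∈ homog R (Q.ix a) := fun c a => by
    have := (Q.isSuperDer c (.inl a)).mem hF
    rwa [add_zero] at this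
  have hg : Q.IsMomenta fun a => Q.D c (.inl a) (Q.gen c') := by
    refine ⟨fun a => ?_, fun a => Q.D_inl_mem_fil (gen_mem_fil c')⟩
    have := (Q.isSuperDer c (.inl a)).mem (gen_even c' : Q.gen c' ∈ homog R 0)
    rwa [add_zero] at this
  have hw := (isBase_po c).isPoint hg
  -- The induction must also carry that the transformed function stays polynomial: otherwise its
  -- Taylor series at the differential of F might diverge.
  suffices h : Q.sub c (Sum.elim (Q.po c) fun a => Q.D c (.inl a) (Q.gen c')) H ∈ Q.poly ∧
      Q.sub c' (Sum.elim (Q.po c') fun a => Q.D c' (.inl a) F)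
        (Q.sub c (Sum.elim (Q.po c) fun a => Q.D c (.inl a) (Q.gen c')) H)
      = Q.sub c (Sum.elim (Q.po c) fun a => Q.D c (.inl a) F) H from h.2
  induction hH using poly_induction with
  | base F h =>
    rw [sub_po_of_zs_eq h, sub_po_of_zs_eq h, sub_po_of_zs_eq h]
    exact ⟨mem_poly_of_zs_eq h, rfl⟩
  | mo d a =>
    rw [mo_eq d c, sub_mo, sub_mo, D_inl_gen]
    have hp : ∀ b, Q.D c (.inl a) (Q.po c' b) ∈ Q.poly := fun b =>
      mem_poly_of_zs_eq (zs_D_inl_po c c' a b)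
    refine ⟨Subalgebra.sum_mem _ fun b _ => Subalgebra.mul_mem _ (hp b) (mo_mem_poly c' b), ?_⟩
    -- The differential of F need not be small, so this substitution is not known to be a
    -- homomorphism of the whole algebra; sums are split term by term, each term being tame.
    have key : ∀ s : Finset ι, Q.sub c' (Sum.elim (Q.po c') fun a => Q.D c' (.inl a) F)
        (∑ b ∈ s, Q.D c (.inl a) (Q.po c' b) * Q.mo c' b)
        = ∑ b ∈ s, Q.D c (.inl a) (Q.po c' b) * Q.D c' (.inl b) F := by
      intro s
      induction s using Finset.induction_on with
      | empty =>
        have := sub_algebraMap (Q := Q) (c := c')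
          (w := Sum.elim (Q.po c') fun a => Q.D c' (.inl a) F) 0
        rwa [map_zero] at this
      | insert b s hb ih =>
        rw [Finset.sum_insert hb, Finset.sum_insert hb, Tame.sub_add, ih,
          Tame.sub_mul (elim_po_mem (hm c')) (tame_of_mem_poly (hm c') (hp b))
            (tame_of_mem_poly (hm c') (mo_mem_poly c' b)), sub_mo,
          sub_po_of_zs_eq (zs_D_inl_po c c' a b)]
        · exact tame_of_mem_poly (hm c') (Subalgebra.mul_mem _ (hp b) (mo_mem_poly c' b))
        · exact tame_of_mem_poly (hm c') (Subalgebra.sum_mem _ fun b _ =>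
            Subalgebra.mul_mem _ (hp b) (mo_mem_poly c' b))
    rw [key]
    exact (D_inl_eq_sum c c' a F).symm
  | add F G hF hG h h' =>
    rw [hw.sub_add]
    refine ⟨Subalgebra.add_mem _ h.1 h'.1, ?_⟩
    rw [Tame.sub_add (tame_of_mem_poly (hm c') h.1) (tame_of_mem_poly (hm c') h'.1), h.2, h'.2,
      Tame.sub_add (tame_of_mem_poly (hm c) hF) (tame_of_mem_poly (hm c) hG)]
  | mul F G hF hG h h' =>
    rw [hw.sub_mul]
    refine ⟨Subalgebra.mul_mem _ h.1 h'.1, ?_⟩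
    rw [Tame.sub_mul (elim_po_mem (hm c')) (tame_of_mem_poly (hm c') h.1)
        (tame_of_mem_poly (hm c') h'.1), h.2, h'.2,
      Tame.sub_mul (elim_po_mem (hm c)) (tame_of_mem_poly (hm c) hF) (tame_of_mem_poly (hm c) hG)]

end PhaseSpace

namespace PhaseSpace

variable {R : Type*} [Ring R] [Algebra ℝ R] [Superalgebra R] {ι κ : Type*} [Fintype ι]
  [DecidableEq ι] {Q : PhaseSpace R ι κ} {c c' : κ} {w : ι ⊕ ι → R} {y q q' : ι → R}
  {F G H K L S X : R} {s t : R} {i j : ZMod 2}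

/-! #### First-order perturbations of the identity -/

theorem D_scalar_mul (hs : s ∈ Q.scalars) (hsi : s ∈ homog R i) (c : κ) (α : ι ⊕ ι) (F : R) :
    Q.D c α (s * F) = sgn (Q.px α * i) • (s * Q.D c α F) := by
  rw [(Q.isSuperDer c α).leibniz, Q.D_scalar c α s hs, zero_mul, zero_add, parPow_of_mem hsi,
    smul_mul_assoc]

theorem mul_mul_self_eq_zero (Q : PhaseSpace R ι κ) (hsi : s ∈ homog R i) (hs : s * s = 0)
    (F G : R) : s * F * (s * G) = 0 := by
  rw [Q.comm.swap hsi, mul_assoc, ← mul_assoc s s, hs, zero_mul, mul_zero]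

theorem tame_po (a : ι) : Q.Tame c w (Q.po c a) := tame_crd (.inl a)

/-- The positions for the generating function `zp + sH`. -/
theorem positions_gen_add (hs : s ∈ Q.scalars) (hsi : s ∈ homog R i)
    (hq : ∀ a, q a ∈ homog R (Q.ix a)) (h : (∀ a, q a ∈ Q.fil 1) ∨ H ∈ Q.poly) (a : ι) :
    Q.eliminationPositions c (Q.gen c + s * H) q a = Q.po c a
      + s * ((sgn (Q.ix a) * sgn (Q.ix a * i)) •
        Q.sub c (Sum.elim (Q.po c) q) (Q.D c (.inr a) H)) := by
  have hw := elim_po_mem (c := c) hq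
  have ht : Q.Tame c (Sum.elim (Q.po c) q) (Q.D c (.inr a) H) :=
    tame_of hq (h.imp_right fun h => D_inr_mem_poly h c a)
  have hts : Q.Tame c (Sum.elim (Q.po c) q) s := tame_scalar hs
  rw [eliminationPositions, map_add, D_inr_gen, D_scalar_mul hs hsi,
    Tame.sub_add ((tame_po a).smul _) ((hts.mul hw ht).smul _),
    Tame.sub_smul (tame_po a), Tame.sub_smul (hts.mul hw ht), hts.sub_mul hw ht,
    sub_scalar hs, smul_add, sgn_smul_sgn_smul, smul_smul, mul_smul_comm, sub_po]
  rfl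

theorem tame_gen (hq : ∀ a, q a ∈ homog R (Q.ix a)) :
    Q.Tame c (Sum.elim (Q.po c) q) (Q.gen c) :=
  tame_of_mem_poly hq (Subalgebra.sum_mem _ fun a _ =>
    Subalgebra.mul_mem _ (mem_poly_of_zs_eq (Q.zs_crd_inl c a)) (mo_mem_poly c a))

theorem sub_gen_of_mem (hq : ∀ a, q a ∈ homog R (Q.ix a)) :
    Q.sub c (Sum.elim (Q.po c) q) (Q.gen c) = ∑ a, Q.po c a * q a := by
  have hw := elim_po_mem (c := c) hq
  have ht : ∀ a, Q.Tame c (Sum.elim (Q.po c) q) (Q.crd c (.inl a) * Q.crd c (.inr a)) :=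
    fun a => (tame_crd (.inl a)).mul hw (tame_crd (.inr a))
  have key : ∀ s : Finset ι, Q.Tame c (Sum.elim (Q.po c) q)
      (∑ a ∈ s, Q.crd c (.inl a) * Q.crd c (.inr a)) ∧ Q.sub c (Sum.elim (Q.po c) q)
      (∑ a ∈ s, Q.crd c (.inl a) * Q.crd c (.inr a)) = ∑ a ∈ s, Q.po c a * q a := by
    intro s
    induction s using Finset.induction_on with
    | empty =>
      have h1 := tame_algebraMap (Q := Q) (c := c) (w := Sum.elim (Q.po c) q) 0
      have h2 := sub_algebraMap (Q := Q) (c := c) (w := Sum.elim (Q.po c) q) 0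
      rw [map_zero] at h1 h2
      exact ⟨h1, h2⟩
    | insert a s ha ih =>
      rw [Finset.sum_insert ha, Finset.sum_insert ha]
      refine ⟨(ht a).add ih.1, ?_⟩
      rw [Tame.sub_add (ht a) ih.1, ih.2, Tame.sub_mul hw (tame_crd _) (tame_crd _), sub_crd,
        sub_crd]
      rfl
  exact (key Finset.univ).2

theorem mem_homog_D_inl (hF : F ∈ homog R 0) (c : κ) (a : ι) :
    Q.D c (.inl a) F ∈ homog R (Q.ix a) := by
  have := (Q.isSuperDer c (.inl a)).mem hF
  rwa [add_zero] at this

/-- Elimination with the generating function `zp + sH`, where `s² = 0`. -/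
theorem elim_gen_add (hF : F ∈ homog R 0) (hs : s ∈ Q.scalars) (hsN : s ∈ Q.N 1)
    (hsi : s ∈ homog R i) (hs2 : s * s = 0) (hH : H ∈ homog R i)
    (h : F ∈ Q.fil 1 ∨ H ∈ Q.poly) : Q.Elim c F (Q.gen c + s * H) G ↔
      G = F + s * Q.sub c (Sum.elim (Q.po c) fun a => Q.D c (.inl a) F) H := by
  have hD := fun a => mem_homog_D_inl (Q := Q) hF c a
  have h0 : (∀ a, Q.D c (.inl a) F ∈ Q.fil 1) ∨ H ∈ Q.poly :=
    h.imp_left fun h a => Q.D_inl_mem_fil h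
  -- The data for a base point `y` with `y - z` divisible by `s`.
  have main : ∀ (y u q : ι → R), Q.IsBase c y → (∀ a, y a = Q.po c a + s * u a) →
      Q.eliminationMomenta c F (Q.mo c) y = q → (∀ a, s * q a = s * Q.D c (.inl a) F) ∧
      (∀ a, q a ∈ homog R (Q.ix a)) ∧ ((∀ a, q a ∈ Q.fil 1) ∨ H ∈ Q.poly) ∧
      Q.sub c (Sum.elim y (Q.mo c)) F + Q.sub c (Sum.elim (Q.po c) q) (Q.gen c + s * H)
        - ∑ a, y a * q a = F + s * Q.sub c (Sum.elim (Q.po c) fun a => Q.D c (.inl a) F) H := by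
    rintro y u q hy hyu rfl
    have hw := hy.isPoint (isMomenta_mo c)
    -- The displacement of y is a multiple of s, so after multiplication by s the point y may be
    -- replaced by z.
    have hsq : ∀ a, s * Q.eliminationMomenta c F (Q.mo c) y a = s * Q.D c (.inl a) F := fun a => by
      conv_rhs => rw [← sub_po_mo (Q := Q) (c := c) (Q.D c (.inl a) F)]
      refine mul_sub_eq hsi ?_ (hw.null _) (((isBase_po c).isPoint (isMomenta_mo c)).null _)
      rintro (b | b)
      · simp only [Sum.elim_inl]
        rw [hyu, mul_add, ← mul_assoc, hs2, zero_mul, add_zero]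
      · rfl
    have hqm : ∀ a, Q.eliminationMomenta c F (Q.mo c) y a ∈ homog R (Q.ix a) := fun a =>
      hw.sub_mem (hD a)
    have hqh : (∀ a, Q.eliminationMomenta c F (Q.mo c) y a ∈ Q.fil 1) ∨ H ∈ Q.poly :=
      h.imp_left fun h a => hw.sub_fil (Q.D_inl_mem_fil h)
    refine ⟨hsq, hqm, hqh, ?_⟩
    have e1 : Q.sub c (Sum.elim y (Q.mo c)) F
        = F + ∑ a, (s * u a) * Q.D c (.inl a) F := by
      rw [sub_eq_add_sum hw, Fintype.sum_sum_type]
      · have : ∑ a, (Sum.elim y (Q.mo c) (.inr a) - Q.crd c (.inr a)) * Q.D c (.inr a) F = 0 :=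
          Finset.sum_eq_zero fun a _ => by simp [mo]
        rw [this, add_zero]
        congr 1
        refine Finset.sum_congr rfl fun a _ => ?_
        rw [Sum.elim_inl, hyu, po, add_sub_cancel_left]
      · have hd : ∀ α, ∃ v, Sum.elim y (Q.mo c) α - Q.crd c α = s * v := by
          rintro (a | a)
          · exact ⟨u a, by rw [Sum.elim_inl, hyu, po, add_sub_cancel_left]⟩
          · exact ⟨0, by simp [mo]⟩
        intro α β
        obtain ⟨v, hv⟩ := hd α
        obtain ⟨v', hv'⟩ := hd β
        rw [hv, hv', mul_mul_self_eq_zero Q hsi hs2]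
    have hpw := elim_po_mem (c := c) hqm
    have htH := tame_of (c := c) hqm hqh
    rw [e1, Tame.sub_add (tame_gen hqm) ((tame_scalar hs).mul hpw htH), sub_gen_of_mem hqm,
      Tame.sub_mul hpw (tame_scalar hs) htH, sub_scalar hs,
      mul_sub_eq hsi (w' := Sum.elim (Q.po c) fun a => Q.D c (.inl a) F) ?_ htH (tame_of hD h0)]
    -- The first-order term su ∂F/∂z of F(y) cancels against the same term of yq, so the value of u
    -- is irrelevant.
    · have e2 : ∀ a, y a * Q.eliminationMomenta c F (Q.mo c) y a
          = Q.po c a * Q.eliminationMomenta c F (Q.mo c) y a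
            + s * u a * Q.D c (.inl a) F := fun a => by
        have : s * u a * Q.eliminationMomenta c F (Q.mo c) y a = s * u a * Q.D c (.inl a) F := by
          rw [Q.comm.swap hsi, mul_assoc, hsq, mul_assoc]
        rw [hyu, add_mul, this]
      rw [Finset.sum_congr rfl fun a _ => e2 a, Finset.sum_add_distrib]
      abel
    · rintro (a | a)
      · rfl
      · exact hsq a
  constructor
  · rintro ⟨y, q, hG⟩
    have hfil : (∀ a, q a ∈ Q.fil 1) ∨ H ∈ Q.poly := h.imp_left fun h a => by
      rw [← hG.momenta]
      exact (hG.base.isPoint (isMomenta_mo c)).sub_fil (Q.D_inl_mem_fil h)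
    rw [hG.eq]
    refine (main y (fun a => (sgn (Q.ix a) * sgn (Q.ix a * i)) •
      Q.sub c (Sum.elim (Q.po c) q) (Q.D c (.inr a) H)) q hG.base (fun a => ?_) hG.momenta).2.2.2
    conv_lhs => rw [← hG.positions]
    exact positions_gen_add hs hsi hG.mem hfil a
  · rintro rfl
    -- Take the positions belonging to q = ∂F/∂z at the undisplaced point. The true q differs from
    -- this, but the positions depend on q only through s times it, where the difference disappears.
    let y := Q.eliminationPositions c (Q.gen c + s * H) fun a => Q.D c (.inl a) F
    have hy : ∀ a, y a = _ := positions_gen_add hs hsi hD h0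
    have hpD := elim_po_mem (Q := Q) (c := c) hD
    have hb : Q.IsBase c y := by
      refine ⟨fun a => ?_, fun a => ?_⟩
      · have e := (Q.isSuperDer c (.inr a)).mem
          (Submodule.add_mem _ (gen_even (Q := Q) c) (mul_self_mem_homog hsi hH))
        rw [add_zero] at e
        refine Submodule.smul_mem _ _ (Tame.sub_mem hpD ?_ e)
        rw [map_add, D_scalar_mul hs hsi, D_inr_gen]
        exact ((tame_crd (.inl a)).smul _).add (((tame_scalar hs).mul hpD
          (tame_of hD (h0.imp_right fun h => D_inr_mem_poly h c a))).smul _)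
      · rw [hy, add_sub_cancel_left]
        exact Q.mul_mem_N_right hsN _
    obtain ⟨h1, h2, h3, h4⟩ := main y _ _ hb hy rfl
    refine ⟨y, _, hb, h2, rfl, ?_, h4.symm⟩
    funext a
    rw [hy, positions_gen_add hs hsi h2 h3]
    simp only [mul_smul_comm]
    congr 2
    refine mul_sub_eq hsi ?_ (tame_of h2 (h3.imp_right fun h => D_inr_mem_poly h c a))
      (tame_of hD (h0.imp_right fun h => D_inr_mem_poly h c a))
    rintro (b | b)
    · rfl
    · exact h1 b

/-- Elimination with `zp + sH`, if `∂F/∂z = p` after multiplication by `s`. -/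
theorem elim_gen_add_of_mul_eq (hF : Q.IsSmall F) (hs : s ∈ Q.scalars) (hsN : s ∈ Q.N 1)
    (hsi : s ∈ homog R i) (hs2 : s * s = 0) (hH : H ∈ homog R i)
    (h : ∀ a, s * Q.D c (.inl a) F = s * Q.mo c a) :
    Q.Elim c F (Q.gen c + s * H) G ↔ G = F + s * H := by
  rw [elim_gen_add hF.even hs hsN hsi hs2 hH (Or.inl hF.fil)]
  rw [mul_sub_eq hsi (w' := Sum.elim (Q.po c) (Q.mo c)), sub_po_mo]
  · rintro (a | a)
    · rfl
    · exact h a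
  · exact tame_of (fun a => mem_homog_D_inl hF.even c a)
      (Or.inl fun a => Q.D_inl_mem_fil hF.fil)
  · exact ((isBase_po c).isPoint (isMomenta_mo c)).null _

theorem nearId_gen_add (hsN : s ∈ Q.N 1) (hsi : s ∈ homog R i) (hH : H ∈ homog R i) :
    Q.NearId c (Q.gen c + s * H) where
  even := Submodule.add_mem _ (gen_even c) (mul_self_mem_homog hsi hH)
  near := by
    rw [add_sub_cancel_left]
    exact Q.mul_mem_N_right hsN _

end PhaseSpace

namespace PhaseSpace

variable {R : Type*} [Ring R] [Algebra ℝ R] [Superalgebra R] {ι κ : Type*} [Fintype ι]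
  [DecidableEq ι] {Q : PhaseSpace R ι κ} {c c' : κ} {w : ι ⊕ ι → R} {y q q' : ι → R}
  {F G H K L S X : R} {s t : R} {i j : ZMod 2}

/-! #### The Poisson bracket -/

variable (Q) in
theorem der (c : κ) (α : ι ⊕ ι) : IsSuperDer (Q.px α) (Q.D c α) := Q.isSuperDer c α

variable (Q) in
/-- The sign in the canonical bracket. -/
def bracketSign : ι ⊕ ι → ℝ := Sum.elim (fun _ => 1) fun a => -sgn (Q.ix a)

variable (Q) in
/-- The canonical Poisson bracket, as a function of its second argument. -/
def hamiltonian (c : κ) (F : R) : R →ₗ[ℝ] R :=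
  ∑ α, Q.bracketSign α • (LinearMap.mulLeft ℝ (Q.D c α (parPow (Q.px α) F)) ∘ₗ Q.D c α.swap)

theorem px_swap (α : ι ⊕ ι) : Q.px α.swap = Q.px α := by
  rcases α with a | a <;> rfl

theorem hamiltonian_apply (F G : R) : Q.hamiltonian c F G = ∑ α, Q.bracketSign α •
    (Q.D c α (parPow (Q.px α) F) * Q.D c α.swap G) := by
  simp [hamiltonian, LinearMap.sum_apply]

theorem hamiltonian_apply' (F G : R) : Q.hamiltonian c F G =
    ∑ a, (Q.D c (.inl a) (parPow (Q.ix a) F) * Q.D c (.inr a) G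
      - sgn (Q.ix a) • (Q.D c (.inr a) (parPow (Q.ix a) F) * Q.D c (.inl a) G)) := by
  rw [hamiltonian_apply, Fintype.sum_sum_type, ← Finset.sum_add_distrib]
  refine Finset.sum_congr rfl fun a _ => ?_
  simp [bracketSign, sub_eq_add_neg]

theorem hamiltonian_add (F F' G : R) :
    Q.hamiltonian c (F + F') G = Q.hamiltonian c F G + Q.hamiltonian c F' G := by
  simp only [hamiltonian_apply, map_add, add_mul, smul_add, Finset.sum_add_distrib]

theorem hamiltonian_smul (r : ℝ) (F G : R) :
    Q.hamiltonian c (r • F) G = r • Q.hamiltonian c F G := by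
  simp only [hamiltonian_apply, map_smul, smul_mul_assoc, Finset.smul_sum, smul_comm r]

theorem hamiltonian_par (F G : R) : Superalgebra.par (Q.hamiltonian c F G)
    = Q.hamiltonian c (Superalgebra.par F) (Superalgebra.par G) := by
  rw [hamiltonian_apply, hamiltonian_apply, map_sum]
  refine Finset.sum_congr rfl fun α _ => ?_
  have h : parPow (Q.px α) (Superalgebra.par F) = Superalgebra.par (parPow (Q.px α) F) := by
    rw [← parPow_one, ← parPow_one, parPow_parPow, parPow_parPow, add_comm]
  rw [map_smul, map_mul, h, (Q.der c α).par, (Q.der c α.swap).par, px_swap,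
    smul_mul_smul_comm, sgn_mul_self, one_smul]

theorem isDerivation_hamiltonian (hF : F ∈ homog R i) :
    Q.IsDerivation i (Q.hamiltonian c F) where
  der :=
    { leibniz := fun G H => by
        simp only [hamiltonian_apply, (Q.der c _).leibniz, mul_add, smul_add,
          Finset.sum_add_distrib, Finset.sum_mul, Finset.mul_sum]
        congr 1
        · refine Finset.sum_congr rfl fun α _ => ?_
          rw [smul_mul_assoc, mul_assoc]
        · refine Finset.sum_congr rfl fun α _ => ?_
          rw [mul_smul_comm, ← mul_assoc,
            Q.comm.swap ((Q.der c α).mem (parPow_mem hF _)), parPow_parPow, mul_assoc]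
          have : Q.px α + i + Q.px α.swap = i := by
            rw [px_swap, add_right_comm, zmod_two_add_self, zero_add]
          rw [this]
      par := fun G => by
        have h := hamiltonian_par (Q := Q) (c := c) F G
        rw [mem_homog.mp hF, hamiltonian_smul] at h
        rw [h, smul_smul, sgn_mul_self, one_smul] }
  fil := ⟨1, fun k G hG => by
    rw [hamiltonian_apply]
    exact Submodule.sum_mem _ fun α _ => Submodule.smul_mem _ _
      (Q.mul_mem_fil_left _ (D_mem_fil c _ hG))⟩
  scalar x hx := by simp [hamiltonian_apply, Q.D_scalar c _ x hx]

theorem IsDerivation.supercommutator {D D' : R →ₗ[ℝ] R} (hD : Q.IsDerivation i D)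
    (hD' : Q.IsDerivation j D') :
    Q.IsDerivation (i + j) (D ∘ₗ D' - sgn (i * j) • (D' ∘ₗ D)) where
  der :=
    { leibniz := fun F G => by
        simp only [LinearMap.sub_apply, LinearMap.comp_apply, LinearMap.smul_apply,
          hD.der.leibniz, hD'.der.leibniz, map_add, hD.der.parPow, hD'.der.parPow, sub_mul,
          mul_sub, smul_add, smul_mul_assoc, mul_smul_comm, smul_smul, parPow_parPow]
        rw [mul_comm j i, sgn_mul_self, one_smul, add_comm j i]
        abel
      par := fun F => by
        simp only [LinearMap.sub_apply, LinearMap.comp_apply, LinearMap.smul_apply,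
          hD.der.par, hD'.der.par, map_sub, map_smul, smul_sub, smul_smul, sgn_add]
        congr 2
        · ring
        · ring }
  fil := by
    obtain ⟨d, hd⟩ := hD.fil
    obtain ⟨d', hd'⟩ := hD'.fil
    refine ⟨d + d', fun k F hF => Submodule.sub_mem _ ?_ (Submodule.smul_mem _ _ ?_)⟩
    · refine hd _ _ (hd' _ _ ?_)
      rwa [add_assoc]
    · refine hd' _ _ (hd _ _ ?_)
      rwa [add_assoc, add_comm d' d]
  scalar x hx := by simp [hD.scalar x hx, hD'.scalar x hx]

theorem IsDerivation.ext {D D' : R →ₗ[ℝ] R} (hD : Q.IsDerivation i D) (hD' : Q.IsDerivation i D')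
    (c : κ) (h : ∀ α, D (Q.crd c α) = D' (Q.crd c α)) : D = D' := by
  ext F
  rw [hD.eq_sum c, hD'.eq_sum c]
  simp only [h]

/-- Bracketing with the conjugate coordinate recovers a partial derivative; comparisons of
Hamiltonian derivations thus reduce to derivatives of the Hamiltonians. -/
theorem hamiltonian_crd (F : R) (α : ι ⊕ ι) : Q.hamiltonian c F (Q.crd c α.swap)
    = Q.bracketSign α • Q.D c α (parPow (Q.px α) F) := by
  rw [hamiltonian_apply, Finset.sum_eq_single α]
  · rw [Q.D_crd, if_pos rfl, mul_one]
  · intro β _ hβ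
    rw [Q.D_crd, if_neg fun h => hβ (Sum.swap_leftInverse.injective h), mul_zero, smul_zero]
  · simp

/-- The partial derivatives are derivations of the bracket. -/
theorem D_hamiltonian (c : κ) (α : ι ⊕ ι) (F G : R) : Q.D c α (Q.hamiltonian c F G)
    = Q.hamiltonian c (Q.D c α F) G + Q.hamiltonian c (parPow (Q.px α) F) (Q.D c α G) := by
  simp only [hamiltonian_apply, map_sum, map_smul, (Q.der c _).leibniz, smul_add,
    Finset.sum_add_distrib]
  congr 1
  · refine Finset.sum_congr rfl fun β _ => ?_
    rw [D_D, (Q.der c α).parPow, map_smul, smul_smul, sgn_mul_self, one_smul]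
  · refine Finset.sum_congr rfl fun β _ => ?_
    have h : parPow (Q.px α) (Q.D c β (parPow (Q.px β) F))
        = sgn (Q.px α * Q.px β) • Q.D c β (parPow (Q.px β) (parPow (Q.px α) F)) := by
      have hc : parPow (Q.px β) (parPow (Q.px α) F) = parPow (Q.px α) (parPow (Q.px β) F) := by
        rw [parPow_parPow, parPow_parPow, add_comm]
      rw [hc, (Q.der c β).parPow _ (parPow (Q.px β) F), smul_smul, mul_comm (Q.px β), sgn_mul_self, one_smul]
    rw [h, D_D c α, px_swap, smul_mul_smul_comm, sgn_mul_self, one_smul]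

theorem hamiltonian_skew (hF : F ∈ homog R i) (hG : G ∈ homog R j) :
    Q.hamiltonian c F G = -(sgn (i * j) • Q.hamiltonian c G F) := by
  rw [hamiltonian_apply, hamiltonian_apply, Finset.smul_sum, ← Finset.sum_neg_distrib]
  -- Reindexing interchanges positions and momenta, which reverses the roles of F and G in each
  -- term.
  refine (Equiv.sum_comp (Equiv.sumComm ι ι) _).symm.trans
    (Finset.sum_congr rfl fun α _ => ?_)
  have e : (Equiv.sumComm ι ι) α = α.swap := rfl
  rw [e, Sum.swap_swap, parPow_of_mem hF, parPow_of_mem hG, map_smul, map_smul, smul_mul_assoc,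
    smul_mul_assoc, Q.comm _ _ _ ((Q.der c α.swap).mem hF) _ ((Q.der c α).mem hG),
    px_swap]
  simp only [smul_smul]
  rw [← neg_smul]
  congr 1
  have hb : Q.bracketSign α.swap = -(sgn (Q.px α) * Q.bracketSign α) := by
    rcases α with a | a <;> simp [bracketSign, sgn_mul_self]
  have hs : sgn (Q.px α) * sgn (Q.px α * i) * sgn ((Q.px α + i) * (Q.px α + j))
      = sgn (i * j) * sgn (Q.px α * j) := by
    simp only [← sgn_add]
    congr 1
    generalize Q.px α = a
    rcases zmod_two i with rfl | rfl <;> rcases zmod_two j with rfl | rfl <;>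
      rcases zmod_two a with rfl | rfl <;> decide
  rw [hb]
  linear_combination (-Q.bracketSign α) * hs

/-- The Jacobi identity. -/
theorem hamiltonian_jacobi (hF : F ∈ homog R i) (hG : G ∈ homog R j) (H : R) :
    Q.hamiltonian c F (Q.hamiltonian c G H) = Q.hamiltonian c (Q.hamiltonian c F G) H
      + sgn (i * j) • Q.hamiltonian c G (Q.hamiltonian c F H) := by
  have hX := isDerivation_hamiltonian (Q := Q) (c := c) hF
  have hY := isDerivation_hamiltonian (Q := Q) (c := c) hG
  have hFG := hX.der.mem hG
  -- Both sides are derivations in H, so coordinates suffice. There the identity says that a partial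
  -- derivative is a derivation of the bracket, combined with skew-symmetry.
  have key := (hX.supercommutator hY).ext (isDerivation_hamiltonian (c := c) hFG) c fun α => by
    obtain ⟨β, rfl⟩ : ∃ β : ι ⊕ ι, α = β.swap := ⟨α.swap, (Sum.swap_swap α).symm⟩
    simp only [LinearMap.sub_apply, LinearMap.comp_apply, LinearMap.smul_apply, hamiltonian_crd,
      map_smul]
    rw [smul_comm (sgn (i * j)), ← smul_sub]
    congr 1
    have hβF := (Q.der c β).mem hF
    rw [parPow_of_mem hF, parPow_of_mem hG, parPow_of_mem hFG, map_smul, map_smul, map_smul,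
      map_smul, map_smul, D_hamiltonian, hamiltonian_skew hG hβF, parPow_of_mem hF,
      hamiltonian_smul, smul_add, smul_neg, smul_neg, sub_neg_eq_add]
    simp only [smul_smul, ← sgn_add]
    rw [add_comm]
    congr 3
    · generalize Q.px β = a
      rcases zmod_two i with rfl | rfl <;> rcases zmod_two j with rfl | rfl <;>
        rcases zmod_two a with rfl | rfl <;> decide
    · generalize Q.px β = a
      rcases zmod_two i with rfl | rfl <;> rcases zmod_two j with rfl | rfl <;>
        rcases zmod_two a with rfl | rfl <;> decide
  have h := LinearMap.congr_fun key H
  simp only [LinearMap.sub_apply, LinearMap.comp_apply, LinearMap.smul_apply] at h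
  rw [← h, sub_add_cancel]

/-! #### Commutators of first-order perturbations of the identity -/

/-- The product of two first-order perturbations of the identity. -/
theorem elim_gen_add_gen_add (hs : s ∈ Q.scalars) (ht : t ∈ Q.scalars) (hsN : s ∈ Q.N 1)
    (htN : t ∈ Q.N 1) (hsi : s ∈ homog R i) (hti : t ∈ homog R j) (hs2 : s * s = 0)
    (ht2 : t * t = 0) (hH : H ∈ homog R i) (hK : K ∈ homog R j) :
    Q.Elim c (Q.gen c + s * H) (Q.gen c + t * K) G ↔ G = Q.gen c + s * H + t * K
      + t * s * ∑ a, Q.D c (.inl a) (parPow (Q.ix a) H) * Q.D c (.inr a) K := by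
  have hF : Q.NearId c (Q.gen c + s * H) := nearId_gen_add hsN hsi hH
  have hDF : ∀ a, Q.D c (.inl a) (Q.gen c + s * H)
      = Q.mo c a + s * Q.D c (.inl a) (parPow (Q.ix a) H) := fun a => by
    rw [map_add, D_inl_gen_self, D_scalar_mul hs hsi, parPow_of_mem hH, map_smul, mul_smul_comm]
    rfl
  have hw := (isBase_po c).isPoint
    (q := fun a => Q.D c (.inl a) (Q.gen c + s * H))
    ⟨fun a => mem_homog_D_inl hF.even c a, fun a => Q.D_inl_mem_fil hF.isSmall.fil⟩
  -- The momenta ∂F/∂z differ from p by multiples of s, so the Taylor expansion of K stops at first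
  -- order.
  have e : Q.sub c (Sum.elim (Q.po c) fun a => Q.D c (.inl a) (Q.gen c + s * H)) K
      = K + s * ∑ a, Q.D c (.inl a) (parPow (Q.ix a) H) * Q.D c (.inr a) K := by
    rw [sub_eq_add_sum hw, Fintype.sum_sum_type, Finset.sum_eq_zero, zero_add, Finset.mul_sum]
    · congr 1
      refine Finset.sum_congr rfl fun a _ => ?_
      rw [Sum.elim_inr, hDF, mo, add_sub_cancel_left, mul_assoc]
    · intro a _
      rw [Sum.elim_inl, po, sub_self, zero_mul]
    · have hd : ∀ α, ∃ v, Sum.elim (Q.po c) (fun a => Q.D c (.inl a) (Q.gen c + s * H)) α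
          - Q.crd c α = s * v := by
        rintro (a | a)
        · exact ⟨0, by simp [po]⟩
        · exact ⟨_, by rw [Sum.elim_inr, hDF, mo, add_sub_cancel_left]⟩
      intro α β
      obtain ⟨v, hv⟩ := hd α
      obtain ⟨v', hv'⟩ := hd β
      rw [hv, hv', mul_mul_self_eq_zero Q hsi hs2]
  rw [elim_gen_add hF.even ht htN hti ht2 hK (Or.inl hF.isSmall.fil), e, mul_add, ← mul_assoc,
    ← add_assoc]

/-- The mixed terms of the two products are the two halves of the bracket; exchanging s with t and
reordering the derivatives produces the signs in its definition. -/
theorem sum_sub_sum_eq_hamiltonian (hsi : s ∈ homog R i) (hti : t ∈ homog R j)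
    (hH : H ∈ homog R i) (hK : K ∈ homog R j) :
    t * s * ∑ a, Q.D c (.inl a) (parPow (Q.ix a) H) * Q.D c (.inr a) K
      - s * t * ∑ a, Q.D c (.inl a) (parPow (Q.ix a) K) * Q.D c (.inr a) H
      = t * s * Q.hamiltonian c H K := by
  rw [hamiltonian_apply', Finset.sum_sub_distrib, mul_sub]
  congr 1
  rw [Q.comm _ _ _ hsi _ hti, smul_mul_assoc, ← mul_smul_comm, Finset.smul_sum]
  congr 1
  refine Finset.sum_congr rfl fun a _ => ?_
  have h1 := (Q.der c (.inl a)).mem hK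
  have h2 := (Q.der c (.inr a)).mem hH
  rw [parPow_of_mem hH, parPow_of_mem hK, map_smul, map_smul, smul_mul_assoc, smul_mul_assoc,
    Q.comm _ _ _ h1 _ h2]
  simp only [smul_smul, ← sgn_add, Sum.elim_inl, Sum.elim_inr]
  congr 2
  generalize Q.ix a = b
  rcases zmod_two i with rfl | rfl <;> rcases zmod_two j with rfl | rfl <;>
      rcases zmod_two b with rfl | rfl <;> decide

/-- The commutator of two first-order perturbations of the identity is given by the bracket. -/
theorem Elim.commutator (hs : s ∈ Q.scalars) (ht : t ∈ Q.scalars) (hts : t * s ∈ Q.scalars)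
    (hsN : s ∈ Q.N 1) (htN : t ∈ Q.N 1) (hsi : s ∈ homog R i) (hti : t ∈ homog R j)
    (hs2 : s * s = 0) (ht2 : t * t = 0) (hH : H ∈ homog R i) (hK : K ∈ homog R j)
    (hF : Q.Elim c (Q.gen c + t * K) (Q.gen c + s * H) F)
    (hG : Q.Elim c (Q.gen c + s * H) (Q.gen c + t * K) G) :
    Q.Elim c F (Q.gen c + t * s * Q.hamiltonian c H K) G := by
  have hHK := (isDerivation_hamiltonian (Q := Q) (c := c) hH).der.mem hK
  have hFs := (hF.nearId (nearId_gen_add htN hti hK) (nearId_gen_add hsN hsi hH)).isSmall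
  have htsi := mul_mem_homog hti hsi
  rw [add_comm] at htsi
  have hst : s * t = sgn (i * j) • (t * s) := Q.comm _ _ _ hsi _ hti
  -- The parameter ts kills all multiples of s and of t, so ∂F/∂z may be replaced by p once
  -- multiplied by ts.
  have h1 : ∀ X, t * s * (s * X) = 0 := fun X => by
    rw [mul_assoc, ← mul_assoc s, hs2, zero_mul, mul_zero]
  have h2 : ∀ X, t * s * (t * X) = 0 := fun X => by
    rw [mul_assoc, ← mul_assoc s, hst, smul_mul_assoc, mul_smul_comm, mul_assoc, ← mul_assoc t t,
      ht2, zero_mul, smul_zero]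
  rw [elim_gen_add_gen_add ht hs htN hsN hti hsi ht2 hs2 hK hH] at hF
  rw [elim_gen_add_gen_add hs ht hsN htN hsi hti hs2 ht2 hH hK] at hG
  rw [elim_gen_add_of_mul_eq hFs hts (Q.mul_mem_N_left t hsN) htsi
    (by rw [mul_assoc, ← mul_assoc s, hst, smul_mul_assoc, mul_smul_comm, mul_assoc t s s, hs2,
      mul_zero, mul_zero, smul_zero]) hHK]
  · rw [hG, hF, ← sum_sub_sum_eq_hamiltonian hsi hti hH hK]
    abel
  · intro a
    rw [hF]
    simp only [map_add, D_inl_gen_self, mul_add, mul_assoc s t]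
    rw [D_scalar_mul ht hti, D_scalar_mul hs hsi, D_scalar_mul hs hsi]
    simp only [mul_smul_comm, h1, h2, smul_zero, add_zero]

end PhaseSpace

namespace PhaseSpace

variable {R R' : Type*} [Ring R] [Algebra ℝ R] [Superalgebra R] [Ring R'] [Algebra ℝ R']
  [Superalgebra R'] {ι κ κ' : Type*} [Fintype ι] [DecidableEq ι] {Q : PhaseSpace R ι κ}
  {Q' : PhaseSpace R' ι κ'} {c : κ} {c' : κ'} {f : R →ₐ[ℝ] R'}

/-! #### Naturality -/

/-- A homomorphism compatible with the structures of phase spaces, for one system of coordinates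
of each of them. -/
structure IsMorphism (Q : PhaseSpace R ι κ) (Q' : PhaseSpace R' ι κ') (c : κ) (c' : κ')
    (f : R →ₐ[ℝ] R') : Prop where
  ix : Q'.ix = Q.ix
  par : ∀ F, f (Superalgebra.par F) = Superalgebra.par (f F)
  crd : ∀ α, f (Q.crd c α) = Q'.crd c' α
  D : ∀ α F, f (Q.D c α F) = Q'.D c' α (f F)
  zs : ∀ F, f (Q.zs F) = Q'.zs (f F)
  fil : ∀ k F, F ∈ Q.fil k → f F ∈ Q'.fil k
  N : ∀ k F, F ∈ Q.N k → f F ∈ Q'.N k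

namespace IsMorphism

theorem mem (hf : IsMorphism Q Q' c c' f) {i : ZMod 2} {F : R} (hF : F ∈ homog R i) :
    f F ∈ homog R' i := by
  rw [mem_homog] at *
  rw [← hf.par, hF, map_smul]

theorem tay (hf : IsMorphism Q Q' c c' f) (w : ι ⊕ ι → R) (k : ℕ) (F : R) :
    f (Q.tay c (displacement (Q.crd c) w) k F)
      = Q'.tay c' (displacement (Q'.crd c') fun α => f (w α)) k (f F) := by
  induction k generalizing F with
  | zero => rw [tay_zero, tay_zero, hf.zs]
  | succ k ih =>
    rw [tay_succ', tay_succ', map_smul, map_sum]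
    congr 1
    refine Finset.sum_congr rfl fun α _ => ?_
    rw [map_mul, ih, hf.D]
    congr 1
    rcases α with a | a
    · simp [displacement, hf.crd]
    · rfl

theorem tame (hf : IsMorphism Q Q' c c' f) {w : ι ⊕ ι → R} {F : R} (h : Q.Tame c w F) :
    Q'.Tame c' (fun α => f (w α)) (f F) := fun k => by
  obtain ⟨K, hK⟩ := h k
  refine ⟨K, fun j hj => ?_⟩
  simp only [← hf.tay]
  exact hf.fil _ _ (hK j hj)

theorem sub (hf : IsMorphism Q Q' c c' f) {w : ι ⊕ ι → R} {F : R} (h : Q.Tame c w F) :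
    f (Q.sub c w F) = Q'.sub c' (fun α => f (w α)) (f F) :=
  (h.sumsTo.map f.toLinearMap (Q' := Q') (d := 0) fun k F hF => hf.fil k F hF).unique
    ((hf.tame h).sumsTo.congr fun k => (hf.tay w k F).symm)

theorem sub_elim (hf : IsMorphism Q Q' c c' f) {y q : ι → R} {F : R}
    (h : Q.Tame c (Sum.elim y q) F) : f (Q.sub c (Sum.elim y q) F)
      = Q'.sub c' (Sum.elim (fun a => f (y a)) fun a => f (q a)) (f F) := by
  rw [hf.sub h]
  congr 1
  funext α
  rcases α with a | a <;> rfl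

theorem gen (hf : IsMorphism Q Q' c c' f) : f (Q.gen c) = Q'.gen c' := by
  simp only [PhaseSpace.gen, map_sum, map_mul, hf.crd]

theorem nearId (hf : IsMorphism Q Q' c c' f) {F : R} (h : Q.NearId c F) : Q'.NearId c' (f F) := by
  refine ⟨hf.mem h.even, ?_⟩
  rw [← hf.gen, ← map_sub]
  exact hf.N _ _ h.near

theorem isBase (hf : IsMorphism Q Q' c c' f) {y : ι → R} (h : Q.IsBase c y) :
    Q'.IsBase c' fun a => f (y a) where
  mem a := by
    rw [hf.ix]
    exact hf.mem (h.mem a)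
  near a := by
    have := hf.N _ _ (h.near a)
    rwa [map_sub, po, hf.crd] at this

theorem elim (hf : IsMorphism Q Q' c c' f) {F S G : R} (hF : Q.IsSmall F) (h : Q.Elim c F S G) :
    Q'.Elim c' (f F) (f S) (f G) := by
  obtain ⟨y, q, h⟩ := h
  have hw := h.base.isPoint (isMomenta_mo c)
  have hw' := (isBase_po c).isPoint (h.isMomenta hF)
  have hmo : (fun a => f (Q.mo c a)) = Q'.mo c' := funext fun a => hf.crd (.inr a)
  have hpo : (fun a => f (Q.po c a)) = Q'.po c' := funext fun a => hf.crd (.inl a)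
  refine ⟨fun a => f (y a), fun a => f (q a), hf.isBase h.base, fun a => ?_, ?_, ?_, ?_⟩
  · rw [hf.ix]
    exact hf.mem (h.mem a)
  · funext a
    conv_rhs => rw [← h.momenta]
    rw [eliminationMomenta, eliminationMomenta, hf.sub_elim (hw.null _), hmo, hf.D]
  · funext a
    conv_rhs => rw [← h.positions]
    rw [eliminationPositions, eliminationPositions, map_smul, hf.sub_elim (hw'.null _), hpo, hf.D,
      hf.ix]
  · rw [h.eq, map_sub, map_add, map_sum, hf.sub_elim (hw.null _), hf.sub_elim (hw'.null _), hmo,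
      hpo]
    simp only [map_mul]

end IsMorphism

end PhaseSpace

/-! ### The phase space of a chart -/

section PhaseSpace

variable {M : SuperSpace.{u}} {n m : ℕ} {A : WeilSuperalgebra} {W : Opens M.carrier}

/-- The derivatives with respect to positions and momenta. -/
def phaseDeriv {c : SuperChart M n m} (hW : W ≤ c.dom) :
    Idx n m ⊕ Idx n m → Mom M n m A W →ₗ[ℝ] Mom M n m A W :=
  Sum.elim (dzLin hW) dpLin

theorem phaseDeriv_inr {c : SuperChart M n m} (hW : W ≤ c.dom) (a : Idx n m) :
    (phaseDeriv hW (.inr a) : Mom M n m A W →ₗ[ℝ] Mom M n m A W) = dpLin a := rfl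

theorem taylorTerm_eq {c : SuperChart M n m} (hW : W ≤ c.dom) (δ P : Idx n m → Mom M n m A W)
    (k : ℕ) (F : Mom M n m A W) : taylorTerm hW δ P k F
      = taylor zeroSectionHom (phaseDeriv hW) (Sum.elim δ P) k F := by
  induction k generalizing F with
  | zero => rfl
  | succ k ih =>
    have h : taylor zeroSectionHom (phaseDeriv hW) (Sum.elim δ P) (k + 1) F
        = ∑ a, δ a * taylor zeroSectionHom (phaseDeriv hW) (Sum.elim δ P) k (dzLin hW a F)
          + ∑ a, P a * taylor zeroSectionHom (phaseDeriv hW) (Sum.elim δ P) k (dpLin a F) := by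
      rw [taylor, LinearMap.sum_apply]
      exact Fintype.sum_sum_type (α₁ := Idx n m) (α₂ := Idx n m) _
    rw [h, taylorTerm, Finset.sum_add_distrib]
    simp only [ih, dzLin_apply, dpLin_apply]

theorem coeff_subst {c : SuperChart M n m} (hW : W ≤ c.dom) (y P : Idx n m → Mom M n m A W)
    (F : Mom M n m A W) (d : Fin n →₀ ℕ) : MvPowerSeries.coeff d (subst hW y P F)
      = ∑ᶠ k : ℕ, ((k.factorial : ℝ)⁻¹) •
        MvPowerSeries.coeff d (taylorTerm hW (fun a => y a - zc hW a) P k F) := rfl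

/-- `subst` sums each coefficient separately by `finsum`, which is meaningful only for finite
support; terms of growing degree leave finitely many contributions to each coefficient, and the
tails are uniformly of degree k. -/
theorem subst_sub_sum_mem {c : SuperChart M n m} (hW : W ≤ c.dom) (y P : Idx n m → Mom M n m A W)
    (F : Mom M n m A W) (hx : ∀ k, ∃ K, ∀ j ≥ K,
      taylorTerm hW (fun a => y a - zc hW a) P j F ∈ momFil M n m A W k) (k : ℕ) :
    ∃ K, ∀ L ≥ K, subst hW y P F - ∑ j ∈ Finset.range L, ((j.factorial : ℝ)⁻¹) •
      taylorTerm hW (fun a => y a - zc hW a) P j F ∈ momFil M n m A W k := by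
  obtain ⟨K, hK⟩ := hx k
  obtain ⟨K₀, hK₀⟩ := exists_coeff_eq_zero (M := M) (n := n) (m := m) (A := A) (W := W)
  refine ⟨K, fun L hL => mem_momFil.mpr fun d => ?_⟩
  obtain ⟨K', hK'⟩ := hx (K₀ + d.degree)
  rw [map_sub, map_sum, coeff_subst]
  generalize hxe : (fun j => taylorTerm hW (fun a => y a - zc hW a) P j F) = x
  have hxe' : ∀ j, taylorTerm hW (fun a => y a - zc hW a) P j F = x j := fun j =>
    congrFun hxe j
  simp only [hxe'] at hK hK' ⊢
  have hzero : ∀ j ≥ K', MvPowerSeries.coeff d (x j) = 0 := fun j hj =>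
    hK₀ _ d _ (hK' j hj) le_rfl
  -- The cutoff K' depends on the coefficient d; summing to L + K' exceeds both it and the partial
  -- sum to be subtracted.
  have hsum : ∑ᶠ j : ℕ, ((j.factorial : ℝ)⁻¹) • MvPowerSeries.coeff d (x j)
      = ∑ j ∈ Finset.range (L + K'), ((j.factorial : ℝ)⁻¹) • MvPowerSeries.coeff d (x j) := by
    refine finsum_eq_sum_of_support_subset _ fun j hj => ?_
    rw [Finset.coe_range, Set.mem_Iio]
    by_contra h
    refine hj ?_
    change _ • MvPowerSeries.coeff d (x j) = 0
    rw [hzero j (by omega), smul_zero]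
  have hsmul : ∀ j : ℕ, MvPowerSeries.coeff d (((j.factorial : ℝ)⁻¹) • x j)
      = ((j.factorial : ℝ)⁻¹) • MvPowerSeries.coeff d (x j) := fun _ => rfl
  simp only [hsmul]
  rw [hsum, Finset.sum_range_add, add_sub_cancel_left]
  exact Submodule.sum_mem _ fun j _ => Submodule.smul_mem _ _ (mem_momFil.mp (hK _ (by omega)) d)

theorem subst_spec {c : SuperChart M n m} (hW : W ≤ c.dom)
    (w : Idx n m ⊕ Idx n m → Mom M n m A W) (F : Mom M n m A W)
    (hx : ∀ k, ∃ K, ∀ j ≥ K, taylor zeroSectionHom (phaseDeriv hW)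
      (displacement (Sum.elim (zc hW) mom) w) j F ∈ momFil M n m A W k) (k : ℕ) :
    ∃ K, ∀ L ≥ K, subst hW (fun a => w (.inl a)) (fun a => w (.inr a)) F
      - ∑ j ∈ Finset.range L, ((j.factorial : ℝ)⁻¹) • taylor zeroSectionHom (phaseDeriv hW)
      (displacement (Sum.elim (zc hW) mom) w) j F ∈ momFil M n m A W k := by
  have e : ∀ j, taylor zeroSectionHom (phaseDeriv hW)
      (displacement (Sum.elim (zc hW) mom) w) j F
      = taylorTerm hW (fun a => w (.inl a) - zc hW a) (fun a => w (.inr a)) j F :=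
    fun j => (taylorTerm_eq hW _ _ j F).symm
  simp only [e] at hx ⊢
  exact subst_sub_sum_mem hW _ _ F hx k

end PhaseSpace

section PhaseSpace

variable {M : SuperSpace.{u}} {n m : ℕ} {A : WeilSuperalgebra} {W : Opens M.carrier}

variable (M n m A W) in
/-- The phase space of formal functions on the cotangent bundle of `W`, with the systems of
coordinates given by the charts whose domains contain `W`. -/
def phaseSpace : PhaseSpace (Mom M n m A W) (Idx n m) {c : SuperChart M n m // W ≤ c.dom} where
  comm := isSupercommutative_mom
  ix := ix
  crd c := Sum.elim (zc c.2) mom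
  D c := phaseDeriv c.2
  zs := zeroSectionHom
  scalars := Set.range scal
  N := nilFil M n m A W
  fil := momFil M n m A W
  sub c w F := subst c.2 (fun a => w (.inl a)) (fun a => w (.inr a)) F
  crd_mem c α := by
    rcases α with a | a
    · exact zc_mem c.2 a
    · exact mom_mem a
  crd_inr _ _ _ := rfl
  isSuperDer c α := by
    rcases α with a | a
    · exact isSuperDer_dzLin c.2 a
    · exact isSuperDer_dpLin a
  D_inr c c' a := (phaseDeriv_inr c.2 a).trans (phaseDeriv_inr c'.2 a).symm
  D_crd c α β := by
    rcases α with a | a <;> rcases β with b | b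
    · simp only [phaseDeriv, Sum.elim_inl, dzLin_zc, Sum.inl.injEq]
    · rw [if_neg (by simp)]
      exact dzLin_mom c.2 a b
    · rw [if_neg (by simp)]
      exact dpLin_const a _
    · simp only [phaseDeriv, Sum.elim_inr, dpLin_mom, Sum.inr.injEq]
  D_scalar c α x hx := by
    obtain ⟨t, rfl⟩ := hx
    rcases α with a | a
    · exact dzLin_scal c.2 a t
    · exact dpLin_scal a t
  zs_par := zeroSection_par
  zs_zs := zeroSection_zeroSection
  zs_crd_inl _ _ := zeroSection_const _
  zs_crd_inr _ a := zeroSection_mom a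
  zs_scalar x hx := by
    obtain ⟨t, rfl⟩ := hx
    exact zeroSection_const _
  D_inl_zs c a F := dzLin_zeroSection c.2 a F
  D_inr_zs _ a F := dpLin_zeroSection a F
  N_zero := nilFil_zero
  N_anti := nilFil_anti
  N_mul := nilFil_mul
  N_eq_bot := exists_nilFil_eq_bot
  D_mem_N {c α j F} hF := by
    rcases α with a | a
    · exact dzLin_mem_nilFil c.2 hF
    · exact dpLin_mem_nilFil hF
  zs_mem_N := zeroSection_mem_nilFil
  N_closed := nilFil_closed
  N_le_fil := nilFil_le_momFil
  fil_zero := momFil_zero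
  fil_anti := momFil_anti
  fil_mul := momFil_mul
  fil_par := isGraded_momFil
  fil_separated _ h := momFil_separated h
  crd_inr_mem_fil _ a := mom_mem_momFil a
  D_inl_mem_fil {c a k F} hF := dzLin_mem_momFil c.2 hF
  D_inr_mem_fil {c a k F} hF := dpLin_mem_momFil hF
  zs_mem_fil := zeroSection_mem_momFil
  sub_spec c w F h k := subst_spec c.2 w F h k
  twisted_ext c Δ ψ₁ ψ₂ s hΔ hψ hcrd hsc hc :=
    twisted_eq_zero c.2 Δ ψ₁ ψ₂ s hΔ (fun a => hψ (.inl a) rfl) (fun a => hcrd (.inl a))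
      (fun a => hcrd (.inr a)) (fun t => hsc _ ⟨t, rfl⟩) hc

end PhaseSpace

/-! ### Restriction and change of parameters -/

namespace WeilSuperalgebra

variable {A B : WeilSuperalgebra}

theorem Hom.aug (φ : Hom A B) {a : A} (ha : a ∈ A.maxIdeal) : φ.toAlgHom a ∈ B.maxIdeal := by
  have h := ((A.nilpotent a ha).map φ.toAlgHom).map B.aug
  exact h.eq_zero

theorem Hom.mem_idealPow (φ : Hom A B) (j : ℕ) {a : A} (ha : a ∈ idealPow A.maxIdeal j) :
    φ.toAlgHom a ∈ idealPow B.maxIdeal j := by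
  have h : (idealPow A.maxIdeal j).map φ.toAlgHom.toLinearMap ≤ idealPow B.maxIdeal j := by
    rw [idealPow, idealPow, Submodule.map_mul, Submodule.map_pow]
    refine mul_le_mul' (pow_le_pow_left' ?_ j) le_top
    rintro _ ⟨b, hb, rfl⟩
    exact φ.aug hb
  exact h ⟨a, ha, rfl⟩

end WeilSuperalgebra

section Change

variable {M M' : SuperSpace.{u}} {n m : ℕ} {A A' : WeilSuperalgebra} {W : Opens M.carrier}
  {W' : Opens M'.carrier}

/-- The homomorphism of formal functions given by homomorphisms of functions and of parameters. -/
def changeHom (f : M.sec W →ₐ[ℝ] M'.sec W')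
    (hf : ∀ s, f (Superalgebra.par s) = Superalgebra.par (f s)) (φ : WeilSuperalgebra.Hom A A') :
    Mom M n m A W →ₐ[ℝ] Mom M' n m A' W' :=
  coeffwiseHom (tmapHom (tmapHom f φ.toAlgHom hf φ.map_par) (AlgHom.id ℝ _)
    (fun x => (tmap_par _ _ hf φ.map_par x)) (fun _ => rfl))

variable {f : M.sec W →ₐ[ℝ] M'.sec W'}
  {hf : ∀ s, f (Superalgebra.par s) = Superalgebra.par (f s)} {φ : WeilSuperalgebra.Hom A A'}

theorem coeff_changeHom (F : Mom M n m A W) (d : Fin n →₀ ℕ) :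
    MvPowerSeries.coeff d (changeHom f hf φ F)
      = tmap (tmap f.toLinearMap φ.toAlgHom.toLinearMap) LinearMap.id
        (MvPowerSeries.coeff d F) := rfl

theorem changeHom_C (b : STensor (Fun M A W) (Grassmann m)) :
    changeHom f hf φ (MvPowerSeries.C b : Mom M n m A W) = MvPowerSeries.C
      (tmap (tmap f.toLinearMap φ.toAlgHom.toLinearMap) LinearMap.id b) :=
  coeffwise_C (σ := Fin n)
    (tmap (tmap f.toLinearMap φ.toAlgHom.toLinearMap) (LinearMap.id : Grassmann m →ₗ[ℝ] _)) b

theorem changeHom_const (g : Fun M A W) : changeHom f hf φ (const g : Mom M n m A W)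
    = const (tmap f.toLinearMap φ.toAlgHom.toLinearMap g) := by
  rw [const, changeHom_C, tmap_stmul]
  rfl

theorem changeHom_scal (t : A) :
    changeHom f hf φ (scal t : Mom M n m A W) = scal (φ.toAlgHom t) := by
  rw [scal, changeHom_const, tmap_stmul, AlgHom.toLinearMap_apply, map_one]
  rfl

theorem changeHom_mom (a : Idx n m) : changeHom f hf φ (mom a : Mom M n m A W) = mom a := by
  classical
  have h1 : tmap f.toLinearMap φ.toAlgHom.toLinearMap (1 : Fun M A W) = 1 := by
    rw [← stmul_one_one, tmap_stmul, AlgHom.toLinearMap_apply, AlgHom.toLinearMap_apply, map_one,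
      map_one, stmul_one_one]
  rcases a with a | μ
  · ext d
    rw [coeff_changeHom, mom, mom, MvPowerSeries.coeff_X, MvPowerSeries.coeff_X]
    split_ifs
    · rw [← stmul_one_one, tmap_stmul, h1]
      exact stmul_one_one
    · rw [map_zero]
  · rw [mom, changeHom_C, tmap_stmul, h1]
    rfl

theorem changeHom_par (F : Mom M n m A W) :
    changeHom f hf φ (Superalgebra.par F) = Superalgebra.par (changeHom f hf φ F) := by
  ext d
  rw [coeff_changeHom, coeff_par, coeff_par, coeff_changeHom]
  exact tmap_par _ _ (fun x => tmap_par _ _ hf φ.map_par x) (fun _ => rfl) _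

theorem changeHom_zeroSection (F : Mom M n m A W) :
    changeHom f hf φ (zeroSection F) = zeroSection (changeHom f hf φ F) := by
  have h : MvPowerSeries.constantCoeff (changeHom f hf φ F)
      = tmap (tmap f.toLinearMap φ.toAlgHom.toLinearMap) LinearMap.id
        (MvPowerSeries.constantCoeff F) := rfl
  rw [zeroSection_eq, zeroSection_eq, changeHom_C, h]
  congr 1
  generalize MvPowerSeries.constantCoeff F = x
  induction x using tensor_induction with
  | hadd x y hx hy => simp only [map_add, hx, hy]
  | h i j r _ b _ => rfl

theorem changeHom_dpLin (a : Idx n m) (F : Mom M n m A W) :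
    changeHom f hf φ (dpLin a F) = dpLin a (changeHom f hf φ F) := by
  ext d
  rcases a with a | μ
  · rw [dpLin, dpLin, coeff_changeHom, coeff_powerDeriv, coeff_powerDeriv, map_smul,
      coeff_changeHom]
  · rw [dpLin, dpLin, coeff_changeHom, coeff_coeffwise, coeff_coeffwise, coeff_changeHom]
    generalize MvPowerSeries.coeff d F = x
    induction x using tensor_induction with
    | hadd x y hx hy => simp only [map_add, hx, hy]
    | h i j r _ b _ =>
      rw [tmap_stmul, tmap_stmul, tmap_stmul, tmap_stmul]
      congr 1
      exact tmap_par _ _ hf φ.map_par r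

theorem changeHom_dzLin {c : SuperChart M n m} {c' : SuperChart M' n m} (hW : W ≤ c.dom)
    (hW' : W' ≤ c'.dom)
    (hpd : ∀ a s, f (SuperChart.pd hW a s) = SuperChart.pd hW' a (f s)) (a : Idx n m)
    (F : Mom M n m A W) :
    changeHom f hf φ (dzLin hW a F) = dzLin hW' a (changeHom f hf φ F) := by
  ext d
  rw [dzLin, dzLin, coeff_changeHom, coeff_coeffwise, coeff_coeffwise, coeff_changeHom]
  generalize MvPowerSeries.coeff d F = x
  induction x using tensor_induction with
  | hadd x y hx hy => simp only [map_add, hx, hy]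
  | h i j r hr b _ =>
    rw [tmap_stmul, tmap_stmul, tmap_stmul, tmap_stmul]
    congr 1
    clear hr
    induction r using tensor_induction with
    | hadd x y hx hy => simp only [map_add, hx, hy]
    | h i j s _ b _ =>
      rw [tmap_stmul, tmap_stmul, tmap_stmul, tmap_stmul]
      congr 1
      exact hpd a s

theorem changeHom_mem_momFil {k : ℕ} {F : Mom M n m A W} (hF : F ∈ momFil M n m A W k) :
    changeHom f hf φ F ∈ momFil M' n m A' W' k :=
  coeffwise_mem_momFil (s := 0) _
    (fun p _ hx => tmap_tmap_mem_bifil _ _ (fun j _ h => φ.mem_idealPow j h) p hx) hF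

theorem changeHom_mem_nilFil {j : ℕ} {F : Mom M n m A W} (hF : F ∈ nilFil M n m A W j) :
    changeHom f hf φ F ∈ nilFil M' n m A' W' j :=
  coeffwise_mem_nilFil _
    (fun _ hx => tmap_tmap_mem_bifil _ _ (fun j _ h => φ.mem_idealPow j h) _ hx) hF

/-- Treats restriction and change of parameters together; only compatibility with coordinates and
their derivatives is required of f. -/
theorem isMorphism_changeHom {c : SuperChart M n m} {c' : SuperChart M' n m} (hW : W ≤ c.dom)
    (hW' : W' ≤ c'.dom)
    (hpd : ∀ a s, f (SuperChart.pd hW a s) = SuperChart.pd hW' a (f s))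
    (hc : ∀ a, f (SuperChart.coord hW a) = SuperChart.coord hW' a) :
    PhaseSpace.IsMorphism (phaseSpace M n m A W) (phaseSpace M' n m A' W') ⟨c, hW⟩ ⟨c', hW'⟩
      (changeHom f hf φ) where
  ix := rfl
  par := changeHom_par
  crd α := by
    rcases α with a | a
    · refine (changeHom_const _).trans ?_
      rw [tmap_stmul, AlgHom.toLinearMap_apply, AlgHom.toLinearMap_apply, hc, map_one]
      rfl
    · exact changeHom_mom a
  D α F := by
    rcases α with a | a
    · exact changeHom_dzLin hW hW' hpd a F
    · exact changeHom_dpLin a F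
  zs := changeHom_zeroSection
  fil _ _ := changeHom_mem_momFil
  N _ _ := changeHom_mem_nilFil

end Change

section Mom

variable {M : SuperSpace.{u}} {n m : ℕ} {A B : WeilSuperalgebra} {W W' : Opens M.carrier}

/-- Restriction as a homomorphism of algebras. -/
def resHom (h : W' ≤ W) : Mom M n m A W →ₐ[ℝ] Mom M n m A W' :=
  changeHom (M.res h) (M.res_par h) (.id A)

theorem resHom_apply (h : W' ≤ W) (F : Mom M n m A W) : resHom h F = resMom h F := rfl

/-- Change of parameters as a homomorphism of algebras. -/
def pushHom (φ : WeilSuperalgebra.Hom A B) : Mom M n m A W →ₐ[ℝ] Mom M n m B W :=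
  changeHom (AlgHom.id ℝ (M.sec W)) (fun _ => rfl) φ

theorem pushHom_apply (φ : WeilSuperalgebra.Hom A B) (F : Mom M n m A W) :
    pushHom φ F = pushMom φ F := rfl

theorem isMorphism_resHom {c : SuperChart M n m} (hW : W ≤ c.dom) (h : W' ≤ W) :
    PhaseSpace.IsMorphism (phaseSpace M n m A W) (phaseSpace M n m A W') ⟨c, hW⟩
      ⟨c, h.trans hW⟩ (resHom h) :=
  isMorphism_changeHom hW (h.trans hW) (SuperChart.res_pd hW h) (SuperChart.res_coord hW h)

theorem isMorphism_pushHom {c : SuperChart M n m} (hW : W ≤ c.dom)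
    (φ : WeilSuperalgebra.Hom A B) :
    PhaseSpace.IsMorphism (phaseSpace M n m A W) (phaseSpace M n m B W) ⟨c, hW⟩ ⟨c, hW⟩
      (pushHom φ) :=
  isMorphism_changeHom hW hW (fun _ _ => rfl) (fun _ => rfl)

theorem coeffwise_tmap_tmap {W'' : Opens M.carrier} {A' A'' : WeilSuperalgebra}
    {f : M.sec W →ₗ[ℝ] M.sec W'} {g : M.sec W' →ₗ[ℝ] M.sec W''} {h : M.sec W →ₗ[ℝ] M.sec W''}
    {φ : A →ₗ[ℝ] A'} {ψ : A' →ₗ[ℝ] A''} {χ : A →ₗ[ℝ] A''} (hf : ∀ s, g (f s) = h s)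
    (hφ : ∀ a, ψ (φ a) = χ a) (F : Mom M n m A W) :
    (coeffwise (tmap (tmap g ψ) LinearMap.id) (coeffwise (tmap (tmap f φ) LinearMap.id) F) :
      Mom M n m A'' W'') = coeffwise (tmap (tmap h χ) LinearMap.id) F := by
  ext d
  rw [coeff_coeffwise, coeff_coeffwise, coeff_coeffwise]
  generalize MvPowerSeries.coeff d F = x
  induction x using tensor_induction with
  | hadd x y hx hy => simp only [map_add, hx, hy]
  | h i j r hr b _ =>
    rw [tmap_stmul, tmap_stmul, tmap_stmul]
    congr 1
    clear hr
    induction r using tensor_induction with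
    | hadd x y hx hy => simp only [map_add, hx, hy]
    | h i j s _ b _ => rw [tmap_stmul, tmap_stmul, tmap_stmul, hf, hφ]

theorem resMom_resMom {W'' : Opens M.carrier} (h : W' ≤ W) (h' : W'' ≤ W') (F : Mom M n m A W) :
    resMom h' (resMom h F) = resMom (h'.trans h) F :=
  coeffwise_tmap_tmap (fun s => M.res_res h' h s) (fun _ => rfl) F

theorem pushMom_pushMom {C : WeilSuperalgebra} (φ : WeilSuperalgebra.Hom A B)
    (ψ : WeilSuperalgebra.Hom B C) (F : Mom M n m A W) :
    pushMom ψ (pushMom φ F) = pushMom (ψ.comp φ) F :=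
  coeffwise_tmap_tmap (fun _ => rfl) (fun _ => rfl) F

theorem pushMom_resMom (h : W' ≤ W) (φ : WeilSuperalgebra.Hom A B) (F : Mom M n m A W) :
    pushMom φ (resMom h F) = resMom h (pushMom φ F) :=
  (coeffwise_tmap_tmap (h := (M.res h).toLinearMap) (χ := φ.toAlgHom.toLinearMap) (fun _ => rfl)
    (fun _ => rfl) F).trans (coeffwise_tmap_tmap (fun _ => rfl) (fun _ => rfl) F).symm

theorem coeffwise_tmap_tmap_id {f : M.sec W →ₗ[ℝ] M.sec W} {φ : A →ₗ[ℝ] A}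
    (hf : ∀ s, f s = s) (hφ : ∀ a, φ a = a) (F : Mom M n m A W) :
    coeffwise (tmap (tmap f φ) LinearMap.id) F = F := by
  obtain rfl : f = LinearMap.id := LinearMap.ext hf
  obtain rfl : φ = LinearMap.id := LinearMap.ext hφ
  ext d
  rw [coeff_coeffwise]
  have : (tmap LinearMap.id LinearMap.id : Fun M A W →ₗ[ℝ] Fun M A W) = LinearMap.id :=
    LinearMap.ext tmap_id
  rw [this, tmap_id]

theorem pushMom_id (F : Mom M n m A W) : pushMom (.id A) F = F :=
  coeffwise_tmap_tmap_id (fun _ => rfl) (fun _ => rfl) F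

/-! ### Reduction modulo the maximal ideal -/

theorem sub_tmap_aug_mem (x : STensor (Fun M A W) (Grassmann m)) :
    x - tmap (tmap LinearMap.id (A.unit.comp A.reduction).toAlgHom.toLinearMap) LinearMap.id x
      ∈ bifil M m A W (1, 0) := by
  induction x using tensor_induction with
  | hadd x y hx hy =>
    rw [map_add, add_sub_add_comm]
    exact Submodule.add_mem _ hx hy
  | h i j r hr b _ =>
    rw [tmap_stmul, LinearMap.id_apply]
    have h : stmul r b - stmul (tmap LinearMap.id
        (A.unit.comp A.reduction).toAlgHom.toLinearMap r) b
        = stmul (r - tmap LinearMap.id (A.unit.comp A.reduction).toAlgHom.toLinearMap r) b := by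
      rw [sub_eq_iff_eq_add, ← add_stmul, sub_add_cancel]
    rw [h]
    refine stmul_mem_tens ?_ (by rw [idealPow_zero]; trivial)
    clear hr h
    induction r using tensor_induction with
    | hadd x y hx hy =>
      rw [map_add, add_sub_add_comm]
      exact Submodule.add_mem _ hx hy
    | h i j s _ a _ =>
      rw [tmap_stmul, LinearMap.id_apply]
      have h : stmul s a - stmul s ((A.unit.comp A.reduction).toAlgHom.toLinearMap a)
          = stmul s (a - (A.unit.comp A.reduction).toAlgHom.toLinearMap a) := by
        rw [sub_eq_iff_eq_add, ← stmul_add, sub_add_cancel]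
      rw [h]
      refine stmul_mem_tens Submodule.mem_top (le_idealPow_one ?_)
      rw [WeilSuperalgebra.mem_maxIdeal, map_sub, sub_eq_zero]
      exact (A.aug.commutes (A.aug a)).symm

theorem idealPow_maxIdeal_one : idealPow A.maxIdeal 1 = A.maxIdeal := by
  refine le_antisymm ?_ le_idealPow_one
  rw [idealPow, pow_one, Submodule.mul_le]
  intro a ha b _
  rw [WeilSuperalgebra.mem_maxIdeal] at *
  rw [map_mul, ha, zero_mul]

/-- Subtracting from F its reduction, viewed again over A, leaves coefficients in 𝔪. This translates
"identity modulo 𝔪" into the nilpotent filtration. -/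
theorem pushMom_reduction_eq_zero {F : Mom M n m A W} :
    pushMom A.reduction F = 0 ↔ F ∈ nilFil M n m A W 1 := by
  constructor
  · intro h d
    have h1 : pushMom A.unit (pushMom A.reduction F) = 0 := by rw [h, map_zero]
    rw [pushMom_pushMom] at h1
    have h2 := congrArg (MvPowerSeries.coeff d) h1
    have h3 := sub_tmap_aug_mem (MvPowerSeries.coeff d F)
    have h4 : tmap (tmap LinearMap.id (A.unit.comp A.reduction).toAlgHom.toLinearMap)
        LinearMap.id (MvPowerSeries.coeff d F) = 0 := h2
    rwa [h4, sub_zero] at h3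
  · intro h
    ext d
    have hd : MvPowerSeries.coeff d F ∈ bifil M m A W (1, 0) := h d
    have : bifil M m A W (1, 0) ≤ LinearMap.ker (tmap (pushFun A.reduction) LinearMap.id) := by
      refine tens_le fun v hv w _ => ?_
      rw [LinearMap.mem_ker, tmap_stmul]
      have : tens ⊤ (idealPow A.maxIdeal 1) ≤ LinearMap.ker (pushFun (M := M) (W := W)
          A.reduction) := by
        refine tens_le fun s _ a ha => ?_
        rw [idealPow_maxIdeal_one] at ha
        have ha' : A.reduction.toAlgHom.toLinearMap a = 0 := ha
        rw [LinearMap.mem_ker, pushFun, tmap_stmul, ha', stmul_zero]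
      have hv' := this hv
      rw [LinearMap.mem_ker] at hv'
      rw [hv', zero_stmul]
    exact this hd

theorem pushMom_zc {c : SuperChart M n m} (hW : W ≤ c.dom) (φ : WeilSuperalgebra.Hom A B)
    (a : Idx n m) : pushMom φ (zc hW a : Mom M n m A W) = zc hW a :=
  (isMorphism_pushHom hW φ).crd (.inl a)

theorem pushMom_idGen {c : SuperChart M n m} (hW : W ≤ c.dom) (φ : WeilSuperalgebra.Hom A B) :
    pushMom φ (idGen hW : Mom M n m A W) = idGen hW :=
  (isMorphism_pushHom hW φ).gen

theorem resMom_idGen {c : SuperChart M n m} (hW : W ≤ c.dom) (h : W' ≤ W) :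
    resMom h (idGen hW : Mom M n m A W) = idGen (h.trans hW) :=
  (isMorphism_resHom hW h).gen

theorem isBase_iff {c : SuperChart M n m} (hW : W ≤ c.dom) (y : Idx n m → Mom M n m A W) :
    (phaseSpace M n m A W).IsBase ⟨c, hW⟩ y ↔ (∀ a, parMom (y a) = sgn (ix a) • y a) ∧
      ∀ a, pushMom A.reduction (y a) = zc hW a := by
  have h : ∀ a, pushMom A.reduction (y a) = zc hW a
      ↔ y a - zc hW a ∈ nilFil M n m A W 1 := fun a => by
    rw [← pushMom_reduction_eq_zero, map_sub, pushMom_zc, sub_eq_zero]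
  constructor
  · intro hy
    exact ⟨hy.mem, fun a => (h a).mpr (hy.near a)⟩
  · intro hy
    exact ⟨hy.1, fun a => (h a).mp (hy.2 a)⟩

/-- The elimination of intermediate variables in terms of the phase space. -/
theorem isElimination_iff {c : SuperChart M n m} (hW : W ≤ c.dom) (F S G : Mom M n m A W) :
    IsElimination hW F S G ↔ (phaseSpace M n m A W).Elim ⟨c, hW⟩ F S G := by
  have hp : ∀ (q : Idx n m → Mom M n m A W) (a : Idx n m),
      (phaseSpace M n m A W).eliminationPositions ⟨c, hW⟩ S q a
        = sgn (ix a) • subst hW (zc hW) q (dp a S) := fun q a => by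
    rw [← dpLin_apply]
    rfl
  constructor
  · rintro ⟨y, q, hy, hq, hr, h1, h2, h3⟩
    exact ⟨y, q, (isBase_iff hW y).mpr ⟨hy, hr⟩, hq, funext fun a => (h1 a).symm,
      funext fun a => (hp q a).trans (h2 a).symm, h3⟩
  · rintro ⟨y, q, h⟩
    have hb := (isBase_iff hW y).mp h.base
    exact ⟨y, q, hb.1, h.mem, hb.2, fun a => (congrFun h.momenta a).symm,
      fun a => (congrFun h.positions a).symm.trans (hp q a), h.eq⟩

theorem nearId_iff {c : SuperChart M n m} (hW : W ≤ c.dom) (S : Mom M n m A W) :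
    (phaseSpace M n m A W).NearId ⟨c, hW⟩ S ↔ parMom S = S ∧
      pushMom A.reduction S = idGen hW := by
  have h : pushMom A.reduction S = idGen hW ↔ S - idGen hW ∈ nilFil M n m A W 1 := by
    rw [← pushMom_reduction_eq_zero, map_sub, pushMom_idGen, sub_eq_zero]
  constructor
  · intro hS
    exact ⟨mem_homog_zero.mp hS.even, h.mpr hS.near⟩
  · intro hS
    exact ⟨mem_homog_zero.mpr hS.1, h.mp hS.2⟩

end Mom

namespace PhaseSpace

variable {R : Type*} [Ring R] [Algebra ℝ R] [Superalgebra R] {ι κ : Type*} [Fintype ι]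
  [DecidableEq ι] {Q : PhaseSpace R ι κ} {c c' : κ} {F S T X X' : R}

/-! #### Change of coordinates -/

/-- An elimination in one system of coordinates may be performed in another one. -/
theorem Elim.change {G : R} (hF : Q.IsSmall F) (hS : Q.NearId c S)
    (hST : Q.Elim c (Q.gen c') S T) (h : Q.Elim c F S G) : Q.Elim c' F T G :=
  Elim.assoc hF (nearId_gen c') hS (elim_gen_right hF) hST h

/-- Changing charts is composing on the left with x'p', so the claim is the associativity of x'p', Φ
and Ψ, after the elimination of Φ' with Ψ has been moved to the other chart. -/
theorem compat_mul {Φ Φ' Ψ Ψ' Θ Θ' : R} (hΦ : Q.NearId c Φ) (hΨ : Q.NearId c Ψ)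
    (hcΦ : Q.Elim c (Q.gen c') Φ Φ') (hcΨ : Q.Elim c (Q.gen c') Ψ Ψ')
    (h : Q.Elim c Φ Ψ Θ) (h' : Q.Elim c' Φ' Ψ' Θ') : Q.Elim c (Q.gen c') Θ Θ' := by
  have hΦ' := hcΦ.nearId (nearId_gen c') hΦ
  have hΨ' := hcΨ.nearId (nearId_gen c') hΨ
  obtain ⟨Z, hZ⟩ := exists_elim hΦ'.isSmall hΨ
  obtain rfl := (Elim.change hΦ'.isSmall hΨ hcΨ hZ).unique h' hΦ'.isSmall hΨ'
  exact Elim.assoc (isSmall_gen c') hΦ hΨ hcΦ h hZ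

/-- Transform X to the other chart as F. Associativity shows that F is also a left inverse of S',
and right cancellation gives F = X'. -/
theorem compat_inv {S' : R} (hS : Q.NearId c S) (hX : Q.NearId c X) (hX' : Q.NearId c' X')
    (hcS : Q.Elim c (Q.gen c') S S') (h : Q.Elim c X S (Q.gen c))
    (h' : Q.Elim c' X' S' (Q.gen c')) : Q.Elim c (Q.gen c') X X' := by
  have hS' := hcS.nearId (nearId_gen c') hS
  obtain ⟨F, hF⟩ := exists_elim (isSmall_gen c') hX
  have hFn := hF.nearId (nearId_gen c') hX
  obtain ⟨Z, hZ⟩ := exists_elim hFn.isSmall hS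
  obtain rfl := (Elim.assoc (isSmall_gen c') hX hS hF h hZ).unique
    (elim_gen_right (isSmall_gen c')) (isSmall_gen c') (nearId_gen c)
  obtain rfl := (Elim.change hFn.isSmall hS hcS hZ).cancel h' hFn hX' hS'
  exact hF

end PhaseSpace

/-! ### The group of thick diffeomorphisms -/

section Group

open PhaseSpace

variable {n m : ℕ} {M : Supermanifold.{u} n m} {A B : WeilSuperalgebra}

namespace ThickPoint

theorem nearId (Φ : ThickPoint M A) (c : Chart M) :
    (phaseSpace M.toSuperSpace n m A c.dom).NearId ⟨c, le_rfl⟩ (Φ.gen c) :=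
  (nearId_iff le_rfl _).mpr ⟨Φ.even c, Φ.reduces c⟩

theorem nearId_res (Φ : ThickPoint M A) (c : Chart M) {W : Opens M.carrier} (h : W ≤ c.dom) :
    (phaseSpace M.toSuperSpace n m A W).NearId ⟨c, h⟩ (resMom h (Φ.gen c)) :=
  (isMorphism_resHom le_rfl h).nearId (Φ.nearId c)

theorem elim_compat (Φ : ThickPoint M A) (c c' : Chart M) :
    (phaseSpace M.toSuperSpace n m A (c.dom ⊓ c'.dom)).Elim ⟨c, inf_le_left⟩
      ((phaseSpace M.toSuperSpace n m A (c.dom ⊓ c'.dom)).gen ⟨c', inf_le_right⟩)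
      (resMom inf_le_left (Φ.gen c)) (resMom inf_le_right (Φ.gen c')) :=
  (isElimination_iff _ _ _ _).mp (Φ.compat c c')

theorem exists_of_family (S : ∀ c : Chart M, Mom M.toSuperSpace n m A c.dom)
    (hS : ∀ c, (phaseSpace M.toSuperSpace n m A c.dom).NearId ⟨c, le_rfl⟩ (S c))
    (hc : ∀ c c' : Chart M, (phaseSpace M.toSuperSpace n m A (c.dom ⊓ c'.dom)).Elim
      ⟨c, inf_le_left⟩
      ((phaseSpace M.toSuperSpace n m A (c.dom ⊓ c'.dom)).gen ⟨c', inf_le_right⟩)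
      (resMom inf_le_left (S c)) (resMom inf_le_right (S c'))) :
    ∃ Φ : ThickPoint M A, Φ.gen = S :=
  ⟨{ gen := S
     even := fun c => ((nearId_iff le_rfl _).mp (hS c)).1
     reduces := fun c => ((nearId_iff le_rfl _).mp (hS c)).2
     compat := fun c c' => (isElimination_iff _ _ _ _).mpr (hc c c') }, rfl⟩

theorem ext_gen {Φ Ψ : ThickPoint M A} (h : ∀ c, Φ.gen c = Ψ.gen c) : Φ = Ψ :=
  ThickPoint.ext (funext h)

end ThickPoint

theorem isComposition_iff {Φ Ψ Θ : ThickPoint M A} : IsComposition Φ Ψ Θ ↔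
    ∀ c, (phaseSpace M.toSuperSpace n m A c.dom).Elim ⟨c, le_rfl⟩ (Φ.gen c) (Ψ.gen c)
      (Θ.gen c) :=
  forall_congr' fun _ => isElimination_iff _ _ _ _

theorem Elim.res {c : Chart M} {F S G : Mom M.toSuperSpace n m A c.dom}
    {W : Opens M.carrier} (h : W ≤ c.dom)
    (hF : (phaseSpace M.toSuperSpace n m A c.dom).IsSmall F)
    (he : (phaseSpace M.toSuperSpace n m A c.dom).Elim ⟨c, le_rfl⟩ F S G) :
    (phaseSpace M.toSuperSpace n m A W).Elim ⟨c, h⟩ (resMom h F) (resMom h S) (resMom h G) :=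
  (isMorphism_resHom le_rfl h).elim hF he

theorem exists_isComposition (Φ Ψ : ThickPoint M A) : ∃ Θ, IsComposition Φ Ψ Θ := by
  choose S hS using fun c : Chart M => exists_elim (Φ.nearId c).isSmall (Ψ.nearId c)
  obtain ⟨Θ, rfl⟩ := ThickPoint.exists_of_family S
    (fun c => (hS c).nearId (Φ.nearId c) (Ψ.nearId c)) fun c c' =>
      compat_mul (Φ.nearId_res c inf_le_left) (Ψ.nearId_res c inf_le_left) (Φ.elim_compat c c')
        (Ψ.elim_compat c c') (Elim.res inf_le_left (Φ.nearId c).isSmall (hS c))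
        (Elim.res inf_le_right (Φ.nearId c').isSmall (hS c'))
  exact ⟨Θ, isComposition_iff.mpr hS⟩

theorem IsComposition.unique {Φ Ψ Θ Θ' : ThickPoint M A} (h : IsComposition Φ Ψ Θ)
    (h' : IsComposition Φ Ψ Θ') : Θ = Θ' :=
  ThickPoint.ext_gen fun c => (isComposition_iff.mp h c).unique (isComposition_iff.mp h' c)
    (Φ.nearId c).isSmall (Ψ.nearId c)

theorem exists_one (M : Supermanifold.{u} n m) (A : WeilSuperalgebra) :
    ∃ Φ : ThickPoint M A, ∀ c, Φ.gen c = idGen (le_refl c.dom) := by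
  refine (ThickPoint.exists_of_family (fun c => idGen (le_refl c.dom)) (fun c => nearId_gen _) fun c c' => ?_).imp
    fun Φ h => congrFun h
  rw [resMom_idGen, resMom_idGen]
  exact elim_gen_right (isSmall_gen _)

theorem exists_inv (Φ : ThickPoint M A) : ∃ Ψ : ThickPoint M A,
    ∀ c, (phaseSpace M.toSuperSpace n m A c.dom).Elim ⟨c, le_rfl⟩ (Ψ.gen c) (Φ.gen c)
      (idGen (le_refl c.dom)) := by
  choose X hX hXe using fun c : Chart M => exists_left_inverse (Φ.nearId c)
  have hr : ∀ (c : Chart M) {W : Opens M.carrier} (h : W ≤ c.dom),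
      (phaseSpace M.toSuperSpace n m A W).Elim ⟨c, h⟩ (resMom h (X c)) (resMom h (Φ.gen c))
        (idGen h) := fun c W h => by
    have := Elim.res h (hX c).isSmall (hXe c)
    rwa [show resMom h ((phaseSpace M.toSuperSpace n m A c.dom).gen ⟨c, le_rfl⟩) = idGen h from
      resMom_idGen le_rfl h] at this
  obtain ⟨Ψ, rfl⟩ := ThickPoint.exists_of_family X hX fun c c' =>
    compat_inv (Φ.nearId_res c inf_le_left)
      ((isMorphism_resHom le_rfl inf_le_left).nearId (hX c))
      ((isMorphism_resHom le_rfl inf_le_right).nearId (hX c')) (Φ.elim_compat c c')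
      (hr c inf_le_left) (hr c' inf_le_right)
  exact ⟨Ψ, hXe⟩

theorem exists_push (φ : WeilSuperalgebra.Hom A B) (Φ : ThickPoint M A) :
    ∃ Ψ : ThickPoint M B, ∀ c, Ψ.gen c = pushMom φ (Φ.gen c) := by
  refine (ThickPoint.exists_of_family (fun c => pushMom φ (Φ.gen c))
    (fun c => (isMorphism_pushHom le_rfl φ).nearId (Φ.nearId c)) fun c c' => ?_).imp
    fun Ψ h => congrFun h
  have h := (isMorphism_pushHom inf_le_left φ).elim (isSmall_gen _) (Φ.elim_compat c c')
  rw [← pushMom_resMom, ← pushMom_resMom]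
  rwa [show pushHom φ ((phaseSpace M.toSuperSpace n m A (c.dom ⊓ c'.dom)).gen
    ⟨c', inf_le_right⟩) = (phaseSpace M.toSuperSpace n m B (c.dom ⊓ c'.dom)).gen
    ⟨c', inf_le_right⟩ from pushMom_idGen _ φ] at h

variable (M) in
/-- The formal supergroup of thick diffeomorphisms. -/
def thickGroup : FormalSupergroup (ThickPoint M) where
  mul Φ Ψ := (exists_isComposition Φ Ψ).choose
  one A := (exists_one M A).choose
  inv Φ := (exists_inv Φ).choose
  map φ Φ := (exists_push φ Φ).choose
  mul_assoc {A} x y z := by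
    have h1 := isComposition_iff.mp (exists_isComposition x y).choose_spec
    have h2 := isComposition_iff.mp (exists_isComposition y z).choose_spec
    have h3 := isComposition_iff.mp
      (exists_isComposition (exists_isComposition x y).choose z).choose_spec
    have h4 := (exists_isComposition x (exists_isComposition y z).choose).choose_spec
    refine IsComposition.unique (isComposition_iff.mpr fun c => ?_) h4
    exact Elim.assoc (x.nearId c).isSmall (y.nearId c) (z.nearId c) (h1 c) (h2 c) (h3 c)
  one_mul {A} x := by
    refine ((exists_isComposition _ x).choose_spec).unique (isComposition_iff.mpr fun c => ?_)
    rw [(exists_one M A).choose_spec]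
    exact elim_gen_left (x.nearId c)
  mul_one {A} x := by
    refine ((exists_isComposition x _).choose_spec).unique (isComposition_iff.mpr fun c => ?_)
    rw [(exists_one M A).choose_spec]
    exact elim_gen_right (x.nearId c).isSmall
  inv_mul {A} x := by
    refine ((exists_isComposition _ x).choose_spec).unique (isComposition_iff.mpr fun c => ?_)
    rw [(exists_one M A).choose_spec]
    exact (exists_inv x).choose_spec c
  map_mul {A B} φ x y := by
    refine IsComposition.unique (isComposition_iff.mpr fun c => ?_)
      (exists_isComposition _ _).choose_spec
    rw [(exists_push φ x).choose_spec, (exists_push φ y).choose_spec,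
      (exists_push φ (exists_isComposition x y).choose).choose_spec]
    exact (isMorphism_pushHom le_rfl φ).elim (x.nearId c).isSmall
      (isComposition_iff.mp (exists_isComposition x y).choose_spec c)
  map_id {A} x := ThickPoint.ext_gen fun c => by
    rw [(exists_push _ x).choose_spec, pushMom_id]
  map_comp {A B C} ψ φ x := ThickPoint.ext_gen fun c => by
    rw [(exists_push _ x).choose_spec, (exists_push ψ _).choose_spec,
      (exists_push φ x).choose_spec, pushMom_pushMom]
  trivial x := ThickPoint.ext_gen fun c => by
    rw [(exists_one M _).choose_spec, ← x.reduces c]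
    exact (coeffwise_tmap_tmap_id (fun _ => rfl) (fun _ => rfl) _).symm

theorem isComposition_thickGroup {Φ Ψ Θ : ThickPoint M A} :
    IsComposition Φ Ψ Θ ↔ Θ = (thickGroup M).mul Φ Ψ :=
  ⟨fun h => h.unique (exists_isComposition Φ Ψ).choose_spec, fun h => by
    rw [h]
    exact (exists_isComposition Φ Ψ).choose_spec⟩

theorem elim_mul (Φ Ψ : ThickPoint M A) (c : Chart M) :
    (phaseSpace M.toSuperSpace n m A c.dom).Elim ⟨c, le_rfl⟩ (Φ.gen c) (Ψ.gen c)
      (((thickGroup M).mul Φ Ψ).gen c) :=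
  isComposition_iff.mp (isComposition_thickGroup.mpr rfl) c

theorem one_gen (c : Chart M) : ((thickGroup M).one A).gen c = idGen (le_refl c.dom) :=
  (exists_one M A).choose_spec c

theorem map_gen (φ : WeilSuperalgebra.Hom A B) (Φ : ThickPoint M A) (c : Chart M) :
    ((thickGroup M).map φ Φ).gen c = pushMom φ (Φ.gen c) :=
  (exists_push φ Φ).choose_spec c

end Group

/-! ### Functions on the base -/

section Fun

variable {M : SuperSpace.{u}} {n m : ℕ} {A B : WeilSuperalgebra} {W W' : Opens M.carrier}

theorem const_injective {f g : Fun M A W} (h : (const f : Mom M n m A W) = const g) : f = g := by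
  have h0 := congrArg (fun F => slice ExteriorAlgebra.algebraMapInv.toLinearMap
    (MvPowerSeries.constantCoeff F)) h
  simpa [const, slice_stmul] using h0

theorem resMom_const (h : W' ≤ W) (f : Fun M A W) :
    resMom h (const f : Mom M n m A W) = const (resFun h f) :=
  changeHom_const (φ := .id A) (hf := M.res_par h) f

theorem pushMom_const (φ : WeilSuperalgebra.Hom A B) (f : Fun M A W) :
    pushMom φ (const f : Mom M n m A W) = const (pushFun φ f) :=
  changeHom_const (f := AlgHom.id ℝ (M.sec W)) (hf := fun _ => rfl) f

theorem const_mem_iff {i : ZMod 2} {f : Fun M A W} :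
    (const f : Mom M n m A W) ∈ homog _ i ↔ f ∈ homog _ i := by
  refine ⟨fun h => ?_, const_mem⟩
  have e : Superalgebra.par (const f : Mom M n m A W) = const (Superalgebra.par f) := by
    rw [const, par_C, par_stmul, map_one]
    rfl
  rw [mem_homog, e, ← constHom_apply, ← constHom_apply, ← map_smul] at h
  exact const_injective h

theorem resFun_resFun {W'' : Opens M.carrier} (h : W' ≤ W) (h' : W'' ≤ W') (f : Fun M A W) :
    resFun h' (resFun h f) = resFun (h'.trans h) f := by
  have := resMom_resMom (n := 0) (m := 0) h h' (const f)
  rw [resMom_const, resMom_const, resMom_const] at this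
  exact const_injective this

theorem pushFun_resFun (h : W' ≤ W) (φ : WeilSuperalgebra.Hom A B) (f : Fun M A W) :
    pushFun φ (resFun h f) = resFun h (pushFun φ f) := by
  have := pushMom_resMom (n := 0) (m := 0) h φ (const f)
  rw [resMom_const, pushMom_const, pushMom_const, resMom_const] at this
  exact const_injective this

theorem resFun_mem {i : ZMod 2} (h : W' ≤ W) {f : Fun M A W} (hf : f ∈ homog _ i) :
    resFun h f ∈ homog _ i := by
  rw [mem_homog] at *
  have := tmap_par (M.res h).toLinearMap (LinearMap.id : A →ₗ[ℝ] A) (M.res_par h) (fun _ => rfl) f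
  rw [hf, map_smul] at this
  exact this.symm

theorem sec_glue {ι : Type u} {U : ι → Opens M.carrier} (hU : ⨆ i, U i = ⊤)
    (s : ∀ i, M.sec (U i)) (hs : ∀ i j, M.res (inf_le_left : U i ⊓ U j ≤ U i) (s i)
      = M.res inf_le_right (s j)) : ∃! t : M.sec ⊤, ∀ i, M.res le_top t = s i := by
  obtain ⟨t, ht, hu⟩ := M.glue U s hs
  refine ⟨M.res hU.ge t, fun i => ?_, fun t' ht' => ?_⟩
  · rw [M.res_res]
    exact ht i
  · have h := hu (M.res le_top t') fun i => by
      rw [M.res_res]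
      exact ht' i
    rw [← h, M.res_res, M.res_refl]

/-- A is finite-dimensional, so the components with respect to a basis of A can be glued one by one.
-/
theorem fun_glue {ι : Type u} {U : ι → Opens M.carrier} (hU : ⨆ i, U i = ⊤)
    (f : ∀ i, Fun M A (U i)) (hf : ∀ i j, resFun (inf_le_left : U i ⊓ U j ≤ U i) (f i)
      = resFun inf_le_right (f j)) : ∃ g : Fun M A ⊤, ∀ i, resFun le_top g = f i := by
  let b := Module.finBasis ℝ A
  have hg := fun k => (sec_glue hU (fun i => slice (b.coord k) (f i)) fun i j => by
    have := congrArg (slice (b.coord k)) (hf i j)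
    rwa [resFun, resFun, slice_tmap, slice_tmap] at this).exists
  choose t ht using hg
  refine ⟨∑ k, stmul (t k) (b k), fun i => ?_⟩
  rw [eq_sum_slice b (f i), map_sum]
  refine Finset.sum_congr rfl fun k _ => ?_
  rw [resFun, tmap_stmul, ← ht k i]
  rfl

theorem fun_separated {ι : Type u} {U : ι → Opens M.carrier} (hU : ⨆ i, U i = ⊤)
    {f g : Fun M A ⊤} (h : ∀ i, resFun (le_top : U i ≤ ⊤) f = resFun le_top g) : f = g := by
  refine slice_ext fun l => ?_
  have h' : ∀ i, M.res (le_top : U i ≤ ⊤) (slice l f) = M.res le_top (slice l g) := fun i => by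
    have := congrArg (slice l) (h i)
    rwa [resFun, slice_tmap, slice_tmap] at this
  refine (sec_glue hU (fun i => M.res le_top (slice l f)) fun i j => ?_).unique (fun _ => rfl)
    fun i => (h' i).symm
  rw [M.res_res, M.res_res]

end Fun

/-! ### Nonlinear pullbacks of functions -/

section Pullback

open PhaseSpace

variable {n m : ℕ} {M : Supermanifold.{u} n m} {A B : WeilSuperalgebra}

theorem iSup_chart_dom (M : Supermanifold.{u} n m) : ⨆ c : Chart M, c.dom = ⊤ := by
  refine top_le_iff.mp fun x _ => ?_
  obtain ⟨c, hc⟩ := M.exists_chart x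
  exact Opens.mem_iSup.mpr ⟨c, hc⟩

theorem isPullback_iff {Φ : ThickPoint M A} {f g : Fun M.toSuperSpace A ⊤} :
    IsPullback Φ f g ↔ ∀ c : Chart M, (phaseSpace M.toSuperSpace n m A c.dom).Elim ⟨c, le_rfl⟩
      (const (resFun le_top f)) (Φ.gen c) (const (resFun le_top g)) :=
  forall_congr' fun _ => isElimination_iff _ _ _ _

theorem isSmall_const {W : Opens M.carrier} {f : Fun M.toSuperSpace A ⊤}
    (hf : f ∈ formalFunctions M A) :
    (phaseSpace M.toSuperSpace n m A W).IsSmall (const (resFun le_top f)) where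
  even := const_mem (resFun_mem _ hf.1)
  fil := nilFil_le_momFil (pushMom_reduction_eq_zero.mp (by
    rw [pushMom_const, pushFun_resFun, hf.2, map_zero, const_zero]))

/-- Compatible local pullbacks of a function define a global one. -/
theorem exists_isPullback {Φ : ThickPoint M A} {f : Fun M.toSuperSpace A ⊤}
    (g : ∀ c : Chart M, Fun M.toSuperSpace A c.dom)
    (hg : ∀ (c : Chart M) G, (phaseSpace M.toSuperSpace n m A c.dom).Elim ⟨c, le_rfl⟩
      (const (resFun le_top f)) (Φ.gen c) G ↔ G = const (g c))
    (hc : ∀ c c' : Chart M, resFun (inf_le_left : c.dom ⊓ c'.dom ≤ c.dom) (g c)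
      = resFun inf_le_right (g c')) :
    ∃ g₀ : Fun M.toSuperSpace A ⊤, (∀ g', IsPullback Φ f g' ↔ g' = g₀) ∧
      ∀ c : Chart M, resFun le_top g₀ = g c := by
  obtain ⟨g₀, hg₀⟩ := fun_glue (iSup_chart_dom M) g hc
  refine ⟨g₀, fun g' => ?_, hg₀⟩
  rw [isPullback_iff]
  constructor
  · intro h
    refine fun_separated (iSup_chart_dom M) fun c => ?_
    rw [hg₀ c]
    exact const_injective ((hg c _).mp (h c))
  · rintro rfl c
    exact (hg c _).mpr (by rw [hg₀ c])

/-- In each chart the elimination exists uniquely and does not involve momenta. On overlaps the two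
local results agree, since the elimination may be carried out in either chart, and the sheaf
property glues them. The result differs from f by nilpotent terms, so it stays zero modulo 𝔪. -/
theorem exists_pullback (Φ : ThickPoint M A) {f : Fun M.toSuperSpace A ⊤}
    (hf : f ∈ formalFunctions M A) :
    ∃ g ∈ formalFunctions M A, ∀ g', IsPullback Φ f g' ↔ g' = g := by
  have hex : ∀ c : Chart M, ∃ g : Fun M.toSuperSpace A c.dom,
      (phaseSpace M.toSuperSpace n m A c.dom).Elim ⟨c, le_rfl⟩
        (const (resFun le_top f)) (Φ.gen c) (const g) := fun c => by
    obtain ⟨G, hG⟩ := exists_elim (isSmall_const hf) (Φ.nearId c)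
    obtain ⟨g, hg⟩ := exists_const_eq_zeroSection G
    have hz : zeroSection G = G := hG.zs_eq (isSmall_const hf) (zeroSection_const _)
    exact ⟨g, by rwa [← hg, hz]⟩
  choose g hg using hex
  have hu : ∀ (c : Chart M) G, (phaseSpace M.toSuperSpace n m A c.dom).Elim ⟨c, le_rfl⟩
      (const (resFun le_top f)) (Φ.gen c) G ↔ G = const (g c) := fun c G =>
    ⟨fun h => h.unique (hg c) (isSmall_const hf) (Φ.nearId c), fun h => h ▸ hg c⟩
  obtain ⟨g₀, h₀, hr⟩ := exists_isPullback g hu fun c c' => by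
    have h1 := Elim.res (inf_le_left : c.dom ⊓ c'.dom ≤ c.dom) (isSmall_const hf) (hg c)
    have h2 := Elim.res (inf_le_right : c.dom ⊓ c'.dom ≤ c'.dom) (isSmall_const hf) (hg c')
    rw [resMom_const, resMom_const, resFun_resFun] at h1 h2
    refine const_injective (n := n) (m := m) (Elim.unique ?_ h2 (isSmall_const hf)
      (Φ.nearId_res c' _))
    exact Elim.change (isSmall_const hf) (Φ.nearId_res c _) (Φ.elim_compat c c') h1
  have hs : ∀ c : Chart M, (phaseSpace M.toSuperSpace n m A c.dom).IsSmall (const (g c)) :=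
    fun c => (hg c).isSmall (isSmall_const hf) (Φ.nearId c)
  refine ⟨g₀, ⟨?_, ?_⟩, h₀⟩
  · rw [mem_homog_zero]
    refine fun_separated (iSup_chart_dom M) fun c => ?_
    have h1 := const_mem_iff.mp (hs c).even
    rw [← hr c, mem_homog_zero] at h1
    conv_rhs => rw [← h1]
    exact tmap_par _ _ (M.res_par _) (fun _ => rfl) _
  · refine fun_separated (iSup_chart_dom M) fun c => ?_
    have h1 := (hg c).sub_mem (isSmall_const hf) (Φ.nearId c)
    have h2 : pushMom A.reduction (const (g c) - const (resFun le_top f)) = 0 :=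
      pushMom_reduction_eq_zero.mpr h1
    rw [map_sub, pushMom_const, pushMom_const, pushFun_resFun, hf.2, map_zero, const_zero,
      sub_zero] at h2
    rw [map_zero, ← pushFun_resFun, hr c]
    exact const_injective (h2.trans const_zero.symm)

theorem isPullback_one {f : Fun M.toSuperSpace A ⊤} (hf : f ∈ formalFunctions M A) :
    IsPullback ((thickGroup M).one A) f f := isPullback_iff.mpr fun c => by
  rw [one_gen]
  exact elim_gen_right (isSmall_const hf)

theorem IsPullback.mul {Φ Ψ : ThickPoint M A} {f g h : Fun M.toSuperSpace A ⊤}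
    (hf : f ∈ formalFunctions M A) (hg : IsPullback Φ f g) (hh : IsPullback Ψ g h) :
    IsPullback ((thickGroup M).mul Φ Ψ) f h := isPullback_iff.mpr fun c =>
  Elim.assoc (isSmall_const hf) (Φ.nearId c) (Ψ.nearId c) (isPullback_iff.mp hg c)
    (elim_mul Φ Ψ c) (isPullback_iff.mp hh c)

theorem IsPullback.map (φ : WeilSuperalgebra.Hom A B) {Φ : ThickPoint M A}
    {f g : Fun M.toSuperSpace A ⊤} (hf : f ∈ formalFunctions M A) (hg : IsPullback Φ f g) :
    IsPullback ((thickGroup M).map φ Φ) (pushFun φ f) (pushFun φ g) :=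
  isPullback_iff.mpr fun c => by
    have := (isMorphism_pushHom le_rfl φ).elim (isSmall_const hf) (isPullback_iff.mp hg c)
    rwa [pushHom_apply, pushHom_apply, pushHom_apply, pushMom_const, pushMom_const, ← map_gen,
      pushFun_resFun, pushFun_resFun] at this

end Pullback

/-! ### First-order deformations of the identity -/

section Scale

variable {M : SuperSpace.{u}} {n m : ℕ} {A B : WeilSuperalgebra} {W : Opens M.carrier}
  {i : ZMod 2} {s : A}

theorem scal_mul (s t : A) : (scal (s * t) : Mom M n m A W) = scal s * scal t := by
  rw [scal, scal, scal, ← constHom_apply, ← constHom_apply, ← constHom_apply, ← map_mul,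
    stmul_mul_one_stmul]

theorem scal_smul (r : ℝ) (s : A) : (scal (r • s) : Mom M n m A W) = r • scal s := by
  rw [scal, scal, stmul_smul, ← constHom_apply, ← constHom_apply, map_smul]

theorem scal_zero : (scal (0 : A) : Mom M n m A W) = 0 := by rw [scal, stmul_zero, const_zero]

theorem scal_mul_self_eq_zero (hs2 : s * s = 0) :
    (scal s : Mom M n m A W) * scal s = 0 := by rw [← scal_mul, hs2, scal_zero]

theorem mem_maxIdeal_of_mul_self_eq_zero (hs2 : s * s = 0) : s ∈ A.maxIdeal := by
  have := congrArg A.aug hs2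
  rw [map_mul, map_zero] at this
  exact mul_self_eq_zero.mp this

theorem scal_mem_nilFil_one (hs2 : s * s = 0) : (scal s : Mom M n m A W) ∈ nilFil M n m A W 1 :=
  scal_mem_nilFil (le_idealPow_one (mem_maxIdeal_of_mul_self_eq_zero hs2))

variable (s) in
/-- The multiples of a parameter. -/
def multiples : WeilSuperalgebra.real →ₗ[ℝ] A where
  toFun r := (show ℝ from r) • s
  map_add' x y := add_smul (show ℝ from x) (show ℝ from y) s
  map_smul' x y := mul_smul x (show ℝ from y) s

theorem multiples_apply (r : WeilSuperalgebra.real) : multiples s r = (show ℝ from r) • s := rfl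

/-- Multiplication by a parameter becomes a coefficientwise map, with the parity involution
accounting for moving s past the function. In this form it can be inverted by a functional on A. -/
theorem scal_mul_push (hs : s ∈ homog A i) (F : Mom M n m .real W) :
    scal s * pushMom A.unit F = coeffwise (tmap
      (tmap (parPow (R := M.sec W) i).toLinearMap (multiples s)) LinearMap.id) F := by
  ext d
  rw [scal, const, MvPowerSeries.coeff_C_mul, coeff_coeffwise, pushMom, coeff_coeffwise]
  generalize MvPowerSeries.coeff d F = x
  induction x using tensor_induction with
  | hadd x y hx hy => simp only [map_add, mul_add, hx, hy]
  | h k l r hr b _ =>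
    rw [tmap_stmul, tmap_stmul, stmul_one_mul_stmul]
    congr 1
    clear hr
    induction r using tensor_induction with
    | hadd x y hx hy => simp only [map_add, mul_add, hx, hy]
    | h k l f _ r _ =>
      rw [pushFun, tmap_stmul, tmap_stmul, stmul_mul_stmul' _ hs, one_mul]
      congr 1
      rw [multiples_apply]
      exact ((Algebra.commutes (show ℝ from r) s).symm.trans
        (Algebra.smul_def (show ℝ from r) s).symm)

/-- A linear functional on A that is nonzero on s recovers F from sF. -/
theorem scal_mul_push_injective (hs : s ∈ homog A i) (hs0 : s ≠ 0) {F G : Mom M n m .real W}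
    (h : scal s * pushMom A.unit F = scal s * pushMom A.unit G) : F = G := by
  obtain ⟨g, hg⟩ : ∃ g : A →ₗ[ℝ] ℝ, g s ≠ 0 := by
    by_contra! h
    exact hs0 ((Module.forall_dual_apply_eq_zero_iff ℝ s).mp h)
  have key : ∀ F : Mom M n m .real W, coeffwise (tmap (tmap (parPow (R := M.sec W) i).toLinearMap
      (B' := WeilSuperalgebra.real) ((g s)⁻¹ • g : A →ₗ[ℝ] ℝ)) LinearMap.id)
      (scal s * pushMom A.unit F) = F := fun F => by
    rw [scal_mul_push hs]
    refine (coeffwise_tmap_tmap (h := LinearMap.id) (χ := LinearMap.id)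
      (A'' := WeilSuperalgebra.real) (fun f => parPow_self i f) (fun r => ?_) F).trans
      (coeffwise_tmap_tmap_id (fun _ => rfl) (fun _ => rfl) F)
    change ((g s)⁻¹ • g) ((show ℝ from r) • s) = (show ℝ from r)
    rw [map_smul, LinearMap.smul_apply, smul_eq_mul, smul_eq_mul, inv_mul_cancel₀ hg, mul_one]
  rw [← key F, h, key G]

theorem tau_mem_homog (i : ZMod 2) :
    WeilSuperalgebra.tau i ∈ homog (WeilSuperalgebra.dual i) i := by
  have := WeilSuperalgebra.tau_mem i 1
  rwa [one_smul] at this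

/-- The maximal ideal of the dual numbers is spanned by τ, so X is the τ-coefficient of F, up to the
sign of moving τ to the front. -/
theorem exists_eq_scal_tau_mul_push {F : Mom M n m (.dual i) W}
    (hF : F ∈ nilFil M n m (.dual i) W 1) :
    ∃ X : Mom M n m .real W, F = scal (WeilSuperalgebra.tau i)
      * pushMom (WeilSuperalgebra.unit (.dual i)) X := by
  let p : WeilSuperalgebra.dual i →ₗ[ℝ] WeilSuperalgebra.real :=
    { toFun := fun x => (show ℝ from TrivSqZeroExt.snd (show DualNumber ℝ from x))
      map_add' := fun _ _ => rfl
      map_smul' := fun _ _ => rfl }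
  -- The projection of the dual numbers onto their maximal ideal; it acts as the identity on
  -- coefficients in 𝔪.
  let q : WeilSuperalgebra.dual i →ₗ[ℝ] WeilSuperalgebra.dual i :=
    LinearMap.id - ((WeilSuperalgebra.unit (.dual i)).comp
      (WeilSuperalgebra.reduction (.dual i))).toAlgHom.toLinearMap
  refine ⟨coeffwise (tmap (tmap (parPow (R := M.sec W) i).toLinearMap p) LinearMap.id) F, ?_⟩
  rw [scal_mul_push (tau_mem_homog i)]
  refine Eq.trans ?_ (coeffwise_tmap_tmap (h := LinearMap.id) (χ := q)
    (fun f => parPow_self i f) (fun x => ?_) F).symm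
  · ext d
    rw [coeff_coeffwise]
    have h1 := hF d
    generalize MvPowerSeries.coeff d F = x at h1 ⊢
    have h2 : bifil M m (.dual i) W (1, 0) ≤ LinearMap.eqLocus LinearMap.id
        (tmap (tmap LinearMap.id q) LinearMap.id) := by
      refine tens_le fun v hv w _ => ?_
      rw [LinearMap.mem_eqLocus, LinearMap.id_apply, tmap_stmul, LinearMap.id_apply]
      congr 1
      have h3 : tens ⊤ (idealPow (WeilSuperalgebra.dual i).maxIdeal 1)
          ≤ LinearMap.eqLocus LinearMap.id (tmap (LinearMap.id : M.sec W →ₗ[ℝ] _) q) := by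
        refine tens_le fun f _ a ha => ?_
        rw [LinearMap.mem_eqLocus, LinearMap.id_apply, tmap_stmul, LinearMap.id_apply]
        congr 1
        rw [idealPow_maxIdeal_one] at ha
        have ha' : (WeilSuperalgebra.reduction (.dual i)).toAlgHom a = 0 := ha
        change a = a - (WeilSuperalgebra.unit (.dual i)).toAlgHom
          ((WeilSuperalgebra.reduction (.dual i)).toAlgHom a)
        rw [ha', map_zero, sub_zero]
      exact h3 hv
    exact h2 h1
  · have h : ∀ y : DualNumber ℝ,
        y.snd • DualNumber.eps = y - algebraMap ℝ (DualNumber ℝ) y.fst := fun y => by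
      ext <;> simp [TrivSqZeroExt.algebraMap_eq_inl]
    exact h x

theorem tau_ne_zero (i : ZMod 2) : WeilSuperalgebra.tau i ≠ 0 := fun h =>
  one_ne_zero (congrArg (fun x : DualNumber ℝ => x.snd) h : (1 : ℝ) = 0)

theorem tau_mul_tau (i : ZMod 2) : WeilSuperalgebra.tau i * WeilSuperalgebra.tau i = 0 :=
  DualNumber.eps_mul_eps

theorem ofDual_tau (hs : s ∈ homog A i) (hs2 : s * s = 0) :
    (WeilSuperalgebra.Hom.ofDual s hs hs2).toAlgHom (WeilSuperalgebra.tau i) = s := by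
  refine (WeilSuperalgebra.dualLift_apply A s hs2 _).trans ?_
  change algebraMap ℝ A (TrivSqZeroExt.fst (DualNumber.eps : DualNumber ℝ))
    + TrivSqZeroExt.snd (DualNumber.eps : DualNumber ℝ) • s = s
  rw [DualNumber.fst_eps, DualNumber.snd_eps, map_zero, zero_add, one_smul]

theorem push_unit_unique (φ : WeilSuperalgebra.Hom .real A) (F : Mom M n m .real W) :
    pushMom φ F = pushMom A.unit F := by
  obtain ⟨f, hf⟩ := φ
  obtain rfl : f = A.unit.toAlgHom := AlgHom.ext fun r =>
    (f.commutes (show ℝ from r)).trans (A.unit.toAlgHom.commutes (show ℝ from r)).symm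
  rfl

theorem push_scal (φ : WeilSuperalgebra.Hom A B) (s : A) :
    pushMom φ (scal s : Mom M n m A W) = scal (φ.toAlgHom s) :=
  changeHom_scal (f := AlgHom.id ℝ (M.sec W)) (hf := fun _ => rfl) s

theorem push_mul (φ : WeilSuperalgebra.Hom A B) (F G : Mom M n m A W) :
    pushMom φ (F * G) = pushMom φ F * pushMom φ G := map_mul (pushHom φ) F G

theorem push_mem {k : ZMod 2} (φ : WeilSuperalgebra.Hom A B) {F : Mom M n m A W}
    (hF : F ∈ homog _ k) : pushMom φ F ∈ homog _ k := by
  rw [mem_homog] at *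
  have h := changeHom_par (f := AlgHom.id ℝ (M.sec W)) (hf := fun _ => rfl) (φ := φ) F
  rw [hF, map_smul] at h
  exact h.symm

theorem res_mul {W' : Opens M.carrier} (h : W' ≤ W) (F G : Mom M n m A W) :
    resMom h (F * G) = resMom h F * resMom h G := map_mul (resHom h) F G

theorem res_scal {W' : Opens M.carrier} (h : W' ≤ W) (s : A) :
    resMom h (scal s : Mom M n m A W) = scal s :=
  changeHom_scal (φ := .id A) (hf := M.res_par h) s

theorem res_mem {k : ZMod 2} {W' : Opens M.carrier} (h : W' ≤ W) {F : Mom M n m A W}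
    (hF : F ∈ homog _ k) : resMom h F ∈ homog _ k := by
  rw [mem_homog] at *
  have h := changeHom_par (φ := .id A) (hf := M.res_par h) F
  rw [hF, map_smul] at h
  exact h.symm

theorem homog_of_scal_mul_push (hs : s ∈ homog A i) (hs0 : s ≠ 0) {X : Mom M n m .real W}
    (h : scal s * pushMom A.unit X ∈ homog (Mom M n m A W) 0) : X ∈ homog _ i := by
  have hp : Superalgebra.par (pushMom A.unit X : Mom M n m A W)
      = pushMom A.unit (Superalgebra.par X) :=
    (changeHom_par (f := AlgHom.id ℝ (M.sec W)) (hf := fun _ => rfl) (φ := A.unit) X).symm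
  have hsc : Superalgebra.par (scal s : Mom M n m A W) = sgn i • scal s := scal_mem hs
  rw [mem_homog_zero, map_mul, hp, hsc, smul_mul_assoc] at h
  rw [mem_homog]
  refine scal_mul_push_injective hs hs0 ?_
  rw [map_smul, mul_smul_comm, ← h, smul_smul, sgn_mul_self, one_smul]

end Scale

namespace PhaseSpace

/-! #### The cotangent lift of a change of coordinates -/

variable {R : Type*} [Ring R] [Algebra ℝ R] [Superalgebra R] {ι κ : Type*} [Fintype ι]
  [DecidableEq ι] {Q : PhaseSpace R ι κ} {c c' : κ} {F G : R} {i j : ZMod 2}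

variable (Q) in
/-- The momenta of the coordinate system `c` in terms of the coordinate system `c'`. -/
def liftMo (c c' : κ) (a : ι) : R := Q.D c (.inl a) (Q.gen c')

theorem liftMo_mem (a : ι) : Q.liftMo c c' a ∈ homog R (Q.ix a) := mem_homog_D_inl (gen_even c') c a

theorem liftMo_self (c : κ) : Q.liftMo c c = Q.mo c := funext fun a => D_inl_gen_self c a

theorem zs_gen (c : κ) : Q.zs (Q.gen c) = 0 := by simp [gen, Q.zs_crd_inr]

theorem zs_liftMo (a : ι) : Q.zs (Q.liftMo c c' a) = 0 := by
  rw [liftMo, ← Q.D_inl_zs, zs_gen, map_zero]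

theorem isMomenta_liftMo (c c' : κ) : Q.IsMomenta (Q.liftMo c c') where
  mem a := liftMo_mem a
  fil _ := Q.D_inl_mem_fil (gen_mem_fil c')

theorem isPoint_liftMo (c c' : κ) : Q.IsPoint c (Sum.elim (Q.po c) (Q.liftMo c c')) :=
  (isBase_po c).isPoint (isMomenta_liftMo c c')

variable (Q) in
/-- The transformation of functions on the cotangent bundle from `c` to `c'`. -/
def lift (c c' : κ) : R →ₐ[ℝ] R := subHom (isPoint_liftMo (Q := Q) c c')

theorem lift_apply (c c' : κ) (F : R) :
    Q.lift c c' F = Q.sub c (Sum.elim (Q.po c) (Q.liftMo c c')) F := rfl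

theorem isSubstitution_lift (c c' : κ) : Q.IsSubstitution (Q.lift c c') :=
  isSubstitution_subHom _

theorem lift_crd_inl (a : ι) : Q.lift c c' (Q.crd c (.inl a)) = Q.crd c (.inl a) := sub_crd _

theorem lift_crd_inr (a : ι) : Q.lift c c' (Q.crd c (.inr a)) = Q.liftMo c c' a := sub_crd _

theorem D_inr_liftMo (d a : ι) : Q.D c' (.inr d) (Q.liftMo c c' a)
    = (sgn (Q.ix d * Q.ix a) * sgn (Q.ix d)) • Q.D c (.inl a) (Q.crd c' (.inl d)) := by
  rw [liftMo, Q.D_inr c' c, D_D, D_inr_gen, map_smul, smul_smul]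
  rfl

/-- This is the chain rule: the Jacobian of c' with respect to c, contracted with the derivatives of
x^b along c', gives the Kronecker symbol. -/
theorem hamiltonian_liftMo_crd_inl (a b : ι) :
    Q.hamiltonian c' (Q.liftMo c c' a) (Q.crd c (.inl b)) = -(if a = b then 1 else 0) := by
  have h := Q.D_crd c (.inl a) (.inl b)
  rw [D_inl_eq_sum c c'] at h
  simp only [Sum.inl.injEq] at h
  rw [hamiltonian_apply', ← h, ← Finset.sum_neg_distrib]
  refine Finset.sum_congr rfl fun d _ => ?_
  rw [D_inr_crd_inl, mul_zero, zero_sub, parPow_of_mem (liftMo_mem a), map_smul, D_inr_liftMo,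
    smul_smul, smul_mul_assoc, smul_smul]
  congr 1
  rw [show sgn (Q.ix d) * (sgn (Q.ix d * Q.ix a) * (sgn (Q.ix d * Q.ix a) * sgn (Q.ix d)))
    = (sgn (Q.ix d) * sgn (Q.ix d)) * (sgn (Q.ix d * Q.ix a) * sgn (Q.ix d * Q.ix a)) by ring,
    sgn_mul_self, sgn_mul_self, one_mul, one_smul]

theorem hamiltonian_crd_inl_crd_inl (a b : ι) :
    Q.hamiltonian c' (Q.crd c (.inl a)) (Q.crd c (.inl b)) = 0 := by
  rw [hamiltonian_apply']
  refine Finset.sum_eq_zero fun d _ => ?_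
  rw [D_inr_crd_inl, mul_zero, zero_sub, parPow_of_mem (Q.crd_mem c _), map_smul, D_inr_crd_inl,
    smul_zero, zero_mul, smul_zero, neg_zero]

/-- Let X be the bracket. By the Jacobi identity X has zero bracket with every position, because the
brackets of transformed momenta with positions are constants; hence X does not depend on the
momenta. But the transformed momenta vanish on the zero section, so each term of X does, and X = 0.
No second derivatives of the coordinate change have to be computed. -/
theorem hamiltonian_liftMo_liftMo (a b : ι) :
    Q.hamiltonian c' (Q.liftMo c c' a) (Q.liftMo c c' b) = 0 := by
  have ha : Q.liftMo c c' a ∈ homog R (Q.ix a) := liftMo_mem a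
  have hb : Q.liftMo c c' b ∈ homog R (Q.ix b) := liftMo_mem b
  have hda := isDerivation_hamiltonian (Q := Q) (c := c') ha
  have hdb := isDerivation_hamiltonian (Q := Q) (c := c') hb
  have hX := hda.der.mem hb
  set X := Q.hamiltonian c' (Q.liftMo c c' a) (Q.liftMo c c' b) with hXd
  have hdX := isDerivation_hamiltonian (Q := Q) (c := c') hX
  have hz : ∀ (p : Prop) [Decidable p] (D : R →ₗ[ℝ] R), D 1 = 0 →
      D (-(if p then 1 else 0)) = 0 := fun p _ D h => by split_ifs <;> simp [h]
  have h1 : ∀ e, Q.hamiltonian c' X (Q.crd c (.inl e)) = 0 := fun e => by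
    have h := hamiltonian_jacobi (Q := Q) (c := c') ha hb (Q.crd c (.inl e))
    rw [hamiltonian_liftMo_crd_inl, hamiltonian_liftMo_crd_inl, hz _ _ hda.der.map_one,
      hz _ _ hdb.der.map_one, smul_zero, add_zero] at h
    exact h.symm
  have h2 : ∀ d, Q.hamiltonian c' X (Q.crd c' (.inl d)) = 0 := fun d => by
    rw [hdX.eq_sum c, Fintype.sum_sum_type]
    simp only [h1, zero_mul, D_inr_crd_inl, mul_zero, Finset.sum_const_zero, add_zero]
  have h3 : Q.zs X = X := zs_eq_of_D_inr (c := c') fun d => by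
    have h := hamiltonian_crd (Q := Q) (c := c') X (.inr d)
    rw [Sum.swap_inr, h2, parPow_of_mem hX, map_smul, smul_smul] at h
    refine (smul_eq_zero.mp h.symm).resolve_left (mul_ne_zero (neg_ne_zero.mpr ?_) ?_)
    all_goals exact left_ne_zero_of_mul_eq_one (sgn_mul_self _)
  rw [← h3, hXd, hamiltonian_apply', map_sum]
  refine Finset.sum_eq_zero fun d _ => ?_
  rw [map_sub, map_smul, map_mul, map_mul, ← Q.D_inl_zs, ← Q.D_inl_zs, parPow_zs, zs_liftMo,
    zs_liftMo, map_zero, map_zero, zero_mul, mul_zero, smul_zero, sub_zero]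

theorem hamiltonian_lift_crd (α β : ι ⊕ ι) :
    Q.hamiltonian c' (Q.lift c c' (Q.crd c α)) (Q.lift c c' (Q.crd c β))
      = Q.lift c c' (Q.hamiltonian c (Q.crd c α) (Q.crd c β)) := by
  have hm : ∀ a, Q.crd c (.inr a) = Q.liftMo c c a := fun a => by rw [liftMo_self, mo]
  have key : ∀ a b, Q.hamiltonian c' (Q.lift c c' (Q.crd c (.inr a)))
      (Q.lift c c' (Q.crd c (.inl b)))
      = Q.lift c c' (Q.hamiltonian c (Q.crd c (.inr a)) (Q.crd c (.inl b))) := fun a b => by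
    rw [lift_crd_inr, lift_crd_inl, hamiltonian_liftMo_crd_inl, hm,
      hamiltonian_liftMo_crd_inl, map_neg, apply_ite (Q.lift c c'), map_one, map_zero]
  rcases α with a | a <;> rcases β with b | b
  · rw [lift_crd_inl, lift_crd_inl, hamiltonian_crd_inl_crd_inl, hamiltonian_crd_inl_crd_inl,
      map_zero]
  · rw [hamiltonian_skew ((isSubstitution_lift c c').mem (Q.crd_mem c (.inl a)))
      ((isSubstitution_lift c c').mem (Q.crd_mem c (.inr b))), key,
      hamiltonian_skew (Q.crd_mem c (.inl a)) (Q.crd_mem c (.inr b)), map_neg, map_smul]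
  · exact key a b
  · rw [lift_crd_inr, lift_crd_inr, hm, hm, hamiltonian_liftMo_liftMo, hamiltonian_liftMo_liftMo,
      map_zero]

/-- For fixed F both sides obey the chain rule in G, so coordinates suffice. -/
theorem hamiltonian_lift_of_forall_crd (hF : F ∈ homog R i)
    (h : ∀ α, Q.hamiltonian c' (Q.lift c c' F) (Q.lift c c' (Q.crd c α))
      = Q.lift c c' (Q.hamiltonian c F (Q.crd c α))) (G : R) :
    Q.hamiltonian c' (Q.lift c c' F) (Q.lift c c' G) = Q.lift c c' (Q.hamiltonian c F G) := by
  rw [(isDerivation_hamiltonian ((isSubstitution_lift c c').mem hF)).chain_rule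
    (isSubstitution_lift c c') c, (isDerivation_hamiltonian hF).eq_sum c, map_sum]
  refine Finset.sum_congr rfl fun α _ => ?_
  rw [h, map_mul]

/-- Changes of coordinates on the cotangent bundle are canonical transformations. -/
theorem hamiltonian_lift (F G : R) :
    Q.hamiltonian c' (Q.lift c c' F) (Q.lift c c' G) = Q.lift c c' (Q.hamiltonian c F G) := by
  induction F using homog_induction with
  | hadd F F' hF hF' => rw [map_add, hamiltonian_add, hF, hF', hamiltonian_add, map_add]
  | h i F hF =>
    refine hamiltonian_lift_of_forall_crd hF (fun α => ?_) G
    have hα := Q.crd_mem c α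
    -- Skew-symmetry lets the reduction to coordinates be applied a second time, now to the other
    -- argument.
    rw [hamiltonian_skew ((isSubstitution_lift c c').mem hF) ((isSubstitution_lift c c').mem hα),
      hamiltonian_lift_of_forall_crd hα (hamiltonian_lift_crd α), hamiltonian_skew hF hα, map_neg,
      map_smul]

end PhaseSpace

namespace PhaseSpace.IsMorphism

variable {R R' : Type*} [Ring R] [Algebra ℝ R] [Superalgebra R] [Ring R'] [Algebra ℝ R']
  [Superalgebra R'] {ι κ κ' : Type*} [Fintype ι] [DecidableEq ι] {Q : PhaseSpace R ι κ}
  {Q' : PhaseSpace R' ι κ'} {c d : κ} {c' d' : κ'} {f : R →ₐ[ℝ] R'}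

theorem parPow (hf : IsMorphism Q Q' c c' f) (i : ZMod 2) (F : R) :
    f (parPow i F) = ThickMorphism.parPow i (f F) := by
  rcases zmod_two i with rfl | rfl
  · simp
  · rw [parPow_one, parPow_one, hf.par]

theorem hamiltonian (hf : IsMorphism Q Q' c c' f) (F G : R) :
    f (Q.hamiltonian c F G) = Q'.hamiltonian c' (f F) (f G) := by
  rw [hamiltonian_apply', hamiltonian_apply', map_sum, hf.ix]
  refine Finset.sum_congr rfl fun a _ => ?_
  rw [map_sub, map_smul, map_mul, map_mul, hf.D, hf.D, hf.D, hf.D, hf.parPow]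

theorem lift (hf : IsMorphism Q Q' c c' f) (hf' : IsMorphism Q Q' d d' f) (F : R) :
    f (Q.lift c d F) = Q'.lift c' d' (f F) := by
  rw [lift_apply, lift_apply, hf.sub_elim ((isPoint_liftMo c d).null F)]
  congr 1
  funext α
  rcases α with a | a
  · exact hf.crd (.inl a)
  · exact (hf.D _ _).trans (congrArg _ hf'.gen)

end PhaseSpace.IsMorphism

/-! ### Functions on the cotangent bundle -/

section Cotangent

open PhaseSpace

variable {n m : ℕ} {M : Supermanifold.{u} n m} {A : WeilSuperalgebra}

theorem isCotangentFunction_iff {H : ∀ c : Chart M, Mom M.toSuperSpace n m .real c.dom} :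
    IsCotangentFunction H ↔ ∀ c c' : Chart M, resMom inf_le_right (H c')
      = (phaseSpace M.toSuperSpace n m .real (c.dom ⊓ c'.dom)).lift ⟨c, inf_le_left⟩
        ⟨c', inf_le_right⟩ (resMom inf_le_left (H c)) := by
  refine forall_congr' fun c => forall_congr' fun c' => ?_
  let Q := phaseSpace M.toSuperSpace n m .real (c.dom ⊓ c'.dom)
  rw [lift_apply, show Q.liftMo ⟨c, inf_le_left⟩ ⟨c', inf_le_right⟩ = _ from
    funext fun a => D_inl_gen _ _ a]
  rfl

variable (M) in
/-- The formal functions on the cotangent bundle. -/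
def cotangentFunctions : Submodule ℝ (∀ c : Chart M, Mom M.toSuperSpace n m .real c.dom) where
  carrier := {H | IsCotangentFunction H}
  add_mem' {H K} hH hK := isCotangentFunction_iff.mpr fun c c' => by
    rw [Pi.add_apply, Pi.add_apply, map_add, map_add, map_add, isCotangentFunction_iff.mp hH c c',
      isCotangentFunction_iff.mp hK c c']
  zero_mem' := isCotangentFunction_iff.mpr fun c c' => by
    rw [Pi.zero_apply, Pi.zero_apply, map_zero, map_zero, map_zero]
  smul_mem' r H hH := isCotangentFunction_iff.mpr fun c c' => by
    rw [Pi.smul_apply, Pi.smul_apply, map_smul, map_smul, map_smul,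
      isCotangentFunction_iff.mp hH c c']

theorem parMom_parMom {W : Opens M.carrier} (F : Mom M.toSuperSpace n m A W) :
    parMom (parMom F) = F := Superalgebra.par_par F

theorem parMom_mem {H : ∀ c : Chart M, Mom M.toSuperSpace n m .real c.dom}
    (hH : H ∈ cotangentFunctions M) : (fun c => parMom (H c)) ∈ cotangentFunctions M :=
  isCotangentFunction_iff.mpr fun c c' => by
    have e : ∀ {c : Chart M} {W : Opens M.carrier} (h : W ≤ c.dom),
        resMom h (parMom (H c)) = Superalgebra.par (resMom h (H c)) := fun {c} _ h =>
      (isMorphism_resHom (le_refl c.dom) h).par (H c)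
    rw [e, e, (isSubstitution_lift _ _).par, isCotangentFunction_iff.mp hH c c']

theorem poisson_eq (c : Chart M) (F G : Mom M.toSuperSpace n m .real c.dom) :
    poisson (le_refl c.dom) F G
      = (phaseSpace M.toSuperSpace n m .real c.dom).hamiltonian ⟨c, le_rfl⟩ F G := by
  rw [hamiltonian_apply', poisson]
  have h : ∀ (i : ZMod 2), (if i = 0 then F else parMom F) = parPow i F := fun i => by
    rcases zmod_two i with rfl | rfl
    · rw [if_pos rfl, parPow_zero]
    · rw [if_neg (by decide), parPow_one]
      rfl
  refine Finset.sum_congr rfl fun a _ => ?_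
  rw [h]
  rcases a with a | a <;> rfl

/-- The transition maps between charts are canonical, so the local brackets transform as H and K do.
-/
theorem poisson_mem {H K : ∀ c : Chart M, Mom M.toSuperSpace n m .real c.dom}
    (hH : H ∈ cotangentFunctions M) (hK : K ∈ cotangentFunctions M) :
    (fun c => poisson (le_refl c.dom) (H c) (K c)) ∈ cotangentFunctions M :=
  isCotangentFunction_iff.mpr fun c c' => by
    have e : ∀ {c : Chart M} {W : Opens M.carrier} (h : W ≤ c.dom),
        resMom h (poisson (le_refl c.dom) (H c) (K c))
          = (phaseSpace M.toSuperSpace n m .real W).hamiltonian ⟨c, h⟩ (resMom h (H c))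
            (resMom h (K c)) := fun {c} _ h => by
      rw [poisson_eq]
      exact (isMorphism_resHom (le_refl c.dom) h).hamiltonian (H c) (K c)
    rw [e, e, ← hamiltonian_lift, isCotangentFunction_iff.mp hH c c',
      isCotangentFunction_iff.mp hK c c']

variable (M) in
/-- The Lie superalgebra of formal functions on the cotangent bundle. -/
def cotangentLie : LieSuperalgebra (cotangentFunctions M) where
  par :=
    { toFun := fun H => ⟨fun c => parMom (H.1 c), parMom_mem H.2⟩
      map_add' := fun H K => Subtype.ext (funext fun c => map_add parMom (H.1 c) (K.1 c))
      map_smul' := fun r H => Subtype.ext (funext fun c => map_smul parMom r (H.1 c)) }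
  par_par H := Subtype.ext (funext fun c => parMom_parMom (H.1 c))
  bracket := LinearMap.mk₂ ℝ (fun H K => ⟨fun c => poisson (le_refl c.dom) (H.1 c) (K.1 c),
      poisson_mem H.2 K.2⟩)
    (fun H H' K => Subtype.ext (funext fun c => by
      simp only [Submodule.coe_add, Pi.add_apply, poisson_eq, hamiltonian_add]))
    (fun r H K => Subtype.ext (funext fun c => by
      simp only [Submodule.coe_smul, Pi.smul_apply, poisson_eq, hamiltonian_smul]))
    (fun H K K' => Subtype.ext (funext fun c => by
      simp only [Submodule.coe_add, Pi.add_apply, poisson_eq, map_add]))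
    (fun r H K => Subtype.ext (funext fun c => by
      simp only [Submodule.coe_smul, Pi.smul_apply, poisson_eq, map_smul]))
  par_bracket H K := Subtype.ext (funext fun c => by
    have h := hamiltonian_par (Q := phaseSpace M.toSuperSpace n m .real c.dom) (c := ⟨c, le_rfl⟩)
      (H.1 c) (K.1 c)
    rw [← poisson_eq, ← poisson_eq] at h
    exact h)
  skew i j H K hH hK := Subtype.ext (funext fun c => by
    have hH' : H.1 c ∈ homog _ i := congrFun (congrArg Subtype.val hH) c
    have hK' : K.1 c ∈ homog _ j := congrFun (congrArg Subtype.val hK) c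
    have h := hamiltonian_skew (Q := phaseSpace M.toSuperSpace n m .real c.dom)
      (c := ⟨c, le_rfl⟩) hH' hK'
    rw [← poisson_eq, ← poisson_eq] at h
    exact h)
  jacobi i j H K L hH hK := Subtype.ext (funext fun c => by
    have hH' : H.1 c ∈ homog _ i := congrFun (congrArg Subtype.val hH) c
    have hK' : K.1 c ∈ homog _ j := congrFun (congrArg Subtype.val hK) c
    have h := hamiltonian_jacobi (Q := phaseSpace M.toSuperSpace n m .real c.dom)
      (c := ⟨c, le_rfl⟩) hH' hK' (L.1 c)
    simp only [← poisson_eq] at h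
    exact h)

theorem cotangentLie_bracket (H K : cotangentFunctions M) (c : Chart M) :
    ((cotangentLie M).bracket H K).1 c = poisson (le_refl c.dom) (H.1 c) (K.1 c) := rfl

theorem mem_part_iff {i : ZMod 2} {H : cotangentFunctions M} :
    H ∈ (cotangentLie M).part i ↔ ∀ c, H.1 c ∈ homog (Mom M.toSuperSpace n m .real c.dom) i :=
  ⟨fun h c => congrFun (congrArg Subtype.val h) c, fun h => Subtype.ext (funext h)⟩

end Cotangent

/-! ### Tangent vectors at the identity -/

section Tangent

open PhaseSpace

variable {n m : ℕ} {M : Supermanifold.{u} n m} {A B : WeilSuperalgebra} {i j : ZMod 2} {s t : A}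

theorem scal_mem_scalars {W : Opens M.carrier} (s : A) :
    scal s ∈ (phaseSpace M.toSuperSpace n m A W).scalars := ⟨s, rfl⟩

theorem push_lift {c c' : Chart M} {W : Opens M.carrier} (h : W ≤ c.dom) (h' : W ≤ c'.dom)
    (φ : WeilSuperalgebra.Hom A B) (F : Mom M.toSuperSpace n m A W) :
    pushMom φ ((phaseSpace M.toSuperSpace n m A W).lift ⟨c, h⟩ ⟨c', h'⟩ F)
      = (phaseSpace M.toSuperSpace n m B W).lift ⟨c, h⟩ ⟨c', h'⟩ (pushMom φ F) :=
  (isMorphism_pushHom h φ).lift (isMorphism_pushHom h' φ) F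

variable (s) in
/-- The generating function of `1 + sH`. -/
def deformation {c : Chart M} (X : Mom M.toSuperSpace n m .real c.dom) :
    Mom M.toSuperSpace n m A c.dom := idGen (le_refl c.dom) + scal s * pushMom A.unit X

theorem deformation_injective (hs : s ∈ homog A i) (hs0 : s ≠ 0) {c : Chart M}
    {X Y : Mom M.toSuperSpace n m .real c.dom} (h : deformation s X = deformation s Y) : X = Y :=
  scal_mul_push_injective hs hs0 (add_left_cancel h)

theorem res_deformation {c : Chart M} {W : Opens M.carrier} (h : W ≤ c.dom)
    (X : Mom M.toSuperSpace n m .real c.dom) : resMom h (deformation s X)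
      = idGen h + scal s * pushMom A.unit (resMom h X) := by
  rw [deformation, map_add, resMom_idGen, res_mul, res_scal, pushMom_resMom]

theorem push_deformation (φ : WeilSuperalgebra.Hom A B) {c : Chart M}
    (X : Mom M.toSuperSpace n m .real c.dom) :
    pushMom φ (deformation s X) = deformation (φ.toAlgHom s) X := by
  rw [deformation, deformation, map_add, pushMom_idGen, push_mul, push_scal, pushMom_pushMom,
    push_unit_unique]

theorem nearId_deformation (hs : s ∈ homog A i) (hs2 : s * s = 0) {c : Chart M}
    {X : Mom M.toSuperSpace n m .real c.dom} (hX : X ∈ homog _ i) :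
    (phaseSpace M.toSuperSpace n m A c.dom).NearId ⟨c, le_rfl⟩ (deformation s X) :=
  nearId_gen_add (scal_mem_nilFil_one hs2) (scal_mem hs) (push_mem _ hX)

/-- The closed formula for F = x'p' substitutes p = ∂(x'p')/∂x into X, which is the cotangent
transformation. So the law for generating functions becomes, after multiplication by s, the law for
functions on the cotangent bundle. -/
theorem elim_deformation (hs : s ∈ homog A i) (hs2 : s * s = 0) {c c' : Chart M}
    {X : Mom M.toSuperSpace n m .real c.dom} {Y : Mom M.toSuperSpace n m .real c'.dom}
    (hX : X ∈ homog _ i) :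
    (phaseSpace M.toSuperSpace n m A (c.dom ⊓ c'.dom)).Elim ⟨c, inf_le_left⟩
      ((phaseSpace M.toSuperSpace n m A (c.dom ⊓ c'.dom)).gen ⟨c', inf_le_right⟩)
      (resMom inf_le_left (deformation s X)) (resMom inf_le_right (deformation s Y)) ↔
    scal s * pushMom A.unit (resMom (inf_le_right : c.dom ⊓ c'.dom ≤ c'.dom) Y)
      = scal s * pushMom A.unit ((phaseSpace M.toSuperSpace n m .real (c.dom ⊓ c'.dom)).lift
        ⟨c, inf_le_left⟩ ⟨c', inf_le_right⟩ (resMom inf_le_left X)) := by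
  rw [res_deformation, res_deformation, push_lift]
  refine (elim_gen_add (gen_even _) (scal_mem_scalars s) (scal_mem_nilFil_one hs2) (scal_mem hs)
    (scal_mul_self_eq_zero hs2) (push_mem _ (res_mem _ hX)) (Or.inl (gen_mem_fil _))).trans ?_
  exact add_right_inj _

theorem exists_deformation (hs : s ∈ homog A i) (hs2 : s * s = 0)
    {H : ∀ c : Chart M, Mom M.toSuperSpace n m .real c.dom} (hH : H ∈ cotangentFunctions M)
    (hi : ∀ c, H c ∈ homog _ i) : ∃ Φ : ThickPoint M A, ∀ c, Φ.gen c = deformation s (H c) := by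
  refine (ThickPoint.exists_of_family (fun c => deformation s (H c))
    (fun c => nearId_deformation hs hs2 (hi c)) fun c c' => ?_).imp fun Φ h => congrFun h
  rw [elim_deformation hs hs2 (hi c), isCotangentFunction_iff.mp hH c c']

theorem mem_cotangentFunctions_of_deformation (hs : s ∈ homog A i) (hs0 : s ≠ 0)
    (hs2 : s * s = 0) {H : ∀ c : Chart M, Mom M.toSuperSpace n m .real c.dom}
    (hi : ∀ c, H c ∈ homog _ i) {Φ : ThickPoint M A} (hΦ : ∀ c, Φ.gen c = deformation s (H c)) :
    H ∈ cotangentFunctions M := isCotangentFunction_iff.mpr fun c c' => by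
  have h := Φ.elim_compat c c'
  rw [hΦ, hΦ, elim_deformation hs hs2 (hi c)] at h
  exact scal_mul_push_injective hs hs0 h

theorem exists_tangent_point (H : (cotangentLie M).part i) :
    ∃ Φ : ThickPoint M (.dual i), ∀ c, Φ.gen c = deformation (WeilSuperalgebra.tau i) (H.1.1 c) :=
  exists_deformation (tau_mem_homog i) (tau_mul_tau i) H.1.2 (mem_part_iff.mp H.2)

variable (M i) in
/-- The tangent vectors of the formal supergroup at the identity. -/
def tangentEquiv : (cotangentLie M).part i ≃ ThickPoint M (.dual i) :=
  Equiv.ofBijective (fun H => (exists_tangent_point H).choose) (by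
    constructor
    · intro H K h
      refine Subtype.ext (Subtype.ext (funext fun c => ?_))
      refine deformation_injective (tau_mem_homog i) (tau_ne_zero i) ?_
      rw [← (exists_tangent_point H).choose_spec c, ← (exists_tangent_point K).choose_spec c]
      exact congrArg (fun Φ => ThickPoint.gen Φ c) h
    -- Surjectivity: the nilpotent part of a generating function over the dual numbers is τX.
    -- Evenness fixes the parity of X, and the compatibility of the charts is its transformation
    -- law.
    · intro Φ
      choose X hX using fun c : Chart M => exists_eq_scal_tau_mul_push (Φ.nearId c).near
      have hg : ∀ c, Φ.gen c = deformation (WeilSuperalgebra.tau i) (X c) := fun c => by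
        rw [deformation, ← hX c]
        exact (add_sub_cancel _ _).symm
      have hi : ∀ c, X c ∈ homog _ i := fun c => by
        refine homog_of_scal_mul_push (tau_mem_homog i) (tau_ne_zero i) ?_
        rw [← hX c]
        exact Submodule.sub_mem _ (Φ.nearId c).even (gen_even _)
      have hH := mem_cotangentFunctions_of_deformation (tau_mem_homog i) (tau_ne_zero i)
        (tau_mul_tau i) hi hg
      let H : (cotangentLie M).part i := ⟨⟨X, hH⟩, mem_part_iff.mpr hi⟩
      refine ⟨H, ThickPoint.ext_gen fun c => ?_⟩
      rw [(exists_tangent_point H).choose_spec c, hg])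

theorem tangentEquiv_gen (H : (cotangentLie M).part i) (c : Chart M) :
    (tangentEquiv M i H).gen c = deformation (WeilSuperalgebra.tau i) (H.1.1 c) :=
  (exists_tangent_point H).choose_spec c

theorem map_tangentEquiv_gen (hs : s ∈ homog A i) (hs2 : s * s = 0)
    (H : (cotangentLie M).part i) (c : Chart M) :
    ((thickGroup M).map (.ofDual s hs hs2) (tangentEquiv M i H)).gen c
      = deformation s (H.1.1 c) := by
  rw [map_gen, tangentEquiv_gen, push_deformation, ofDual_tau]

/-- Deformations of the identity by the same parameter are multiplied by adding the functions. -/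
theorem elim_deformation_deformation (hs : s ∈ homog A i) (ht : t ∈ homog A j)
    (hs2 : s * s = 0) (ht2 : t * t = 0) (hts : t * s = 0) {c : Chart M}
    {X Y : Mom M.toSuperSpace n m .real c.dom} (hX : X ∈ homog _ i) (hY : Y ∈ homog _ j)
    {G : Mom M.toSuperSpace n m A c.dom} :
    (phaseSpace M.toSuperSpace n m A c.dom).Elim ⟨c, le_rfl⟩ (deformation s X) (deformation t Y) G
      ↔ G = deformation s X + scal t * pushMom A.unit Y := by
  refine elim_gen_add_of_mul_eq (nearId_deformation hs hs2 hX).isSmall (scal_mem_scalars t)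
    (scal_mem_nilFil_one ht2) (scal_mem ht) (scal_mul_self_eq_zero ht2) (push_mem _ hY)
    fun a => ?_
  have h1 : (phaseSpace M.toSuperSpace n m A c.dom).D ⟨c, le_rfl⟩ (.inl a) (deformation s X)
      = _ := map_add _ _ _
  rw [h1, D_scalar_mul (scal_mem_scalars s) (scal_mem hs), mul_add, mul_smul_comm, ← mul_assoc, ← scal_mul,
    hts, scal_zero, zero_mul, smul_zero, add_zero]
  exact congrArg _ (D_inl_gen_self _ a)

theorem deformation_add_scal_mul_push_comm {c : Chart M}
    (X Y : Mom M.toSuperSpace n m .real c.dom) :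
    deformation s X + scal t * pushMom A.unit Y = deformation t Y + scal s * pushMom A.unit X := by
  rw [deformation, deformation, add_right_comm]

theorem deformation_add {c : Chart M} (X Y : Mom M.toSuperSpace n m .real c.dom) :
    deformation s (X + Y) = deformation s X + scal s * pushMom A.unit Y := by
  rw [deformation, deformation, map_add, mul_add, add_assoc]

theorem deformation_smul (r : ℝ) {c : Chart M} (X : Mom M.toSuperSpace n m .real c.dom) :
    deformation s (r • X) = deformation (r • s) X := by
  rw [deformation, deformation, map_smul, scal_smul, mul_smul_comm, smul_mul_assoc]

theorem mul_eq_of_elim {Φ Ψ Θ : ThickPoint M A}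
    (h : ∀ c, (phaseSpace M.toSuperSpace n m A c.dom).Elim ⟨c, le_rfl⟩ (Φ.gen c) (Ψ.gen c)
      (Θ.gen c)) : (thickGroup M).mul Φ Ψ = Θ :=
  (isComposition_thickGroup.mp (isComposition_iff.mpr h)).symm

/-- When the products of the parameters vanish, the mixed term disappears and the composite xp + sX
+ tY is symmetric. -/
theorem mul_comm_of_deformation (hs : s ∈ homog A i) (ht : t ∈ homog A j) (hs2 : s * s = 0)
    (ht2 : t * t = 0) (hts : t * s = 0) (hst : s * t = 0) {Φ Ψ : ThickPoint M A}
    {X Y : ∀ c : Chart M, Mom M.toSuperSpace n m .real c.dom} (hX : ∀ c, X c ∈ homog _ i)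
    (hY : ∀ c, Y c ∈ homog _ j) (hΦ : ∀ c, Φ.gen c = deformation s (X c))
    (hΨ : ∀ c, Ψ.gen c = deformation t (Y c)) :
    (thickGroup M).mul Φ Ψ = (thickGroup M).mul Ψ Φ := mul_eq_of_elim fun c => by
  have h := elim_mul Ψ Φ c
  rw [hΦ, hΨ, elim_deformation_deformation ht hs ht2 hs2 hst (hY c) (hX c)] at h
  rw [hΦ, hΨ, elim_deformation_deformation hs ht hs2 ht2 hts (hX c) (hY c), h,
    deformation_add_scal_mul_push_comm]

/-- The commutator relation freed of inverses, so that it can be checked on generating functions. -/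
theorem mul_eq_mul_mul_of_deformation (hs : s ∈ homog A i) (ht : t ∈ homog A j) (hs2 : s * s = 0)
    (ht2 : t * t = 0) {Φ Ψ Θ : ThickPoint M A}
    {X Y : ∀ c : Chart M, Mom M.toSuperSpace n m .real c.dom} (hX : ∀ c, X c ∈ homog _ i)
    (hY : ∀ c, Y c ∈ homog _ j) (hΦ : ∀ c, Φ.gen c = deformation s (X c))
    (hΨ : ∀ c, Ψ.gen c = deformation t (Y c))
    (hΘ : ∀ c, Θ.gen c = deformation (t * s) (poisson (le_refl c.dom) (X c) (Y c))) :
    (thickGroup M).mul ((thickGroup M).mul Ψ Φ) Θ = (thickGroup M).mul Φ Ψ :=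
  mul_eq_of_elim fun c => by
    have h1 := elim_mul Ψ Φ c
    have h2 := elim_mul Φ Ψ c
    rw [hΦ, hΨ] at h1 h2
    have hts : scal t * scal s ∈ (phaseSpace M.toSuperSpace n m A c.dom).scalars := by
      rw [← scal_mul]
      exact scal_mem_scalars (t * s)
    have h := Elim.commutator (Q := phaseSpace M.toSuperSpace n m A c.dom) (c := ⟨c, le_rfl⟩)
      (s := scal s) (t := scal t) (H := pushMom A.unit (X c)) (K := pushMom A.unit (Y c))
      (scal_mem_scalars s) (scal_mem_scalars t) hts (scal_mem_nilFil_one hs2)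
      (scal_mem_nilFil_one ht2) (scal_mem hs) (scal_mem ht) (scal_mul_self_eq_zero hs2)
      (scal_mul_self_eq_zero ht2) (push_mem _ (hX c)) (push_mem _ (hY c)) h1 h2
    have e := (isMorphism_pushHom (le_refl c.dom) A.unit).hamiltonian (X c) (Y c)
    rw [pushHom_apply, ← poisson_eq] at e
    rw [hΘ, deformation, e, scal_mul]
    exact h

/-- Since w commutes with x and y, it can be moved past their inverses; this restores the commutator
with both inverses on the right. -/
theorem commutator_eq_of_commute {G : Type*} [Group G] {x y w : G} (h : y * x * w = x * y)
    (hx : w * x = x * w) (hy : w * y = y * w) : x * y * (x⁻¹ * y⁻¹) = w := by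
  rw [← h, mul_assoc (y * x), ← mul_assoc w, (Commute.inv_right (show Commute w x from hx)).eq,
    mul_assoc x⁻¹, (Commute.inv_right (show Commute w y from hy)).eq]
  group

theorem mul_mul_eq_zero_of_homog (hs : s ∈ homog A i) (ht : t ∈ homog A j) (hs2 : s * s = 0) :
    s * (t * s) = 0 := by
  rw [← mul_assoc, A.comm i j s hs t ht, smul_mul_assoc, mul_assoc, hs2, mul_zero, smul_zero]

theorem isLieSuperalgebraOf_tangentEquiv :
    IsLieSuperalgebraOf (thickGroup M) (cotangentLie M) (tangentEquiv M) where
  map_add i x y := by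
    refine (mul_eq_of_elim fun c => ?_).symm
    rw [tangentEquiv_gen, tangentEquiv_gen, tangentEquiv_gen, elim_deformation_deformation
      (tau_mem_homog i) (tau_mem_homog i) (tau_mul_tau i) (tau_mul_tau i) (tau_mul_tau i)
      (mem_part_iff.mp x.2 c) (mem_part_iff.mp y.2 c)]
    exact deformation_add (s := WeilSuperalgebra.tau i) (x.1.1 c) (y.1.1 c)
  map_smul i r x := ThickPoint.ext_gen fun c => by
    rw [map_tangentEquiv_gen, tangentEquiv_gen]
    exact deformation_smul (s := WeilSuperalgebra.tau i) r (x.1.1 c)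
  commutator A i j x y s t hs ht hs2 ht2 hts hts2 := by
    have hx := map_tangentEquiv_gen hs hs2 x
    have hy := map_tangentEquiv_gen ht ht2 y
    have hw := map_tangentEquiv_gen hts hts2
      ⟨(cotangentLie M).bracket x y, (cotangentLie M).bracket_mem x.2 y.2⟩
    have hX := mem_part_iff.mp x.2
    have hY := mem_part_iff.mp y.2
    have hZ := mem_part_iff.mp ((cotangentLie M).bracket_mem x.2 y.2)
    let _ : Group (ThickPoint M A) :=
      { mul := (thickGroup M).mul
        one := (thickGroup M).one A
        inv := (thickGroup M).inv
        mul_assoc := (thickGroup M).mul_assoc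
        one_mul := (thickGroup M).one_mul
        mul_one := (thickGroup M).mul_one
        inv_mul_cancel := (thickGroup M).inv_mul }
    refine commutator_eq_of_commute
      (mul_eq_mul_mul_of_deformation hs ht hs2 ht2 hX hY hx hy hw)
      -- The parameter ts annihilates both s and t on either side, so 1 + ts{H, K} commutes with 1 +
      -- sH and 1 + tK.
      (mul_comm_of_deformation hts hs hts2 hs2 (mul_mul_eq_zero_of_homog hs ht hs2) ?_ hZ hX hw hx)
      (mul_comm_of_deformation hts ht hts2 ht2 ?_ ?_ hZ hY hw hy)
    · rw [mul_assoc, hs2, mul_zero]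
    · rw [← mul_assoc, ht2, zero_mul]
    · rw [mul_assoc, mul_mul_eq_zero_of_homog ht hs ht2]

end Tangent

/-! ### The Hamilton–Jacobi action -/

theorem mem_of_coeff_eq_zero {σ B : Type*} [Ring B] [Algebra ℝ B] [Finite σ]
    {K : Subalgebra ℝ (MvPowerSeries σ B)} (hC : ∀ b, MvPowerSeries.C b ∈ K)
    (hX : ∀ a, MvPowerSeries.X a ∈ K) {F : MvPowerSeries σ B} {k : ℕ}
    (hF : ∀ d, k ≤ d.degree → MvPowerSeries.coeff d F = 0) : F ∈ K := by
  classical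
  have h : F = ∑ d ∈ (Finsupp.finite_of_degree_lt k).toFinset,
      MvPowerSeries.monomial d (MvPowerSeries.coeff d F) := by
    ext e
    rw [map_sum, Finset.sum_eq_single e]
    · rw [MvPowerSeries.coeff_monomial_same]
    · intro d _ hd
      exact MvPowerSeries.coeff_monomial_ne hd.symm _
    · intro he
      rw [MvPowerSeries.coeff_monomial_same]
      exact hF e (not_lt.mp fun h => he ((Finsupp.finite_of_degree_lt k).mem_toFinset.mpr h))
  rw [h]
  exact K.sum_mem fun d _ => monomial_mem hC hX d _

open PhaseSpace

theorem PhaseSpace.IsMorphism.mem_poly {R R' : Type*} [Ring R] [Algebra ℝ R] [Superalgebra R]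
    [Ring R'] [Algebra ℝ R'] [Superalgebra R'] {ι κ κ' : Type*} [Fintype ι] [DecidableEq ι]
    {Q : PhaseSpace R ι κ} {Q' : PhaseSpace R' ι κ'} {c : κ} {c' : κ'} {f : R →ₐ[ℝ] R'}
    (hf : IsMorphism Q Q' c c' f) {F : R} (hF : F ∈ Q.poly) : f F ∈ Q'.poly := by
  induction hF using poly_induction with
  | base F hF => exact mem_poly_of_zs_eq (by rw [← hf.zs, hF])
  | mo d a =>
    rw [mo_eq d c, mo, hf.crd]
    exact mo_mem_poly c' a
  | add F G _ _ hF hG =>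
    rw [map_add]
    exact add_mem hF hG
  | mul F G _ _ hF hG =>
    rw [map_mul]
    exact mul_mem hF hG

/-! ### Fibrewise polynomial functions -/

section FibrewisePolynomial

variable {M : SuperSpace.{u}} {n m : ℕ} {A : WeilSuperalgebra} {W : Opens M.carrier}

theorem const_mem_poly (f : Fun M A W) : const f ∈ (phaseSpace M n m A W).poly :=
  mem_poly_of_zs_eq (zeroSection_const f)

/-- A bound on the degree in the even momenta suffices, the odd ones being nilpotent. -/
theorem mem_poly_of_coeff_eq_zero {c : SuperChart M n m} (hW : W ≤ c.dom) {F : Mom M n m A W}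
    {N : ℕ} (hF : ∀ d, N ≤ d.degree → MvPowerSeries.coeff d F = 0) :
    F ∈ (phaseSpace M n m A W).poly := by
  have hp : ∀ a, mom a ∈ (phaseSpace M n m A W).poly := fun a => mo_mem_poly ⟨c, hW⟩ a
  exact mem_of_coeff_eq_zero (mem_of_generators hW (fun _ => const_mem_poly _)
    (fun _ => const_mem_poly _) hp fun _ => const_mem_poly _) (fun a => hp (.inl a)) hF

end FibrewisePolynomial

section HamiltonJacobi

variable {n m : ℕ} {M : Supermanifold.{u} n m} {A : WeilSuperalgebra} {i : ZMod 2} {t : A}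
  {f : Fun M.toSuperSpace A ⊤} {Φ : ThickPoint M A}
  {H : ∀ c : Chart M, Mom M.toSuperSpace n m .real c.dom}

variable (f) in
/-- The Hamiltonian evaluated on the graph of the differential of a function. -/
def onDifferential (c : Chart M) (W : Opens M.carrier) (h : W ≤ c.dom)
    (X : Mom M.toSuperSpace n m A W) : Mom M.toSuperSpace n m A W :=
  (phaseSpace M.toSuperSpace n m A W).sub ⟨c, h⟩
    (Sum.elim ((phaseSpace M.toSuperSpace n m A W).po ⟨c, h⟩)
      fun a => (phaseSpace M.toSuperSpace n m A W).D ⟨c, h⟩ (.inl a) (const (resFun le_top f))) X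

theorem const_resFun_mem (hf : f ∈ homog _ 0) (W : Opens M.carrier) :
    (const (resFun le_top f) : Mom M.toSuperSpace n m A W) ∈ homog _ 0 :=
  const_mem (resFun_mem _ hf)

theorem elim_const_deformation (ht : t ∈ homog A i) (ht2 : t * t = 0) (hf : f ∈ homog _ 0)
    {c : Chart M} {X : Mom M.toSuperSpace n m .real c.dom} (hX : X ∈ homog _ i)
    (h : f ∈ formalFunctions M A ∨ X ∈ (phaseSpace M.toSuperSpace n m .real c.dom).poly)
    {G : Mom M.toSuperSpace n m A c.dom} :
    (phaseSpace M.toSuperSpace n m A c.dom).Elim ⟨c, le_rfl⟩ (const (resFun le_top f))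
      (deformation t X) G ↔
    G = const (resFun le_top f)
      + scal t * onDifferential f c c.dom le_rfl (pushMom A.unit X) :=
  elim_gen_add (Q := phaseSpace M.toSuperSpace n m A c.dom) (c := ⟨c, le_rfl⟩) (s := scal t)
    (H := pushMom A.unit X) (const_resFun_mem hf _) (scal_mem_scalars t)
    (scal_mem_nilFil_one ht2) (scal_mem ht) (scal_mul_self_eq_zero ht2) (push_mem _ hX)
    (h.imp (fun h => (isSmall_const h).fil) fun h =>
      (isMorphism_pushHom (le_refl c.dom) A.unit).mem_poly h)

theorem exists_isPullback_deformation_of_small (ht : t ∈ homog A i) (ht2 : t * t = 0)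
    (hi : ∀ c, H c ∈ homog _ i) (hΦ : ∀ c, Φ.gen c = deformation t (H c))
    (hf : f ∈ formalFunctions M A) :
    ∃ g : Fun M.toSuperSpace A ⊤, (∀ g', IsPullback Φ f g' ↔ g' = g) ∧
      ∀ c : Chart M, const (resFun (le_top : c.dom ≤ ⊤) g) = const (resFun le_top f)
        + scal t * onDifferential f c c.dom le_rfl (pushMom A.unit (H c)) := by
  obtain ⟨g, -, hg⟩ := exists_pullback Φ hf
  refine ⟨g, hg, fun c => ?_⟩
  have h := isPullback_iff.mp ((hg g).mpr rfl) c
  rwa [hΦ, elim_const_deformation ht ht2 hf.1 (hi c) (Or.inl hf)] at h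

theorem res_onDifferential (hf : f ∈ homog _ 0) {c : Chart M} {W : Opens M.carrier}
    (h : W ≤ c.dom) {X : Mom M.toSuperSpace n m A c.dom}
    (hX : X ∈ (phaseSpace M.toSuperSpace n m A c.dom).poly) :
    resMom h (onDifferential f c c.dom le_rfl X) = onDifferential f c W h (resMom h X) := by
  have hr := isMorphism_resHom (A := A) (le_refl c.dom) h
  have hq := fun a => mem_homog_D_inl (Q := phaseSpace M.toSuperSpace n m A c.dom)
    (const_resFun_mem hf c.dom) ⟨c, le_rfl⟩ a
  refine (hr.sub_elim (tame_of_mem_poly hq hX)).trans (congrArg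
    (fun w => (phaseSpace M.toSuperSpace n m A W).sub ⟨c, h⟩ w (resMom h X)) (funext fun α => ?_))
  rcases α with a | a
  · exact hr.crd (.inl a)
  · refine (hr.D (.inl a) _).trans ?_
    rw [resHom_apply, resMom_const, resFun_resFun]
    rfl

theorem zs_onDifferential (hf : f ∈ homog _ 0) {c : Chart M}
    {X : Mom M.toSuperSpace n m A c.dom}
    (hX : X ∈ (phaseSpace M.toSuperSpace n m A c.dom).poly) :
    (phaseSpace M.toSuperSpace n m A c.dom).zs (onDifferential f c c.dom le_rfl X)
      = onDifferential f c c.dom le_rfl X := by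
  have hq := fun a => mem_homog_D_inl (Q := phaseSpace M.toSuperSpace n m A c.dom)
    (const_resFun_mem hf c.dom) ⟨c, le_rfl⟩ a
  have hz : ∀ a, (phaseSpace M.toSuperSpace n m A c.dom).zs
      ((phaseSpace M.toSuperSpace n m A c.dom).D ⟨c, le_rfl⟩ (.inl a) (const (resFun le_top f)))
      = (phaseSpace M.toSuperSpace n m A c.dom).D ⟨c, le_rfl⟩ (.inl a)
        (const (resFun le_top f)) := fun a => by
    rw [← PhaseSpace.D_inl_zs]
    exact congrArg _ (zeroSection_const _)
  exact zs_sub_eq (tame_of_mem_poly hq hX) hz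

/-- Since f need not vanish modulo 𝔪, the general existence and uniqueness of eliminations are not
available. The closed formula replaces them in each chart, and the local results glue because
evaluating a polynomial Hamiltonian on a differential does not depend on the coordinates. -/
theorem exists_isPullback_deformation_of_poly (ht : t ∈ homog A i) (ht2 : t * t = 0)
    (hH : H ∈ cotangentFunctions M) (hi : ∀ c, H c ∈ homog _ i)
    (hΦ : ∀ c, Φ.gen c = deformation t (H c)) (hf : f ∈ homog _ 0)
    (hp : IsFibrewisePolynomial H) :
    ∃ g : Fun M.toSuperSpace A ⊤, (∀ g', IsPullback Φ f g' ↔ g' = g) ∧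
      ∀ c : Chart M, const (resFun (le_top : c.dom ≤ ⊤) g) = const (resFun le_top f)
        + scal t * onDifferential f c c.dom le_rfl (pushMom A.unit (H c)) := by
  have hp' : ∀ c, H c ∈ (phaseSpace M.toSuperSpace n m .real c.dom).poly := fun c => by
    obtain ⟨N, hN⟩ := hp c
    exact mem_poly_of_coeff_eq_zero (le_refl c.dom) hN
  have hpush : ∀ c, pushMom A.unit (H c) ∈ (phaseSpace M.toSuperSpace n m A c.dom).poly :=
    fun c => (isMorphism_pushHom (le_refl c.dom) A.unit).mem_poly (hp' c)
  have hex : ∀ c : Chart M, ∃ g : Fun M.toSuperSpace A c.dom, const (resFun le_top f)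
      + scal t * onDifferential f c c.dom le_rfl (pushMom A.unit (H c)) = const g := fun c => by
    obtain ⟨g, hg⟩ := exists_const_eq_zeroSection (onDifferential f c c.dom le_rfl
      (pushMom A.unit (H c)))
    have hg := (zs_onDifferential hf (hpush c)).symm.trans hg
    exact ⟨resFun le_top f + stmul 1 t * g, by
      rw [hg, scal, ← constHom_apply, ← constHom_apply, ← constHom_apply, ← constHom_apply,
        map_add, map_mul]⟩
  choose g hg using hex
  obtain ⟨g₀, h₀, hr⟩ := exists_isPullback (Φ := Φ) (f := f) g (fun c G => by
    rw [hΦ, elim_const_deformation ht ht2 hf (hi c) (Or.inr (hp' c)), hg]) fun c c' => by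
    have e : ∀ {c : Chart M} {W : Opens M.carrier} (h : W ≤ c.dom),
        (const (resFun h (g c)) : Mom M.toSuperSpace n m A W) = const (resFun le_top f)
          + scal t * onDifferential f c W h (pushMom A.unit (resMom h (H c))) := fun {c} W h => by
      rw [← resMom_const, ← hg, map_add, res_mul, res_scal, resMom_const, resFun_resFun,
        res_onDifferential hf h (hpush c), pushMom_resMom]
    refine const_injective (n := n) (m := m) ?_
    rw [e, e, isCotangentFunction_iff.mp hH c c', push_lift]
    congr 2
    exact (sub_differential (Q := phaseSpace M.toSuperSpace n m A (c.dom ⊓ c'.dom))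
      (c := ⟨c, inf_le_left⟩) (c' := ⟨c', inf_le_right⟩) (const_resFun_mem hf _)
      ((isMorphism_pushHom inf_le_left A.unit).mem_poly
        ((isMorphism_resHom le_rfl inf_le_left).mem_poly (hp' c)))).symm
  exact ⟨g₀, h₀, fun c => by rw [hr, hg]⟩

end HamiltonJacobi

end ThickMorphism

end

theorem theorem1 {n m : ℕ} (M : Supermanifold.{u} n m) :
    -- The thick morphisms of `M` to itself near the identity form a formal supergroup.
    ∃ 𝔾 : FormalSupergroup (ThickPoint M),
      (∀ (A : WeilSuperalgebra) (Φ Ψ Θ : ThickPoint M A),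
        IsComposition Φ Ψ Θ ↔ Θ = 𝔾.mul Φ Ψ) ∧
      (∀ (A : WeilSuperalgebra) (c : Chart M), (𝔾.one A).gen c = idGen (le_refl c.dom)) ∧
      (∀ (A B : WeilSuperalgebra) (φ : WeilSuperalgebra.Hom A B) (Φ : ThickPoint M A)
        (c : Chart M), (𝔾.map φ Φ).gen c = pushMom φ (Φ.gen c)) ∧
      -- It acts on even functions (near zero) from the right by the nonlinear pullbacks.
      (∀ (A : WeilSuperalgebra) (Φ : ThickPoint M A), ∀ f ∈ formalFunctions M A,
        ∃ g ∈ formalFunctions M A, ∀ g', IsPullback Φ f g' ↔ g' = g) ∧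
      (∀ (A : WeilSuperalgebra), ∀ f ∈ formalFunctions M A, IsPullback (𝔾.one A) f f) ∧
      (∀ (A : WeilSuperalgebra) (Φ Ψ : ThickPoint M A), ∀ f ∈ formalFunctions M A, ∀ g h,
        IsPullback Φ f g → IsPullback Ψ g h → IsPullback (𝔾.mul Φ Ψ) f h) ∧
      (∀ (A B : WeilSuperalgebra) (φ : WeilSuperalgebra.Hom A B) (Φ : ThickPoint M A),
        ∀ f ∈ formalFunctions M A, ∀ g, IsPullback Φ f g →
          IsPullback (𝔾.map φ Φ) (pushFun φ f) (pushFun φ g)) ∧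
      -- The formal functions on `T^*M` form a Lie superalgebra under the Poisson bracket.
      ∃ 𝔤 : Submodule ℝ (∀ c : Chart M, Mom M.toSuperSpace n m .real c.dom),
        (∀ H, H ∈ 𝔤 ↔ IsCotangentFunction H) ∧
        ∃ 𝔏 : LieSuperalgebra 𝔤,
          (∀ (H : 𝔤) (c : Chart M), (𝔏.par H).1 c = parMom (H.1 c)) ∧
          (∀ (H K : 𝔤) (c : Chart M),
            (𝔏.bracket H K).1 c = poisson (le_refl c.dom) (H.1 c) (K.1 c)) ∧
          -- It is the Lie superalgebra of the formal supergroup: `H` corresponds to `xp + τH`.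
          ∃ e : ∀ i : ZMod 2, 𝔏.part i ≃ ThickPoint M (.dual i),
            (∀ (i : ZMod 2) (H : 𝔏.part i) (c : Chart M),
              (e i H).gen c = idGen (le_refl c.dom) +
                scal (WeilSuperalgebra.tau i) *
                  pushMom (WeilSuperalgebra.unit (.dual i)) (H.1.1 c)) ∧
            IsLieSuperalgebraOf 𝔾 𝔏 e ∧
            -- The infinitesimal action is `f(x) ↦ f(x) + t H(x, ∂f/∂x)`.
            (∀ (A : WeilSuperalgebra) (i : ZMod 2) (H : 𝔏.part i) (t : A)
              (ht : t ∈ homog A i) (ht2 : t * t = 0) (f : Fun M.toSuperSpace A ⊤),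
              f ∈ homog _ 0 → (f ∈ formalFunctions M A ∨ IsFibrewisePolynomial H.1.1) →
              ∃ g : Fun M.toSuperSpace A ⊤,
                (∀ g', IsPullback (𝔾.map (.ofDual t ht ht2) (e i H)) f g' ↔ g' = g) ∧
                ∀ c : Chart M, const (n := n) (m := m) (resFun (le_top : c.dom ≤ ⊤) g) =
                  const (resFun le_top f) +
                    scal t * subst (le_refl c.dom) (zc (le_refl c.dom))
                      (fun a => dz (le_refl c.dom) a (const (resFun le_top f)))
                      (pushMom (WeilSuperalgebra.unit A) (H.1.1 c))) := by
  refine ⟨thickGroup M, fun A Φ Ψ Θ => isComposition_thickGroup, fun A c => one_gen c,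
    fun A B φ Φ c => map_gen φ Φ c, fun A Φ f hf => exists_pullback Φ hf,
    fun A f hf => isPullback_one hf, fun A Φ Ψ f hf g h hg hh => hg.mul hf hh,
    fun A B φ Φ f hf g hg => hg.map φ hf, cotangentFunctions M, fun H => Iff.rfl,
    cotangentLie M, fun H c => rfl, cotangentLie_bracket, tangentEquiv M,
    fun i H c => tangentEquiv_gen H c, isLieSuperalgebraOf_tangentEquiv, ?_⟩
  intro A i H t ht ht2 f hf h
  have hi := mem_part_iff.mp H.2
  have hg := map_tangentEquiv_gen ht ht2 H
  rcases h with h | h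
  · exact exists_isPullback_deformation_of_small ht ht2 hi hg h
  · exact exists_isPullback_deformation_of_poly ht ht2 H.1.2 hi hg hf h
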